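/- Let $m\ge 3$, $s\in\{0,\dots,m\}$, $k\in\mathbb N_0$. Let $\mathcal C\ell_m$ be either the real Clifford algebra $\mathbb R_{0,m}$ generated by the orthonormal basis $e_1,\dots,e_m$ of $\mathbb R^m$ with $e_ie_j+e_je_i=-2\delta_{ij}$, or its complexification $\mathbb C_m$; let $\mathcal C\ell_m^s$ be its subspace of $s$-vectors, and identify $x\in\mathbb R^m$ with $\sum_i x_ie_i$. For a vector $u$ and an $s$-vector $v$ put $u\bullet v=\frac12(uv-(-1)^svu)$ and $u\wedge v=\frac12(uv+(-1)^svu)$, extended linearly to all $v\in\mathcal C\ell_m$. Let $\mathcal H^s_k(\mathbb R^m)$ be the space of $k$-homogeneous polynomials $P:\mathbb R^m\to\mathcal C\ell_m^s$ with $\sum_i e_i\partial_{x_i}P=0$ (equivalently, the $k$-homogeneous $s$-vector valued solutions of the Hodge--de Rham system). Let $Pin(m)$ be the group of finite products of unit vectors of $\mathbb R^m$ in $\mathcal C\ell_m$; it acts on $\mathcal C\ell_m$-valued functions by the $H$-action $[H(r)f](x)=r\,f(r^{-1}xr)\,r^{-1}$. Let $Pin(m-1)\subset Pin(m)$ be the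 subgroup of products of unit vectors of $\mathbb R^{m-1}=\operatorname{span}(e_1,\dots,e_{m-1})$. Write $x=(\underline x,x_m)$, $\underline x=x_1e_1+\dots+x_{m-1}e_{m-1}$, $(\nu)_d=\nu(\nu+1)\cdots(\nu+d-1)$, $C^\nu_d(z)=\sum_{i=0}^{[d/2]}\frac{(-1)^i(\nu)_{d-i}}{i!(d-2i)!}(2z)^{d-2i}$, and for integers $d,j\ge 0$ $$F^{(d)}_{m,j}(x)=\frac{(j+1)_d}{(m-2+2j)_d}\,|x|^d\,C^{m/2+j-1}_d(x_m/|x|),\qquad X^{(d)}_{m,j}(x)=F^{(d)}_{m,j}(x)+\frac{j+1}{m+2j-1}F^{(d-1)}_{m,j+1}(x)\,\underline x\,e_m,$$ with $F^{(d)}_{m,j}=X^{(d)}_{m,j}=0$ for $d<0$. Let $N^{s,m}_k$ be the set of pairs $(t,j)\in\{0,\dots,m-1\}\times\{0,\dots,k\}$ such that $t\in\{s-1,s\}$ and, if $t\in\{0,m-1\}$, then $j=0$. For $(t,j)\in N^{s,m}_k$ let $$X^{s,t,m}_{k,j}(x)=X^{(k-j)}_{m,j}(x)\,e_m^{s-t}+\alpha\,X^{(k-1-j)}_{m,j+1}(x)\bigl(\beta^{t-s}(\underline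 x\,\wedge)+\beta^{t-s+1}(\underline x\,\bullet)\bigr)e_m^{s-t+1},$$ where $\beta=-(j+m-1-t)/(j+t)$, and $\alpha=-(j+1)/(m+2j-1)$ unless $t\in\{0,m-1\}$; if $t\in\{0,m-1\}$, then $\alpha=0$ and the second term is absent. If $s\in\{0,m\}$ and $k\ge1$, then $\mathcal H^s_k(\mathbb R^m)=\{0\}$. In all other cases, under the $H$-action of $Pin(m-1)$, $$\mathcal H^s_k(\mathbb R^m)=\bigoplus_{(t,j)\in N^{s,m}_k}X^{s,t,m}_{k,j}\,\mathcal H^t_j(\mathbb R^{m-1})$$ is a multiplicity free irreducible decomposition: the summands are irreducible and pairwise inequivalent $Pin(m-1)$-submodules. In particular, this decomposition is orthogonal with respect to any $Pin(m-1)$-invariant inner product on $\mathcal H^s_k(\mathbb R^m)$. The $L^2$-inner product $(f,g)=\int_{\mathbb B_m}[\bar f g]_0\,d\lambda^m$ over the unit ball is one of them, where $\bar a$ is the Clifford conjugate (conjugate linear in the complex case) and $[a]_0$ the scalar part of $a$. -/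

import Mathlib

open scoped TensorProduct

noncomputable section

namespace HodgeDeRham

/-- The Euclidean space `ℝ^m`. -/
abbrev Euc (m : ℕ) : Type := EuclideanSpace ℝ (Fin m)

/-- The quadratic form `x ↦ -|x|²` on `ℝ^m`. -/
def negSq (m : ℕ) : QuadraticForm ℝ (Euc m) := -LinearMap.BilinMap.toQuadraticMap (innerₗ (Euc m))

theorem negSq_apply (m : ℕ) (x : Euc m) : negSq m x = -‖x‖ ^ 2 := by
  simp [negSq]

/-- The real Clifford algebra `ℝ_{0,m}`, with `e_i e_j + e_j e_i = -2 δ_{ij}`. -/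
abbrev RCl (m : ℕ) : Type := CliffordAlgebra (negSq m)

/-- The Clifford algebra with scalars in `𝕜`: the complex Clifford algebra `ℂ_m = ℂ ⊗ ℝ_{0,m}` for
`𝕜 = ℂ`, and `ℝ ⊗ ℝ_{0,m} = ℝ_{0,m}` for `𝕜 = ℝ`. -/
abbrev Cl (𝕜 : Type*) [RCLike 𝕜] (m : ℕ) : Type _ := 𝕜 ⊗[ℝ] RCl m

variable (𝕜 : Type*) [RCLike 𝕜]

/-- The inclusion of the real Clifford algebra. -/
def incl (m : ℕ) : RCl m →ₐ[ℝ] Cl 𝕜 m := Algebra.TensorProduct.includeRight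

/-- A vector of `ℝ^m` as an element of the Clifford algebra. -/
def vec {m : ℕ} (x : Euc m) : Cl 𝕜 m := incl 𝕜 m (CliffordAlgebra.ι (negSq m) x)

/-- The standard basis vector `e_i`, as an element of the Clifford algebra. -/
def e {m : ℕ} (i : Fin m) : Cl 𝕜 m := vec 𝕜 (EuclideanSpace.single i 1)

/-- The space of `s`-vectors, spanned by the products `e_{i_1} ⋯ e_{i_s}` with
`i_1 < ⋯ < i_s`. -/
def sVectors (m s : ℕ) : Submodule 𝕜 (Cl 𝕜 m) :=
  Submodule.span 𝕜 (Set.range fun i : Fin s ↪o Fin m => (List.ofFn fun l => e 𝕜 (i l)).prod)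

/-- The grade involution, which is `(-1)^s` on `s`-vectors. -/
def gradeInv (m : ℕ) : Cl 𝕜 m →ₐ[𝕜] Cl 𝕜 m :=
  Algebra.TensorProduct.map (AlgHom.id 𝕜 𝕜) CliffordAlgebra.involute

/-- The outer product `u ∧ a` of a vector and a Clifford number; for an `s`-vector `a` it is
`(u a + (-1)^s a u) / 2`. -/
def wedge {m : ℕ} (u : Euc m) (a : Cl 𝕜 m) : Cl 𝕜 m :=
  (1 / 2 : ℝ) • (vec 𝕜 u * a + gradeInv 𝕜 m a * vec 𝕜 u)

/-- The inner product `u • a` of a vector and a Clifford number; for an `s`-vector `a` it is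
`(u a - (-1)^s a u) / 2`. -/
def bullet {m : ℕ} (u : Euc m) (a : Cl 𝕜 m) : Cl 𝕜 m :=
  (1 / 2 : ℝ) • (vec 𝕜 u * a - gradeInv 𝕜 m a * vec 𝕜 u)

/-- The `k`-homogeneous polynomial functions on `ℝ^m` with values in the Clifford algebra. -/
def homPoly (m k : ℕ) : Submodule 𝕜 (Euc m → Cl 𝕜 m) :=
  Submodule.span 𝕜 {f | ∃ (p : MvPolynomial (Fin m) ℝ) (c : Cl 𝕜 m), p.IsHomogeneous k ∧
    f = fun x => (MvPolynomial.eval (fun i => x i) p) • c}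

variable {𝕜}

/-- `g = ∂f/∂x_i` on all of `ℝ^m`. The Clifford algebra is finite dimensional; the derivative is
taken componentwise, that is, after composition with any linear functional. -/
def HasPartial {m : ℕ} (i : Fin m) (f g : Euc m → Cl 𝕜 m) : Prop :=
  ∀ (φ : Cl 𝕜 m →ₗ[𝕜] 𝕜) (x : Euc m),
    HasDerivAt (fun t : ℝ => φ (f (x + t • EuclideanSpace.single i 1))) (φ (g x)) 0

/-- `f` has partial derivatives and solves the Dirac equation `∑ e_i ∂f/∂x_i = 0`. -/
def IsMonogenic {m : ℕ} (f : Euc m → Cl 𝕜 m) : Prop :=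
  ∃ g : Fin m → Euc m → Cl 𝕜 m, (∀ i, HasPartial i f (g i)) ∧ ∀ x, ∑ i, e 𝕜 i * g i x = 0

variable (𝕜)

/-- The space `H^s_k(ℝ^m)` of `k`-homogeneous monogenic polynomials with values in `s`-vectors. -/
def hodge (m s k : ℕ) : Submodule 𝕜 (Euc m → Cl 𝕜 m) where
  carrier := {f | f ∈ homPoly 𝕜 m k ∧ (∀ x, f x ∈ sVectors 𝕜 m s) ∧ IsMonogenic f}
  zero_mem' := ⟨Submodule.zero_mem _, fun _ => Submodule.zero_mem _, 0,
    fun i φ x => by simpa using hasDerivAt_const (0 : ℝ) (0 : 𝕜), fun x => by simp⟩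
  add_mem' := by
    rintro f f' ⟨h1, h2, g, h3, h4⟩ ⟨h1', h2', g', h3', h4'⟩
    refine ⟨Submodule.add_mem _ h1 h1', fun x => Submodule.add_mem _ (h2 x) (h2' x), g + g',
      fun i φ x => ?_, fun x => ?_⟩
    · simpa using! (h3 i φ x).add (h3' i φ x)
    · simp [mul_add, Finset.sum_add_distrib, h4, h4']
  smul_mem' := by
    rintro c f ⟨h1, h2, g, h3, h4⟩
    refine ⟨Submodule.smul_mem _ c h1, fun x => Submodule.smul_mem _ c (h2 x), c • g,
      fun i φ x => ?_, fun x => ?_⟩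
    · simpa using! (h3 i φ x).const_mul c
    · simp [← Finset.smul_sum, h4]

/-! ### The Pin group and the `H`-action -/

/-- The group `Pin(m)` of finite products of unit vectors of `ℝ^m` in the Clifford algebra. -/
def Pin (m : ℕ) : Subgroup (RCl m)ˣ :=
  Subgroup.closure {r | ∃ v : Euc m, ‖v‖ = 1 ∧ (r : RCl m) = CliffordAlgebra.ι (negSq m) v}

theorem ι_injective (m : ℕ) : Function.Injective (CliffordAlgebra.ι (negSq m)) := by
  intro x y h
  have := congrArg (CliffordAlgebra.equivExterior (negSq m)) h
  simpa [CliffordAlgebra.equivExterior] using! this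

theorem exists_conj {m : ℕ} (r : Pin m) (x : Euc m) :
    ∃ y : Euc m, CliffordAlgebra.ι (negSq m) y =
      ((r⁻¹ : Pin m) : (RCl m)ˣ) * CliffordAlgebra.ι (negSq m) x * ((r : (RCl m)ˣ) : RCl m) := by
  suffices H : ∀ r ∈ Pin m, (∀ x : Euc m, ∃ y : Euc m, CliffordAlgebra.ι (negSq m) y =
      ((r⁻¹ : (RCl m)ˣ) : RCl m) * CliffordAlgebra.ι (negSq m) x * (r : RCl m)) ∧
      (∀ x : Euc m, ∃ y : Euc m, CliffordAlgebra.ι (negSq m) y =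
      (r : RCl m) * CliffordAlgebra.ι (negSq m) x * ((r⁻¹ : (RCl m)ˣ) : RCl m)) by
    exact (H r r.2).1 x
  intro r hr
  induction hr using Subgroup.closure_induction with
  | mem r h =>
    obtain ⟨v, hv, h⟩ := h
    have hinv : ((r⁻¹ : (RCl m)ˣ) : RCl m) = -CliffordAlgebra.ι (negSq m) v := by
      apply Units.inv_eq_of_mul_eq_one_right
      rw [h, mul_neg, CliffordAlgebra.ι_sq_scalar, negSq_apply, hv]
      simp
    constructor <;> intro x <;>
      refine ⟨-(QuadraticMap.polar (negSq m) v x • v - negSq m v • x), ?_⟩ <;>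
      rw [map_neg, ← CliffordAlgebra.ι_mul_ι_mul_ι, h, hinv] <;> simp
  | one => exact ⟨fun x => ⟨x, by simp⟩, fun x => ⟨x, by simp⟩⟩
  | mul a b _ _ ha hb =>
    constructor
    · intro x
      obtain ⟨y, hy⟩ := ha.1 x
      obtain ⟨z, hz⟩ := hb.1 y
      exact ⟨z, by rw [hz, hy]; simp [mul_assoc]⟩
    · intro x
      obtain ⟨y, hy⟩ := hb.2 x
      obtain ⟨z, hz⟩ := ha.2 y
      exact ⟨z, by rw [hz, hy]; simp [mul_assoc]⟩
  | inv a _ ha => exact ⟨by simpa using ha.2, by simpa using ha.1⟩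

/-- The vector `r⁻¹ x r`, for `r ∈ Pin(m)` and `x ∈ ℝ^m`. -/
def conj {m : ℕ} (r : Pin m) (x : Euc m) : Euc m := (exists_conj r x).choose

theorem ι_conj {m : ℕ} (r : Pin m) (x : Euc m) :
    CliffordAlgebra.ι (negSq m) (conj r x) =
      ((r⁻¹ : Pin m) : (RCl m)ˣ) * CliffordAlgebra.ι (negSq m) x * ((r : (RCl m)ˣ) : RCl m) :=
  (exists_conj r x).choose_spec

theorem conj_one {m : ℕ} (x : Euc m) : conj (1 : Pin m) x = x :=
  ι_injective m (by simp [ι_conj])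

theorem conj_mul {m : ℕ} (r r' : Pin m) (x : Euc m) :
    conj (r * r') x = conj r' (conj r x) :=
  ι_injective m (by simp [ι_conj, mul_assoc])

/-- The `H`-action of `Pin(m)` on Clifford algebra valued functions,
`[H(r) f](x) = r f(r⁻¹ x r) r⁻¹`. -/
def hAction (m : ℕ) : Representation 𝕜 (Pin m) (Euc m → Cl 𝕜 m) where
  toFun r :=
    { toFun := fun f x => incl 𝕜 m ((r : (RCl m)ˣ) : RCl m) * f (conj r x) *
        incl 𝕜 m (((r⁻¹ : Pin m) : (RCl m)ˣ) : RCl m)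
      map_add' := fun f g => by ext x; simp [mul_add, add_mul]
      map_smul' := fun c f => by ext x; simp }
  map_one' := by
    ext f x
    simp [conj_one]
  map_mul' r r' := by
    ext f x
    simp [conj_mul, mul_assoc]

/-! ### The inclusion of `ℝ^n` into `ℝ^(n+1)` -/

/-- The inclusion `ℝ^n → ℝ^(n+1)`, `x ↦ (x, 0)`. -/
def up (n : ℕ) : Euc n →ₗ[ℝ] Euc (n + 1) where
  toFun x := WithLp.toLp 2 (Fin.snoc (α := fun _ => ℝ) (fun i => x i) 0)
  map_add' x y := by
    ext i
    refine Fin.lastCases ?_ (fun i => ?_) i <;> simp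
  map_smul' c x := by
    ext i
    refine Fin.lastCases ?_ (fun i => ?_) i <;> simp

/-- The projection `(x_1, …, x_{n+1}) ↦ (x_1, …, x_n)`. -/
def low {n : ℕ} (x : Euc (n + 1)) : Euc n := WithLp.toLp 2 fun i => x i.castSucc

theorem norm_up {n : ℕ} (x : Euc n) : ‖up n x‖ = ‖x‖ := by
  simp [EuclideanSpace.norm_eq, up, Fin.sum_univ_castSucc]

/-- The inclusion `ℝ_{0,n} → ℝ_{0,n+1}`. -/
def upRCl (n : ℕ) : RCl n →ₐ[ℝ] RCl (n + 1) :=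
  CliffordAlgebra.map
    { up n with map_app' := fun x => by simpa [negSq_apply] using! norm_up x }

theorem upRCl_ι {n : ℕ} (x : Euc n) :
    upRCl n (CliffordAlgebra.ι (negSq n) x) = CliffordAlgebra.ι (negSq (n + 1)) (up n x) := by
  simp [upRCl]; rfl

/-- The inclusion of the Clifford algebra over `ℝ^n` into the one over `ℝ^(n+1)`. -/
def upCl (n : ℕ) : Cl 𝕜 n →ₐ[𝕜] Cl 𝕜 (n + 1) :=
  Algebra.TensorProduct.map (AlgHom.id 𝕜 𝕜) (upRCl n)

theorem upRCl_mem_Pin {n : ℕ} (r : Pin n) :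
    Units.map (upRCl n : RCl n →* RCl (n + 1)) r ∈ Pin (n + 1) := by
  obtain ⟨r, hr⟩ := r
  have : Pin n ≤ (Pin (n + 1)).comap (Units.map (upRCl n : RCl n →* RCl (n + 1))) := by
    rw [Pin, Subgroup.closure_le]
    rintro r ⟨v, hv, h⟩
    refine Subgroup.subset_closure ⟨up n v, by rw [norm_up, hv], ?_⟩
    simp [h, upRCl_ι]
  exact this hr

/-- `Pin(n)` as a subgroup of `Pin(n+1)`: the products of unit vectors orthogonal to `e_{n+1}`. -/
def upPin (n : ℕ) : Pin n →* Pin (n + 1) :=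
  ((Units.map (upRCl n : RCl n →* RCl (n + 1))).comp (Pin n).subtype).codRestrict (Pin (n + 1))
    upRCl_mem_Pin

/-- The `H`-action of the subgroup `Pin(n)` of `Pin(n+1)` on functions on `ℝ^(n+1)`. -/
def hActionSub (n : ℕ) : Representation 𝕜 (Pin n) (Euc (n + 1) → Cl 𝕜 (n + 1)) :=
  (hAction 𝕜 (n + 1)).comp (upPin n)

/-! ### The embedding factors, for `m = n + 1` -/

/-- The Pochhammer symbol `(ν)_k = ν (ν+1) ⋯ (ν+k-1)`. -/
def poch (ν : ℝ) (k : ℕ) : ℝ := ∏ i ∈ Finset.range k, (ν + i)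

/-- The value at `z` of the Gegenbauer polynomial `C^ν_k`. -/
def gegenbauer (ν : ℝ) (k : ℕ) (z : ℝ) : ℝ :=
  ∑ i ∈ Finset.range (k / 2 + 1), (-1) ^ i * poch ν (k - i) /
    ((Nat.factorial i : ℝ) * (Nat.factorial (k - 2 * i) : ℝ)) * (2 * z) ^ (k - 2 * i)

/-- The factor `F^{(d)}_{m,j}` for `m = n + 1`; it is `0` for `d < 0`. -/
def F (n : ℕ) (d : ℤ) (j : ℕ) (x : Euc (n + 1)) : ℝ :=
  let m : ℝ := n + 1
  if d < 0 then 0 else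
    poch (j + 1) d.toNat / poch (m - 2 + 2 * j) d.toNat * ‖x‖ ^ d.toNat *
      gegenbauer (m / 2 + j - 1) d.toNat (x (Fin.last n) / ‖x‖)

/-- The factor `X^{(d)}_{m,j}` for `m = n + 1`; it is `0` for `d < 0`. -/
def X (n : ℕ) (d : ℤ) (j : ℕ) (x : Euc (n + 1)) : Cl 𝕜 (n + 1) :=
  let m : ℝ := n + 1
  F n d j x • (1 : Cl 𝕜 (n + 1)) +
    ((j + 1) / (m + 2 * j - 1) * F n (d - 1) (j + 1) x) •
      (vec 𝕜 (up n (low x)) * e 𝕜 (Fin.last n))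

/-- The constant `α` for `m = n + 1`. -/
def alpha (n t j : ℕ) : ℝ :=
  let m : ℝ := n + 1
  if t = 0 ∨ t = n then 0 else -(j + 1) / (m + 2 * j - 1)

/-- The constant `β` for `m = n + 1`. -/
def beta (n t j : ℕ) : ℝ :=
  let m : ℝ := n + 1
  (-(j + m - 1 - t)) / (j + t)

/-- The embedding factor `X^{s,t,m}_{k,j}` for `m = n + 1` and `t ∈ {s-1, s}`, as an operator from
functions on `ℝ^n` to functions on `ℝ^(n+1)`. -/
def embed (n s t k j : ℕ) : (Euc n → Cl 𝕜 n) →ₗ[𝕜] (Euc (n + 1) → Cl 𝕜 (n + 1)) where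
  toFun P x :=
    let em : Cl 𝕜 (n + 1) := e 𝕜 (Fin.last n)
    let a : Cl 𝕜 (n + 1) := upCl 𝕜 n (P (low x))
    let b := beta n t j
    X 𝕜 n (k - j) j x * (em ^ (s - t) * a) +
      alpha n t j • (X 𝕜 n (k - 1 - j) (j + 1) x *
        (b ^ ((t : ℤ) - s) • wedge 𝕜 (up n (low x)) (em ^ (s - t + 1) * a) +
          b ^ ((t : ℤ) - s + 1) • bullet 𝕜 (up n (low x)) (em ^ (s - t + 1) * a)))
  map_add' P P' := by
    ext x
    simp only [wedge, bullet, Pi.add_apply, map_add, mul_add, add_mul, mul_sub, smul_add, smul_sub,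
      mul_smul_comm]
    abel
  map_smul' c P := by
    ext x
    simp only [wedge, bullet, Pi.smul_apply, map_smul, mul_smul_comm, smul_mul_assoc, smul_add,
      smul_sub, RingHom.id_apply, mul_add, mul_sub, smul_comm c (_ : ℝ)]

/-- The index set `N^{s,m}_k` for `m = n + 1`. -/
def indexSet (n s k : ℕ) : Set (ℕ × ℕ) :=
  {p | p.1 ≤ n ∧ p.2 ≤ k ∧ (p.1 + 1 = s ∨ p.1 = s) ∧ (p.1 = 0 ∨ p.1 = n → p.2 = 0)}

/-- The space `X^{s,t,m}_{k,j} H^t_j(ℝ^{m-1})` for `m = n + 1`. -/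
def piece (n s t k j : ℕ) : Submodule 𝕜 (Euc (n + 1) → Cl 𝕜 (n + 1)) :=
  (hodge 𝕜 n t j).map (embed 𝕜 n s t k j)

/-! ### Inner products -/

/-- The Clifford conjugation; it is conjugate linear for `𝕜 = ℂ`, with `conj (e_i) = -e_i`. -/
def cliffConj (m : ℕ) : Cl 𝕜 m →ₗ[ℝ] Cl 𝕜 m :=
  TensorProduct.map (RCLike.conjAe (K := 𝕜)).toLinearMap
    (CliffordAlgebra.reverse ∘ₗ (CliffordAlgebra.involute (Q := negSq m)).toLinearMap)

/-- The scalar part `[a]_0` of a Clifford number. -/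
def scalarPart (m : ℕ) : Cl 𝕜 m →ₗ[ℝ] 𝕜 :=
  (TensorProduct.rid ℝ 𝕜).toLinearMap ∘ₗ LinearMap.lTensor 𝕜
    ((ExteriorAlgebra.algebraMapInv (R := ℝ) (M := Euc m)).toLinearMap ∘ₗ
      (CliffordAlgebra.equivExterior (negSq m)).toLinearMap)

/-- The `L²`-inner product `∫ [conj f g]_0` over the unit ball. -/
def l2Inner {m : ℕ} (f g : Euc m → Cl 𝕜 m) : 𝕜 :=
  ∫ x in Metric.ball (0 : Euc m) 1, scalarPart 𝕜 m (cliffConj 𝕜 m (f x) * g x)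

/-- An inner product on a `G`-module is invariant if every `r ∈ G` preserves it. -/
def InvariantInner {G V : Type*} [Monoid G] [AddCommGroup V] [Module 𝕜 V]
    (ρ : Representation 𝕜 G V) (c : InnerProductSpace.Core 𝕜 V) : Prop :=
  ∀ (r : G) (f g : V), c.inner (ρ r f) (ρ r g) = c.inner f g

end HodgeDeRham

end

open scoped TensorProduct
noncomputable section
namespace HodgeDeRham

/-! ### Algebra of `s`-vectors in the Clifford algebra -/

section Clifford

variable {𝕜 : Type*} [RCLike 𝕜] {m : ℕ}

/-! ### Vectors in the Clifford algebra -/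

/-! Put m = n + 1. Differentiation in x_m maps H^s_{k+1}(ℝ^m) into H^s_k(ℝ^m). For s ≥ 1 its kernel
consists of the functions A + e_m B, where A and B are solutions on ℝ^n of the same degree with
values in s-vectors and (s-1)-vectors (`exists_eq_lift_add`). The embeddings form an Appell sequence
for this derivative: the x_m-derivative of the embedding of degree k + 1 is k + 1 times the
embedding of degree k (`embed_hasPd_last`), and for k = j the embedding is P ↦ e_m^{s-t} P
(`embed_self`). Induction on k then shows that the embedded spaces span and are independent
(`exists_eq_embedSum`, `embedSum_eq_zero`). That an embedded function is an s-vector valued solution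
rests on Gegenbauer identities (`dirac_X_mul`), on the choice of β (`dirac_twist`) and on the choice
of α (`embed_apply_mem`).

Each embedding commutes with the action of a unit vector of ℝ^n up to the sign (-1)^(k+j+s-t)
(`actBy_embed`). The pieces are separated by the Casimir operator of the rotations, which is the
scalar -8(j+t)(j+n-t) on H^t_j(ℝ^n) (`casimir`). Two different indices share this scalar only if j =
j' and t + t' = n; as t and t' are consecutive, n is odd. Then the two signs differ, whereas the
product of all basis vectors acts trivially in odd dimension, so again no nonzero equivariant map
exists (`eq_zero_of_odd`, `intertwiner_eq_zero`). This argument concerns arbitrary equivariant maps;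
it needs neither irreducibility nor algebraically closed scalars. Orthogonality follows, because the
orthogonal projection onto one piece, restricted to another, is equivariant.

Irreducibility of H^s_k(ℝ^m) under Pin(m) is proved by induction on m, starting from the plane. An
invariant subspace has an equivariant L²-projection T, and T has to be shown to be a scalar. By the
branching already established T preserves the pieces. All pieces with j ≥ 1 vanish at the pole e_m,
and the two pieces with j = 0 supply the tangential and the normal part of the value there; T acts
on each of them by a scalar. Since Pin(m) moves the pole to every point of the sphere, Tf is
everywhere the same combination of the tangential and the normal part of f (`eq_smul_of_pole`). If
the two scalars were different, the normal part of f would itself be a solution, which forces f = 0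
(`eq_zero_of_normal_part`). -/

theorem vec_add (x y : Euc m) : vec 𝕜 (x + y) = vec 𝕜 x + vec 𝕜 y := by
  simp [vec]

theorem vec_smul (c : ℝ) (x : Euc m) : vec 𝕜 (c • x) = c • vec 𝕜 x := by
  simp [vec]

theorem vec_neg (x : Euc m) : vec 𝕜 (-x) = -vec 𝕜 x := by
  simp [vec]

theorem vec_zero : vec 𝕜 (0 : Euc m) = 0 := by
  simp [vec]

/-- The inclusion of vectors as a linear map. -/
def vecₗ (𝕜 : Type*) [RCLike 𝕜] (m : ℕ) : Euc m →ₗ[ℝ] Cl 𝕜 m where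
  toFun := vec 𝕜
  map_add' := vec_add
  map_smul' := vec_smul

theorem vec_mul_self (x : Euc m) : vec 𝕜 x * vec 𝕜 x = (-(‖x‖ ^ 2)) • (1 : Cl 𝕜 m) := by
  rw [vec, ← map_mul, CliffordAlgebra.ι_sq_scalar, negSq_apply, AlgHom.commutes,
    Algebra.algebraMap_eq_smul_one]

theorem vec_mul_vec (x y : Euc m) :
    vec 𝕜 x * vec 𝕜 y = -(vec 𝕜 y * vec 𝕜 x) + (-(2 * inner ℝ x y)) • (1 : Cl 𝕜 m) := by
  have h := vec_mul_self (𝕜 := 𝕜) (x + y)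
  rw [vec_add, mul_add, add_mul, add_mul, vec_mul_self, vec_mul_self, norm_add_sq_real] at h
  have h' : vec 𝕜 x * vec 𝕜 y =
    ((-(‖x‖ ^ 2)) • (1 : Cl 𝕜 m) + vec 𝕜 y * vec 𝕜 x + (vec 𝕜 x * vec 𝕜 y + (-(‖y‖ ^ 2)) • 1))
      - (-(‖x‖ ^ 2)) • (1 : Cl 𝕜 m) - vec 𝕜 y * vec 𝕜 x - (-(‖y‖ ^ 2)) • 1 := by module
  rw [h', h]
  module

theorem vec_mul_vec_mul_self (x : Euc m) (a : Cl 𝕜 m) :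
    vec 𝕜 x * (vec 𝕜 x * a) = (-(‖x‖ ^ 2)) • a := by
  rw [← mul_assoc, vec_mul_self, smul_one_mul]

theorem e_mul_self (i : Fin m) : e 𝕜 i * e 𝕜 i = (-1 : Cl 𝕜 m) := by
  rw [e, vec_mul_self]; simp

theorem e_mul_e_mul_self (i : Fin m) (a : Cl 𝕜 m) : e 𝕜 i * (e 𝕜 i * a) = -a := by
  rw [← mul_assoc, e_mul_self, neg_one_mul]

theorem e_mul_e {i j : Fin m} (h : i ≠ j) : e 𝕜 i * e 𝕜 j = -(e 𝕜 j * e 𝕜 i) := by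
  rw [e, e, vec_mul_vec]
  simp [EuclideanSpace.inner_single_left, h]

theorem vec_eq_sum (x : Euc m) : vec 𝕜 x = ∑ i, x i • e 𝕜 i := by
  have : x = ∑ i, x i • EuclideanSpace.single i (1 : ℝ) := by
    ext j
    simp [Finset.sum_apply, Pi.single_apply]
  conv_lhs => rw [this]
  change vecₗ 𝕜 m _ = _
  rw [map_sum]
  simp only [map_smul]
  rfl

theorem vec_mul_e (x : Euc m) (i : Fin m) :
    vec 𝕜 x * e 𝕜 i = -(e 𝕜 i * vec 𝕜 x) + (-(2 * x i)) • (1 : Cl 𝕜 m) := by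
  rw [e, vec_mul_vec]
  simp [EuclideanSpace.inner_single_right]

theorem gradeInv_vec (x : Euc m) : gradeInv 𝕜 m (vec 𝕜 x) = -vec 𝕜 x := by
  simp [gradeInv, vec, incl, TensorProduct.tmul_neg]

theorem gradeInv_e (i : Fin m) : gradeInv 𝕜 m (e 𝕜 i) = -e 𝕜 i := gradeInv_vec _

theorem Cl_algHom_ext {A : Type*} [Semiring A] [Algebra 𝕜 A] {f g : Cl 𝕜 m →ₐ[𝕜] A}
    (h : ∀ x, f (vec 𝕜 x) = g (vec 𝕜 x)) : f = g := by
  let : Algebra ℝ A := Algebra.compHom A (algebraMap ℝ 𝕜)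
  have : IsScalarTower ℝ 𝕜 A := IsScalarTower.of_algebraMap_eq fun _ => rfl
  apply Algebra.TensorProduct.ext
  · ext
  · apply CliffordAlgebra.hom_ext
    ext1 x
    exact h x

theorem gradeInv_smul (c : ℝ) (a : Cl 𝕜 m) : gradeInv 𝕜 m (c • a) = c • gradeInv 𝕜 m a :=
  LinearMap.map_smul_of_tower (gradeInv 𝕜 m).toLinearMap c a

theorem gradeInv_gradeInv (a : Cl 𝕜 m) : gradeInv 𝕜 m (gradeInv 𝕜 m a) = a := by
  have : (gradeInv 𝕜 m).comp (gradeInv 𝕜 m) = AlgHom.id 𝕜 (Cl 𝕜 m) :=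
    Cl_algHom_ext fun x => by simp [gradeInv_vec]
  exact DFunLike.congr_fun this a

/-- The reversal, a linear anti-automorphism fixing vectors. -/
def rev (𝕜 : Type*) [RCLike 𝕜] (m : ℕ) : Cl 𝕜 m →ₗ[𝕜] Cl 𝕜 m :=
  LinearMap.baseChange 𝕜 CliffordAlgebra.reverse

theorem rev_vec (x : Euc m) : rev 𝕜 m (vec 𝕜 x) = vec 𝕜 x := by
  simp [rev, vec, incl]

theorem rev_one : rev 𝕜 m 1 = 1 := by
  simp [rev, Algebra.TensorProduct.one_def]

theorem rev_mul (a b : Cl 𝕜 m) : rev 𝕜 m (a * b) = rev 𝕜 m b * rev 𝕜 m a := by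
  induction a using TensorProduct.induction_on with
  | zero => simp
  | add x y hx hy => simp [add_mul, mul_add, hx, hy]
  | tmul z r =>
    induction b using TensorProduct.induction_on with
    | zero => simp
    | add x y hx hy => simp [add_mul, mul_add, hx, hy]
    | tmul w t => simp [rev, mul_comm]

/-! ### Products of basis vectors and `s`-vectors -/

/-- The product of basis vectors along a list. -/
def eL (𝕜 : Type*) [RCLike 𝕜] {m : ℕ} (l : List (Fin m)) : Cl 𝕜 m := (l.map (e 𝕜)).prod

theorem eL_nil : eL 𝕜 ([] : List (Fin m)) = 1 := rfl

theorem eL_cons (i : Fin m) (l : List (Fin m)) : eL 𝕜 (i :: l) = e 𝕜 i * eL 𝕜 l := by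
  simp [eL]

theorem eL_perm {l l' : List (Fin m)} (h : l.Perm l') (hl : l.Nodup) :
    eL 𝕜 l = eL 𝕜 l' ∨ eL 𝕜 l = -eL 𝕜 l' := by
  induction h with
  | nil => simp
  | cons x h ih =>
    rcases ih hl.of_cons with h | h <;> simp [eL_cons, h]
  | swap x y l =>
    right
    have : y ≠ x := by
      rintro rfl
      simp at hl
    rw [eL_cons, eL_cons, eL_cons, eL_cons, ← mul_assoc, ← mul_assoc, e_mul_e this, neg_mul]
  | trans h1 h2 ih1 ih2 =>
    rcases ih1 hl with h | h <;> rcases ih2 (h1.nodup_iff.1 hl) with h' | h' <;> simp [h, h']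

/-- Sorting the list changes the product only by a sign, because distinct basis vectors anticommute.
-/
theorem eL_mem_sVectors {l : List (Fin m)} (hl : l.Nodup) : eL 𝕜 l ∈ sVectors 𝕜 m l.length := by
  have hc : l.toFinset.card = l.length := List.toFinset_card_of_nodup hl
  have hp : l.Perm (l.toFinset.sort (· ≤ ·)) := by
    rw [List.perm_ext_iff_of_nodup hl (Finset.sort_nodup _ _)]
    simp
  have hmem : eL 𝕜 (l.toFinset.sort (· ≤ ·)) ∈ sVectors 𝕜 m l.length := by
    refine Submodule.subset_span ⟨l.toFinset.orderEmbOfFin hc, ?_⟩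
    simp only [eL]
    congr 1
    apply List.ext_getElem
    · simp [hc]
    · intro i h1 h2
      simp [Finset.orderEmbOfFin_apply]
  rcases eL_perm (𝕜 := 𝕜) hp hl with h | h
  · rw [h]; exact hmem
  · rw [h]; exact Submodule.neg_mem _ hmem

theorem sVectors_eq_span (s : ℕ) : sVectors 𝕜 m s =
    Submodule.span 𝕜 {a | ∃ l : List (Fin m), l.Nodup ∧ l.length = s ∧ eL 𝕜 l = a} := by
  apply le_antisymm
  · apply Submodule.span_le.2
    rintro _ ⟨i, rfl⟩
    refine Submodule.subset_span ⟨List.ofFn i, ?_, by simp, ?_⟩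
    · exact List.nodup_ofFn.2 i.injective
    · simp only [eL, List.map_ofFn]; rfl
  · apply Submodule.span_le.2
    rintro _ ⟨l, hl, rfl, rfl⟩
    exact eL_mem_sVectors hl

theorem sVectors_induction {s : ℕ} {p : Cl 𝕜 m → Prop}
    (hL : ∀ l : List (Fin m), l.Nodup → l.length = s → p (eL 𝕜 l)) (h0 : p 0)
    (hadd : ∀ a b, p a → p b → p (a + b)) (hsmul : ∀ (c : 𝕜) a, p a → p (c • a))
    {a : Cl 𝕜 m} (ha : a ∈ sVectors 𝕜 m s) : p a := by
  rw [sVectors_eq_span] at ha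
  induction ha using Submodule.span_induction with
  | mem x h => obtain ⟨l, h1, h2, rfl⟩ := h; exact hL l h1 h2
  | zero => exact h0
  | add x y _ _ hx hy => exact hadd x y hx hy
  | smul c x _ hx => exact hsmul c x hx

/-- Two linear maps that agree on products of `s` distinct basis vectors agree on `s`-vectors. -/
theorem sVectors_eqOn {s : ℕ} {V : Type*} [AddCommGroup V] [Module 𝕜 V] (f g : Cl 𝕜 m →ₗ[𝕜] V)
    (h : ∀ l : List (Fin m), l.Nodup → l.length = s → f (eL 𝕜 l) = g (eL 𝕜 l))
    {a : Cl 𝕜 m} (ha : a ∈ sVectors 𝕜 m s) : f a = g a := by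
  refine sVectors_induction (p := fun a => f a = g a) h (by simp) (fun a b ha hb => ?_)
    (fun c a ha => ?_) ha
  · rw [map_add, map_add, ha, hb]
  · rw [map_smul, map_smul, ha]

theorem gradeInv_eL (l : List (Fin m)) : gradeInv 𝕜 m (eL 𝕜 l) = (-1 : ℝ) ^ l.length • eL 𝕜 l := by
  induction l with
  | nil => simp [eL_nil]
  | cons i l ih =>
    rw [eL_cons, map_mul, ih, gradeInv_e, List.length_cons, pow_succ]
    simp

theorem gradeInv_of_mem {s : ℕ} {a : Cl 𝕜 m} (ha : a ∈ sVectors 𝕜 m s) :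
    gradeInv 𝕜 m a = (-1 : ℝ) ^ s • a := by
  refine sVectors_induction (p := fun a => gradeInv 𝕜 m a = (-1 : ℝ) ^ s • a)
    (fun l _ hl => by rw [gradeInv_eL, hl]) (by simp) (fun a b ha hb => ?_) (fun c a ha => ?_) ha
  · rw [map_add, ha, hb, smul_add]
  · rw [map_smul, ha, smul_comm]

theorem e_mul_eL_of_notMem {i : Fin m} {l : List (Fin m)} (h : i ∉ l) :
    e 𝕜 i * eL 𝕜 l = (-1 : ℝ) ^ l.length • (eL 𝕜 l * e 𝕜 i) := by
  induction l with
  | nil => simp [eL_nil]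
  | cons j l ih =>
    simp only [List.mem_cons, not_or] at h
    rw [eL_cons, ← mul_assoc, e_mul_e h.1, neg_mul, mul_assoc, ih h.2, List.length_cons, pow_succ]
    simp [mul_assoc]

theorem exists_eL_eq {i : Fin m} {l : List (Fin m)} (hl : l.Nodup) (h : i ∈ l) :
    ∃ l' : List (Fin m), l'.Nodup ∧ l'.length + 1 = l.length ∧ i ∉ l' ∧
      (∀ j, j ∈ l ↔ j = i ∨ j ∈ l') ∧ ∃ c : 𝕜, (c = 1 ∨ c = -1) ∧ eL 𝕜 l = c • (e 𝕜 i * eL 𝕜 l') := by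
  have hp := List.perm_cons_erase h
  have hn := hp.nodup_iff.1 hl
  refine ⟨l.erase i, hn.of_cons, by simpa using hp.length_eq.symm, by simpa using hn.notMem,
    fun j => by rw [hp.mem_iff]; simp, ?_⟩
  rcases eL_perm (𝕜 := 𝕜) hp hl with h' | h'
  · exact ⟨1, Or.inl rfl, by rw [h', eL_cons, one_smul]⟩
  · exact ⟨-1, Or.inr rfl, by rw [h', eL_cons, neg_one_smul]⟩

theorem e_mul_eL_of_mem {i : Fin m} {l : List (Fin m)} (hl : l.Nodup) (h : i ∈ l) :
    e 𝕜 i * eL 𝕜 l = -((-1 : ℝ) ^ l.length • (eL 𝕜 l * e 𝕜 i)) := by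
  obtain ⟨l', -, hlen, hi, -, c, -, hc⟩ := exists_eL_eq (𝕜 := 𝕜) hl h
  have hcomm := e_mul_eL_of_notMem (𝕜 := 𝕜) hi
  have : e 𝕜 i * eL 𝕜 l' * e 𝕜 i = -((-1 : ℝ) ^ l'.length • eL 𝕜 l') := by
    rw [hcomm, smul_mul_assoc, mul_assoc, e_mul_self]
    simp
  rw [hc, mul_smul_comm, smul_mul_assoc, this, e_mul_e_mul_self, ← hlen, pow_succ]
  simp only [smul_neg, mul_neg, mul_one, neg_smul, neg_neg]
  rw [smul_comm _ c, smul_smul, ← mul_pow]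
  simp

/-- For a monomial e_I with |I| = s, the product e_i e_I e_i is (-1)^(s+1) e_I if i ∉ I and (-1)^s
e_I if i ∈ I. The constant counts the m - s indices of the first kind against the s indices of the
second. -/
theorem sum_e_mul_mul_e {s : ℕ} {a : Cl 𝕜 m} (ha : a ∈ sVectors 𝕜 m s) :
    ∑ i, e 𝕜 i * a * e 𝕜 i = ((-1 : ℝ) ^ (s + 1) * (m - 2 * s)) • a := by
  refine sVectors_induction (p := fun a => ∑ i, e 𝕜 i * a * e 𝕜 i =
    ((-1 : ℝ) ^ (s + 1) * (m - 2 * s)) • a) (fun l hl hlen => ?_) (by simp) (fun a b ha hb => ?_)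
    (fun c a ha => ?_) ha
  · have h1 : ∀ i, e 𝕜 i * eL 𝕜 l * e 𝕜 i =
        ((-1 : ℝ) ^ (s + 1) * (1 - 2 * (if i ∈ l.toFinset then 1 else 0))) • eL 𝕜 l := by
      intro i
      split_ifs with h
      · rw [e_mul_eL_of_mem hl (by simpa using h), neg_mul, smul_mul_assoc, mul_assoc, e_mul_self,
          hlen, pow_succ]
        simp only [mul_neg, mul_one, smul_neg, neg_neg]
        module
      · rw [e_mul_eL_of_notMem (by simpa using h), smul_mul_assoc, mul_assoc, e_mul_self, hlen,
          pow_succ]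
        simp only [mul_neg, mul_one, smul_neg]
        module
    rw [Finset.sum_congr rfl fun i _ => h1 i, ← Finset.sum_smul, ← Finset.mul_sum,
      Finset.sum_sub_distrib, ← Finset.mul_sum]
    rw [Finset.sum_ite_mem, Finset.univ_inter]
    simp [List.toFinset_card_of_nodup hl, hlen]
  · simp only [mul_add, add_mul, Finset.sum_add_distrib, ha, hb, smul_add]
  · simp only [mul_smul_comm, smul_mul_assoc, ← Finset.smul_sum, ha]
    rw [smul_comm]

/-- The sign of the reversal on `s`-vectors. -/
def revSign : ℕ → ℝ
  | 0 => 1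
  | s + 1 => (-1) ^ s * revSign s

theorem revSign_mul_self (s : ℕ) : revSign s * revSign s = 1 := by
  induction s with
  | zero => simp [revSign]
  | succ s ih =>
    rw [revSign, mul_mul_mul_comm, ih, ← mul_pow]
    simp

theorem rev_eL {l : List (Fin m)} (hl : l.Nodup) :
    rev 𝕜 m (eL 𝕜 l) = revSign l.length • eL 𝕜 l := by
  induction l with
  | nil => simp [eL_nil, rev_one, revSign]
  | cons i l ih =>
    rw [eL_cons, rev_mul, ih hl.of_cons, e, rev_vec, ← e, e_mul_eL_of_notMem hl.notMem,
      List.length_cons, revSign, smul_mul_assoc, smul_smul, mul_right_comm, ← mul_pow]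
    simp

theorem rev_of_mem {s : ℕ} {a : Cl 𝕜 m} (ha : a ∈ sVectors 𝕜 m s) :
    rev 𝕜 m a = revSign s • a := by
  refine sVectors_induction (p := fun a => rev 𝕜 m a = revSign s • a)
    (fun l hl hlen => by rw [rev_eL hl, hlen]) (by simp) (fun a b ha hb => ?_) (fun c a ha => ?_) ha
  · rw [map_add, ha, hb, smul_add]
  · rw [map_smul, ha, smul_comm]

/-! ### The outer and the inner product -/

/-- The outer product with a vector as a linear map. -/
def wedgeₗ (𝕜 : Type*) [RCLike 𝕜] {m : ℕ} (u : Euc m) : Cl 𝕜 m →ₗ[𝕜] Cl 𝕜 m where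
  toFun := wedge 𝕜 u
  map_add' a b := by simp only [wedge, mul_add, map_add, add_mul]; module
  map_smul' c a := by
    simp only [wedge, map_smul, mul_smul_comm, smul_mul_assoc, RingHom.id_apply]; module

/-- The inner product with a vector as a linear map. -/
def bulletₗ (𝕜 : Type*) [RCLike 𝕜] {m : ℕ} (u : Euc m) : Cl 𝕜 m →ₗ[𝕜] Cl 𝕜 m where
  toFun := bullet 𝕜 u
  map_add' a b := by simp only [bullet, mul_add, map_add, add_mul]; module
  map_smul' c a := by
    simp only [bullet, map_smul, mul_smul_comm, smul_mul_assoc, RingHom.id_apply]; module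

theorem wedge_add_bullet (u : Euc m) (a : Cl 𝕜 m) : wedge 𝕜 u a + bullet 𝕜 u a = vec 𝕜 u * a := by
  simp only [wedge, bullet]; module

theorem wedge_of_mem (u : Euc m) {s : ℕ} {a : Cl 𝕜 m} (ha : a ∈ sVectors 𝕜 m s) :
    wedge 𝕜 u a = (1 / 2 : ℝ) • (vec 𝕜 u * a + (-1 : ℝ) ^ s • (a * vec 𝕜 u)) := by
  rw [wedge, gradeInv_of_mem ha, smul_mul_assoc]

theorem bullet_of_mem (u : Euc m) {s : ℕ} {a : Cl 𝕜 m} (ha : a ∈ sVectors 𝕜 m s) :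
    bullet 𝕜 u a = (1 / 2 : ℝ) • (vec 𝕜 u * a - (-1 : ℝ) ^ s • (a * vec 𝕜 u)) := by
  rw [bullet, gradeInv_of_mem ha, smul_mul_assoc]

theorem wedge_eq_sum (u : Euc m) (a : Cl 𝕜 m) :
    wedge 𝕜 u a = ∑ i, u i • wedge 𝕜 (EuclideanSpace.single i 1) a := by
  simp only [wedge]
  conv_lhs => rw [vec_eq_sum]
  simp only [Finset.sum_mul, Finset.mul_sum, ← Finset.sum_add_distrib, Finset.smul_sum,
    smul_mul_assoc, mul_smul_comm]
  exact Finset.sum_congr rfl fun i _ => by rw [e]; module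

theorem bullet_eq_sum (u : Euc m) (a : Cl 𝕜 m) :
    bullet 𝕜 u a = ∑ i, u i • bullet 𝕜 (EuclideanSpace.single i 1) a := by
  simp only [bullet]
  conv_lhs => rw [vec_eq_sum]
  simp only [Finset.sum_mul, Finset.mul_sum, ← Finset.sum_sub_distrib, Finset.smul_sum,
    smul_mul_assoc, mul_smul_comm]
  exact Finset.sum_congr rfl fun i _ => by rw [e]; module

theorem smul_mem_sVectors {s : ℕ} (c : ℝ) {a : Cl 𝕜 m} (ha : a ∈ sVectors 𝕜 m s) :
    c • a ∈ sVectors 𝕜 m s := by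
  rw [← algebraMap_smul 𝕜 c a]
  exact Submodule.smul_mem _ _ ha

theorem wedge_mem (u : Euc m) {s : ℕ} {a : Cl 𝕜 m} (ha : a ∈ sVectors 𝕜 m s) :
    wedge 𝕜 u a ∈ sVectors 𝕜 m (s + 1) := by
  change wedgeₗ 𝕜 u a ∈ _
  refine sVectors_induction (p := fun a => wedgeₗ 𝕜 u a ∈ sVectors 𝕜 m (s + 1))
    (fun l hl hlen => ?_) (by simp) (fun a b ha hb => ?_) (fun c a ha => ?_) ha
  · change wedge 𝕜 u _ ∈ _
    rw [wedge_eq_sum]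
    refine Submodule.sum_mem _ fun i _ => smul_mem_sVectors _ ?_
    rw [wedge, gradeInv_eL, ← e, smul_mul_assoc]
    by_cases h : i ∈ l
    · rw [e_mul_eL_of_mem hl h]
      simp
    · rw [← e_mul_eL_of_notMem h, ← eL_cons, ← hlen]
      have := eL_mem_sVectors (𝕜 := 𝕜) (List.nodup_cons.2 ⟨h, hl⟩)
      exact smul_mem_sVectors _ (Submodule.add_mem _ this this)
  · rw [map_add]; exact Submodule.add_mem _ ha hb
  · rw [map_smul]; exact Submodule.smul_mem _ _ ha

theorem bullet_mem (u : Euc m) {s : ℕ} {a : Cl 𝕜 m} (ha : a ∈ sVectors 𝕜 m (s + 1)) :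
    bullet 𝕜 u a ∈ sVectors 𝕜 m s := by
  change bulletₗ 𝕜 u a ∈ _
  refine sVectors_induction (p := fun a => bulletₗ 𝕜 u a ∈ sVectors 𝕜 m s)
    (fun l hl hlen => ?_) (by simp) (fun a b ha hb => ?_) (fun c a ha => ?_) ha
  · change bullet 𝕜 u _ ∈ _
    rw [bullet_eq_sum]
    refine Submodule.sum_mem _ fun i _ => smul_mem_sVectors _ ?_
    rw [bullet, gradeInv_eL, ← e, smul_mul_assoc]
    by_cases h : i ∈ l
    · rw [← neg_eq_iff_eq_neg.2 (e_mul_eL_of_mem (𝕜 := 𝕜) hl h)]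
      obtain ⟨l', hl', hlen', hi, -, c, -, hc⟩ := exists_eL_eq (𝕜 := 𝕜) hl h
      have : e 𝕜 i * eL 𝕜 l ∈ sVectors 𝕜 m s := by
        rw [hc, mul_smul_comm, e_mul_e_mul_self]
        have := eL_mem_sVectors (𝕜 := 𝕜) hl'
        rw [show l'.length = s by omega] at this
        exact Submodule.smul_mem _ _ (Submodule.neg_mem _ this)
      exact smul_mem_sVectors _ (Submodule.sub_mem _ this (Submodule.neg_mem _ this))
    · rw [← e_mul_eL_of_notMem h]
      simp
  · rw [map_add]; exact Submodule.add_mem _ ha hb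
  · rw [map_smul]; exact Submodule.smul_mem _ _ ha

theorem bullet_of_mem_zero (u : Euc m) {a : Cl 𝕜 m} (ha : a ∈ sVectors 𝕜 m 0) :
    bullet 𝕜 u a = 0 := by
  refine sVectors_eqOn (bulletₗ 𝕜 u) 0 (fun l _ hl => ?_) ha
  rw [List.length_eq_zero_iff] at hl
  subst hl
  simp [bulletₗ, eL_nil, bullet]

theorem wedge_of_mem_top (u : Euc m) {a : Cl 𝕜 m} (ha : a ∈ sVectors 𝕜 m m) :
    wedge 𝕜 u a = 0 := by
  refine sVectors_eqOn (wedgeₗ 𝕜 u) 0 (fun l hl hlen => ?_) ha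
  change wedge 𝕜 u _ = 0
  rw [wedge_eq_sum]
  refine Finset.sum_eq_zero fun i _ => ?_
  have hi : i ∈ l := by
    have : l.toFinset = Finset.univ := by
      rw [← Finset.card_eq_iff_eq_univ, List.toFinset_card_of_nodup hl, hlen, Fintype.card_fin]
    rw [← List.mem_toFinset, this]
    exact Finset.mem_univ i
  rw [wedge, gradeInv_eL, ← e, smul_mul_assoc, e_mul_eL_of_mem hl hi]
  simp

theorem wedge_wedge (u : Euc m) (a : Cl 𝕜 m) : wedge 𝕜 u (wedge 𝕜 u a) = 0 := by
  simp only [wedge, gradeInv_smul, map_add, map_mul, gradeInv_vec, gradeInv_gradeInv, mul_add,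
    add_mul, mul_smul_comm, smul_mul_assoc, neg_mul, mul_neg, vec_mul_vec_mul_self, mul_assoc, vec_mul_self,
    mul_one]
  module

theorem bullet_bullet (u : Euc m) (a : Cl 𝕜 m) : bullet 𝕜 u (bullet 𝕜 u a) = 0 := by
  simp only [bullet, gradeInv_smul, map_sub, map_mul, gradeInv_vec, gradeInv_gradeInv, mul_sub,
    sub_mul, mul_smul_comm, smul_mul_assoc, neg_mul, mul_neg, vec_mul_vec_mul_self, mul_assoc, vec_mul_self,
    mul_one]
  module

/-- Expand u(ua) = -|u|² a with left multiplication by u written as the sum of the outer and the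
inner product: both of these square to zero, so only the mixed terms survive. -/
theorem bullet_wedge_add (u : Euc m) (a : Cl 𝕜 m) :
    bullet 𝕜 u (wedge 𝕜 u a) + wedge 𝕜 u (bullet 𝕜 u a) = (-(‖u‖ ^ 2)) • a := by
  have h1 := wedge_add_bullet u (wedge 𝕜 u a)
  have h2 := wedge_add_bullet u (bullet 𝕜 u a)
  rw [wedge_wedge, zero_add] at h1
  rw [bullet_bullet, add_zero] at h2
  rw [h1, h2, ← mul_add, wedge_add_bullet, vec_mul_vec_mul_self]

end Clifford

/-! ### The positive definite form [ā b]_0 and its orthonormal basis -/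

section ScalarPart

variable {𝕜 : Type*} [RCLike 𝕜] {m : ℕ}

/-! ### The scalar part and the inner product of Clifford numbers -/

theorem associated_neg_negSq_apply (x y : Euc m) :
    QuadraticMap.associated (R := ℝ) (-negSq m) x y = inner ℝ x y := by
  rw [QuadraticMap.associated_apply]
  simp only [neg_apply, negSq_apply, norm_add_sq_real]
  have h2 : ∀ z : ℝ, (⅟2 : Module.End ℝ ℝ) • (2 * z) = z := fun z => by
    simp
  rw [show -(-(‖x‖ ^ 2 + 2 * inner ℝ x y + ‖y‖ ^ 2)) - -(-‖x‖ ^ 2) - -(-‖y‖ ^ 2) =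
    2 * inner ℝ x y by ring, h2]

theorem contractLeft_prod_eq_zero (d : Module.Dual ℝ (Euc m)) (l : List (Euc m))
    (h : ∀ v ∈ l, d v = 0) :
    CliffordAlgebra.contractLeft (Q := (0 : QuadraticForm ℝ (Euc m))) d
      (l.map (CliffordAlgebra.ι (0 : QuadraticForm ℝ (Euc m)))).prod = 0 := by
  induction l with
  | nil => simp
  | cons v l ih =>
    rw [List.map_cons, List.prod_cons, CliffordAlgebra.contractLeft_ι_mul, h v (by simp),
      ih fun w hw => h w (by simp [hw])]
    simp

/-- Passing to the exterior algebra corrects a product by contractions with inner products of its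
factors; for pairwise orthogonal factors all corrections vanish. This makes the scalar part
computable on monomials of basis vectors. -/
theorem equivExterior_prod (l : List (Euc m)) (h : l.Pairwise fun v w => inner ℝ v w = 0) :
    CliffordAlgebra.equivExterior (negSq m) (l.map (CliffordAlgebra.ι (negSq m))).prod =
      (l.map (CliffordAlgebra.ι (0 : QuadraticForm ℝ (Euc m)))).prod := by
  change CliffordAlgebra.changeForm CliffordAlgebra.changeForm.associated_neg_proof _ = _
  induction l with
  | nil => simp
  | cons v l ih =>
    rw [List.map_cons, List.prod_cons, CliffordAlgebra.changeForm_ι_mul, ih h.of_cons,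
      contractLeft_prod_eq_zero, sub_zero, List.map_cons, List.prod_cons]
    intro w hw
    rw [associated_neg_negSq_apply]
    exact List.rel_of_pairwise_cons h hw

theorem scalarPart_tmul (z : 𝕜) (r : RCl m) : scalarPart 𝕜 m (z ⊗ₜ[ℝ] r) =
    (ExteriorAlgebra.algebraMapInv (R := ℝ) (M := Euc m)
      (CliffordAlgebra.equivExterior (negSq m) r)) • z := by
  simp [scalarPart]

theorem scalarPart_smul (c : 𝕜) (a : Cl 𝕜 m) : scalarPart 𝕜 m (c • a) = c * scalarPart 𝕜 m a := by
  induction a using TensorProduct.induction_on with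
  | zero => simp
  | add x y hx hy => simp [mul_add, hx, hy]
  | tmul z r => simp [TensorProduct.smul_tmul', scalarPart_tmul]

theorem eL_eq_incl (l : List (Fin m)) : eL 𝕜 l = incl 𝕜 m
    ((l.map fun i => EuclideanSpace.single i (1 : ℝ)).map (CliffordAlgebra.ι (negSq m))).prod := by
  simp only [eL, map_list_prod, List.map_map]
  rfl

theorem scalarPart_eL {l : List (Fin m)} (hl : l.Nodup) (h : l ≠ []) :
    scalarPart 𝕜 m (eL 𝕜 l) = 0 := by
  rw [eL_eq_incl, incl, Algebra.TensorProduct.includeRight_apply, scalarPart_tmul,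
    equivExterior_prod]
  · obtain ⟨i, l', rfl⟩ := List.exists_cons_of_ne_nil h
    rw [List.map_cons, List.map_cons, List.prod_cons]
    have : ExteriorAlgebra.algebraMapInv (R := ℝ) (M := Euc m)
      (CliffordAlgebra.ι (0 : QuadraticForm ℝ (Euc m)) (EuclideanSpace.single i (1 : ℝ))) = 0 := by
      change ExteriorAlgebra.algebraMapInv (ExteriorAlgebra.ι ℝ _) = 0
      simp [ExteriorAlgebra.algebraMapInv]
    rw [map_mul, this, zero_mul, zero_smul]
  · rw [List.pairwise_map]
    refine hl.imp fun {a b} hab => ?_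
    simp [EuclideanSpace.inner_single_left, hab]

theorem scalarPart_one : scalarPart 𝕜 m 1 = 1 := by
  rw [Algebra.TensorProduct.one_def, scalarPart_tmul]
  have : CliffordAlgebra.equivExterior (negSq m) 1 = 1 := by
    change CliffordAlgebra.changeForm CliffordAlgebra.changeForm.associated_neg_proof _ = _
    simp
  rw [this]
  simp

theorem cliffConj_tmul (z : 𝕜) (r : RCl m) : cliffConj 𝕜 m (z ⊗ₜ[ℝ] r) =
    (starRingEnd 𝕜 z) ⊗ₜ[ℝ] (CliffordAlgebra.reverse (CliffordAlgebra.involute r)) := by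
  simp [cliffConj]

theorem cliffConj_smul (c : 𝕜) (a : Cl 𝕜 m) :
    cliffConj 𝕜 m (c • a) = (starRingEnd 𝕜 c) • cliffConj 𝕜 m a := by
  induction a using TensorProduct.induction_on with
  | zero => simp
  | add x y hx hy => simp [hx, hy]
  | tmul z r => simp [TensorProduct.smul_tmul', cliffConj_tmul]

theorem cliffConj_mul (a b : Cl 𝕜 m) :
    cliffConj 𝕜 m (a * b) = cliffConj 𝕜 m b * cliffConj 𝕜 m a := by
  induction a using TensorProduct.induction_on with
  | zero => simp
  | add x y hx hy => simp [add_mul, mul_add, hx, hy]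
  | tmul z r =>
    induction b using TensorProduct.induction_on with
    | zero => simp
    | add x y hx hy => simp [add_mul, mul_add, hx, hy]
    | tmul w t => simp [cliffConj_tmul, mul_comm]

theorem cliffConj_vec (x : Euc m) : cliffConj 𝕜 m (vec 𝕜 x) = -vec 𝕜 x := by
  simp [vec, incl, cliffConj_tmul, TensorProduct.tmul_neg]

theorem cliffConj_one : cliffConj 𝕜 m 1 = 1 := by
  simp [Algebra.TensorProduct.one_def, cliffConj_tmul]

theorem eL_mul_eL {l l' : List (Fin m)} (hl : l.Nodup) (hl' : l'.Nodup) :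
    ∃ (l'' : List (Fin m)) (c : 𝕜), l''.Nodup ∧ (∀ j, j ∈ l'' ↔ Xor (j ∈ l) (j ∈ l')) ∧
      eL 𝕜 l * eL 𝕜 l' = c • eL 𝕜 l'' := by
  induction l with
  | nil => exact ⟨l', 1, hl', by simp [Xor], by simp [eL_nil]⟩
  | cons i l ih =>
    obtain ⟨k, c, hk, hmem, h⟩ := ih hl.of_cons
    have hi := hl.notMem
    by_cases hik : i ∈ k
    · obtain ⟨k', hk', -, hik', hmem', d, -, hd⟩ := exists_eL_eq (𝕜 := 𝕜) hk hik
      refine ⟨k', -(c * d), hk', fun j => ?_, ?_⟩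
      · have h1 := hmem' j
        have h2 := hmem j
        have h3 := hmem i
        by_cases hj : j = i
        · subst hj
          simp_all [Xor]
        · simp_all [Xor]
      · rw [eL_cons, mul_assoc, h, hd, mul_smul_comm, mul_smul_comm, e_mul_e_mul_self, smul_smul,
          smul_neg, neg_smul]
    · refine ⟨i :: k, c, List.nodup_cons.2 ⟨hik, hk⟩, fun j => ?_, ?_⟩
      · have h2 := hmem j
        have h3 := hmem i
        by_cases hj : j = i
        · subst hj
          simp_all [Xor]
        · simp_all [Xor]
      · rw [eL_cons, mul_assoc, h, mul_smul_comm, eL_cons]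

theorem cliffConj_eL {l : List (Fin m)} (hl : l.Nodup) :
    ∃ c : 𝕜, cliffConj 𝕜 m (eL 𝕜 l) = c • eL 𝕜 l := by
  induction l with
  | nil => exact ⟨1, by simp [eL_nil, cliffConj_one]⟩
  | cons i l ih =>
    obtain ⟨c, hc⟩ := ih hl.of_cons
    refine ⟨-c * (algebraMap ℝ 𝕜 ((-1) ^ l.length)), ?_⟩
    rw [eL_cons, cliffConj_mul, hc, e, cliffConj_vec, ← e, mul_smul, algebraMap_smul,
      e_mul_eL_of_notMem hl.notMem, smul_smul, ← mul_pow]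
    simp

theorem cliffConj_eL_mul_eL (l : List (Fin m)) : cliffConj 𝕜 m (eL 𝕜 l) * eL 𝕜 l = 1 := by
  induction l with
  | nil => simp [eL_nil, cliffConj_one]
  | cons i l ih =>
    rw [eL_cons, cliffConj_mul, mul_assoc, e, cliffConj_vec, ← e, neg_mul, e_mul_e_mul_self,
      neg_neg, ih]

/-- The products of basis vectors indexed by subsets. -/
def eF (𝕜 : Type*) [RCLike 𝕜] {m : ℕ} (I : Finset (Fin m)) : Cl 𝕜 m := eL 𝕜 (I.sort (· ≤ ·))

/-- The product of the conjugate of e_I with e_J is a multiple of the monomial on the symmetric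
difference of I and J, and that monomial has scalar part zero unless I = J. -/
theorem scalarPart_cliffConj_eF (I J : Finset (Fin m)) :
    scalarPart 𝕜 m (cliffConj 𝕜 m (eF 𝕜 I) * eF 𝕜 J) = if I = J then 1 else 0 := by
  split_ifs with h
  · rw [h, eF, cliffConj_eL_mul_eL, scalarPart_one]
  · obtain ⟨c, hc⟩ := cliffConj_eL (𝕜 := 𝕜) (Finset.sort_nodup I (· ≤ ·))
    obtain ⟨l, d, hl, hmem, hd⟩ := eL_mul_eL (𝕜 := 𝕜) (Finset.sort_nodup I (· ≤ ·))
      (Finset.sort_nodup J (· ≤ ·))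
    rw [eF, eF, hc, smul_mul_assoc, hd, scalarPart_smul, scalarPart_smul, scalarPart_eL hl]
    · simp
    · rintro rfl
      apply h
      ext j
      have := hmem j
      simpa [Xor, not_or, iff_iff_implies_and_implies] using this

/-- The span contains 1 and is stable under left multiplication by scalars and by every e_i, hence
by the whole algebra. -/
theorem span_eL : Submodule.span 𝕜 {a | ∃ l : List (Fin m), l.Nodup ∧ eL 𝕜 l = a} = ⊤ := by
  set M := Submodule.span 𝕜 {a | ∃ l : List (Fin m), l.Nodup ∧ eL 𝕜 l = a} with hM
  have he : ∀ (i : Fin m), ∀ b ∈ M, e 𝕜 i * b ∈ M := by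
    intro i b hb
    induction hb using Submodule.span_induction with
    | mem x h =>
      obtain ⟨l, hl, rfl⟩ := h
      obtain ⟨l', c, hl', -, h⟩ := eL_mul_eL (𝕜 := 𝕜) (List.nodup_singleton i) hl
      rw [eL_cons, eL_nil, mul_one] at h
      rw [h]
      exact Submodule.smul_mem _ _ (Submodule.subset_span ⟨l', hl', rfl⟩)
    | zero => simp
    | add x y _ _ hx hy => rw [mul_add]; exact Submodule.add_mem _ hx hy
    | smul c x _ hx => rw [mul_smul_comm]; exact Submodule.smul_mem _ _ hx
  have hr : ∀ (c : ℝ), ∀ b ∈ M, c • b ∈ M := by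
    intro c b hb
    rw [← algebraMap_smul 𝕜 c b]
    exact Submodule.smul_mem _ _ hb
  have hincl : ∀ (r : RCl m), ∀ b ∈ M, incl 𝕜 m r * b ∈ M := by
    intro r
    induction r using CliffordAlgebra.induction with
    | algebraMap c =>
      intro b hb
      rw [AlgHom.commutes, ← Algebra.smul_def]
      exact hr c b hb
    | ι x =>
      intro b hb
      change vec 𝕜 x * b ∈ M
      rw [vec_eq_sum, Finset.sum_mul]
      refine Submodule.sum_mem _ fun i _ => ?_
      rw [smul_mul_assoc]
      exact hr _ _ (he i b hb)
    | mul a b ha hb =>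
      intro x hx
      rw [map_mul, mul_assoc]
      exact ha _ (hb _ hx)
    | add a b ha hb =>
      intro x hx
      rw [map_add, add_mul]
      exact Submodule.add_mem _ (ha x hx) (hb x hx)
  have h1 : (1 : Cl 𝕜 m) ∈ M := Submodule.subset_span ⟨[], List.nodup_nil, rfl⟩
  rw [eq_top_iff]
  rintro a -
  induction a using TensorProduct.induction_on with
  | zero => simp
  | add x y hx hy => exact Submodule.add_mem _ hx hy
  | tmul z r =>
    have : z ⊗ₜ[ℝ] r = z • (incl 𝕜 m r * 1) := by
      simp [incl, TensorProduct.smul_tmul']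
    rw [this]
    exact Submodule.smul_mem _ _ (hincl r 1 h1)

theorem Cl_induction {p : Cl 𝕜 m → Prop} (hL : ∀ l : List (Fin m), l.Nodup → p (eL 𝕜 l))
    (h0 : p 0) (hadd : ∀ a b, p a → p b → p (a + b)) (hsmul : ∀ (c : 𝕜) a, p a → p (c • a))
    (a : Cl 𝕜 m) : p a := by
  have ha : a ∈ Submodule.span 𝕜 {a | ∃ l : List (Fin m), l.Nodup ∧ eL 𝕜 l = a} := by
    rw [span_eL]; trivial
  induction ha using Submodule.span_induction with
  | mem x h => obtain ⟨l, h1, rfl⟩ := h; exact hL l h1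
  | zero => exact h0
  | add x y _ _ hx hy => exact hadd x y hx hy
  | smul c x _ hx => exact hsmul c x hx

theorem span_eF : Submodule.span 𝕜 (Set.range (eF 𝕜 (m := m))) = ⊤ := by
  rw [eq_top_iff, ← span_eL, Submodule.span_le]
  rintro _ ⟨l, hl, rfl⟩
  have hp : l.Perm (l.toFinset.sort (· ≤ ·)) := by
    rw [List.perm_ext_iff_of_nodup hl (Finset.sort_nodup _ _)]
    simp
  have hmem : eF 𝕜 l.toFinset ∈ Submodule.span 𝕜 (Set.range (eF 𝕜 (m := m))) :=
    Submodule.subset_span ⟨_, rfl⟩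
  rcases eL_perm (𝕜 := 𝕜) hp hl with h | h
  · rw [h]; exact hmem
  · rw [h]; exact Submodule.neg_mem _ hmem

instance finite_Cl : Module.Finite 𝕜 (Cl 𝕜 m) :=
  ⟨by rw [← span_eF]; exact Submodule.fg_span (Set.finite_range _)⟩

theorem exists_eq_sum_eF (a : Cl 𝕜 m) : ∃ c : Finset (Fin m) → 𝕜, a = ∑ I, c I • eF 𝕜 I := by
  have : a ∈ Submodule.span 𝕜 (Set.range (eF 𝕜 (m := m))) := by rw [span_eF]; trivial
  obtain ⟨c, hc⟩ := (Submodule.mem_span_range_iff_exists_fun 𝕜).1 this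
  exact ⟨c, hc.symm⟩

theorem scalarPart_cliffConj_sum (c d : Finset (Fin m) → 𝕜) :
    scalarPart 𝕜 m (cliffConj 𝕜 m (∑ I, c I • eF 𝕜 I) * ∑ I, d I • eF 𝕜 I) =
      ∑ I, (starRingEnd 𝕜 (c I)) * d I := by
  simp only [map_sum, cliffConj_smul, Finset.sum_mul, Finset.mul_sum, smul_mul_assoc,
    mul_smul_comm, scalarPart_smul, scalarPart_cliffConj_eF]
  simp [mul_comm]

theorem scalarPart_cliffConj_symm (a b : Cl 𝕜 m) :
    starRingEnd 𝕜 (scalarPart 𝕜 m (cliffConj 𝕜 m b * a)) =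
      scalarPart 𝕜 m (cliffConj 𝕜 m a * b) := by
  obtain ⟨c, rfl⟩ := exists_eq_sum_eF a
  obtain ⟨d, rfl⟩ := exists_eq_sum_eF b
  rw [scalarPart_cliffConj_sum, scalarPart_cliffConj_sum, map_sum]
  simp [mul_comm]

theorem scalarPart_cliffConj_self (a : Cl 𝕜 m) : ∃ r : ℝ, 0 ≤ r ∧
    scalarPart 𝕜 m (cliffConj 𝕜 m a * a) = (r : 𝕜) ∧ (r = 0 → a = 0) := by
  obtain ⟨c, rfl⟩ := exists_eq_sum_eF a
  refine ⟨∑ I, ‖c I‖ ^ 2, by positivity, ?_, fun h => ?_⟩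
  · rw [scalarPart_cliffConj_sum]
    simp [RCLike.conj_mul]
  · rw [Finset.sum_eq_zero_iff_of_nonneg fun _ _ => by positivity] at h
    refine Finset.sum_eq_zero fun I _ => ?_
    have := h I (Finset.mem_univ I)
    simp only [ne_eq, OfNat.ofNat_ne_zero, not_false_eq_true, pow_eq_zero_iff, norm_eq_zero] at this
    rw [this, zero_smul]

theorem eq_zero_of_scalarPart {a : Cl 𝕜 m} (h : scalarPart 𝕜 m (cliffConj 𝕜 m a * a) = 0) :
    a = 0 := by
  obtain ⟨r, -, h1, h2⟩ := scalarPart_cliffConj_self a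
  rw [h] at h1
  exact h2 (by exact_mod_cast h1.symm)

/-- The trace property of the scalar part, for one factor a basis vector; it makes the pointwise
inner product invariant under a ↦ -v a v (`scalarPart_conjBy`). -/
theorem scalarPart_e_mul (i : Fin m) (a : Cl 𝕜 m) :
    scalarPart 𝕜 m (e 𝕜 i * a) = scalarPart 𝕜 m (a * e 𝕜 i) := by
  refine Cl_induction (p := fun a => scalarPart 𝕜 m (e 𝕜 i * a) = scalarPart 𝕜 m (a * e 𝕜 i))
    (fun l hl => ?_) (by simp) (fun a b ha hb => ?_) (fun c a ha => ?_) a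
  · by_cases h : i ∈ l
    · obtain ⟨l', hl', -, hi, -, c, -, hc⟩ := exists_eL_eq (𝕜 := 𝕜) hl h
      rw [hc, mul_smul_comm, smul_mul_assoc, scalarPart_smul, scalarPart_smul, e_mul_e_mul_self,
        e_mul_eL_of_notMem hi, smul_mul_assoc, mul_assoc, e_mul_self, mul_neg, mul_one, map_neg,
        smul_neg, map_neg, map_smul]
      by_cases h0 : l' = []
      · simp [h0]
      · simp [scalarPart_eL hl' h0]
    · have h1 := scalarPart_eL (𝕜 := 𝕜) (List.nodup_cons.2 ⟨h, hl⟩) (by simp)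
      rw [eL_cons] at h1
      have h2 := h1
      rw [e_mul_eL_of_notMem h, map_smul, smul_eq_zero] at h2
      rw [h1, h2.resolve_left (by simp)]
  · rw [mul_add, add_mul, map_add, map_add, ha, hb]
  · rw [mul_smul_comm, smul_mul_assoc, scalarPart_smul, scalarPart_smul, ha]

theorem scalarPart_vec_mul (v : Euc m) (a : Cl 𝕜 m) :
    scalarPart 𝕜 m (vec 𝕜 v * a) = scalarPart 𝕜 m (a * vec 𝕜 v) := by
  rw [vec_eq_sum]
  simp only [Finset.sum_mul, Finset.mul_sum, map_sum, smul_mul_assoc, mul_smul_comm, map_smul,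
    scalarPart_e_mul]

end ScalarPart

/-! ### Splitting the Clifford algebra of ℝ^(n+1) along the last basis vector -/

section Up

variable {𝕜 : Type*} [RCLike 𝕜] {n : ℕ}

/-! ### The inclusion of Clifford algebras -/

theorem upCl_vec (x : Euc n) : upCl 𝕜 n (vec 𝕜 x) = vec 𝕜 (up n x) := by
  simp [upCl, vec, incl, upRCl_ι]

theorem up_single (i : Fin n) :
    up n (EuclideanSpace.single i 1) = EuclideanSpace.single i.castSucc 1 := by
  ext j
  refine Fin.lastCases ?_ (fun j => ?_) j
  · simp [up, Pi.single_apply, Fin.last_eq_zero_iff, (Fin.castSucc_lt_last i).ne']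
  · simp [up, Pi.single_apply]

theorem upCl_e (i : Fin n) : upCl 𝕜 n (e 𝕜 i) = e 𝕜 i.castSucc := by
  rw [e, upCl_vec, up_single, e]

theorem upCl_eL (l : List (Fin n)) : upCl 𝕜 n (eL 𝕜 l) = eL 𝕜 (l.map Fin.castSucc) := by
  induction l with
  | nil => simp [eL_nil]
  | cons i l ih => rw [eL_cons, map_mul, ih, upCl_e, List.map_cons, eL_cons]

theorem upCl_gradeInv (a : Cl 𝕜 n) : upCl 𝕜 n (gradeInv 𝕜 n a) = gradeInv 𝕜 (n + 1) (upCl 𝕜 n a) := by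
  have : (upCl 𝕜 n).comp (gradeInv 𝕜 n) = (gradeInv 𝕜 (n + 1)).comp (upCl 𝕜 n) :=
    Cl_algHom_ext fun x => by simp [gradeInv_vec, upCl_vec]
  exact DFunLike.congr_fun this a

theorem upCl_smul (c : ℝ) (a : Cl 𝕜 n) : upCl 𝕜 n (c • a) = c • upCl 𝕜 n a :=
  LinearMap.map_smul_of_tower (upCl 𝕜 n).toLinearMap c a

theorem scalarPart_upCl (a : Cl 𝕜 n) : scalarPart 𝕜 (n + 1) (upCl 𝕜 n a) = scalarPart 𝕜 n a := by
  refine Cl_induction (p := fun a => scalarPart 𝕜 (n + 1) (upCl 𝕜 n a) = scalarPart 𝕜 n a)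
    (fun l hl => ?_) (by simp) (fun a b ha hb => ?_) (fun c a ha => ?_) a
  · rw [upCl_eL]
    by_cases h : l = []
    · simp [h, eL_nil, scalarPart_one]
    · rw [scalarPart_eL hl h, scalarPart_eL (hl.map (Fin.castSucc_injective n)) (by simpa using h)]
  · rw [map_add, map_add, map_add, ha, hb]
  · rw [map_smul, scalarPart_smul, scalarPart_smul, ha]

/-- The inclusion preserves scalar parts, and [ā a]_0 vanishes only for a = 0. -/
theorem upCl_injective : Function.Injective (upCl 𝕜 n) := by
  rw [injective_iff_map_eq_zero]
  intro a ha
  apply eq_zero_of_scalarPart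
  rw [← scalarPart_upCl, map_mul, ha, mul_zero, map_zero]

theorem exists_upCl_leftInverse : ∃ g : Cl 𝕜 (n + 1) →ₗ[𝕜] Cl 𝕜 n, ∀ a, g (upCl 𝕜 n a) = a := by
  obtain ⟨g, hg⟩ := LinearMap.exists_leftInverse_of_injective (upCl 𝕜 n).toLinearMap
    (LinearMap.ker_eq_bot.2 upCl_injective)
  exact ⟨g, fun a => DFunLike.congr_fun hg a⟩

theorem e_last_mul_vec_up (x : Euc n) :
    e 𝕜 (Fin.last n) * vec 𝕜 (up n x) = -(vec 𝕜 (up n x) * e 𝕜 (Fin.last n)) := by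
  rw [vec_mul_e]
  simp [up]

theorem e_last_mul_upCl (a : Cl 𝕜 n) :
    e 𝕜 (Fin.last n) * upCl 𝕜 n a = upCl 𝕜 n (gradeInv 𝕜 n a) * e 𝕜 (Fin.last n) := by
  refine Cl_induction (p := fun a => e 𝕜 (Fin.last n) * upCl 𝕜 n a =
    upCl 𝕜 n (gradeInv 𝕜 n a) * e 𝕜 (Fin.last n))
    (fun l hl => ?_) (by simp) (fun a b ha hb => ?_) (fun c a ha => ?_) a
  · induction l with
    | nil => simp [eL_nil]
    | cons i l ih => 
      rw [eL_cons, map_mul, map_mul, map_mul, ← mul_assoc, gradeInv_e, map_neg, upCl_e,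
        e_mul_e (Fin.castSucc_lt_last i).ne', neg_mul, mul_assoc, ih hl.of_cons]
      simp [mul_assoc]
  · simp only [map_add, mul_add, add_mul, ha, hb]
  · simp only [map_smul, mul_smul_comm, smul_mul_assoc, ha]

theorem upCl_mem {s : ℕ} {a : Cl 𝕜 n} (ha : a ∈ sVectors 𝕜 n s) :
    upCl 𝕜 n a ∈ sVectors 𝕜 (n + 1) s := by
  refine sVectors_induction (p := fun a => upCl 𝕜 n a ∈ sVectors 𝕜 (n + 1) s)
    (fun l hl hlen => ?_) (by simp) (fun a b ha hb => ?_) (fun c a ha => ?_) ha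
  · rw [upCl_eL, ← hlen, ← List.length_map (f := Fin.castSucc)]
    exact eL_mem_sVectors (hl.map (Fin.castSucc_injective n))
  · rw [map_add]; exact Submodule.add_mem _ ha hb
  · rw [map_smul]; exact Submodule.smul_mem _ _ ha

theorem e_last_mul_upCl_mem {s : ℕ} {a : Cl 𝕜 n} (ha : a ∈ sVectors 𝕜 n s) :
    e 𝕜 (Fin.last n) * upCl 𝕜 n a ∈ sVectors 𝕜 (n + 1) (s + 1) := by
  refine sVectors_induction (p := fun a => e 𝕜 (Fin.last n) * upCl 𝕜 n a ∈ sVectors 𝕜 (n + 1) (s + 1))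
    (fun l hl hlen => ?_) (by simp) (fun a b ha hb => ?_) (fun c a ha => ?_) ha
  · have := eL_mem_sVectors (𝕜 := 𝕜) (l := Fin.last n :: l.map Fin.castSucc)
      (List.nodup_cons.2 ⟨by simp [(Fin.castSucc_lt_last _).ne], hl.map (Fin.castSucc_injective n)⟩)
    rwa [eL_cons, List.length_cons, List.length_map, hlen, ← upCl_eL] at this
  · rw [map_add, mul_add]; exact Submodule.add_mem _ ha hb
  · rw [map_smul, mul_smul_comm]; exact Submodule.smul_mem _ _ ha

theorem exists_eL_eq_upCl {l : List (Fin (n + 1))} (hl : l.Nodup) (h : Fin.last n ∉ l) :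
    ∃ l' : List (Fin n), l'.Nodup ∧ l'.length = l.length ∧ eL 𝕜 l = upCl 𝕜 n (eL 𝕜 l') := by
  have : ∃ l' : List (Fin n), l'.map Fin.castSucc = l := by
    induction l with
    | nil => exact ⟨[], rfl⟩
    | cons i l ih =>
      simp only [List.mem_cons, not_or] at h
      obtain ⟨l', rfl⟩ := ih hl.of_cons h.2
      obtain ⟨j, rfl⟩ := Fin.exists_castSucc_eq.2 (Ne.symm h.1)
      exact ⟨j :: l', rfl⟩
  obtain ⟨l', rfl⟩ := this
  exact ⟨l', hl.of_map _, by simp, by rw [upCl_eL]⟩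

theorem exists_eq_upCl_add {s : ℕ} {a : Cl 𝕜 (n + 1)} (ha : a ∈ sVectors 𝕜 (n + 1) (s + 1)) :
    ∃ A ∈ sVectors 𝕜 n (s + 1), ∃ B ∈ sVectors 𝕜 n s,
      a = upCl 𝕜 n A + e 𝕜 (Fin.last n) * upCl 𝕜 n B := by
  refine sVectors_induction (p := fun a => ∃ A ∈ sVectors 𝕜 n (s + 1), ∃ B ∈ sVectors 𝕜 n s,
      a = upCl 𝕜 n A + e 𝕜 (Fin.last n) * upCl 𝕜 n B) (fun l hl hlen => ?_)
    ⟨0, Submodule.zero_mem _, 0, Submodule.zero_mem _, by simp⟩ ?_ ?_ ha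
  · by_cases h : Fin.last n ∈ l
    · obtain ⟨k, hk, hlen', hnot, -, c, -, hc⟩ := exists_eL_eq (𝕜 := 𝕜) hl h
      obtain ⟨k', hk', hlen'', h'⟩ := exists_eL_eq_upCl (𝕜 := 𝕜) hk hnot
      have hm := eL_mem_sVectors (𝕜 := 𝕜) hk'
      rw [show k'.length = s by omega] at hm
      exact ⟨0, Submodule.zero_mem _, c • eL 𝕜 k', Submodule.smul_mem _ _ hm, by
        rw [hc, h', map_smul]; simp⟩
    · obtain ⟨k', hk', hlen'', h'⟩ := exists_eL_eq_upCl (𝕜 := 𝕜) hl h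
      have hm := eL_mem_sVectors (𝕜 := 𝕜) hk'
      rw [hlen'', hlen] at hm
      exact ⟨eL 𝕜 k', hm, 0, Submodule.zero_mem _, by rw [h']; simp⟩
  · rintro _ _ ⟨A, hA, B, hB, rfl⟩ ⟨A', hA', B', hB', rfl⟩
    exact ⟨A + A', Submodule.add_mem _ hA hA', B + B', Submodule.add_mem _ hB hB', by
      simp only [map_add, mul_add]; abel⟩
  · rintro c _ ⟨A, hA, B, hB, rfl⟩
    exact ⟨c • A, Submodule.smul_mem _ _ hA, c • B, Submodule.smul_mem _ _ hB, by
      simp only [map_smul, mul_smul_comm, smul_add]⟩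

theorem mem_sVectors_zero {m : ℕ} {a : Cl 𝕜 m} (ha : a ∈ sVectors 𝕜 m 0) : ∃ c : 𝕜, a = c • 1 := by
  refine sVectors_induction (p := fun a => ∃ c : 𝕜, a = c • 1) (fun l _ hl => ?_)
    ⟨0, by simp⟩ ?_ ?_ ha
  · rw [List.length_eq_zero_iff] at hl
    exact ⟨1, by simp [hl, eL_nil]⟩
  · rintro _ _ ⟨c, rfl⟩ ⟨d, rfl⟩
    exact ⟨c + d, by rw [add_smul]⟩
  · rintro c _ ⟨d, rfl⟩
    exact ⟨c * d, by rw [mul_smul]⟩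

theorem one_mem_sVectors_zero {m : ℕ} : (1 : Cl 𝕜 m) ∈ sVectors 𝕜 m 0 :=
  eL_mem_sVectors (𝕜 := 𝕜) (l := ([] : List (Fin m))) List.nodup_nil

/-- The part of a Clifford number over `ℝ^(n+1)` that does not contain `e_{n+1}`. -/
def tangential (𝕜 : Type*) [RCLike 𝕜] (n : ℕ) : Cl 𝕜 (n + 1) →ₗ[𝕜] Cl 𝕜 (n + 1) where
  toFun a := (1 / 2 : ℝ) • (a - e 𝕜 (Fin.last n) * gradeInv 𝕜 (n + 1) a * e 𝕜 (Fin.last n))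
  map_add' a b := by simp only [map_add, mul_add, add_mul]; module
  map_smul' c a := by
    simp only [map_smul, mul_smul_comm, smul_mul_assoc, RingHom.id_apply]; module

theorem tangential_upCl (a : Cl 𝕜 n) : tangential 𝕜 n (upCl 𝕜 n a) = upCl 𝕜 n a := by
  change (1 / 2 : ℝ) • (_ : Cl 𝕜 (n + 1)) = _
  rw [← upCl_gradeInv, mul_assoc, ← e_last_mul_upCl, e_mul_e_mul_self]
  module

theorem tangential_e_last_mul (a : Cl 𝕜 n) :
    tangential 𝕜 n (e 𝕜 (Fin.last n) * upCl 𝕜 n a) = 0 := by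
  change (1 / 2 : ℝ) • (_ : Cl 𝕜 (n + 1)) = _
  rw [map_mul, gradeInv_e, ← upCl_gradeInv, mul_assoc, neg_mul, neg_mul, mul_neg, mul_assoc,
    ← e_last_mul_upCl, e_mul_e_mul_self, sub_neg_eq_add, add_neg_cancel, smul_zero]

theorem upCl_add_e_last_mul_eq_zero {A B : Cl 𝕜 n}
    (h : upCl 𝕜 n A + e 𝕜 (Fin.last n) * upCl 𝕜 n B = 0) : A = 0 ∧ B = 0 := by
  have hA : upCl 𝕜 n A = 0 := by
    have := congrArg (tangential 𝕜 n) h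
    rwa [map_add, tangential_upCl, tangential_e_last_mul, add_zero, map_zero] at this
  have hB : upCl 𝕜 n B = 0 := by
    rw [hA, zero_add] at h
    have := congrArg (e 𝕜 (Fin.last n) * ·) h
    simpa [e_mul_e_mul_self] using this
  exact ⟨upCl_injective (by simpa using hA), upCl_injective (by simpa using hB)⟩

end Up

/-! ### Calculus of homogeneous polynomials with values in a vector space -/

section Calculus

variable {𝕜 : Type*} [RCLike 𝕜] {m m' : ℕ} {V W : Type*} [AddCommGroup V] [Module 𝕜 V] [Module ℝ V]
  [IsScalarTower ℝ 𝕜 V] [AddCommGroup W] [Module 𝕜 W] [Module ℝ W] [IsScalarTower ℝ 𝕜 W]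

/-! ### Homogeneous polynomials with values in a vector space -/

theorem eq_of_dual {v w : V} (h : ∀ φ : V →ₗ[𝕜] 𝕜, φ v = φ w) : v = w := by
  rw [← sub_eq_zero, ← Module.forall_dual_apply_eq_zero_iff 𝕜]
  intro φ
  rw [map_sub, h φ, sub_self]

/-- `g = ∂f/∂x_i`, for functions with values in any vector space. -/
def HasPd (𝕜 : Type*) [RCLike 𝕜] [Module 𝕜 V] (i : Fin m) (f g : Euc m → V) : Prop :=
  ∀ (φ : V →ₗ[𝕜] 𝕜) (x : Euc m),
    HasDerivAt (fun t : ℝ => φ (f (x + t • EuclideanSpace.single i 1))) (φ (g x)) 0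

theorem HasPd.unique {i : Fin m} {f g g' : Euc m → V} (h : HasPd 𝕜 i f g) (h' : HasPd 𝕜 i f g') :
    g = g' :=
  funext fun x => eq_of_dual (𝕜 := 𝕜) fun φ => (h φ x).unique (h' φ x)

open Classical in
/-- The partial derivative (zero if it does not exist). -/
def pd (𝕜 : Type*) [RCLike 𝕜] [Module 𝕜 V] (i : Fin m) (f : Euc m → V) : Euc m → V :=
  if h : ∃ g, HasPd 𝕜 i f g then h.choose else 0

theorem HasPd.pd_eq {i : Fin m} {f g : Euc m → V} (h : HasPd 𝕜 i f g) : pd 𝕜 i f = g := by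
  have h' : ∃ g, HasPd 𝕜 i f g := ⟨g, h⟩
  rw [pd, dif_pos h']
  exact h'.choose_spec.unique h

theorem hasPd_const (i : Fin m) (c : V) : HasPd 𝕜 i (fun _ : Euc m => c) 0 := fun φ x => by
  simpa using hasDerivAt_const (0 : ℝ) (φ c)

theorem HasPd.add {i : Fin m} {f f' g g' : Euc m → V} (h : HasPd 𝕜 i f g) (h' : HasPd 𝕜 i f' g') :
    HasPd 𝕜 i (fun x => f x + f' x) (fun x => g x + g' x) := fun φ x => by
  simpa using! (h φ x).add (h' φ x)

theorem HasPd.sum {ι : Type*} {i : Fin m} {s : Finset ι} {f g : ι → Euc m → V}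
    (h : ∀ j ∈ s, HasPd 𝕜 i (f j) (g j)) :
    HasPd 𝕜 i (fun x => ∑ j ∈ s, f j x) (fun x => ∑ j ∈ s, g j x) := fun φ x => by
  simp only [map_sum]
  exact HasDerivAt.fun_sum fun j hj => h j hj φ x

theorem HasPd.const_smul {i : Fin m} {f g : Euc m → V} (h : HasPd 𝕜 i f g) (c : 𝕜) :
    HasPd 𝕜 i (fun x => c • f x) (fun x => c • g x) := fun φ x => by
  simpa using! (h φ x).const_mul c

theorem HasPd.map {i : Fin m} {f g : Euc m → V} (h : HasPd 𝕜 i f g) (L : V →ₗ[𝕜] W) :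
    HasPd 𝕜 i (fun x => L (f x)) (fun x => L (g x)) := fun φ x => h (φ ∘ₗ L) x

theorem HasPd.smul {i : Fin m} {f g : Euc m → V} (h : HasPd 𝕜 i f g) {u u' : Euc m → ℝ}
    (hu : ∀ x, HasDerivAt (fun t : ℝ => u (x + t • EuclideanSpace.single i 1)) (u' x) 0) :
    HasPd 𝕜 i (fun x => u x • f x) (fun x => u' x • f x + u x • g x) := fun φ x => by
  have := (hu x).smul (h φ x)
  simp only [zero_smul, add_zero] at this
  simp only [map_add, LinearMap.map_smul_of_tower]
  rw [add_comm]
  exact this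

theorem hasDerivAt_coord (i j : Fin m) (x : Euc m) :
    HasDerivAt (fun t : ℝ => (x + t • EuclideanSpace.single i (1 : ℝ)) j) (if i = j then 1 else 0) 0 := by
  have h : (fun t : ℝ => (x + t • EuclideanSpace.single i (1 : ℝ)) j) =
      fun t : ℝ => x j + t * (if i = j then 1 else 0) := by
    funext t
    simp [Pi.single_apply, eq_comm]
  rw [h]
  simpa using ((hasDerivAt_id (0 : ℝ)).mul_const (if i = j then (1 : ℝ) else 0)).const_add (x j)

theorem HasPd.coord_smul {i : Fin m} {f g : Euc m → V} (h : HasPd 𝕜 i f g) (j : Fin m) :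
    HasPd 𝕜 i (fun x => x j • f x) (fun x => (if i = j then (1 : ℝ) else 0) • f x + x j • g x) :=
  h.smul fun x => hasDerivAt_coord i j x

/-- The `k`-homogeneous polynomial functions with values in `V`. -/
def HPoly (𝕜 : Type*) [RCLike 𝕜] (V : Type*) [AddCommGroup V] [Module 𝕜 V] [Module ℝ V] (m k : ℕ) :
    Submodule 𝕜 (Euc m → V) :=
  Submodule.span 𝕜 {f | ∃ (p : MvPolynomial (Fin m) ℝ) (c : V), p.IsHomogeneous k ∧
    f = fun x => (MvPolynomial.eval (fun i => x i) p) • c}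

theorem hasDerivAt_eval (p : MvPolynomial (Fin m) ℝ) {γ : ℝ → Euc m} {γ' : Fin m → ℝ} {t : ℝ}
    (hγ : ∀ i, HasDerivAt (fun t => γ t i) (γ' i) t) :
    HasDerivAt (fun t => MvPolynomial.eval (fun i => γ t i) p)
      (∑ i, γ' i * MvPolynomial.eval (fun i => γ t i) (MvPolynomial.pderiv i p)) t := by
  induction p using MvPolynomial.induction_on with
  | C a => simpa using hasDerivAt_const t a
  | add p q hp hq => simpa [mul_add, Finset.sum_add_distrib] using! hp.add hq
  | mul_X p j hp =>
    have := hp.mul (hγ j)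
    simp only [map_mul, MvPolynomial.eval_X, MvPolynomial.pderiv_mul, map_add, MvPolynomial.pderiv_X]
    refine this.congr_deriv ?_
    simp only [mul_add, Finset.sum_add_distrib, Finset.sum_mul, mul_assoc, Pi.single_apply]
    simp [mul_comm]

/-- The chain rule is stated along an arbitrary curve because it serves several kinds of curve:
coordinate lines, rays (Euler's identity), images of lines under linear maps, and orbits of
rotations. The value space carries no topology, so derivatives are tested on functionals. -/
theorem HPoly_exists_gradient {k : ℕ} {f : Euc m → V} (hf : f ∈ HPoly 𝕜 V m k) :
    ∃ g : Fin m → Euc m → V, (∀ i, g i ∈ HPoly 𝕜 V m (k - 1)) ∧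
      ∀ (φ : V →ₗ[𝕜] 𝕜) (γ : ℝ → Euc m) (γ' : Fin m → ℝ) (t : ℝ),
        (∀ i, HasDerivAt (fun t => γ t i) (γ' i) t) →
        HasDerivAt (fun t => φ (f (γ t))) (∑ i, γ' i • φ (g i (γ t))) t := by
  induction hf using Submodule.span_induction with
  | mem f h =>
    obtain ⟨p, c, hp, rfl⟩ := h
    refine ⟨fun i x => (MvPolynomial.eval (fun i => x i) (MvPolynomial.pderiv i p)) • c,
      fun i => Submodule.subset_span ⟨_, c, hp.pderiv, rfl⟩, fun φ γ γ' t hγ => ?_⟩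
    have := (hasDerivAt_eval p hγ).smul_const (φ c)
    simp only [LinearMap.map_smul_of_tower]
    refine this.congr_deriv ?_
    simp only [Finset.sum_smul, smul_smul]
  | zero => exact ⟨0, fun i => Submodule.zero_mem _, fun φ γ γ' t _ => by
      simpa using hasDerivAt_const t (0 : 𝕜)⟩
  | add f f' _ _ h h' =>
    obtain ⟨g, hg, h⟩ := h
    obtain ⟨g', hg', h'⟩ := h'
    refine ⟨fun i => g i + g' i, fun i => Submodule.add_mem _ (hg i) (hg' i),
      fun φ γ γ' t hγ => ?_⟩
    simpa [Finset.sum_add_distrib] using! (h φ γ γ' t hγ).add (h' φ γ γ' t hγ)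
  | smul c f _ h =>
    obtain ⟨g, hg, h⟩ := h
    refine ⟨fun i => c • g i, fun i => Submodule.smul_mem _ _ (hg i), fun φ γ γ' t hγ => ?_⟩
    refine HasDerivAt.congr_deriv (by simpa using! (h φ γ γ' t hγ).const_mul c) ?_
    simp [Finset.mul_sum]

theorem HPoly_pd_spec {k : ℕ} {f : Euc m → V} (hf : f ∈ HPoly 𝕜 V m k) :
    (∀ i, pd 𝕜 i f ∈ HPoly 𝕜 V m (k - 1)) ∧ (∀ i, HasPd 𝕜 i f (pd 𝕜 i f)) ∧
      ∀ (φ : V →ₗ[𝕜] 𝕜) (γ : ℝ → Euc m) (γ' : Fin m → ℝ) (t : ℝ),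
        (∀ i, HasDerivAt (fun t => γ t i) (γ' i) t) →
        HasDerivAt (fun t => φ (f (γ t))) (∑ i, γ' i • φ (pd 𝕜 i f (γ t))) t := by
  obtain ⟨g, hg, h⟩ := HPoly_exists_gradient hf
  have h1 : ∀ i, HasPd 𝕜 i f (g i) := fun i φ x => by
    have := h φ (fun t => x + t • EuclideanSpace.single i (1 : ℝ)) _ 0
      (fun j => hasDerivAt_coord i j x)
    simpa using this
  have h2 : ∀ i, pd 𝕜 i f = g i := fun i => (h1 i).pd_eq
  refine ⟨fun i => h2 i ▸ hg i, fun i => h2 i ▸ h1 i, ?_⟩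
  simp only [h2]
  exact h

theorem pd_mem {k : ℕ} {f : Euc m → V} (hf : f ∈ HPoly 𝕜 V m k) (i : Fin m) :
    pd 𝕜 i f ∈ HPoly 𝕜 V m (k - 1) := (HPoly_pd_spec hf).1 i

theorem hasPd_pd {k : ℕ} {f : Euc m → V} (hf : f ∈ HPoly 𝕜 V m k) (i : Fin m) :
    HasPd 𝕜 i f (pd 𝕜 i f) := (HPoly_pd_spec hf).2.1 i

/-- The chain rule along a curve. -/
theorem HPoly_hasDerivAt {k : ℕ} {f : Euc m → V} (hf : f ∈ HPoly 𝕜 V m k) (φ : V →ₗ[𝕜] 𝕜)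
    {γ : ℝ → Euc m} {γ' : Fin m → ℝ} {t : ℝ} (hγ : ∀ i, HasDerivAt (fun t => γ t i) (γ' i) t) :
    HasDerivAt (fun t => φ (f (γ t))) (∑ i, γ' i • φ (pd 𝕜 i f (γ t))) t :=
  (HPoly_pd_spec hf).2.2 φ γ γ' t hγ

theorem pd_add {k k' : ℕ} {f g : Euc m → V} (hf : f ∈ HPoly 𝕜 V m k) (hg : g ∈ HPoly 𝕜 V m k')
    (i : Fin m) : pd 𝕜 i (f + g) = pd 𝕜 i f + pd 𝕜 i g :=
  ((hasPd_pd hf i).add (hasPd_pd hg i)).pd_eq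

theorem pd_smul {k : ℕ} {f : Euc m → V} (hf : f ∈ HPoly 𝕜 V m k) (c : 𝕜) (i : Fin m) :
    pd 𝕜 i (c • f) = c • pd 𝕜 i f :=
  ((hasPd_pd hf i).const_smul c).pd_eq

theorem pd_zero (i : Fin m) : pd 𝕜 i (0 : Euc m → V) = 0 := (hasPd_const i 0).pd_eq

theorem pd_eval_smul (p : MvPolynomial (Fin m) ℝ) (c : V) (i : Fin m) :
    pd 𝕜 i (fun x : Euc m => (MvPolynomial.eval (fun i => x i) p) • c) =
      fun x : Euc m => (MvPolynomial.eval (fun i => x i) (MvPolynomial.pderiv i p)) • c := by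
  have : HasPd 𝕜 i (fun x : Euc m => (MvPolynomial.eval (fun i => x i) p) • c)
      fun x : Euc m => (MvPolynomial.eval (fun i => x i) (MvPolynomial.pderiv i p)) • c := by
    have := (hasPd_const (𝕜 := 𝕜) i c).smul
      (u := fun x : Euc m => MvPolynomial.eval (fun i => x i) p)
      (u' := fun x : Euc m => MvPolynomial.eval (fun i => x i) (MvPolynomial.pderiv i p))
      fun x => by
        simpa using hasDerivAt_eval p (fun j => hasDerivAt_coord i j x)
    simpa using this
  exact this.pd_eq

/-- The commutator of two derivations is a derivation, and this one kills the variables. -/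
theorem pderiv_comm (i j : Fin m) (p : MvPolynomial (Fin m) ℝ) :
    MvPolynomial.pderiv i (MvPolynomial.pderiv j p) =
      MvPolynomial.pderiv j (MvPolynomial.pderiv i p) := by
  let D : Fin m → Derivation ℝ (MvPolynomial (Fin m) ℝ) (MvPolynomial (Fin m) ℝ) :=
    fun i => MvPolynomial.pderiv i
  have : ⁅D i, D j⁆ = 0 := by
    apply MvPolynomial.derivation_ext
    intro l
    simp only [D, Derivation.commutator_apply, MvPolynomial.pderiv_X, Derivation.zero_apply,
      Pi.single_apply]
    split_ifs <;> simp
  have h := DFunLike.congr_fun this p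
  rwa [Derivation.commutator_apply, Derivation.zero_apply, sub_eq_zero] at h

theorem pd_comm {k : ℕ} {f : Euc m → V} (hf : f ∈ HPoly 𝕜 V m k) (i j : Fin m) :
    pd 𝕜 i (pd 𝕜 j f) = pd 𝕜 j (pd 𝕜 i f) := by
  induction hf using Submodule.span_induction with
  | mem f h =>
    obtain ⟨p, c, -, rfl⟩ := h
    rw [pd_eval_smul, pd_eval_smul, pd_eval_smul, pd_eval_smul, pderiv_comm]
  | zero => simp [pd_zero]
  | add f g hf hg h h' =>
    rw [pd_add hf hg, pd_add hf hg, pd_add (pd_mem hf j) (pd_mem hg j),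
      pd_add (pd_mem hf i) (pd_mem hg i), h, h']
  | smul c f hf h =>
    rw [pd_smul hf, pd_smul hf, pd_smul (pd_mem hf j), pd_smul (pd_mem hf i), h]

theorem HPoly_smul {d k : ℕ} {p : MvPolynomial (Fin m) ℝ} (hp : p.IsHomogeneous d) {f : Euc m → V}
    (hf : f ∈ HPoly 𝕜 V m k) :
    (fun x : Euc m => (MvPolynomial.eval (fun i => x i) p) • f x) ∈ HPoly 𝕜 V m (d + k) := by
  induction hf using Submodule.span_induction with
  | mem f h =>
    obtain ⟨q, c, hq, rfl⟩ := h
    refine Submodule.subset_span ⟨p * q, c, hp.mul hq, ?_⟩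
    funext x
    rw [map_mul, mul_smul]
  | zero => simp only [Pi.zero_apply, smul_zero]; exact Submodule.zero_mem _
  | add f g _ _ h h' => simpa only [Pi.add_apply, smul_add] using! Submodule.add_mem _ h h'
  | smul c f _ h =>
    have := Submodule.smul_mem _ c h
    convert this using 1
    funext x
    rw [Pi.smul_apply, Pi.smul_apply, ← algebraMap_smul 𝕜, smul_comm, algebraMap_smul]

theorem HPoly_coord_smul {k : ℕ} {f : Euc m → V} (hf : f ∈ HPoly 𝕜 V m k) (i : Fin m) :
    (fun x : Euc m => x i • f x) ∈ HPoly 𝕜 V m (k + 1) := by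
  have := HPoly_smul (MvPolynomial.isHomogeneous_X ℝ i) hf
  simpa [add_comm] using this

theorem HPoly_map {k : ℕ} {f : Euc m → V} (hf : f ∈ HPoly 𝕜 V m k) (L : V →ₗ[𝕜] W) :
    (fun x => L (f x)) ∈ HPoly 𝕜 W m k := by
  induction hf using Submodule.span_induction with
  | mem f h =>
    obtain ⟨q, c, hq, rfl⟩ := h
    refine Submodule.subset_span ⟨q, L c, hq, ?_⟩
    funext x
    rw [LinearMap.map_smul_of_tower]
  | zero => simp only [Pi.zero_apply, map_zero]; exact Submodule.zero_mem _
  | add f g _ _ h h' => simpa only [Pi.add_apply, map_add] using! Submodule.add_mem _ h h'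
  | smul c f _ h => simpa only [Pi.smul_apply, map_smul] using! Submodule.smul_mem _ c h

theorem HPoly_sum {ι : Type*} {k : ℕ} {s : Finset ι} {f : ι → Euc m → V}
    (h : ∀ j ∈ s, f j ∈ HPoly 𝕜 V m k) : (fun x => ∑ j ∈ s, f j x) ∈ HPoly 𝕜 V m k := by
  have := Submodule.sum_mem _ h
  convert this using 1
  funext x
  rw [Finset.sum_apply]

theorem HPoly_comp {k : ℕ} {f : Euc m → V} (hf : f ∈ HPoly 𝕜 V m k) (A : Euc m' →ₗ[ℝ] Euc m) :
    (fun x => f (A x)) ∈ HPoly 𝕜 V m' k := by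
  induction hf using Submodule.span_induction with
  | mem f h =>
    obtain ⟨q, c, hq, rfl⟩ := h
    let g : Fin m → MvPolynomial (Fin m') ℝ := fun i =>
      ∑ j, MvPolynomial.C (A (EuclideanSpace.single j 1) i) * MvPolynomial.X j
    have hg : ∀ i, (g i).IsHomogeneous 1 := fun i =>
      MvPolynomial.IsHomogeneous.sum _ _ _ fun j _ => MvPolynomial.isHomogeneous_C_mul_X _ _
    refine Submodule.subset_span ⟨MvPolynomial.aeval g q, c, by simpa using hq.aeval g hg, ?_⟩
    refine funext fun x => ?_
    have hx : ∀ i, A x i = MvPolynomial.eval (fun j => x j) (g i) := by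
      intro i
      have : x = ∑ j, x j • EuclideanSpace.single j (1 : ℝ) := by
        ext l
        simp [Finset.sum_apply, Pi.single_apply]
      conv_lhs => rw [this]
      simp [g, Finset.sum_apply, mul_comm]
    suffices key : MvPolynomial.eval (fun i => A x i) q =
        MvPolynomial.eval (fun j => x j) (MvPolynomial.aeval g q) by
      change MvPolynomial.eval (fun i => A x i) q • c = _
      rw [key]
    simp only [hx]
    clear hq
    induction q using MvPolynomial.induction_on with
    | C a => simp
    | add p q hp hq => simp only [map_add, hp, hq]
    | mul_X p i hp => simp only [map_mul, hp, MvPolynomial.eval_X, MvPolynomial.aeval_X]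
  | zero => exact Submodule.zero_mem _
  | add f g _ _ h h' => exact Submodule.add_mem _ h h'
  | smul c f _ h => exact Submodule.smul_mem _ c h

theorem HPoly_const (c : V) : (fun _ : Euc m => c) ∈ HPoly 𝕜 V m 0 :=
  Submodule.subset_span ⟨1, c, MvPolynomial.isHomogeneous_one _ _, by simp⟩

theorem HPoly_homogeneous {k : ℕ} {f : Euc m → V} (hf : f ∈ HPoly 𝕜 V m k) (c : ℝ) (x : Euc m) :
    f (c • x) = c ^ k • f x := by
  induction hf using Submodule.span_induction with
  | mem f h =>
    obtain ⟨q, v, hq, rfl⟩ := h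
    have : MvPolynomial.eval (fun i => (c • x) i) q =
        c ^ k * MvPolynomial.eval (fun i => x i) q := by
      rw [MvPolynomial.eval_eq, MvPolynomial.eval_eq, Finset.mul_sum]
      refine Finset.sum_congr rfl fun d hd => ?_
      have hd' : ∑ i ∈ d.support, d i = k := (hq.degree_eq_sum_deg_support hd).symm
      simp only [PiLp.smul_apply, smul_eq_mul, mul_pow, Finset.prod_mul_distrib]
      rw [Finset.prod_pow_eq_pow_sum, hd']
      ring
    change _ • v = c ^ k • (_ • v)
    rw [this, mul_smul]
  | zero => simp
  | add f g _ _ h h' => simp [h, h']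
  | smul c' f _ h => 
    rw [Pi.smul_apply, Pi.smul_apply, h, ← algebraMap_smul 𝕜, smul_comm, algebraMap_smul]

theorem HPoly_zero_const {f : Euc m → V} (hf : f ∈ HPoly 𝕜 V m 0) (x : Euc m) : f x = f 0 := by
  have := HPoly_homogeneous hf 0 x
  simpa using this.symm

/-- Euler's identity. -/
theorem HPoly_euler {k : ℕ} {f : Euc m → V} (hf : f ∈ HPoly 𝕜 V m k) (x : Euc m) :
    ∑ i, x i • pd 𝕜 i f x = (k : ℝ) • f x := by
  refine eq_of_dual (𝕜 := 𝕜) fun φ => ?_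
  have h1 := HPoly_hasDerivAt hf φ (γ := fun t => t • x) (γ' := fun i => x i) (t := 1) fun i => by
    simpa using (hasDerivAt_id (1 : ℝ)).mul_const (x i)
  have h2 : HasDerivAt (fun t : ℝ => φ (f (t • x))) ((k : ℝ) • φ (f x)) 1 := by
    simp only [HPoly_homogeneous hf, LinearMap.map_smul_of_tower]
    simpa using (hasDerivAt_pow k (1 : ℝ)).smul_const (φ (f x))
  have := h1.unique h2
  simpa [LinearMap.map_smul_of_tower, one_smul] using this

theorem pd_comp {k : ℕ} {f : Euc m → V} (hf : f ∈ HPoly 𝕜 V m k) (A : Euc m' →ₗ[ℝ] Euc m)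
    (i : Fin m') : pd 𝕜 i (fun x => f (A x)) =
      fun x => ∑ j, A (EuclideanSpace.single i 1) j • pd 𝕜 j f (A x) := by
  refine HasPd.pd_eq fun φ x => ?_
  have := HPoly_hasDerivAt hf φ (γ := fun t => A (x + t • EuclideanSpace.single i (1 : ℝ)))
    (γ' := fun j => A (EuclideanSpace.single i 1) j) (t := 0) fun j => by
      simpa using ((hasDerivAt_id (0 : ℝ)).mul_const
        (A (EuclideanSpace.single i 1) j)).const_add (A x j)
  simpa [LinearMap.map_smul_of_tower] using this

theorem HPoly_eq_zero_of_pd {k : ℕ} (hk : 1 ≤ k) {f : Euc m → V} (hf : f ∈ HPoly 𝕜 V m k)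
    (h : ∀ i, pd 𝕜 i f = 0) : f = 0 := by
  funext x
  have := HPoly_euler hf x
  simp only [h, Pi.zero_apply, smul_zero, Finset.sum_const_zero] at this
  have h2 := smul_eq_zero.1 (this.symm.trans rfl)
  exact h2.resolve_left (by positivity)

theorem HPoly_eq_of_pd_eq_zero {k : ℕ} {f : Euc m → V} (hf : f ∈ HPoly 𝕜 V m k) {i : Fin m}
    (h : pd 𝕜 i f = 0) (x : Euc m) (t : ℝ) : f (x + t • EuclideanSpace.single i 1) = f x := by
  refine eq_of_dual (𝕜 := 𝕜) fun φ => ?_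
  have h1 : ∀ t : ℝ, HasDerivAt (fun t : ℝ => φ (f (x + t • EuclideanSpace.single i (1 : ℝ)))) 0 t := by
    intro t
    have := HPoly_hasDerivAt hf φ (γ := fun t => x + t • EuclideanSpace.single i (1 : ℝ))
      (γ' := fun j => if i = j then 1 else 0) (t := t) fun j => by
        simpa [Pi.single_apply, eq_comm] using ((hasDerivAt_id t).mul_const
          (if i = j then (1 : ℝ) else 0)).const_add (x j)
    simpa [h] using this
  have := is_const_of_deriv_eq_zero (fun t => (h1 t).differentiableAt) (fun t => (h1 t).deriv) t 0
  simpa using this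

/-- A finite set of generators of the homogeneous scalar polynomials gives finitely many linear maps
V → (functions) whose ranges cover the space. Finite dimension is what later provides orthogonal
projections and enough functionals. -/
instance finite_HPoly [Module.Finite 𝕜 V] (k : ℕ) : Module.Finite 𝕜 (HPoly 𝕜 V m k) := by
  obtain ⟨S, hS⟩ := MvPolynomial.homogeneousSubmodule_fg (σ := Fin m) (R := ℝ) k
  let Ψ : MvPolynomial (Fin m) ℝ → V →ₗ[𝕜] (Euc m → V) := fun p =>
    { toFun := fun c x => (MvPolynomial.eval (fun i => x i) p) • c
      map_add' := fun a b => by funext x; simp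
      map_smul' := fun a b => by
        funext x
        simp only [RingHom.id_apply, Pi.smul_apply]
        rw [← algebraMap_smul 𝕜, smul_comm, algebraMap_smul] }
  have hle : HPoly 𝕜 V m k ≤ ⨆ p : S, LinearMap.range (Ψ p) := by
    rw [HPoly, Submodule.span_le]
    rintro _ ⟨p, c, hp, rfl⟩
    have hp' : p ∈ Submodule.span ℝ (S : Set (MvPolynomial (Fin m) ℝ)) := by
      rw [hS]; exact hp
    change Ψ p c ∈ _
    clear hp
    induction hp' using Submodule.span_induction with
    | mem q hq => exact Submodule.mem_iSup_of_mem ⟨q, hq⟩ ⟨c, rfl⟩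
    | zero =>
      have : Ψ 0 c = 0 := by funext x; simp [Ψ]
      rw [this]; exact Submodule.zero_mem _
    | add p q _ _ h h' =>
      have : Ψ (p + q) c = Ψ p c + Ψ q c := by funext x; simp [Ψ, add_smul]
      rw [this]; exact Submodule.add_mem _ h h'
    | smul a p _ h =>
      have : Ψ (a • p) c = (algebraMap ℝ 𝕜 a) • Ψ p c := by
        funext x; simp only [Ψ, LinearMap.coe_mk, AddHom.coe_mk, Pi.smul_apply, algebraMap_smul]
        simp [mul_smul]
      rw [this]; exact Submodule.smul_mem _ _ h
  exact Submodule.finiteDimensional_of_le hle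

end Calculus

/-! ### The Dirac equation and its invariance under unit vectors -/

section Dirac

variable {𝕜 : Type*} [RCLike 𝕜] {m : ℕ}

/-! ### The Dirac operator -/

/-- The Dirac operator `∑ e_i ∂_i`. -/
def dirac (𝕜 : Type*) [RCLike 𝕜] {m : ℕ} (f : Euc m → Cl 𝕜 m) (x : Euc m) : Cl 𝕜 m :=
  ∑ i, e 𝕜 i * pd 𝕜 i f x

theorem mem_hodge_iff {s k : ℕ} {f : Euc m → Cl 𝕜 m} : f ∈ hodge 𝕜 m s k ↔
    f ∈ HPoly 𝕜 (Cl 𝕜 m) m k ∧ (∀ x, f x ∈ sVectors 𝕜 m s) ∧ ∀ x, dirac 𝕜 f x = 0 := by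
  constructor
  · rintro ⟨h1, h2, g, h3, h4⟩
    refine ⟨h1, h2, fun x => ?_⟩
    have : ∀ i, pd 𝕜 i f = g i := fun i => HasPd.pd_eq (h3 i)
    simp only [dirac, this]
    exact h4 x
  · rintro ⟨h1, h2, h3⟩
    exact ⟨h1, h2, fun i => pd 𝕜 i f, fun i => hasPd_pd h1 i, h3⟩

/-- A subspace is cut out by the functionals that vanish on it, and such a functional also
annihilates the derivative. -/
theorem pd_apply_mem {V : Type*} [AddCommGroup V] [Module 𝕜 V] [Module ℝ V] [IsScalarTower ℝ 𝕜 V]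
    (S : Submodule 𝕜 V) {k : ℕ} {f : Euc m → V} (hf : f ∈ HPoly 𝕜 V m k) (hS : ∀ x, f x ∈ S)
    (i : Fin m) (x : Euc m) : pd 𝕜 i f x ∈ S := by
  by_contra hx
  obtain ⟨φ, hφ, hle⟩ := Submodule.exists_le_ker_of_notMem hx
  apply hφ
  have h := hasPd_pd hf i φ x
  simp only [fun y => LinearMap.mem_ker.1 (hle (hS y))] at h
  exact h.unique (hasDerivAt_const _ _)

/-- Left multiplication as a `𝕜`-linear map. -/
def mulL (a : Cl 𝕜 m) : Cl 𝕜 m →ₗ[𝕜] Cl 𝕜 m := LinearMap.mulLeft 𝕜 a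

/-- Right multiplication as a `𝕜`-linear map. -/
def mulR (a : Cl 𝕜 m) : Cl 𝕜 m →ₗ[𝕜] Cl 𝕜 m := LinearMap.mulRight 𝕜 a

theorem HPoly_mul_left {k m' : ℕ} {f : Euc m' → Cl 𝕜 m} (hf : f ∈ HPoly 𝕜 (Cl 𝕜 m) m' k)
    (a : Cl 𝕜 m) : (fun x => a * f x) ∈ HPoly 𝕜 (Cl 𝕜 m) m' k :=
  HPoly_map hf (mulL a)

theorem HPoly_wedge {k : ℕ} {f : Euc m → Cl 𝕜 m} (hf : f ∈ HPoly 𝕜 (Cl 𝕜 m) m k) :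
    (fun x => wedge 𝕜 x (f x)) ∈ HPoly 𝕜 (Cl 𝕜 m) m (k + 1) := by
  simp only [fun x : Euc m => wedge_eq_sum x (f x)]
  exact HPoly_sum fun j _ =>
    HPoly_coord_smul (HPoly_map hf (wedgeₗ 𝕜 (EuclideanSpace.single j 1))) j

theorem HPoly_bullet {k : ℕ} {f : Euc m → Cl 𝕜 m} (hf : f ∈ HPoly 𝕜 (Cl 𝕜 m) m k) :
    (fun x => bullet 𝕜 x (f x)) ∈ HPoly 𝕜 (Cl 𝕜 m) m (k + 1) := by
  simp only [fun x : Euc m => bullet_eq_sum x (f x)]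
  exact HPoly_sum fun j _ =>
    HPoly_coord_smul (HPoly_map hf (bulletₗ 𝕜 (EuclideanSpace.single j 1))) j

theorem HasPd.wedge {i : Fin m} {f g : Euc m → Cl 𝕜 m} (h : HasPd 𝕜 i f g) :
    HasPd 𝕜 i (fun x => wedge 𝕜 x (f x))
      (fun x => wedge 𝕜 (EuclideanSpace.single i 1) (f x) + wedge 𝕜 x (g x)) := by
  have := HasPd.sum (s := Finset.univ) fun j _ =>
    (h.map (wedgeₗ 𝕜 (EuclideanSpace.single j 1))).coord_smul j
  simp only [fun x : Euc m => wedge_eq_sum x (f x), fun x : Euc m => wedge_eq_sum x (g x)]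
  simpa [Finset.sum_add_distrib] using! this

theorem HasPd.bullet {i : Fin m} {f g : Euc m → Cl 𝕜 m} (h : HasPd 𝕜 i f g) :
    HasPd 𝕜 i (fun x => bullet 𝕜 x (f x))
      (fun x => bullet 𝕜 (EuclideanSpace.single i 1) (f x) + bullet 𝕜 x (g x)) := by
  have := HasPd.sum (s := Finset.univ) fun j _ =>
    (h.map (bulletₗ 𝕜 (EuclideanSpace.single j 1))).coord_smul j
  simp only [fun x : Euc m => bullet_eq_sum x (f x), fun x : Euc m => bullet_eq_sum x (g x)]
  simpa [Finset.sum_add_distrib] using! this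

theorem sum_e_mul_wedge {s : ℕ} {a : Cl 𝕜 m} (ha : a ∈ sVectors 𝕜 m s) :
    ∑ i, e 𝕜 i * wedge 𝕜 (EuclideanSpace.single i 1) a = (-((m : ℝ) - s)) • a := by
  have h : ∀ i, e 𝕜 i * wedge 𝕜 (EuclideanSpace.single i 1) a =
      (-1 / 2 : ℝ) • a + ((-1 : ℝ) ^ s / 2) • (e 𝕜 i * a * e 𝕜 i) := fun i => by
    rw [wedge_of_mem _ ha, ← e, mul_smul_comm, mul_add, e_mul_e_mul_self, mul_smul_comm, mul_assoc]
    module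
  rw [Finset.sum_congr rfl fun i _ => h i, Finset.sum_add_distrib, ← Finset.smul_sum,
    ← Finset.smul_sum, sum_e_mul_mul_e ha, Finset.sum_const, Finset.card_univ, Fintype.card_fin,
    ← Nat.cast_smul_eq_nsmul ℝ, smul_smul, smul_smul, ← add_smul, pow_succ]
  congr 1
  have : ((-1 : ℝ) ^ s) * (-1) ^ s = 1 := by rw [← mul_pow]; simp
  linear_combination (-((m : ℝ) - 2 * s) / 2) * this

theorem sum_e_mul_bullet {s : ℕ} {a : Cl 𝕜 m} (ha : a ∈ sVectors 𝕜 m s) :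
    ∑ i, e 𝕜 i * bullet 𝕜 (EuclideanSpace.single i 1) a = (-(s : ℝ)) • a := by
  have h : ∀ i, e 𝕜 i * bullet 𝕜 (EuclideanSpace.single i 1) a =
      -a - e 𝕜 i * wedge 𝕜 (EuclideanSpace.single i 1) a := fun i => by
    have := congrArg (e 𝕜 i * ·) (wedge_add_bullet (𝕜 := 𝕜) (EuclideanSpace.single i 1) a)
    simp only [mul_add, ← show e 𝕜 i = vec 𝕜 (EuclideanSpace.single i 1) from rfl,
      e_mul_e_mul_self] at this
    rw [← this]
    abel
  rw [Finset.sum_congr rfl fun i _ => h i, Finset.sum_sub_distrib, sum_e_mul_wedge ha,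
    Finset.sum_const, Finset.card_univ, Fintype.card_fin, ← Nat.cast_smul_eq_nsmul ℝ]
  module

/-- Moving e_i past x by e_i x = -x e_i - 2 x_i leaves the Euler operator and the Dirac operator. -/
theorem sum_e_mul_vec_mul_pd {k : ℕ} {f : Euc m → Cl 𝕜 m} (hf : f ∈ HPoly 𝕜 (Cl 𝕜 m) m k)
    (x : Euc m) :
    ∑ i, e 𝕜 i * (vec 𝕜 x * pd 𝕜 i f x) = (-(2 * k : ℝ)) • f x - vec 𝕜 x * dirac 𝕜 f x := by
  have h : ∀ i, e 𝕜 i * (vec 𝕜 x * pd 𝕜 i f x) =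
      (-2 : ℝ) • (x i • pd 𝕜 i f x) - vec 𝕜 x * (e 𝕜 i * pd 𝕜 i f x) := fun i => by
    have := congrArg (· * pd 𝕜 i f x) (vec_mul_e (𝕜 := 𝕜) x i)
    simp only [add_mul, neg_mul, smul_one_mul, mul_assoc] at this
    rw [this]
    module
  rw [Finset.sum_congr rfl fun i _ => h i, Finset.sum_sub_distrib, ← Finset.smul_sum,
    HPoly_euler hf, dirac, Finset.mul_sum]
  module

/-- For a solution f only the first term is left, here and in `dirac_bullet`; the ratio of the
constants m - s + k and s + k determines β. The terms with Df are kept for `eq_zero_of_normal_part`,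
where the formula is applied to x • f, which need not be a solution. -/
theorem dirac_wedge {s k : ℕ} {f : Euc m → Cl 𝕜 m} (hf : f ∈ HPoly 𝕜 (Cl 𝕜 m) m k)
    (hs : ∀ x, f x ∈ sVectors 𝕜 m s) (x : Euc m) :
    dirac 𝕜 (fun x => wedge 𝕜 x (f x)) x = (-((m : ℝ) - s + k)) • f x +
      (1 / 2 : ℝ) • (-(vec 𝕜 x * dirac 𝕜 f x) + (-1 : ℝ) ^ s • (dirac 𝕜 f x * vec 𝕜 x)) := by
  have h1 : ∀ i, pd 𝕜 i (fun x => wedge 𝕜 x (f x)) x =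
      wedge 𝕜 (EuclideanSpace.single i 1) (f x) + wedge 𝕜 x (pd 𝕜 i f x) := fun i => by
    rw [(hasPd_pd hf i).wedge.pd_eq]
  have h2 : ∀ i, e 𝕜 i * wedge 𝕜 x (pd 𝕜 i f x) = (1 / 2 : ℝ) • (e 𝕜 i * (vec 𝕜 x * pd 𝕜 i f x)) +
      ((-1 : ℝ) ^ s / 2) • (e 𝕜 i * pd 𝕜 i f x * vec 𝕜 x) := fun i => by
    rw [wedge_of_mem _ (pd_apply_mem _ hf hs i x), mul_smul_comm, mul_add, mul_smul_comm, mul_assoc]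
    module
  simp only [dirac, h1, mul_add, Finset.sum_add_distrib, h2, sum_e_mul_wedge (hs x),
    ← Finset.smul_sum, sum_e_mul_vec_mul_pd hf, ← Finset.sum_mul]
  module

theorem dirac_bullet {s k : ℕ} {f : Euc m → Cl 𝕜 m} (hf : f ∈ HPoly 𝕜 (Cl 𝕜 m) m k)
    (hs : ∀ x, f x ∈ sVectors 𝕜 m s) (x : Euc m) :
    dirac 𝕜 (fun x => bullet 𝕜 x (f x)) x = (-((s : ℝ) + k)) • f x +
      (1 / 2 : ℝ) • (-(vec 𝕜 x * dirac 𝕜 f x) - (-1 : ℝ) ^ s • (dirac 𝕜 f x * vec 𝕜 x)) := by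
  have h1 : ∀ i, pd 𝕜 i (fun x => bullet 𝕜 x (f x)) x =
      bullet 𝕜 (EuclideanSpace.single i 1) (f x) + bullet 𝕜 x (pd 𝕜 i f x) := fun i => by
    rw [(hasPd_pd hf i).bullet.pd_eq]
  have h2 : ∀ i, e 𝕜 i * bullet 𝕜 x (pd 𝕜 i f x) =
      (1 / 2 : ℝ) • (e 𝕜 i * (vec 𝕜 x * pd 𝕜 i f x)) -
      ((-1 : ℝ) ^ s / 2) • (e 𝕜 i * pd 𝕜 i f x * vec 𝕜 x) := fun i => by
    rw [bullet_of_mem _ (pd_apply_mem _ hf hs i x), mul_smul_comm, mul_sub, mul_smul_comm, mul_assoc]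
    module
  simp only [dirac, h1, mul_add, Finset.sum_add_distrib, h2, sum_e_mul_bullet (hs x),
    Finset.sum_sub_distrib, ← Finset.smul_sum, sum_e_mul_vec_mul_pd hf, ← Finset.sum_mul]
  module

/-- An `s`-vector valued solution of the Dirac equation also solves it from the right. -/
theorem sum_pd_mul_e {s k : ℕ} {f : Euc m → Cl 𝕜 m} (hf : f ∈ hodge 𝕜 m s k) (x : Euc m) :
    ∑ i, pd 𝕜 i f x * e 𝕜 i = 0 := by
  obtain ⟨h1, h2, h3⟩ := mem_hodge_iff.1 hf
  -- Reversal turns e_i ∂_i f into ±(∂_i f) e_i, with the same sign for all i because every ∂_i f is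
  -- s-vector valued.
  have := congrArg (rev 𝕜 m) (h3 x)
  simp only [dirac, map_sum, rev_mul, map_zero, rev_of_mem (pd_apply_mem _ h1 h2 _ x), e, rev_vec,
    smul_mul_assoc, ← Finset.smul_sum] at this
  refine (smul_eq_zero.1 this).resolve_left fun h => ?_
  have := revSign_mul_self s
  rw [h] at this
  simp at this

theorem pd_mem_hodge {s k : ℕ} {f : Euc m → Cl 𝕜 m} (hf : f ∈ hodge 𝕜 m s k) (i : Fin m) :
    pd 𝕜 i f ∈ hodge 𝕜 m s (k - 1) := by
  obtain ⟨h1, h2, h3⟩ := mem_hodge_iff.1 hf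
  refine mem_hodge_iff.2 ⟨pd_mem h1 i, pd_apply_mem _ h1 h2 i, fun x => ?_⟩
  have h4 : HasPd 𝕜 i (fun x => ∑ j, mulL (e 𝕜 j) (pd 𝕜 j f x))
      fun x => ∑ j, mulL (e 𝕜 j) (pd 𝕜 i (pd 𝕜 j f) x) :=
    HasPd.sum fun j _ => (hasPd_pd (pd_mem h1 j) i).map _
  have h5 : (fun x => ∑ j, mulL (e 𝕜 j) (pd 𝕜 j f x)) = fun _ => 0 := funext h3
  rw [h5] at h4
  have := congrFun (h4.unique (hasPd_const i 0)) x
  rw [Pi.zero_apply] at this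
  simp only [dirac]
  rw [← this]
  exact Finset.sum_congr rfl fun j _ => by rw [pd_comm h1]; rfl

/-- For scalar values the components of ∑ e_i ∂_i f along the e_i are the partial derivatives
themselves, so they all vanish. -/
theorem hodge_zero_eq_bot {k : ℕ} (hk : 1 ≤ k) : hodge 𝕜 m 0 k = ⊥ := by
  rw [eq_bot_iff]
  intro f hf
  obtain ⟨h1, h2, h3⟩ := mem_hodge_iff.1 hf
  refine HPoly_eq_zero_of_pd hk h1 fun i => funext fun x => ?_
  have hc : ∀ j, ∃ c : 𝕜, pd 𝕜 j f x = c • 1 := fun j =>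
    mem_sVectors_zero (pd_apply_mem _ h1 h2 j x)
  choose c hc using hc
  have h5 := h3 x
  simp only [dirac, hc, mul_smul_comm, mul_one] at h5
  have h6 := congrArg (fun a => scalarPart 𝕜 m (cliffConj 𝕜 m (e 𝕜 i) * a)) h5
  have h7 : ∀ j, scalarPart 𝕜 m (cliffConj 𝕜 m (e 𝕜 i) * e 𝕜 j) = if j = i then 1 else 0 := by
    intro j
    split_ifs with h
    · subst h
      rw [e, cliffConj_vec, neg_mul, ← e, e_mul_self, neg_neg, scalarPart_one]
    · have h8 := scalarPart_eL (𝕜 := 𝕜) (l := [i, j]) (by simp [Ne.symm h]) (by simp)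
      rw [eL_cons, eL_cons, eL_nil, mul_one] at h8
      rw [e, cliffConj_vec, neg_mul, ← e, map_neg, h8, neg_zero]
  simp only [Finset.mul_sum, mul_smul_comm, map_sum, scalarPart_smul, h7, mul_zero, map_zero] at h6
  simp only [mul_ite, mul_one, mul_zero, Finset.sum_ite_eq', Finset.mem_univ, if_true] at h6
  rw [hc, h6, zero_smul, Pi.zero_apply]

/-- Outer products with m-vectors vanish, so `dirac_wedge` with s = m reads 0 = -k f. -/
theorem hodge_top_eq_bot {k : ℕ} (hk : 1 ≤ k) : hodge 𝕜 m m k = ⊥ := by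
  rw [eq_bot_iff]
  intro f hf
  obtain ⟨h1, h2, h3⟩ := mem_hodge_iff.1 hf
  funext x
  have h4 := dirac_wedge h1 h2 x
  have h5 : (fun x => wedge 𝕜 x (f x)) = 0 := funext fun x => wedge_of_mem_top x (h2 x)
  rw [h5, h3] at h4
  simp only [dirac, pd_zero, Pi.zero_apply, mul_zero, Finset.sum_const_zero, sub_self, zero_add,
    zero_mul, neg_zero, smul_zero, add_zero] at h4
  have h6 := smul_eq_zero.1 h4.symm
  exact h6.resolve_left (neg_ne_zero.2 (by positivity))

/-! ### The action of unit vectors -/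

/-- The map `x ↦ -v x v` for a unit vector `v`. -/
def flip (v : Euc m) : Euc m →ₗ[ℝ] Euc m where
  toFun x := (2 * inner ℝ v x) • v - x
  map_add' x y := by rw [inner_add_right]; module
  map_smul' c x := by rw [inner_smul_right, RingHom.id_apply]; module

theorem flip_apply (v x : Euc m) : flip v x = (2 * inner ℝ v x) • v - x := rfl

theorem vec_mul_mul_vec (v x : Euc m) (hv : ‖v‖ = 1) :
    vec 𝕜 v * vec 𝕜 x * vec 𝕜 v = -vec 𝕜 (flip v x) := by
  rw [vec_mul_vec, add_mul, neg_mul, mul_assoc, vec_mul_self, hv, flip_apply, sub_eq_add_neg,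
    vec_add, vec_smul, vec_neg, mul_smul_comm, mul_one, smul_one_mul]
  module

theorem flip_flip {v : Euc m} (hv : ‖v‖ = 1) (x : Euc m) : flip v (flip v x) = x := by
  simp only [flip_apply, inner_sub_right, inner_smul_right, real_inner_self_eq_norm_sq, hv]
  module

theorem norm_flip {v : Euc m} (hv : ‖v‖ = 1) (x : Euc m) : ‖flip v x‖ = ‖x‖ := by
  have h : ‖flip v x‖ ^ 2 = ‖x‖ ^ 2 := by
    rw [flip_apply, norm_sub_sq_real, norm_smul, inner_smul_left, hv]
    simp only [Real.norm_eq_abs, mul_one, sq_abs, conj_trivial]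
    ring
  exact (pow_left_inj₀ (norm_nonneg _) (norm_nonneg _) two_ne_zero).1 h

theorem flip_single_apply (v : Euc m) (i j : Fin m) :
    flip v (EuclideanSpace.single i 1) j = flip v (EuclideanSpace.single j 1) i := by
  simp [flip_apply, EuclideanSpace.inner_single_right, Pi.single_apply, eq_comm]
  ring

/-- The map `a ↦ -v a v`. -/
def conjBy (𝕜 : Type*) [RCLike 𝕜] {m : ℕ} (v : Euc m) : Cl 𝕜 m →ₗ[𝕜] Cl 𝕜 m :=
  -(mulL (vec 𝕜 v) ∘ₗ mulR (vec 𝕜 v))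

theorem conjBy_apply (v : Euc m) (a : Cl 𝕜 m) : conjBy 𝕜 v a = -(vec 𝕜 v * (a * vec 𝕜 v)) := rfl

theorem conjBy_vec {v : Euc m} (hv : ‖v‖ = 1) (x : Euc m) :
    conjBy 𝕜 v (vec 𝕜 x) = vec 𝕜 (flip v x) := by
  rw [conjBy_apply, ← mul_assoc, vec_mul_mul_vec v x hv, neg_neg]

theorem conjBy_one {v : Euc m} (hv : ‖v‖ = 1) : conjBy 𝕜 v 1 = 1 := by
  rw [conjBy_apply, one_mul, vec_mul_self, hv]
  simp

theorem conjBy_mul {v : Euc m} (hv : ‖v‖ = 1) (a b : Cl 𝕜 m) :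
    conjBy 𝕜 v (a * b) = conjBy 𝕜 v a * conjBy 𝕜 v b := by
  simp only [conjBy_apply, neg_mul_neg, mul_assoc, vec_mul_vec_mul_self, hv]
  simp

theorem conjBy_pow {v : Euc m} (hv : ‖v‖ = 1) (a : Cl 𝕜 m) (k : ℕ) :
    conjBy 𝕜 v (a ^ k) = conjBy 𝕜 v a ^ k := by
  induction k with
  | zero => simp [conjBy_one hv]
  | succ k ih => rw [pow_succ, pow_succ, conjBy_mul hv, ih]

theorem conjBy_smul (v : Euc m) (c : ℝ) (a : Cl 𝕜 m) : conjBy 𝕜 v (c • a) = c • conjBy 𝕜 v a :=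
  LinearMap.map_smul_of_tower (conjBy 𝕜 v) c a

theorem conjBy_conjBy {v : Euc m} (hv : ‖v‖ = 1) (a : Cl 𝕜 m) : conjBy 𝕜 v (conjBy 𝕜 v a) = a := by
  simp only [conjBy_apply, mul_neg, neg_mul, neg_neg, mul_assoc, vec_mul_self,
    vec_mul_vec_mul_self, hv, mul_smul_comm, mul_one]
  simp

theorem gradeInv_conjBy (v : Euc m) (a : Cl 𝕜 m) :
    gradeInv 𝕜 m (conjBy 𝕜 v a) = conjBy 𝕜 v (gradeInv 𝕜 m a) := by
  simp [conjBy_apply, gradeInv_vec]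

theorem conjBy_wedge {v : Euc m} (hv : ‖v‖ = 1) (u : Euc m) (a : Cl 𝕜 m) :
    conjBy 𝕜 v (wedge 𝕜 u a) = wedge 𝕜 (flip v u) (conjBy 𝕜 v a) := by
  rw [wedge, wedge, conjBy_smul, map_add, conjBy_mul hv, conjBy_mul hv, conjBy_vec hv,
    gradeInv_conjBy]

theorem conjBy_bullet {v : Euc m} (hv : ‖v‖ = 1) (u : Euc m) (a : Cl 𝕜 m) :
    conjBy 𝕜 v (bullet 𝕜 u a) = bullet 𝕜 (flip v u) (conjBy 𝕜 v a) := by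
  rw [bullet, bullet, conjBy_smul, map_sub, conjBy_mul hv, conjBy_mul hv, conjBy_vec hv,
    gradeInv_conjBy]

/-- For an s-vector a, the product a v is ±(v ∧ a - v • a). Left multiplication by v sends v ∧ a to
v • (v ∧ a) and v • a to v ∧ (v • a), which both have degree s again. -/
theorem conjBy_mem (v : Euc m) {s : ℕ} {a : Cl 𝕜 m} (ha : a ∈ sVectors 𝕜 m s) :
    conjBy 𝕜 v a ∈ sVectors 𝕜 m s := by
  have h1 : a * vec 𝕜 v = (-1 : ℝ) ^ s • (wedge 𝕜 v a - bullet 𝕜 v a) := by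
    rw [wedge_of_mem v ha, bullet_of_mem v ha]
    have : (-1 : ℝ) ^ s * (-1) ^ s = 1 := by rw [← mul_pow]; simp
    calc a * vec 𝕜 v = ((-1 : ℝ) ^ s * (-1) ^ s) • (a * vec 𝕜 v) := by rw [this, one_smul]
      _ = _ := by module
  have h2 : vec 𝕜 v * wedge 𝕜 v a = bullet 𝕜 v (wedge 𝕜 v a) := by
    rw [← wedge_add_bullet, wedge_wedge, zero_add]
  have h3 : vec 𝕜 v * bullet 𝕜 v a = wedge 𝕜 v (bullet 𝕜 v a) := by
    rw [← wedge_add_bullet, bullet_bullet, add_zero]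
  rw [conjBy_apply, h1, mul_smul_comm, mul_sub, h2, h3]
  refine Submodule.neg_mem _ (smul_mem_sVectors _ (Submodule.sub_mem _
    (bullet_mem v (wedge_mem v ha)) ?_))
  -- There is no degree below zero; for s = 0 the inner product is zero.
  cases s with
  | zero =>
    rw [bullet_of_mem_zero v ha]
    have : wedge 𝕜 v (0 : Cl 𝕜 m) = 0 := map_zero (wedgeₗ 𝕜 v)
    rw [this]
    exact Submodule.zero_mem _
  | succ s => exact wedge_mem v (bullet_mem v ha)

/-- The action of a unit vector, `f ↦ -v f(-v x v) v`. -/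
def actBy (𝕜 : Type*) [RCLike 𝕜] {m : ℕ} (v : Euc m) :
    (Euc m → Cl 𝕜 m) →ₗ[𝕜] (Euc m → Cl 𝕜 m) where
  toFun f x := conjBy 𝕜 v (f (flip v x))
  map_add' f g := by funext x; simp
  map_smul' c f := by funext x; simp

theorem actBy_apply (v : Euc m) (f : Euc m → Cl 𝕜 m) (x : Euc m) :
    actBy 𝕜 v f x = conjBy 𝕜 v (f (flip v x)) := rfl

theorem actBy_actBy {v : Euc m} (hv : ‖v‖ = 1) (f : Euc m → Cl 𝕜 m) :
    actBy 𝕜 v (actBy 𝕜 v f) = f := by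
  funext x
  rw [actBy_apply, actBy_apply, flip_flip hv, conjBy_conjBy hv]

theorem actBy_mem_hodge {s k : ℕ} {v : Euc m} (hv : ‖v‖ = 1) {f : Euc m → Cl 𝕜 m}
    (hf : f ∈ hodge 𝕜 m s k) : actBy 𝕜 v f ∈ hodge 𝕜 m s k := by
  obtain ⟨h1, h2, h3⟩ := mem_hodge_iff.1 hf
  refine mem_hodge_iff.2 ⟨HPoly_map (HPoly_comp h1 (flip v)) (conjBy 𝕜 v), fun x => conjBy_mem v (h2 _),
    fun x => ?_⟩
  have h4 : ∀ i, pd 𝕜 i (actBy 𝕜 v f) x = conjBy 𝕜 v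
      (∑ j, flip v (EuclideanSpace.single j 1) i • pd 𝕜 j f (flip v x)) := fun i => by
    have := ((hasPd_pd (HPoly_comp h1 (flip v)) i).map (conjBy 𝕜 v)).pd_eq
    rw [pd_comp h1] at this
    -- The matrix of `flip v` is symmetric, so after the chain rule it can be moved from the
    -- derivatives to the e_i, where it is the conjugation by v.
    simp only [flip_single_apply v i] at this
    exact congrFun this x
  simp only [dirac, h4]
  have h5 : ∀ i, conjBy 𝕜 v (e 𝕜 i) = vec 𝕜 (flip v (EuclideanSpace.single i 1)) := fun i =>
    conjBy_vec hv _
  have h6 : ∑ j, vec 𝕜 (flip v (EuclideanSpace.single j 1)) * conjBy 𝕜 v (pd 𝕜 j f (flip v x)) = 0 := by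
    have := congrArg (conjBy 𝕜 v) (h3 (flip v x))
    simpa only [dirac, map_sum, conjBy_mul hv, h5, map_zero] using this
  rw [← h6]
  simp only [vec_eq_sum (flip v (EuclideanSpace.single _ 1)), Finset.sum_mul, map_sum,
    Finset.mul_sum, conjBy_smul, mul_smul_comm, smul_mul_assoc]
  exact Finset.sum_comm

end Dirac

/-! ### Identities for Gegenbauer polynomials, with integer degree and homogenized in (z, N) -/

section Gegenbauer

/-! ### Homogeneous Gegenbauer polynomials -/

theorem poch_succ (ν : ℝ) (k : ℕ) : poch ν (k + 1) = poch ν k * (ν + k) := by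
  rw [poch, poch, Finset.prod_range_succ]

theorem poch_succ' (ν : ℝ) (k : ℕ) : poch ν (k + 1) = ν * poch (ν + 1) k := by
  rw [poch, poch, Finset.prod_range_succ', mul_comm, Nat.cast_zero, add_zero]
  congr 1
  exact Finset.prod_congr rfl fun i _ => by push_cast; ring

theorem poch_pos {ν : ℝ} (hν : 0 < ν) (k : ℕ) : 0 < poch ν k :=
  Finset.prod_pos fun i _ => by positivity

/-- The reciprocal of the factorial, extended by zero to negative integers. -/
def rfact (a : ℤ) : ℝ := if a < 0 then 0 else ((Nat.factorial a.toNat : ℕ) : ℝ)⁻¹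

theorem rfact_of_neg {a : ℤ} (h : a < 0) : rfact a = 0 := if_pos h

theorem rfact_natCast (a : ℕ) : rfact a = ((Nat.factorial a : ℕ) : ℝ)⁻¹ := by
  simp [rfact]

/-- Extending 1/a! by zero makes this hold for all integers a, so the recurrences below have no
boundary cases. -/
theorem mul_rfact (a : ℤ) : a * rfact a = rfact (a - 1) := by
  rcases lt_trichotomy a 0 with h | rfl | h
  · rw [rfact_of_neg h, rfact_of_neg (by omega), mul_zero]
  · rw [rfact_of_neg (by omega : (0 : ℤ) - 1 < 0)]
    simp
  · obtain ⟨b, rfl⟩ : ∃ b : ℕ, a = b + 1 := ⟨(a - 1).toNat, by omega⟩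
    rw [add_sub_cancel_right, rfact_natCast, show ((b : ℤ) + 1) = ((b + 1 : ℕ) : ℤ) by push_cast; rfl,
      rfact_natCast, Nat.factorial_succ]
    have : ((b + 1 : ℕ) : ℝ) ≠ 0 := by positivity
    have : ((Nat.factorial b : ℕ) : ℝ) ≠ 0 := by positivity
    push_cast
    field_simp

/-- The `i`-th term of the homogeneous Gegenbauer polynomial of degree `d` in `(z, √N)`. -/
def gegTerm (μ : ℝ) (d : ℤ) (z N : ℝ) (i : ℕ) : ℝ :=
  (-1) ^ i * poch μ (d - i).toNat * rfact i * rfact (d - 2 * i) * (2 * z) ^ (d - 2 * i).toNat * N ^ i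

/-- The homogeneous Gegenbauer polynomial; `|x|^d C^μ_d(x_m/|x|)` is its value at `(x_m, |x|²)`. -/
def hgeg (μ : ℝ) (d : ℤ) (z N : ℝ) : ℝ := ∑ i ∈ Finset.range (d.toNat + 1), gegTerm μ d z N i

theorem gegTerm_eq_zero {d : ℤ} {i : ℕ} (h : d < 2 * i) (μ z N : ℝ) : gegTerm μ d z N i = 0 := by
  rw [gegTerm, rfact_of_neg (a := d - 2 * i) (by omega)]
  simp

/-- Terms with 2i > d vanish, so sums for neighbouring degrees can be taken over one common range
and compared termwise. -/
theorem hgeg_eq_sum {d : ℤ} {M : ℕ} (h : d < 2 * M) (μ z N : ℝ) :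
    hgeg μ d z N = ∑ i ∈ Finset.range M, gegTerm μ d z N i := by
  have key : ∀ M M' : ℕ, M ≤ M' → d < 2 * M → ∑ i ∈ Finset.range M, gegTerm μ d z N i =
      ∑ i ∈ Finset.range M', gegTerm μ d z N i := fun M M' hM hd =>
    Finset.sum_subset (Finset.range_mono hM) fun i _ hi => gegTerm_eq_zero (by
      simp only [Finset.mem_range, not_lt] at hi
      omega) μ z N
  rw [hgeg]
  rcases le_total (d.toNat + 1) M with hM | hM
  · exact key _ _ hM (by omega)
  · exact (key _ _ hM h).symm

theorem hgeg_of_neg {d : ℤ} (h : d < 0) (μ z N : ℝ) : hgeg μ d z N = 0 := by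
  rw [hgeg_eq_sum (M := 0) (by simpa using h)]
  simp

/-- The `z`-derivative of a term. -/
theorem gegTerm_dz (μ : ℝ) (d : ℤ) (z N : ℝ) (i : ℕ) :
    (-1) ^ i * poch μ (d - i).toNat * rfact i * rfact (d - 2 * i) *
      ((d - 2 * i).toNat * (2 * z) ^ ((d - 2 * i).toNat - 1) * 2) * N ^ i =
      2 * μ * gegTerm (μ + 1) (d - 1) z N i := by
  rcases le_or_gt (d - 2 * i) 0 with h | h
  · rw [gegTerm_eq_zero (by omega), show (d - 2 * i).toNat = 0 by omega]
    simp
  · obtain ⟨a, ha⟩ : ∃ a : ℕ, d = a + 1 + 2 * i := ⟨(d - 2 * i - 1).toNat, by omega⟩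
    subst ha
    have h1 := mul_rfact ((a : ℤ) + 1 + 2 * i - 2 * i)
    rw [gegTerm]
    have e1 : ((a : ℤ) + 1 + 2 * i - 2 * i).toNat = a + 1 := by omega
    have e2 : ((a : ℤ) + 1 + 2 * i - i).toNat = a + i + 1 := by omega
    have e3 : ((a : ℤ) + 1 + 2 * i - 1 - 2 * i).toNat = a := by omega
    have e4 : ((a : ℤ) + 1 + 2 * i - 1 - i).toNat = a + i := by omega
    have e5 : ((a : ℤ) + 1 + 2 * i - 1 - 2 * i) = (a : ℤ) + 1 + 2 * i - 2 * i - 1 := by ring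
    rw [e1, e2, e3, e4, e5, ← h1, poch_succ']
    push_cast
    simp only [add_tsub_cancel_right]
    ring

/-- The `N`-derivative of a term. -/
theorem gegTerm_dN (μ : ℝ) (d : ℤ) (z N : ℝ) (i : ℕ) :
    (-1) ^ (i + 1) * poch μ (d - (i + 1 : ℕ)).toNat * rfact (i + 1 : ℕ) * rfact (d - 2 * (i + 1 : ℕ)) *
      (2 * z) ^ (d - 2 * (i + 1 : ℕ)).toNat * ((i + 1 : ℕ) * N ^ i) =
      -μ * gegTerm (μ + 1) (d - 2) z N i := by
  rcases lt_or_ge (d - 2 * (i + 1)) 0 with h | h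
  · rw [gegTerm_eq_zero (by omega), rfact_of_neg (a := d - 2 * (i + 1 : ℕ)) (by push_cast; omega)]
    simp
  · obtain ⟨a, ha⟩ : ∃ a : ℕ, d = a + 2 * (i + 1) := ⟨(d - 2 * (i + 1)).toNat, by omega⟩
    subst ha
    have h1 := mul_rfact ((i + 1 : ℕ) : ℤ)
    rw [gegTerm]
    have e2 : ((a : ℤ) + 2 * (i + 1) - (i + 1 : ℕ)).toNat = a + i + 1 := by omega
    have e4 : ((a : ℤ) + 2 * (i + 1) - 2 - i).toNat = a + i := by omega
    have e5 : ((a : ℤ) + 2 * (i + 1) - 2 - 2 * i) = a := by ring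
    have e6 : ((a : ℤ) + 2 * (i + 1) - 2 * (i + 1 : ℕ)) = a := by push_cast; ring
    have e7 : ((i + 1 : ℕ) : ℤ) - 1 = i := by push_cast; ring
    rw [e7] at h1
    rw [e2, e4, e5, e6, ← h1, poch_succ']
    push_cast
    ring

theorem hasDerivAt_hgeg (μ : ℝ) (d : ℤ) {z N : ℝ → ℝ} {z' N' t : ℝ} (hz : HasDerivAt z z' t)
    (hN : HasDerivAt N N' t) : HasDerivAt (fun t => hgeg μ d (z t) (N t))
      (2 * μ * z' * hgeg (μ + 1) (d - 1) (z t) (N t) - μ * N' * hgeg (μ + 1) (d - 2) (z t) (N t)) t := by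
  have hterm : ∀ i : ℕ, HasDerivAt (fun t => gegTerm μ d (z t) (N t) i)
      (2 * μ * z' * gegTerm (μ + 1) (d - 1) (z t) (N t) i +
        (-1) ^ i * poch μ (d - i).toNat * rfact i * rfact (d - 2 * i) *
          (2 * z t) ^ (d - 2 * i).toNat * (i * (N t) ^ (i - 1)) * N') t := by
    intro i
    have h1 := ((((hz.const_mul 2).pow (d - 2 * i).toNat).mul (hN.pow i)).const_mul
      ((-1) ^ i * poch μ (d - i).toNat * rfact i * rfact (d - 2 * i)))
    refine (h1.congr_deriv ?_).congr_of_eventuallyEq (Filter.Eventually.of_forall fun t => ?_)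
    · rw [show 2 * μ * z' * gegTerm (μ + 1) (d - 1) (z t) (N t) i =
        z' * (2 * μ * gegTerm (μ + 1) (d - 1) (z t) (N t) i) by ring, ← gegTerm_dz]
      simp only [Pi.pow_apply]
      ring
    · simp only [gegTerm, Pi.mul_apply, Pi.pow_apply]
      ring
  have hsum := HasDerivAt.fun_sum (u := Finset.range (d.toNat + 1)) fun i _ => hterm i
  refine hsum.congr_deriv ?_
  rw [Finset.sum_add_distrib, ← Finset.mul_sum, ← hgeg_eq_sum (by omega)]
  have : ∑ i ∈ Finset.range (d.toNat + 1), (-1) ^ i * poch μ (d - i).toNat * rfact i *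
      rfact (d - 2 * i) * (2 * z t) ^ (d - 2 * i).toNat * (i * (N t) ^ (i - 1)) * N' =
      -(μ * N' * hgeg (μ + 1) (d - 2) (z t) (N t)) := by
    rw [Finset.sum_range_succ']
    simp only [add_tsub_cancel_right, gegTerm_dN]
    rw [← Finset.sum_mul, ← Finset.mul_sum, ← hgeg_eq_sum (by omega)]
    simp
    ring
  rw [this]
  ring

/-- Since N = |x|² also depends on x_m, the x_m-derivative of `hgeg μ d` is the right-hand side by
`hasDerivAt_hgeg`. The recurrence returns it to the parameter μ, which is the source of the Appell
property. -/
theorem hgeg_recurrence (μ : ℝ) (d : ℤ) (z N : ℝ) :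
    (2 * μ + d - 1) * hgeg μ (d - 1) z N =
      2 * μ * (hgeg (μ + 1) (d - 1) z N - z * hgeg (μ + 1) (d - 2) z N) := by
  have hM : ∀ e : ℤ, e ≤ d → e < 2 * (d.toNat + 1 : ℕ) := fun e he => by push_cast; omega
  rw [hgeg_eq_sum (hM _ (by omega)), hgeg_eq_sum (hM _ (by omega)), hgeg_eq_sum (hM _ (by omega)),
    Finset.mul_sum, Finset.mul_sum, ← Finset.sum_sub_distrib, Finset.mul_sum]
  refine Finset.sum_congr rfl fun i _ => ?_
  rcases lt_or_ge (d - 1 - 2 * i) 0 with h | h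
  · rw [gegTerm_eq_zero (by omega), gegTerm_eq_zero (by omega), gegTerm_eq_zero (by omega)]
    ring
  · obtain ⟨a, ha⟩ : ∃ a : ℕ, d = a + 1 + 2 * i := ⟨(d - 1 - 2 * i).toNat, by omega⟩
    subst ha
    have e1 : ((a : ℤ) + 1 + 2 * i - 1 - 2 * i) = a := by ring
    have e2 : ((a : ℤ) + 1 + 2 * i - 1 - i).toNat = a + i := by omega
    -- Termwise, z times the polynomial of degree d - 2 and parameter μ + 1 is proportional to the
    -- polynomial of degree d - 1 and parameter μ; here a is the exponent of 2z.
    have h0 : 2 * μ * (z * gegTerm (μ + 1) ((a : ℤ) + 1 + 2 * i - 2) z N i) =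
        a * gegTerm μ ((a : ℤ) + 1 + 2 * i - 1) z N i := by
      cases a with
      | zero =>
        rw [gegTerm_eq_zero (d := ((0 : ℕ) : ℤ) + 1 + 2 * i - 2) (by push_cast; omega)]
        simp
      | succ a =>
        have e3 : (((a + 1 : ℕ) : ℤ) + 1 + 2 * i - 2 - 2 * i) = a := by push_cast; ring
        have e4 : (((a + 1 : ℕ) : ℤ) + 1 + 2 * i - 2 - i).toNat = a + i := by push_cast; omega
        have e5 : (((a + 1 : ℕ) : ℤ) + 1 + 2 * i - 1 - i).toNat = a + i + 1 := by push_cast; omega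
        have e6 : (((a + 1 : ℕ) : ℤ) + 1 + 2 * i - 1 - 2 * i) = ((a + 1 : ℕ) : ℤ) := by
          push_cast; ring
        have h1 := mul_rfact ((a + 1 : ℕ) : ℤ)
        rw [show ((a + 1 : ℕ) : ℤ) - 1 = a by push_cast; ring] at h1
        rw [gegTerm, gegTerm, e3, e4, e5, e6, ← h1, poch_succ']
        simp only [Int.toNat_natCast]
        push_cast
        ring
    rw [mul_sub, h0, gegTerm, gegTerm, e1, e2, Int.toNat_natCast]
    have h2 : μ * poch (μ + 1) (a + i) = poch μ (a + i) * (μ + (a + i : ℕ)) := by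
      rw [← poch_succ', poch_succ]
    push_cast at h2 ⊢
    linear_combination (-(2 * (-1) ^ i * rfact i * rfact a * (2 * z) ^ a * N ^ i) : ℝ) * h2

/-- Euler's identity for a polynomial that is homogeneous of degree d when z has weight 1 and N has
weight 2, with both derivatives inserted. -/
theorem hgeg_euler (μ : ℝ) (d : ℤ) (z N : ℝ) :
    d * hgeg μ d z N = 2 * μ * z * hgeg (μ + 1) (d - 1) z N -
      2 * μ * N * hgeg (μ + 1) (d - 2) z N := by
  have h1 : 2 * μ * z * hgeg (μ + 1) (d - 1) z N =
      ∑ i ∈ Finset.range (d.toNat + 1), (d - 2 * i : ℝ) * gegTerm μ d z N i := by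
    rw [hgeg_eq_sum (M := d.toNat + 1) (by push_cast; omega), Finset.mul_sum]
    refine Finset.sum_congr rfl fun i _ => ?_
    rw [show 2 * μ * z * gegTerm (μ + 1) (d - 1) z N i =
      z * (2 * μ * gegTerm (μ + 1) (d - 1) z N i) by ring, ← gegTerm_dz, gegTerm]
    rcases lt_or_ge (d - 2 * i) 0 with h | h
    · rw [rfact_of_neg h]; ring
    · obtain ⟨a, ha⟩ : ∃ a : ℕ, d = a + 2 * i := ⟨(d - 2 * i).toNat, by omega⟩
      subst ha
      rw [show ((a : ℤ) + 2 * i - 2 * i) = a by ring]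
      simp only [Int.toNat_natCast]
      cases a with
      | zero => simp
      | succ a => push_cast; simp only [add_tsub_cancel_right]; ring
  have h2 : 2 * μ * N * hgeg (μ + 1) (d - 2) z N =
      -∑ i ∈ Finset.range (d.toNat + 1), (2 * i : ℝ) * gegTerm μ d z N i := by
    rw [hgeg_eq_sum (M := d.toNat) (by omega), Finset.sum_range_succ', Finset.mul_sum, neg_add,
      ← Finset.sum_neg_distrib]
    simp only [Nat.cast_zero, mul_zero, zero_mul, neg_zero, add_zero]
    refine Finset.sum_congr rfl fun i _ => ?_
    rw [show 2 * μ * N * gegTerm (μ + 1) (d - 2) z N i =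
      -(2 * N * (-μ * gegTerm (μ + 1) (d - 2) z N i)) by ring, ← gegTerm_dN, gegTerm, pow_succ N]
    ring
  rw [h1, h2, hgeg_eq_sum (M := d.toNat + 1) (by push_cast; omega), Finset.mul_sum, sub_neg_eq_add,
    ← Finset.sum_add_distrib]
  exact Finset.sum_congr rfl fun i _ => by ring

theorem hgeg_neg (μ : ℝ) (d : ℤ) (z N : ℝ) : hgeg μ d (-z) N = (-1) ^ d.toNat * hgeg μ d z N := by
  rw [hgeg, hgeg, Finset.mul_sum]
  refine Finset.sum_congr rfl fun i _ => ?_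
  rcases lt_or_ge (d - 2 * i) 0 with h | h
  · rw [gegTerm_eq_zero (by omega), gegTerm_eq_zero (by omega), mul_zero]
  · have : (-1 : ℝ) ^ d.toNat = (-1) ^ (d - 2 * i).toNat := by
      rw [show d.toNat = (d - 2 * i).toNat + 2 * i by omega, pow_add, pow_mul]
      simp
    rw [gegTerm, gegTerm, this, mul_neg, neg_pow (2 * z)]
    ring

theorem hgeg_zero (μ z N : ℝ) : hgeg μ 0 z N = 1 := by
  simp [hgeg, gegTerm, rfact, poch]

theorem norm_pow_mul_gegenbauer (μ : ℝ) (d : ℕ) (z r : ℝ) (h : r = 0 → z = 0) :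
    r ^ d * gegenbauer μ d (z / r) = hgeg μ d z (r ^ 2) := by
  rw [gegenbauer, hgeg_eq_sum (M := d / 2 + 1) (by push_cast; omega), Finset.mul_sum]
  refine Finset.sum_congr rfl fun i hi => ?_
  have hi' : 2 * i ≤ d := by
    have := Finset.mem_range.1 hi
    omega
  have e1 : ((d : ℤ) - 2 * i).toNat = d - 2 * i := by omega
  have e2 : ((d : ℤ) - i).toNat = d - i := by omega
  have e3 : ((d : ℤ) - 2 * i) = ((d - 2 * i : ℕ) : ℤ) := by omega
  rw [gegTerm, e1, e2, e3, rfact_natCast, rfact_natCast]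
  have key : r ^ d * (2 * (z / r)) ^ (d - 2 * i) = (2 * z) ^ (d - 2 * i) * (r ^ 2) ^ i := by
    -- At the origin z / r is 0 / 0 = 0; both sides are then 1 for d = 0 and 0 otherwise.
    by_cases hr : r = 0
    · subst hr
      rw [h rfl]
      by_cases hd : d = 0
      · subst hd
        simp at hi'
        simp [hi']
      · by_cases hi0 : i = 0
        · subst hi0; simp [hd]
        · simp [hd, hi0]
    · rw [← pow_mul, ← mul_div_assoc, div_pow]
      conv_lhs => rw [show d = (d - 2 * i) + 2 * i by omega, pow_add]
      rw [show d - 2 * i + 2 * i - 2 * i = d - 2 * i by omega]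
      field_simp
  rw [show r ^ d * ((-1) ^ i * poch μ (d - i) / ((Nat.factorial i : ℝ) *
    (Nat.factorial (d - 2 * i) : ℝ)) * (2 * (z / r)) ^ (d - 2 * i)) =
    ((-1) ^ i * poch μ (d - i) / ((Nat.factorial i : ℝ) *
    (Nat.factorial (d - 2 * i) : ℝ))) * (r ^ d * (2 * (z / r)) ^ (d - 2 * i)) by ring, key]
  rw [div_eq_mul_inv, mul_inv]
  ring

end Gegenbauer

/-! ### Derivatives of and relations between the scalar factors -/

section Factors

variable {n : ℕ}

/-! ### The scalar factors `F` -/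

/-- The normalizing constant of `F`. -/
def normF (n : ℕ) (d : ℤ) (j : ℕ) : ℝ := poch (j + 1) d.toNat / poch (n - 1 + 2 * j) d.toNat

/-- The constant `(j + 1) / (m + 2 j - 1)` for `m = n + 1`. -/
def coefX (n j : ℕ) : ℝ := (j + 1) / (n + 2 * j)

/-- The parameter of the Gegenbauer polynomial in `F`. -/
def paramF (n j : ℕ) : ℝ := ((n : ℝ) + 1) / 2 + j - 1

theorem F_eq (d : ℤ) (j : ℕ) (x : Euc (n + 1)) :
    F n d j x = normF n d j * hgeg (paramF n j) d (x (Fin.last n)) (‖x‖ ^ 2) := by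
  simp only [F]
  split_ifs with h
  · rw [hgeg_of_neg h, mul_zero]
  · obtain ⟨D, rfl⟩ : ∃ D : ℕ, d = D := ⟨d.toNat, by omega⟩
    rw [mul_assoc, Int.toNat_natCast, norm_pow_mul_gegenbauer, normF, paramF, Int.toNat_natCast]
    · congr 3
      ring
    · intro h
      rw [norm_eq_zero.1 h]
      simp

theorem F_of_neg {d : ℤ} (h : d < 0) (j : ℕ) (x : Euc (n + 1)) : F n d j x = 0 := by
  rw [F_eq, hgeg_of_neg h, mul_zero]

theorem F_zero (j : ℕ) (x : Euc (n + 1)) : F n 0 j x = 1 := by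
  rw [F_eq, hgeg_zero]
  simp [normF, poch]

theorem two_mul_paramF (n j : ℕ) : 2 * paramF n j = n - 1 + 2 * j := by
  rw [paramF]; ring

theorem paramF_succ (n j : ℕ) : paramF n (j + 1) = paramF n j + 1 := by
  rw [paramF, paramF]; push_cast; ring

/-- This and the next two identities are the purpose of the normalization (j+1)_d / (m-2+2j)_d. They
convert the Gegenbauer relations, with their factors 2μ = m-2+2j and 2μ+d-1, into relations between
the `F` with coefficients j + d and `coefX`. -/
theorem normF_mul (hn : 2 ≤ n) (d j : ℕ) :
    normF n (d + 1) j * (n - 1 + 2 * j + d) = (j + 1 + d) * normF n d j := by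
  have h : (0 : ℝ) < n - 1 + 2 * j := by
    have : (2 : ℝ) ≤ n := by exact_mod_cast hn
    have : (0 : ℝ) ≤ j := by positivity
    linarith
  have h1 := poch_pos h d
  have h2 : (0 : ℝ) < n - 1 + 2 * j + d := by positivity
  rw [normF, normF, show ((d : ℤ) + 1).toNat = d + 1 by omega, Int.toNat_natCast, poch_succ,
    poch_succ]
  generalize (n : ℝ) - 1 + 2 * j = a at *
  field_simp

theorem normF_mul_param (hn : 2 ≤ n) (d j : ℕ) :
    normF n (d + 1) j * (n - 1 + 2 * j) = coefX n j * (n + 2 * j + d) * normF n d (j + 1) := by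
  have h : (0 : ℝ) < n - 1 + 2 * j := by
    have : (2 : ℝ) ≤ n := by exact_mod_cast hn
    have : (0 : ℝ) ≤ j := by positivity
    linarith
  have h1 := poch_pos (show (0 : ℝ) < n - 1 + 2 * j + 1 by positivity) d
  have h2 := poch_pos (show (0 : ℝ) < n - 1 + 2 * j + 1 + 1 by positivity) d
  have h3 := (poch_succ (n - 1 + 2 * j + 1 : ℝ) d).symm.trans (poch_succ' _ d)
  have h4 : (0 : ℝ) < n + 2 * j := by linarith
  rw [normF, normF, coefX, show ((d : ℤ) + 1).toNat = d + 1 by omega, Int.toNat_natCast, poch_succ',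
    poch_succ', show ((n : ℝ) - 1 + 2 * (j + 1 : ℕ)) = n - 1 + 2 * j + 1 + 1 by push_cast; ring,
    show (((j + 1 : ℕ) : ℝ) + 1) = j + 1 + 1 by push_cast; ring]
  have h5 : (n : ℝ) + 2 * j = n - 1 + 2 * j + 1 := by ring
  rw [h5] at h4 ⊢
  generalize (n : ℝ) - 1 + 2 * j = a at *
  field_simp
  linear_combination (-(poch (j + 1 + 1 : ℝ) d)) * h3

theorem normF_mul_param' (hn : 2 ≤ n) (d j : ℕ) :
    normF n (d + 2) j * (n - 1 + 2 * j) = coefX n j * (j + 2 + d) * normF n d (j + 1) := by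
  have h1 := normF_mul_param hn (d + 1) j
  have h2 := normF_mul hn d (j + 1)
  push_cast at h1 h2
  rw [show ((d : ℤ) + 2) = d + 1 + 1 by ring, h1]
  linear_combination coefX n j * h2

/-- The derivative of `F` in the last variable. -/
theorem F_hasDerivAt_last (hn : 2 ≤ n) (d : ℤ) (j : ℕ) (x : Euc (n + 1)) :
    HasDerivAt (fun t : ℝ => F n d j (x + t • EuclideanSpace.single (Fin.last n) 1))
      ((j + d) * F n (d - 1) j x) 0 := by
  have hz : HasDerivAt (fun t : ℝ => (x + t • EuclideanSpace.single (Fin.last n) (1 : ℝ)) (Fin.last n))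
      1 0 := by simpa using hasDerivAt_coord (Fin.last n) (Fin.last n) x
  have hN : HasDerivAt (fun t : ℝ => ‖x + t • EuclideanSpace.single (Fin.last n) (1 : ℝ)‖ ^ 2)
      (2 * x (Fin.last n)) 0 := by
    simp only [EuclideanSpace.norm_sq_eq, Real.norm_eq_abs, sq_abs]
    have := HasDerivAt.fun_sum (u := Finset.univ) fun i _ =>
      (hasDerivAt_coord (Fin.last n) i x).pow 2
    refine this.congr_deriv ?_
    simp
  have := (hasDerivAt_hgeg (paramF n j) d hz hN).const_mul (normF n d j)
  simp only [F_eq]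
  refine this.congr_deriv ?_
  simp only [zero_smul, add_zero, mul_one]
  have hr := hgeg_recurrence (paramF n j) d (x (Fin.last n)) (‖x‖ ^ 2)
  rw [show 2 * paramF n j * hgeg (paramF n j + 1) (d - 1) (x (Fin.last n)) (‖x‖ ^ 2) -
    paramF n j * (2 * x (Fin.last n)) * hgeg (paramF n j + 1) (d - 2) (x (Fin.last n)) (‖x‖ ^ 2) =
    (2 * paramF n j + d - 1) * hgeg (paramF n j) (d - 1) (x (Fin.last n)) (‖x‖ ^ 2) by
      rw [hr]; ring]
  rcases lt_or_ge (d - 1) 0 with h | h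
  · rw [hgeg_of_neg h]; ring
  · obtain ⟨D, rfl⟩ : ∃ D : ℕ, d = D + 1 := ⟨(d - 1).toNat, by omega⟩
    have h1 := normF_mul hn D j
    rw [two_mul_paramF, add_sub_cancel_right]
    push_cast
    linear_combination (hgeg (paramF n j) D (x (Fin.last n)) (‖x‖ ^ 2)) * h1

/-- The derivative of `F` in the other variables. -/
theorem F_hasDerivAt_castSucc (hn : 2 ≤ n) (d : ℤ) (j : ℕ) (i : Fin n) (x : Euc (n + 1)) :
    HasDerivAt (fun t : ℝ => F n d j (x + t • EuclideanSpace.single i.castSucc 1))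
      (-(coefX n j * (j + d) * x i.castSucc * F n (d - 2) (j + 1) x)) 0 := by
  have hz : HasDerivAt (fun t : ℝ => (x + t • EuclideanSpace.single i.castSucc (1 : ℝ)) (Fin.last n))
      0 0 := by
    simpa [(Fin.castSucc_lt_last i).ne] using hasDerivAt_coord i.castSucc (Fin.last n) x
  have hN : HasDerivAt (fun t : ℝ => ‖x + t • EuclideanSpace.single i.castSucc (1 : ℝ)‖ ^ 2)
      (2 * x i.castSucc) 0 := by
    simp only [EuclideanSpace.norm_sq_eq, Real.norm_eq_abs, sq_abs]
    have := HasDerivAt.fun_sum (u := Finset.univ) fun l _ =>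
      (hasDerivAt_coord i.castSucc l x).pow 2
    refine this.congr_deriv ?_
    simp
  have := (hasDerivAt_hgeg (paramF n j) d hz hN).const_mul (normF n d j)
  simp only [F_eq]
  refine this.congr_deriv ?_
  simp only [zero_smul, add_zero, mul_zero, zero_mul, zero_sub]
  rcases lt_or_ge (d - 2) 0 with h | h
  · rw [hgeg_of_neg h, hgeg_of_neg h]; ring
  · obtain ⟨D, rfl⟩ : ∃ D : ℕ, d = D + 2 := ⟨(d - 2).toNat, by omega⟩
    have h1 := normF_mul_param' hn D j
    rw [← two_mul_paramF] at h1
    rw [add_sub_cancel_right, paramF_succ]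
    push_cast
    linear_combination (-(x i.castSucc * hgeg (paramF n j + 1) D (x (Fin.last n)) (‖x‖ ^ 2))) * h1

/-- `hgeg_recurrence` in the normalization of `F`. -/
theorem F_recurrence (hn : 2 ≤ n) (d : ℤ) (j : ℕ) (x : Euc (n + 1)) :
    (j + d) * F n (d - 1) j x = coefX n j * (n - 1 + 2 * j + d) * F n (d - 1) (j + 1) x -
      coefX n j * (j + d) * x (Fin.last n) * F n (d - 2) (j + 1) x := by
  rcases lt_or_ge (d - 1) 0 with h | h
  · rw [F_of_neg h, F_of_neg h, F_of_neg (by omega)]; ring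
  obtain ⟨D, rfl⟩ : ∃ D : ℕ, d = D + 1 := ⟨(d - 1).toNat, by omega⟩
  have hr := hgeg_recurrence (paramF n j) (D + 1) (x (Fin.last n)) (‖x‖ ^ 2)
  have h1 := normF_mul hn D j
  have h2 := normF_mul_param hn D j
  -- For D = 0 the polynomial has degree -1 and vanishes; `normF_mul_param'` covers the other
  -- degrees.
  have h3 : normF n (D + 1) j * (n - 1 + 2 * j) *
      hgeg (paramF n j + 1) ((D : ℤ) + 1 - 2) (x (Fin.last n)) (‖x‖ ^ 2) =
      coefX n j * (j + 1 + D) * normF n ((D : ℤ) + 1 - 2) (j + 1) *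
      hgeg (paramF n j + 1) ((D : ℤ) + 1 - 2) (x (Fin.last n)) (‖x‖ ^ 2) := by
    cases D with
    | zero => rw [hgeg_of_neg (by omega)]; ring
    | succ D =>
      have h1 := normF_mul_param' hn D j
      rw [show (((D + 1 : ℕ) : ℤ) + 1) = D + 2 by push_cast; ring, h1, add_sub_cancel_right]
      push_cast
      ring
  rw [F_eq, F_eq, F_eq, paramF_succ]
  rw [two_mul_paramF] at hr
  rw [add_sub_cancel_right] at hr ⊢
  push_cast at hr ⊢
  linear_combination (-hgeg (paramF n j) D (x (Fin.last n)) (‖x‖ ^ 2)) * h1 +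
    normF n (D + 1) j * hr +
    hgeg (paramF n j + 1) D (x (Fin.last n)) (‖x‖ ^ 2) * h2 -
    x (Fin.last n) * h3

theorem norm_sq_eq_low (x : Euc (n + 1)) : ‖x‖ ^ 2 = ‖low x‖ ^ 2 + x (Fin.last n) ^ 2 := by
  simp [EuclideanSpace.norm_sq_eq, Fin.sum_univ_castSucc, low]

/-- Euler's identity for `F`: the first term is x_m times the derivative in x_m, the second is the
sum of x_i times the derivative in x_i over the remaining variables. -/
theorem F_euler (hn : 2 ≤ n) (d : ℤ) (j : ℕ) (x : Euc (n + 1)) :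
    d * F n d j x = x (Fin.last n) * ((j + d) * F n (d - 1) j x) -
      coefX n j * (j + d) * ‖low x‖ ^ 2 * F n (d - 2) (j + 1) x := by
  rcases lt_trichotomy d 0 with h | rfl | h
  · rw [F_of_neg h, F_of_neg (by omega), F_of_neg (by omega)]; ring
  · rw [F_of_neg (d := 0 - 1) (by omega), F_of_neg (d := 0 - 2) (by omega)]; simp
  obtain ⟨D, rfl⟩ : ∃ D : ℕ, d = D + 1 := ⟨(d - 1).toNat, by omega⟩
  have he := hgeg_euler (paramF n j) (D + 1) (x (Fin.last n)) (‖x‖ ^ 2)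
  have hr := hgeg_recurrence (paramF n j) (D + 1) (x (Fin.last n)) (‖x‖ ^ 2)
  have h1 := normF_mul hn D j
  have h3 : normF n (D + 1) j * (n - 1 + 2 * j) *
      hgeg (paramF n j + 1) ((D : ℤ) + 1 - 2) (x (Fin.last n)) (‖x‖ ^ 2) =
      coefX n j * (j + 1 + D) * normF n ((D : ℤ) + 1 - 2) (j + 1) *
      hgeg (paramF n j + 1) ((D : ℤ) + 1 - 2) (x (Fin.last n)) (‖x‖ ^ 2) := by
    cases D with
    | zero => rw [hgeg_of_neg (by omega)]; ring
    | succ D =>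
      have h1 := normF_mul_param' hn D j
      rw [show (((D + 1 : ℕ) : ℤ) + 1) = D + 2 by push_cast; ring, h1, add_sub_cancel_right]
      push_cast
      ring
  have hN := norm_sq_eq_low x
  rw [F_eq, F_eq, F_eq, paramF_succ]
  rw [two_mul_paramF] at hr he
  rw [add_sub_cancel_right] at hr he ⊢
  push_cast at hr he ⊢
  linear_combination normF n (D + 1) j * he - x (Fin.last n) * normF n (D + 1) j * hr +
    x (Fin.last n) * hgeg (paramF n j) D (x (Fin.last n)) (‖x‖ ^ 2) * h1
    - ‖low x‖ ^ 2 * h3 - (n - 1 + 2 * j) * normF n (D + 1) j *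
      hgeg (paramF n j + 1) (D + 1 - 2) (x (Fin.last n)) (‖x‖ ^ 2) * hN

theorem coefX_mul (hn : 2 ≤ n) (j : ℕ) : coefX n j * (n + 2 * j) = j + 1 := by
  have : (0 : ℝ) < n + 2 * j := by positivity
  rw [coefX]
  field_simp

/-- The identity between the factors that makes `X` monogenic. -/
theorem F_relation (hn : 2 ≤ n) (d : ℤ) (j : ℕ) (x : Euc (n + 1)) :
    (j + d) * F n (d - 1) j x + coefX n j * coefX n (j + 1) * (j + d) * ‖low x‖ ^ 2 *
      F n (d - 3) (j + 2) x = (j + 1) * F n (d - 1) (j + 1) x := by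
  have h1 := F_recurrence hn d j x
  -- Euler's identity for degree d - 1 and index j + 1 removes the term with x_m from the
  -- recurrence.
  have h2 := F_euler hn (d - 1) (j + 1) x
  rw [show d - 1 - 1 = d - 2 by ring, show d - 1 - 2 = d - 3 by ring] at h2
  have h3 := coefX_mul hn j
  push_cast at h2
  linear_combination h1 + coefX n j * h2 + F n (d - 1) (j + 1) x * h3

/-- `F` is a homogeneous polynomial. -/
theorem F_poly (d : ℤ) (j D : ℕ) (h : d = D ∨ d < 0) : ∃ p : MvPolynomial (Fin (n + 1)) ℝ,
    p.IsHomogeneous D ∧ ∀ x : Euc (n + 1), F n d j x = MvPolynomial.eval (fun i => x i) p := by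
  rcases h with rfl | h
  swap
  · exact ⟨0, MvPolynomial.isHomogeneous_zero _ _ _, fun x => by rw [F_of_neg h, map_zero]⟩
  let N : MvPolynomial (Fin (n + 1)) ℝ := ∑ i, MvPolynomial.X i ^ 2
  have hN : N.IsHomogeneous 2 := MvPolynomial.IsHomogeneous.sum _ _ _ fun i _ => by
    simpa using MvPolynomial.isHomogeneous_X_pow (R := ℝ) i 2
  refine ⟨MvPolynomial.C (normF n D j) * ∑ i ∈ Finset.range (D / 2 + 1),
    MvPolynomial.C ((-1) ^ i * poch (paramF n j) ((D : ℤ) - i).toNat * rfact i *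
      rfact ((D : ℤ) - 2 * i) * 2 ^ (D - 2 * i)) *
      (MvPolynomial.X (Fin.last n) ^ (D - 2 * i) * N ^ i), ?_, fun x => ?_⟩
  · refine MvPolynomial.IsHomogeneous.C_mul (MvPolynomial.IsHomogeneous.sum _ _ _ fun i hi => ?_) _
    refine MvPolynomial.IsHomogeneous.C_mul ?_ _
    have h1 := (MvPolynomial.isHomogeneous_X_pow (R := ℝ) (Fin.last n) (D - 2 * i)).mul (hN.pow i)
    have : 1 * (D - 2 * i) + 2 * i = D := by
      have := Finset.mem_range.1 hi
      omega
    convert h1 using 1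
    omega
  · rw [F_eq, hgeg_eq_sum (M := D / 2 + 1) (by push_cast; omega), map_mul, MvPolynomial.eval_C,
      map_sum]
    congr 1
    refine Finset.sum_congr rfl fun i hi => ?_
    have e1 : ((D : ℤ) - 2 * i).toNat = D - 2 * i := by omega
    have hNx : MvPolynomial.eval (fun i => x i) N = ‖x‖ ^ 2 := by
      simp [N, EuclideanSpace.norm_sq_eq]
    simp only [gegTerm, map_mul, map_pow, MvPolynomial.eval_C, MvPolynomial.eval_X, hNx, e1, mul_pow]
    ring

end Factors

/-! ### Multiplication by `X` preserves solutions -/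

section Embedding

variable {𝕜 : Type*} [RCLike 𝕜] {n : ℕ}

/-- The projection `low` as a linear map. -/
def lowₗ (n : ℕ) : Euc (n + 1) →ₗ[ℝ] Euc n where
  toFun := low
  map_add' x y := by ext i; simp [low]
  map_smul' c x := by ext i; simp [low]

theorem low_up (u : Euc n) : low (up n u) = u := by
  ext i; simp [low, up]

theorem up_low_apply_castSucc (x : Euc (n + 1)) (i : Fin n) :
    up n (low x) i.castSucc = x i.castSucc := by simp [low, up]

theorem up_apply_last (u : Euc n) : up n u (Fin.last n) = 0 := by simp [up]

theorem low_single_castSucc (i : Fin n) :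
    low (EuclideanSpace.single i.castSucc (1 : ℝ)) = EuclideanSpace.single i 1 := by
  ext j; simp [low, Pi.single_apply]

theorem low_single_last : low (EuclideanSpace.single (Fin.last n) (1 : ℝ)) = 0 := by
  ext j; simp [low, Pi.single_apply, Fin.castSucc_ne_last]

theorem vec_up_low (x : Euc (n + 1)) :
    vec 𝕜 (up n (low x)) = ∑ i : Fin n, x i.castSucc • e 𝕜 i.castSucc := by
  rw [vec_eq_sum, Fin.sum_univ_castSucc, up_apply_last, zero_smul, add_zero]
  simp only [up_low_apply_castSucc]

theorem X_eq (d : ℤ) (j : ℕ) (x : Euc (n + 1)) : X 𝕜 n d j x = F n d j x • (1 : Cl 𝕜 (n + 1)) +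
    (coefX n j * F n (d - 1) (j + 1) x) • (vec 𝕜 (up n (low x)) * e 𝕜 (Fin.last n)) := by
  simp only [X, coefX]
  congr 4
  ring

theorem X_of_neg {d : ℤ} (h : d < 0) (j : ℕ) (x : Euc (n + 1)) : X 𝕜 n d j x = 0 := by
  rw [X_eq, F_of_neg h, F_of_neg (by omega)]
  simp

theorem X_zero (j : ℕ) (x : Euc (n + 1)) : X 𝕜 n 0 j x = 1 := by
  rw [X_eq, F_zero, F_of_neg (by omega)]
  simp

theorem X_mul (d : ℤ) (j : ℕ) (x : Euc (n + 1)) (a : Cl 𝕜 (n + 1)) :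
    X 𝕜 n d j x * a = F n d j x • a + (coefX n j * F n (d - 1) (j + 1) x) •
      (vec 𝕜 (up n (low x)) * (e 𝕜 (Fin.last n) * a)) := by
  rw [X_eq, add_mul, smul_mul_assoc, smul_mul_assoc, one_mul, mul_assoc]

theorem vec_up_low_mul (x : Euc (n + 1)) (a : Cl 𝕜 (n + 1)) : vec 𝕜 (up n (low x)) * a =
    ∑ i : Fin n, x i.castSucc • (e 𝕜 i.castSucc * a) := by
  rw [vec_up_low, Finset.sum_mul]
  simp only [smul_mul_assoc]

theorem HPoly_vec_up_low_mul {k : ℕ} {f : Euc (n + 1) → Cl 𝕜 (n + 1)}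
    (hf : f ∈ HPoly 𝕜 (Cl 𝕜 (n + 1)) (n + 1) k) :
    (fun x => vec 𝕜 (up n (low x)) * f x) ∈ HPoly 𝕜 (Cl 𝕜 (n + 1)) (n + 1) (k + 1) := by
  simp only [vec_up_low_mul]
  exact HPoly_sum fun i _ => HPoly_coord_smul (HPoly_mul_left hf _) _

theorem HasPd.mulL {m : ℕ} {i : Fin m} {f g : Euc m → Cl 𝕜 m} (h : HasPd 𝕜 i f g)
    (a : Cl 𝕜 m) : HasPd 𝕜 i (fun x => a * f x) (fun x => a * g x) :=
  h.map (HodgeDeRham.mulL a)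

theorem HasPd.vec_up_low_mul {i : Fin (n + 1)} {f g : Euc (n + 1) → Cl 𝕜 (n + 1)}
    (h : HasPd 𝕜 i f g) : HasPd 𝕜 i (fun x => vec 𝕜 (up n (low x)) * f x)
      (fun x => vec 𝕜 (up n (low (EuclideanSpace.single i 1))) * f x +
        vec 𝕜 (up n (low x)) * g x) := by
  have := HasPd.sum (𝕜 := 𝕜) (i := i) (s := Finset.univ) fun (l : Fin n) _ =>
    (h.mulL (e 𝕜 l.castSucc)).coord_smul l.castSucc
  simp only [HodgeDeRham.vec_up_low_mul]
  convert this using 2 with x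
  rw [← Finset.sum_add_distrib]
  refine Finset.sum_congr rfl fun l _ => ?_
  simp [Pi.single_apply, eq_comm]

theorem F_smul_mem {k K : ℕ} {d : ℤ} (h : d + k = K ∨ d < 0) (j : ℕ) {f : Euc (n + 1) → Cl 𝕜 (n + 1)}
    (hf : f ∈ HPoly 𝕜 (Cl 𝕜 (n + 1)) (n + 1) k) :
    (fun x => F n d j x • f x) ∈ HPoly 𝕜 (Cl 𝕜 (n + 1)) (n + 1) K := by
  rcases lt_or_ge d 0 with hd | hd
  · have : (fun x => F n d j x • f x) = 0 := by
      funext x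
      rw [F_of_neg hd, zero_smul, Pi.zero_apply]
    rw [this]
    exact Submodule.zero_mem _
  · obtain ⟨p, hp, h'⟩ := F_poly (n := n) d j d.toNat (Or.inl (by omega))
    simp only [h']
    have := HPoly_smul hp hf
    rwa [show d.toNat + k = K by omega] at this

theorem X_mul_mem {j K : ℕ} {d : ℤ} (h : d + j = K ∨ d < 0) {Q : Euc (n + 1) → Cl 𝕜 (n + 1)}
    (hQ : Q ∈ HPoly 𝕜 (Cl 𝕜 (n + 1)) (n + 1) j) :
    (fun x => X 𝕜 n d j x * Q x) ∈ HPoly 𝕜 (Cl 𝕜 (n + 1)) (n + 1) K := by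
  simp only [X_mul]
  refine Submodule.add_mem _ (F_smul_mem h j hQ) ?_
  have h1 := F_smul_mem (n := n) (d := d - 1) (k := j + 1) (K := K) (by push_cast; omega) (j + 1)
    (HPoly_vec_up_low_mul (HPoly_mul_left hQ (e 𝕜 (Fin.last n))))
  have h2 := Submodule.smul_mem _ ((coefX n j : ℝ) : 𝕜) h1
  convert h2 using 1
  funext x
  simp only [Pi.smul_apply, mul_smul]
  exact (algebraMap_smul 𝕜 _ _).symm

/-- The partial derivatives of `F`. -/
def gradF (n : ℕ) (d : ℤ) (j : ℕ) (i : Fin (n + 1)) (x : Euc (n + 1)) : ℝ :=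
  Fin.lastCases ((j + d) * F n (d - 1) j x)
    (fun i => -(coefX n j * (j + d) * x i.castSucc * F n (d - 2) (j + 1) x)) i

theorem F_hasDerivAt (hn : 2 ≤ n) (d : ℤ) (j : ℕ) (i : Fin (n + 1)) (x : Euc (n + 1)) :
    HasDerivAt (fun t : ℝ => F n d j (x + t • EuclideanSpace.single i 1)) (gradF n d j i x) 0 := by
  refine Fin.lastCases ?_ (fun i => ?_) i
  · simpa [gradF] using F_hasDerivAt_last hn d j x
  · simpa [gradF] using F_hasDerivAt_castSucc hn d j i x

theorem sum_gradF_mul (d : ℤ) (j : ℕ) (x : Euc (n + 1)) (a : Cl 𝕜 (n + 1)) :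
    ∑ i, e 𝕜 i * (gradF n d j i x • a) =
      (-(coefX n j * (j + d) * F n (d - 2) (j + 1) x)) • (vec 𝕜 (up n (low x)) * a) +
      ((j + d) * F n (d - 1) j x) • (e 𝕜 (Fin.last n) * a) := by
  rw [Fin.sum_univ_castSucc]
  simp only [gradF, Fin.lastCases_last, Fin.lastCases_castSucc, mul_smul_comm]
  rw [vec_up_low_mul, Finset.smul_sum]
  congr 1
  refine Finset.sum_congr rfl fun i _ => ?_
  rw [smul_smul]
  congr 1
  ring

theorem X_mul_hasPd (hn : 2 ≤ n) (d : ℤ) (j : ℕ) {i : Fin (n + 1)}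
    {Q Q' : Euc (n + 1) → Cl 𝕜 (n + 1)} (hQ : HasPd 𝕜 i Q Q') :
    HasPd 𝕜 i (fun x => X 𝕜 n d j x * Q x) fun x =>
      (gradF n d j i x • Q x + F n d j x • Q' x) +
      ((coefX n j * gradF n (d - 1) (j + 1) i x) •
        (vec 𝕜 (up n (low x)) * (e 𝕜 (Fin.last n) * Q x)) +
       (coefX n j * F n (d - 1) (j + 1) x) •
        (vec 𝕜 (up n (low (EuclideanSpace.single i 1))) * (e 𝕜 (Fin.last n) * Q x) +
          vec 𝕜 (up n (low x)) * (e 𝕜 (Fin.last n) * Q' x))) := by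
  simp only [X_mul]
  exact (hQ.smul fun x => F_hasDerivAt hn d j i x).add
    ((hQ.mulL _).vec_up_low_mul.smul fun x => (F_hasDerivAt hn (d - 1) (j + 1) i x).const_mul _)

/-- The Appell property of `X`. -/
theorem X_mul_hasPd_last (hn : 2 ≤ n) (d : ℤ) (j : ℕ) {Q : Euc (n + 1) → Cl 𝕜 (n + 1)}
    (hQ : HasPd 𝕜 (Fin.last n) Q 0) :
    HasPd 𝕜 (Fin.last n) (fun x => X 𝕜 n d j x * Q x) fun x =>
      ((j : ℝ) + d) • (X 𝕜 n (d - 1) j x * Q x) := by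
  convert X_mul_hasPd hn d j hQ using 2 with x
  simp only [X_mul, gradF, Fin.lastCases_last, Pi.zero_apply, low_single_last, map_zero, vec_zero,
    zero_mul, mul_zero, smul_zero, add_zero]
  rw [smul_add, smul_smul, smul_smul]
  congr 2
  push_cast
  ring

/-- This is why `X` has its second term. Applying the Dirac operator leaves multiples of x̲ Q and of
e_m Q, where x̲ is the projection of x to ℝ^n. Those of x̲ Q come from the derivatives of the two
factors `F` and cancel because e_m x̲ e_m = x̲. The coefficient of e_m Q vanishes by `F_relation`.
-/
theorem dirac_X_mul (hn : 2 ≤ n) (d : ℤ) {j : ℕ} {Q : Euc (n + 1) → Cl 𝕜 (n + 1)}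
    (hQ : Q ∈ HPoly 𝕜 (Cl 𝕜 (n + 1)) (n + 1) j) (hl : pd 𝕜 (Fin.last n) Q = 0)
    (hD : ∀ x, dirac 𝕜 Q x = 0) (x : Euc (n + 1)) :
    dirac 𝕜 (fun x => X 𝕜 n d j x * Q x) x = 0 := by
  have hpd : ∀ i, pd 𝕜 i (fun x => X 𝕜 n d j x * Q x) x = _ := fun i =>
    congrFun (X_mul_hasPd hn d j (hasPd_pd hQ i)).pd_eq x
  simp only [dirac, hpd, mul_add, Finset.sum_add_distrib]
  have hD' : ∑ i : Fin n, e 𝕜 i.castSucc * pd 𝕜 i.castSucc Q x = 0 := by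
    have := hD x
    rwa [dirac, Fin.sum_univ_castSucc, hl, Pi.zero_apply, mul_zero, add_zero] at this
  have hE : ∑ i : Fin n, x i.castSucc • pd 𝕜 i.castSucc Q x = (j : ℝ) • Q x := by
    have := HPoly_euler hQ x
    rwa [Fin.sum_univ_castSucc, hl, Pi.zero_apply, smul_zero, add_zero] at this
  have t1 : ∑ i, e 𝕜 i * (F n d j x • pd 𝕜 i Q x) = 0 := by
    simp only [mul_smul_comm, ← Finset.smul_sum]
    rw [show ∑ i, e 𝕜 i * pd 𝕜 i Q x = dirac 𝕜 Q x from rfl, hD, smul_zero]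
  -- Differentiating the factor x̲ contributes -n, and differentiating Q contributes -2j after e_i
  -- is moved past x̲ and Euler's identity is used; `coefX n j` times n + 2j is j + 1.
  have t2 : ∑ i, e 𝕜 i * ((coefX n j * F n (d - 1) (j + 1) x) •
      (vec 𝕜 (up n (low (EuclideanSpace.single i 1))) * (e 𝕜 (Fin.last n) * Q x) +
          vec 𝕜 (up n (low x)) * (e 𝕜 (Fin.last n) * pd 𝕜 i Q x))) =
      (-((j + 1) * F n (d - 1) (j + 1) x)) • (e 𝕜 (Fin.last n) * Q x) := by
    simp only [mul_smul_comm, ← Finset.smul_sum, mul_add, Finset.sum_add_distrib]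
    have s1 : ∑ i, e 𝕜 i * (vec 𝕜 (up n (low (EuclideanSpace.single i 1))) *
        (e 𝕜 (Fin.last n) * Q x)) = (-(n : ℝ)) • (e 𝕜 (Fin.last n) * Q x) := by
      rw [Fin.sum_univ_castSucc, low_single_last, map_zero, vec_zero, zero_mul, mul_zero, add_zero]
      simp only [low_single_castSucc, up_single]
      simp only [← e.eq_1, e_mul_e_mul_self]
      simp [← Nat.cast_smul_eq_nsmul ℝ]
    have s2 : ∑ i, e 𝕜 i * (vec 𝕜 (up n (low x)) * (e 𝕜 (Fin.last n) * pd 𝕜 i Q x)) =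
        (-(2 * j : ℝ)) • (e 𝕜 (Fin.last n) * Q x) := by
      rw [Fin.sum_univ_castSucc, hl, Pi.zero_apply, mul_zero, mul_zero, mul_zero, add_zero]
      have : ∀ i : Fin n, e 𝕜 i.castSucc *
          (vec 𝕜 (up n (low x)) * (e 𝕜 (Fin.last n) * pd 𝕜 i.castSucc Q x)) =
          vec 𝕜 (up n (low x)) * (e 𝕜 (Fin.last n) * (e 𝕜 i.castSucc * pd 𝕜 i.castSucc Q x)) +
          (-2 : ℝ) • (e 𝕜 (Fin.last n) * (x i.castSucc • pd 𝕜 i.castSucc Q x)) := by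
        intro i
        have h1 := vec_mul_e (𝕜 := 𝕜) (up n (low x)) i.castSucc
        rw [up_low_apply_castSucc] at h1
        have h2 : e 𝕜 i.castSucc * vec 𝕜 (up n (low x)) = -(vec 𝕜 (up n (low x)) * e 𝕜 i.castSucc)
            + (-(2 * x i.castSucc)) • (1 : Cl 𝕜 (n + 1)) := by
          rw [h1]; abel
        have h3 : e 𝕜 (Fin.last n) * e 𝕜 i.castSucc = -(e 𝕜 i.castSucc * e 𝕜 (Fin.last n)) :=
          e_mul_e (Fin.castSucc_ne_last i).symm
        rw [← mul_assoc (e 𝕜 i.castSucc), h2, ← mul_assoc (e 𝕜 (Fin.last n)) (e 𝕜 i.castSucc), h3,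
          add_mul, smul_mul_assoc, one_mul, mul_smul_comm, smul_smul, neg_mul, neg_mul, mul_neg,
          mul_assoc, mul_assoc, neg_mul]
      simp only [this, Finset.sum_add_distrib, ← Finset.smul_sum, ← Finset.mul_sum, hD', hE]
      rw [mul_zero, mul_zero, zero_add, mul_smul_comm, smul_smul]
      congr 1
      ring
    rw [s1, s2, ← add_smul, smul_smul]
    congr 1
    have := coefX_mul hn j
    linear_combination (-(F n (d - 1) (j + 1) x)) * this
  rw [sum_gradF_mul, t1, t2]
  simp only [mul_smul, mul_smul_comm, ← Finset.smul_sum]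
  have t3 := sum_gradF_mul (𝕜 := 𝕜) (d - 1) (j + 1) x
    (vec 𝕜 (up n (low x)) * (e 𝕜 (Fin.last n) * Q x))
  simp only [mul_smul_comm] at t3
  rw [t3, vec_mul_vec_mul_self, ← mul_assoc (e 𝕜 (Fin.last n)) (vec 𝕜 (up n (low x))),
    e_last_mul_vec_up, neg_mul, mul_assoc (vec 𝕜 (up n (low x))), e_mul_e_mul_self, mul_neg, neg_neg, norm_up]
  have h := F_relation hn d j x
  rw [show d - 1 - 2 = d - 3 by ring, show d - 1 - 1 = d - 2 by ring, add_assoc j 1 1]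
  push_cast
  have h' : (j + 1) * F n (d - 1) (j + 1) x = _ := h.symm
  generalize vec 𝕜 (up n (low x)) * Q x = A
  generalize e 𝕜 (Fin.last n) * Q x = B
  rw [h']
  module

end Embedding

/-! ### The embeddings produce solutions and form an Appell sequence -/

section Pieces

variable {𝕜 : Type*} [RCLike 𝕜] {n : ℕ}

/-- The function `x ↦ e_{n+1}^q R(x_1, …, x_n)`. -/
def lift (q : ℕ) (R : Euc n → Cl 𝕜 n) (x : Euc (n + 1)) : Cl 𝕜 (n + 1) :=
  e 𝕜 (Fin.last n) ^ q * upCl 𝕜 n (R (low x))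

theorem lift_mem (q : ℕ) {j : ℕ} {R : Euc n → Cl 𝕜 n} (hR : R ∈ HPoly 𝕜 (Cl 𝕜 n) n j) :
    lift q R ∈ HPoly 𝕜 (Cl 𝕜 (n + 1)) (n + 1) j :=
  HPoly_mul_left (HPoly_map (HPoly_comp hR (lowₗ n)) (upCl 𝕜 n).toLinearMap) _

theorem lift_hasPd (q : ℕ) {j : ℕ} {R : Euc n → Cl 𝕜 n} (hR : R ∈ HPoly 𝕜 (Cl 𝕜 n) n j)
    (i : Fin (n + 1)) : HasPd 𝕜 i (lift q R) fun x => e 𝕜 (Fin.last n) ^ q * upCl 𝕜 n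
      (∑ l, low (EuclideanSpace.single i 1) l • pd 𝕜 l R (low x)) := by
  have h := hasPd_pd (HPoly_comp hR (lowₗ n)) i
  rw [pd_comp hR] at h
  exact (h.map (upCl 𝕜 n).toLinearMap).mulL _

theorem lift_pd_last (q : ℕ) {j : ℕ} {R : Euc n → Cl 𝕜 n} (hR : R ∈ HPoly 𝕜 (Cl 𝕜 n) n j) :
    HasPd 𝕜 (Fin.last n) (lift q R) 0 := by
  have := lift_hasPd q hR (Fin.last n)
  simp only [low_single_last] at this
  convert this using 2
  simp

theorem lift_pd_castSucc (q : ℕ) {j : ℕ} {R : Euc n → Cl 𝕜 n} (hR : R ∈ HPoly 𝕜 (Cl 𝕜 n) n j)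
    (i : Fin n) : pd 𝕜 i.castSucc (lift q R) = lift q (pd 𝕜 i R) := by
  rw [(lift_hasPd q hR i.castSucc).pd_eq]
  funext x
  simp [low_single_castSucc, lift, Pi.single_apply]

theorem mul_e_last_pow {b : Cl 𝕜 (n + 1)}
    (h : b * e 𝕜 (Fin.last n) = -(e 𝕜 (Fin.last n) * b)) (q : ℕ) :
    b * e 𝕜 (Fin.last n) ^ q = (-1 : ℝ) ^ q • (e 𝕜 (Fin.last n) ^ q * b) := by
  induction q with
  | zero => simp
  | succ q ih => rw [pow_succ, ← mul_assoc, ih, smul_mul_assoc, mul_assoc, h, pow_succ (-1 : ℝ),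
      mul_smul, neg_one_smul, mul_assoc, mul_neg]

theorem vec_up_mul_e_last_pow (u : Euc n) (q : ℕ) :
    vec 𝕜 (up n u) * e 𝕜 (Fin.last n) ^ q = (-1 : ℝ) ^ q • (e 𝕜 (Fin.last n) ^ q * vec 𝕜 (up n u)) :=
  mul_e_last_pow (by rw [e_last_mul_vec_up, neg_neg]) q

theorem dirac_lift (q : ℕ) {j : ℕ} {R : Euc n → Cl 𝕜 n} (hR : R ∈ HPoly 𝕜 (Cl 𝕜 n) n j)
    (x : Euc (n + 1)) : dirac 𝕜 (lift q R) x =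
      (-1 : ℝ) ^ q • (e 𝕜 (Fin.last n) ^ q * upCl 𝕜 n (dirac 𝕜 R (low x))) := by
  rw [dirac, Fin.sum_univ_castSucc, (lift_pd_last q hR).pd_eq, Pi.zero_apply, mul_zero, add_zero,
    dirac, map_sum, Finset.mul_sum, Finset.smul_sum]
  refine Finset.sum_congr rfl fun i _ => ?_
  rw [lift_pd_castSucc q hR, lift, ← mul_assoc, mul_e_last_pow (e_mul_e (Fin.castSucc_ne_last i)),
    map_mul, upCl_e, smul_mul_assoc, mul_assoc]

theorem gradeInv_e_last_pow_mul (q : ℕ) (a : Cl 𝕜 n) :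
    gradeInv 𝕜 (n + 1) (e 𝕜 (Fin.last n) ^ q * upCl 𝕜 n a) =
      (-1 : ℝ) ^ q • (e 𝕜 (Fin.last n) ^ q * upCl 𝕜 n (gradeInv 𝕜 n a)) := by
  rw [map_mul, map_pow, gradeInv_e, upCl_gradeInv, ← neg_one_smul ℝ, smul_pow, smul_mul_assoc]

theorem wedge_up (u : Euc n) (q : ℕ) (a : Cl 𝕜 n) :
    wedge 𝕜 (up n u) (e 𝕜 (Fin.last n) ^ q * upCl 𝕜 n a) =
      (-1 : ℝ) ^ q • (e 𝕜 (Fin.last n) ^ q * upCl 𝕜 n (wedge 𝕜 u a)) := by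
  rw [wedge, wedge, gradeInv_e_last_pow_mul, ← mul_assoc, vec_up_mul_e_last_pow, upCl_smul, map_add,
    map_mul, map_mul, upCl_vec]
  simp only [smul_mul_assoc, mul_smul_comm, mul_add, mul_assoc, smul_add]
  module

theorem bullet_up (u : Euc n) (q : ℕ) (a : Cl 𝕜 n) :
    bullet 𝕜 (up n u) (e 𝕜 (Fin.last n) ^ q * upCl 𝕜 n a) =
      (-1 : ℝ) ^ q • (e 𝕜 (Fin.last n) ^ q * upCl 𝕜 n (bullet 𝕜 u a)) := by
  rw [bullet, bullet, gradeInv_e_last_pow_mul, ← mul_assoc, vec_up_mul_e_last_pow, upCl_smul,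
    map_sub, map_mul, map_mul, upCl_vec]
  simp only [smul_mul_assoc, mul_smul_comm, mul_sub, mul_assoc, smul_sub]
  module

theorem e_last_pow_mul_upCl_mem {t r : ℕ} (hr : r ≤ 1) {a : Cl 𝕜 n} (ha : a ∈ sVectors 𝕜 n t) :
    e 𝕜 (Fin.last n) ^ r * upCl 𝕜 n a ∈ sVectors 𝕜 (n + 1) (t + r) := by
  interval_cases r
  · simpa using upCl_mem ha
  · simpa using e_last_mul_upCl_mem ha

/-- The argument of the second factor of the embedding. -/
def twist (n t r j : ℕ) (P : Euc n → Cl 𝕜 n) (u : Euc n) : Cl 𝕜 n :=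
  (-1 : ℝ) ^ (r + 1) • (beta n t j ^ (-(r : ℤ)) • wedge 𝕜 u (P u) +
    beta n t j ^ (-(r : ℤ) + 1) • bullet 𝕜 u (P u))

theorem real_smul_mem {V : Type*} [AddCommGroup V] [Module 𝕜 V] [Module ℝ V] [IsScalarTower ℝ 𝕜 V]
    (S : Submodule 𝕜 V) (c : ℝ) {v : V} (hv : v ∈ S) : c • v ∈ S := by
  have := S.smul_mem (c : 𝕜) hv
  rwa [← RCLike.algebraMap_eq_ofReal, algebraMap_smul] at this

theorem twist_mem {t r j : ℕ} {P : Euc n → Cl 𝕜 n} (hP : P ∈ HPoly 𝕜 (Cl 𝕜 n) n j) :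
    twist n t r j P ∈ HPoly 𝕜 (Cl 𝕜 n) n (j + 1) :=
  real_smul_mem _ _ (Submodule.add_mem _ (real_smul_mem _ _ (HPoly_wedge hP))
    (real_smul_mem _ _ (HPoly_bullet hP)))

theorem beta_mul {t : ℕ} (j : ℕ) (ht : t ≠ 0) : beta n t j * (j + t) = -(j + n - t) := by
  have : (0 : ℝ) < j + t := by positivity
  rw [beta]
  field_simp
  ring

theorem beta_ne_zero {t : ℕ} (j : ℕ) (ht : t ≠ 0) (ht' : t < n) : beta n t j ≠ 0 := by
  intro h
  have h1 := beta_mul (n := n) j ht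
  have h2 : (t : ℝ) < n := by exact_mod_cast ht'
  rw [h, zero_mul] at h1
  have : (0 : ℝ) ≤ j := by positivity
  linarith

theorem hasPd_real_smul {i : Fin n} {f g : Euc n → Cl 𝕜 n} (h : HasPd 𝕜 i f g) (c : ℝ) :
    HasPd 𝕜 i (c • f) (c • g) := by
  have := h.const_smul (c : 𝕜)
  simp only [← RCLike.algebraMap_eq_ofReal, algebraMap_smul] at this
  exact this

theorem dirac_real_smul {k : ℕ} {f : Euc n → Cl 𝕜 n} (hf : f ∈ HPoly 𝕜 (Cl 𝕜 n) n k) (c : ℝ)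
    (x : Euc n) : dirac 𝕜 (c • f) x = c • dirac 𝕜 f x := by
  simp only [dirac, (hasPd_real_smul (hasPd_pd hf _) c).pd_eq, Pi.smul_apply, mul_smul_comm,
    Finset.smul_sum]

theorem dirac_add {k k' : ℕ} {f g : Euc n → Cl 𝕜 n} (hf : f ∈ HPoly 𝕜 (Cl 𝕜 n) n k)
    (hg : g ∈ HPoly 𝕜 (Cl 𝕜 n) n k') (x : Euc n) :
    dirac 𝕜 (f + g) x = dirac 𝕜 f x + dirac 𝕜 g x := by
  simp only [dirac, pd_add hf hg, Pi.add_apply, mul_add, Finset.sum_add_distrib]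

/-- D(u ∧ P) = -(n-t+j) P and D(u • P) = -(t+j) P, so the two contributions cancel exactly for β =
-(j+n-t)/(j+t). -/
theorem dirac_twist {t r j : ℕ} {P : Euc n → Cl 𝕜 n} (ht : t ≠ 0) (ht' : t < n)
    (hP : P ∈ hodge 𝕜 n t j) (x : Euc n) : dirac 𝕜 (twist n t r j P) x = 0 := by
  obtain ⟨h1, h2, h3⟩ := mem_hodge_iff.1 hP
  have hw := HPoly_wedge h1
  have hb := HPoly_bullet h1
  have : twist n t r j P = (-1 : ℝ) ^ (r + 1) • (beta n t j ^ (-(r : ℤ)) • (fun u => wedge 𝕜 u (P u)) +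
    beta n t j ^ (-(r : ℤ) + 1) • (fun u => bullet 𝕜 u (P u))) := rfl
  rw [this, dirac_real_smul (Submodule.add_mem _ (real_smul_mem _ _ hw) (real_smul_mem _ _ hb)),
    dirac_add (real_smul_mem _ _ hw) (real_smul_mem _ _ hb), dirac_real_smul hw, dirac_real_smul hb,
    dirac_wedge h1 h2, dirac_bullet h1 h2, h3, zpow_add_one₀ (beta_ne_zero j ht ht')]
  have hβ := beta_mul (n := n) j ht
  simp only [mul_zero, zero_mul, smul_zero, sub_zero, neg_zero, add_zero]
  rw [smul_smul, smul_smul, ← add_smul, show beta n t j ^ (-(r : ℤ)) * -((n : ℝ) - t + j) +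
    beta n t j ^ (-(r : ℤ)) * beta n t j * -((t : ℝ) + j) = 0 by
      linear_combination (-(beta n t j ^ (-(r : ℤ)))) * hβ, zero_smul, smul_zero]

/-- Written with s = t + r, both terms of the embedding have the form `X` times a function of x̲
alone, so `dirac_X_mul` and `X_mul_hasPd_last` apply to each. -/
theorem embed_apply (t r k j : ℕ) (P : Euc n → Cl 𝕜 n) (x : Euc (n + 1)) :
    embed 𝕜 n (t + r) t k j P x = X 𝕜 n (k - j) j x * lift r P x +
      alpha n t j • (X 𝕜 n (k - 1 - j) (j + 1) x * lift (r + 1) (twist n t r j P) x) := by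
  have h1 : t + r - t = r := by omega
  have h2 : (t : ℤ) - (t + r : ℕ) = -r := by push_cast; ring
  -- The sign in `twist` arises from pulling e_m^(r+1) out of the outer and inner products with x̲.
  have h3 : lift (r + 1) (twist n t r j P) x =
    beta n t j ^ (-(r : ℤ)) • wedge 𝕜 (up n (low x)) (e 𝕜 (Fin.last n) ^ (r + 1) * upCl 𝕜 n (P (low x)))
    + beta n t j ^ (-(r : ℤ) + 1) •
      bullet 𝕜 (up n (low x)) (e 𝕜 (Fin.last n) ^ (r + 1) * upCl 𝕜 n (P (low x))) := by
    rw [wedge_up, bullet_up, lift, twist, upCl_smul, map_add, upCl_smul, upCl_smul]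
    simp only [mul_smul_comm, mul_add]
    module
  rw [h3]
  simp only [embed, LinearMap.coe_mk, AddHom.coe_mk, h1, h2, lift]

theorem alpha_eq {t : ℕ} (j : ℕ) (ht : t ≠ 0) (ht' : t ≠ n) : alpha n t j = -coefX n j := by
  simp only [alpha, coefX, ht, ht', or_self, if_false]
  rw [neg_div]
  congr 2
  ring

theorem alpha_eq_zero {t : ℕ} (j : ℕ) (ht : t = 0 ∨ t = n) : alpha n t j = 0 := by
  simp only [alpha, if_pos ht]

theorem embed_eq (t r k j : ℕ) (P : Euc n → Cl 𝕜 n) : embed 𝕜 n (t + r) t k j P =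
    (fun x => X 𝕜 n (k - j) j x * lift r P x) +
      alpha n t j • fun x => X 𝕜 n (k - 1 - j) (j + 1) x * lift (r + 1) (twist n t r j P) x :=
  funext (embed_apply t r k j P)

theorem embed_mem_HPoly (t r k j : ℕ) {P : Euc n → Cl 𝕜 n} (hP : P ∈ HPoly 𝕜 (Cl 𝕜 n) n j) :
    embed 𝕜 n (t + r) t k j P ∈ HPoly 𝕜 (Cl 𝕜 (n + 1)) (n + 1) k := by
  rw [embed_eq]
  exact Submodule.add_mem _ (X_mul_mem (by omega) (lift_mem r hP))
    (real_smul_mem _ _ (X_mul_mem (by push_cast; omega) (lift_mem _ (twist_mem hP))))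

theorem dirac_embed (hn : 2 ≤ n) {t r k j : ℕ} (ht : t ≤ n) {P : Euc n → Cl 𝕜 n}
    (hP : P ∈ hodge 𝕜 n t j) (x : Euc (n + 1)) : dirac 𝕜 (embed 𝕜 n (t + r) t k j P) x = 0 := by
  obtain ⟨h1, h2, h3⟩ := mem_hodge_iff.1 hP
  have hX : (fun x => X 𝕜 n (k - j) j x * lift r P x) ∈ HPoly 𝕜 (Cl 𝕜 (n + 1)) (n + 1) k :=
    X_mul_mem (by omega) (lift_mem r h1)
  have hX' : (fun x => X 𝕜 n (k - 1 - j) (j + 1) x * lift (r + 1) (twist n t r j P) x) ∈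
      HPoly 𝕜 (Cl 𝕜 (n + 1)) (n + 1) k :=
    X_mul_mem (by push_cast; omega) (lift_mem _ (twist_mem h1))
  rw [embed_eq, dirac_add hX (real_smul_mem _ _ hX'), dirac_real_smul hX',
    dirac_X_mul hn _ (lift_mem r h1) (lift_pd_last r h1).pd_eq, zero_add]
  · rcases eq_or_ne t 0 with h0 | h0
    · rw [alpha_eq_zero j (Or.inl h0), zero_smul]
    rcases eq_or_ne t n with hn' | hn'
    · rw [alpha_eq_zero j (Or.inr hn'), zero_smul]
    rw [dirac_X_mul hn _ (lift_mem _ (twist_mem h1)) (lift_pd_last _ (twist_mem h1)).pd_eq,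
      smul_zero]
    intro x
    rw [dirac_lift _ (twist_mem h1), dirac_twist h0 (by omega) hP, map_zero, mul_zero, smul_zero]
  · intro x
    rw [dirac_lift _ h1, h3, map_zero, mul_zero, smul_zero]

/-- The Appell property of the embedding. -/
theorem embed_hasPd_last (hn : 2 ≤ n) (t r k j : ℕ) {P : Euc n → Cl 𝕜 n}
    (hP : P ∈ HPoly 𝕜 (Cl 𝕜 n) n j) :
    pd 𝕜 (Fin.last n) (embed 𝕜 n (t + r) t (k + 1) j P) =
      ((k : ℝ) + 1) • embed 𝕜 n (t + r) t k j P := by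
  refine HasPd.pd_eq ?_
  have h1 := X_mul_hasPd_last hn (((k + 1 : ℕ) : ℤ) - j) j (lift_pd_last r hP)
  have h2 := X_mul_hasPd_last hn (((k + 1 : ℕ) : ℤ) - 1 - j) (j + 1)
    (lift_pd_last (r + 1) (twist_mem (t := t) (r := r) hP))
  have h3 := h1.add (hasPd_real_smul h2 (alpha n t j))
  rw [embed_eq]
  refine (congrArg (HasPd 𝕜 (Fin.last n) _) ?_).mpr h3
  funext x
  rw [Pi.smul_apply, embed_apply]
  simp only [Pi.smul_apply]
  push_cast
  rw [show (k : ℤ) + 1 - j - 1 = k - j by ring, show (k : ℤ) + 1 - 1 - j - 1 = k - 1 - j by ring]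
  module

/-- The start of the Appell sequence: X^(0) = 1, and the second term carries X^(-1) = 0. -/
theorem embed_self (t r j : ℕ) (P : Euc n → Cl 𝕜 n) :
    embed 𝕜 n (t + r) t j j P = lift r P := by
  funext x
  rw [embed_apply, sub_self, X_zero, X_of_neg (by omega), zero_mul, smul_zero, add_zero, one_mul]

end Pieces

/-! ### Degree, equivariance and pole values of embedded functions -/

section Pieces

variable {𝕜 : Type*} [RCLike 𝕜] {n : ℕ}

theorem vec_mul_twist {t r j : ℕ} {P : Euc n → Cl 𝕜 n} (hP : ∀ u, P u ∈ sVectors 𝕜 n t)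
    (u : Euc n) : vec 𝕜 u * twist n t r j P u ∈ sVectors 𝕜 n t := by
  have h1 : vec 𝕜 u * wedge 𝕜 u (P u) = bullet 𝕜 u (wedge 𝕜 u (P u)) := by
    rw [← wedge_add_bullet, wedge_wedge, zero_add]
  have h2 : vec 𝕜 u * bullet 𝕜 u (P u) = wedge 𝕜 u (bullet 𝕜 u (P u)) := by
    rw [← wedge_add_bullet, bullet_bullet, add_zero]
  rw [twist, mul_smul_comm, mul_add, mul_smul_comm, mul_smul_comm, h1, h2]
  refine smul_mem_sVectors _ (Submodule.add_mem _ (smul_mem_sVectors _ (bullet_mem _ (wedge_mem _ (hP u))))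
    (smul_mem_sVectors _ ?_))
  rcases t with _ | t
  · rw [bullet_of_mem_zero u (hP u), wedge]
    simp
  · exact wedge_mem _ (bullet_mem _ (hP u))

theorem e_last_mul_lift (q : ℕ) (R : Euc n → Cl 𝕜 n) (x : Euc (n + 1)) :
    e 𝕜 (Fin.last n) * lift q R x = lift (q + 1) R x := by
  rw [lift, lift, pow_succ', mul_assoc]

theorem vec_up_mul_lift (q : ℕ) (R : Euc n → Cl 𝕜 n) (x : Euc (n + 1)) :
    vec 𝕜 (up n (low x)) * lift q R x =
      (-1 : ℝ) ^ q • (e 𝕜 (Fin.last n) ^ q * upCl 𝕜 n (vec 𝕜 (low x) * R (low x))) := by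
  rw [lift, ← mul_assoc, vec_up_mul_e_last_pow, map_mul, upCl_vec, smul_mul_assoc, mul_assoc]

theorem lift_add_two (q : ℕ) (R : Euc n → Cl 𝕜 n) (x : Euc (n + 1)) :
    lift (q + 2) R x = -lift q R x := by
  rw [lift, lift, pow_add, pow_two, e_mul_self, mul_neg, mul_one, neg_mul]

/-- Components of a wrong degree can only come from the second half of the first `X` and the first
half of the second, which share a factor `F`. For r = 0 the wrong part is e_m (x̲ ∧ P), for r = 1 it
is x̲ • P; α = -`coefX` and the powers of β are such that exactly this part cancels. For t = n, r =
0 and for t = 0, r = 1 the wrong part is zero by itself, and α = 0 is allowed. The remaining cases t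
+ r = 0 and t + r = n + 1 occur only for k = 0. -/
theorem embed_apply_mem {t r k j : ℕ} (ht : t ≤ n) (hr : r ≤ 1)
    (h : t + r = 0 ∨ t + r = n + 1 → k = 0) {P : Euc n → Cl 𝕜 n}
    (hP : ∀ u, P u ∈ sVectors 𝕜 n t) (x : Euc (n + 1)) :
    embed 𝕜 n (t + r) t k j P x ∈ sVectors 𝕜 (n + 1) (t + r) := by
  have hd : (k : ℤ) - j - 1 = k - 1 - j := by ring
  have hl : lift r P x ∈ sVectors 𝕜 (n + 1) (t + r) := e_last_pow_mul_upCl_mem hr (hP _)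
  rw [embed_apply, X_mul, X_mul, e_last_mul_lift, e_last_mul_lift, hd]
  have h4 : vec 𝕜 (up n (low x)) * lift (r + 1 + 1) (twist n t r j P) x ∈
      sVectors 𝕜 (n + 1) (t + r) := by
    rw [lift_add_two, mul_neg, vec_up_mul_lift]
    exact Submodule.neg_mem _ (smul_mem_sVectors _
      (e_last_pow_mul_upCl_mem hr (vec_mul_twist hP _)))
  suffices H : (coefX n j * F n (k - 1 - j) (j + 1) x) • (vec 𝕜 (up n (low x)) * lift (r + 1) P x) +
      alpha n t j • F n (k - 1 - j) (j + 1) x • lift (r + 1) (twist n t r j P) x ∈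
      sVectors 𝕜 (n + 1) (t + r) by
    have := Submodule.add_mem _ (Submodule.add_mem _ H (smul_mem_sVectors (F n (k - j) j x) hl))
      (smul_mem_sVectors (alpha n t j) (smul_mem_sVectors
        (coefX n (j + 1) * F n (k - 1 - j - 1) (j + 1 + 1) x) h4))
    convert this using 1
    rw [smul_add]
    abel
  rw [smul_comm (alpha n t j), mul_comm, mul_smul, ← smul_add]
  -- For k = 0 the common factor `F` has negative degree.
  by_cases hk : k = 0
  · rw [F_of_neg (by omega), zero_smul]
    exact Submodule.zero_mem _
  refine smul_mem_sVectors _ ?_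
  rw [vec_up_mul_lift]
  set u := low x
  have hw : ∀ q, q = t + 1 → wedge 𝕜 u (P u) ∈ sVectors 𝕜 n q := fun q hq => hq ▸ wedge_mem _ (hP u)
  have hb : ∀ q, q + 1 = t → bullet 𝕜 u (P u) ∈ sVectors 𝕜 n q := fun q hq =>
    bullet_mem _ (hq ▸ hP u)
  have hr' : r = 0 ∨ r = 1 := by omega
  have hem : e 𝕜 (Fin.last n) ^ 2 = (-1 : Cl 𝕜 (n + 1)) := by rw [pow_two, e_mul_self]
  rcases hr' with rfl | rfl
  · -- the wedge products cancel
    have hb' : e 𝕜 (Fin.last n) * upCl 𝕜 n (bullet 𝕜 u (P u)) ∈ sVectors 𝕜 (n + 1) (t + 0) := by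
      obtain ⟨q, rfl⟩ : ∃ q, t = q + 1 := ⟨t - 1, by omega⟩
      exact e_last_mul_upCl_mem (hb q rfl)
    rw [← wedge_add_bullet]
    by_cases htn : t = n
    · subst htn
      rw [alpha_eq_zero j (Or.inr rfl), zero_smul, add_zero, wedge_of_mem_top _ (hP u), zero_add]
      simpa using smul_mem_sVectors (coefX t j) hb'
    · rw [alpha_eq j (by omega) htn, lift, twist]
      have : coefX n j • (-1 : ℝ) ^ (0 + 1) • (e 𝕜 (Fin.last n) ^ (0 + 1) *
          upCl 𝕜 n (wedge 𝕜 u (P u) + bullet 𝕜 u (P u))) +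
          (-coefX n j) • (e 𝕜 (Fin.last n) ^ (0 + 1) * upCl 𝕜 n ((-1 : ℝ) ^ (0 + 1) •
          (beta n t j ^ (-((0 : ℕ) : ℤ)) • wedge 𝕜 u (P u) +
            beta n t j ^ (-((0 : ℕ) : ℤ) + 1) • bullet 𝕜 u (P u)))) =
          (coefX n j * (beta n t j - 1)) • (e 𝕜 (Fin.last n) * upCl 𝕜 n (bullet 𝕜 u (P u))) := by
        simp only [upCl_smul, map_add, mul_smul_comm, mul_add, zero_add, pow_one, Nat.cast_zero,
          neg_zero, zpow_zero, zpow_one, one_smul]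
        module
      rw [this]
      exact smul_mem_sVectors _ hb'
  · have hw' : upCl 𝕜 n (wedge 𝕜 u (P u)) ∈ sVectors 𝕜 (n + 1) (t + 1) := upCl_mem (hw _ rfl)
    rw [← wedge_add_bullet]
    by_cases ht0 : t = 0
    · subst ht0
      rw [alpha_eq_zero j (Or.inl rfl), zero_smul, add_zero, bullet_of_mem_zero _ (hP u), add_zero,
        show 1 + 1 = 2 from rfl, hem, neg_one_mul]
      exact smul_mem_sVectors _ (smul_mem_sVectors _ (Submodule.neg_mem _ hw'))
    · rw [alpha_eq j ht0 (by omega), lift, twist, show 1 + 1 = 2 from rfl, hem]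
      have : coefX n j • (-1 : ℝ) ^ 2 • (-1 * upCl 𝕜 n (wedge 𝕜 u (P u) + bullet 𝕜 u (P u))) +
          (-coefX n j) • (-1 * upCl 𝕜 n ((-1 : ℝ) ^ 2 •
          (beta n t j ^ (-((1 : ℕ) : ℤ)) • wedge 𝕜 u (P u) +
            beta n t j ^ (-((1 : ℕ) : ℤ) + 1) • bullet 𝕜 u (P u)))) =
          (coefX n j * (beta n t j ^ (-1 : ℤ) - 1)) • upCl 𝕜 n (wedge 𝕜 u (P u)) := by
        simp only [upCl_smul, map_add, mul_smul_comm, mul_add, Nat.cast_one, neg_add_cancel,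
          zpow_zero, one_smul, neg_one_mul]
        module
      rw [this]
      exact smul_mem_sVectors _ hw'

theorem embed_mem_hodge (hn : 2 ≤ n) {t r k j : ℕ} (ht : t ≤ n) (hr : r ≤ 1)
    (h : t + r = 0 ∨ t + r = n + 1 → k = 0) {P : Euc n → Cl 𝕜 n} (hP : P ∈ hodge 𝕜 n t j) :
    embed 𝕜 n (t + r) t k j P ∈ hodge 𝕜 (n + 1) (t + r) k :=
  mem_hodge_iff.2 ⟨embed_mem_HPoly t r k j (mem_hodge_iff.1 hP).1,
    embed_apply_mem ht hr h (mem_hodge_iff.1 hP).2.1, dirac_embed hn ht hP⟩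

/-! ### Equivariance -/

theorem inner_up (v : Euc n) (x : Euc (n + 1)) : inner ℝ (up n v) x = inner ℝ v (low x) := by
  simp [PiLp.inner_apply, Fin.sum_univ_castSucc, up, low]

theorem low_flip_up (v : Euc n) (x : Euc (n + 1)) : low (flip (up n v) x) = flip v (low x) := by
  change lowₗ n _ = _
  rw [flip_apply, flip_apply, map_sub, map_smul, inner_up]
  change _ • low (up n v) - low x = _
  rw [low_up]

theorem flip_up_last (v : Euc n) (x : Euc (n + 1)) :
    flip (up n v) x (Fin.last n) = -x (Fin.last n) := by
  simp [flip_apply, up]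

theorem conjBy_up_upCl {v : Euc n} (hv : ‖v‖ = 1) (a : Cl 𝕜 n) :
    conjBy 𝕜 (up n v) (upCl 𝕜 n a) = upCl 𝕜 n (conjBy 𝕜 v a) := by
  rw [conjBy_apply, conjBy_apply, map_neg, map_mul, map_mul, upCl_vec]

theorem conjBy_up_e_last {v : Euc n} (hv : ‖v‖ = 1) :
    conjBy 𝕜 (up n v) (e 𝕜 (Fin.last n)) = -e 𝕜 (Fin.last n) := by
  rw [conjBy_apply, e_last_mul_vec_up, mul_neg, vec_mul_vec_mul_self, norm_up, hv]
  simp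

theorem F_flip_up {v : Euc n} (hv : ‖v‖ = 1) (d : ℤ) (j : ℕ) (x : Euc (n + 1)) :
    F n d j (flip (up n v) x) = (-1) ^ d * F n d j x := by
  rcases lt_or_ge d 0 with h | h
  · rw [F_of_neg h, F_of_neg h, mul_zero]
  · rw [F_eq, F_eq, flip_up_last, norm_flip (by rw [norm_up, hv]), hgeg_neg]
    obtain ⟨D, rfl⟩ := Int.eq_ofNat_of_zero_le h
    rw [zpow_natCast, Int.toNat_natCast]
    ring

theorem flip_up_up {v : Euc n} (u : Euc n) : flip (up n v) (up n u) = up n (flip v u) := by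
  rw [flip_apply, flip_apply, inner_up, low_up, map_sub, map_smul]

theorem conjBy_X {v : Euc n} (hv : ‖v‖ = 1) (d : ℤ) (j : ℕ) (x : Euc (n + 1)) :
    conjBy 𝕜 (up n v) (X 𝕜 n d j (flip (up n v) x)) = (-1 : ℝ) ^ d • X 𝕜 n d j x := by
  have hv' : ‖up n v‖ = 1 := by rw [norm_up, hv]
  rw [X_eq, X_eq, map_add, conjBy_smul, conjBy_smul, conjBy_one hv', conjBy_mul hv', conjBy_vec hv',
    conjBy_up_e_last hv, F_flip_up hv, F_flip_up hv, low_flip_up, flip_up_up, flip_flip hv,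
    zpow_sub_one₀ (by norm_num), mul_neg]
  norm_num
  module

theorem conjBy_lift {v : Euc n} (hv : ‖v‖ = 1) (q : ℕ) (R : Euc n → Cl 𝕜 n) (x : Euc (n + 1)) :
    conjBy 𝕜 (up n v) (lift q R (flip (up n v) x)) = (-1 : ℝ) ^ q • lift q (actBy 𝕜 v R) x := by
  have hv' : ‖up n v‖ = 1 := by rw [norm_up, hv]
  rw [lift, lift, conjBy_mul hv', conjBy_pow hv', conjBy_up_upCl hv, conjBy_up_e_last hv,
    low_flip_up, actBy_apply, ← neg_one_smul ℝ, smul_pow, smul_mul_assoc]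

theorem twist_actBy {v : Euc n} (hv : ‖v‖ = 1) (t r j : ℕ) (P : Euc n → Cl 𝕜 n) :
    actBy 𝕜 v (twist n t r j P) = twist n t r j (actBy 𝕜 v P) := by
  funext u
  simp only [actBy_apply, twist, conjBy_smul, map_add, conjBy_wedge hv, conjBy_bullet hv,
    flip_flip hv]

/-- A unit vector v of ℝ^n sends e_m to -e_m and x_m to -x_m. This gives (-1)^(k-j) from `X`, which
has parity k - j, and (-1)^r from e_m^r; in the second term both exponents change by one. Embeddings
are therefore equivariant up to a sign that depends on the piece, and this sign is what separates
pieces with equal Casimir value. -/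
theorem actBy_embed {v : Euc n} (hv : ‖v‖ = 1) (t r k j : ℕ) (P : Euc n → Cl 𝕜 n) :
    actBy 𝕜 (up n v) (embed 𝕜 n (t + r) t k j P) =
      (-1 : ℝ) ^ (k + j + r) • embed 𝕜 n (t + r) t k j (actBy 𝕜 v P) := by
  have hv' : ‖up n v‖ = 1 := by rw [norm_up, hv]
  have e1 : (-1 : ℝ) ^ ((k : ℤ) - j) = (-1) ^ (k + j) := by
    rw [zpow_sub₀ (by norm_num), pow_add, zpow_natCast, zpow_natCast, div_eq_mul_inv, ← inv_pow]
    norm_num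
  have e2 : (-1 : ℝ) ^ ((k : ℤ) - 1 - j) = -(-1) ^ (k + j) := by
    rw [show (k : ℤ) - 1 - j = k - j - 1 by ring, zpow_sub_one₀ (by norm_num), e1]
    norm_num
  funext x
  rw [actBy_apply, Pi.smul_apply, embed_apply, embed_apply, map_add, conjBy_smul, conjBy_mul hv',
    conjBy_mul hv', conjBy_X hv, conjBy_X hv, conjBy_lift hv, conjBy_lift hv, twist_actBy hv, e1, e2]
  simp only [smul_mul_assoc, mul_smul_comm, pow_add, pow_one]
  module

/-! ### Values at the north pole -/

/-- At the pole x̲ = 0, where homogeneous polynomials of positive degree in x̲ vanish; only pieces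
with j = 0 are visible there. -/
theorem embed_apply_pole_of_pos {t r k j : ℕ} (hj : 1 ≤ j) {P : Euc n → Cl 𝕜 n}
    (hP : P ∈ HPoly 𝕜 (Cl 𝕜 n) n j) :
    embed 𝕜 n (t + r) t k j P (EuclideanSpace.single (Fin.last n) 1) = 0 := by
  have h0 : P 0 = 0 := by
    have := HPoly_homogeneous hP 0 0
    rwa [smul_zero, zero_pow (by omega), zero_smul] at this
  have h1 : twist n t r j P 0 = 0 := by
    have := HPoly_homogeneous (twist_mem (t := t) (r := r) hP) 0 0
    rwa [smul_zero, zero_pow (by omega), zero_smul] at this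
  rw [embed_apply, lift, lift, low_single_last, h0, h1]
  simp

theorem embed_apply_pole_zero {t r k : ℕ} {P : Euc n → Cl 𝕜 n} (hP : P ∈ HPoly 𝕜 (Cl 𝕜 n) n 0) :
    embed 𝕜 n (t + r) t k 0 P (EuclideanSpace.single (Fin.last n) 1) =
      F n k 0 (EuclideanSpace.single (Fin.last n) 1) • (e 𝕜 (Fin.last n) ^ r * upCl 𝕜 n (P 0)) := by
  have h1 : twist n t r 0 P 0 = 0 := by
    have := HPoly_homogeneous (twist_mem (t := t) (r := r) hP) 0 0
    rwa [smul_zero, zero_pow (by omega), zero_smul] at this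
  rw [embed_apply, lift, lift, low_single_last, h1, X_mul, low_single_last]
  simp [vec_zero]

end Pieces

/-! ### The direct sum decomposition -/

section Branching

variable {𝕜 : Type*} [RCLike 𝕜] {n : ℕ}

theorem sVectors_eq_bot {m s : ℕ} (h : m < s) : sVectors 𝕜 m s = ⊥ := by
  rw [sVectors, Submodule.span_eq_bot]
  rintro _ ⟨i, rfl⟩
  have := Fintype.card_le_of_injective i i.injective
  simp at this
  omega

theorem hodge_eq_bot_of_lt {m s k : ℕ} (h : m < s) : hodge 𝕜 m s k = ⊥ := by
  rw [eq_bot_iff]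
  intro f hf
  have := (mem_hodge_iff.1 hf).2.1
  rw [sVectors_eq_bot h] at this
  exact funext this

theorem lift_eq_zero {A B : Euc n → Cl 𝕜 n} (h : lift 0 A + lift 1 B = 0) : A = 0 ∧ B = 0 := by
  have : ∀ u, A u = 0 ∧ B u = 0 := fun u => by
    have h1 := congrFun h (up n u)
    simp only [Pi.add_apply, lift, low_up, pow_zero, one_mul, pow_one, Pi.zero_apply] at h1
    exact upCl_add_e_last_mul_eq_zero h1
  exact ⟨funext fun u => (this u).1, funext fun u => (this u).2⟩

theorem eq_up_low_add (x : Euc (n + 1)) :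
    x = up n (low x) + x (Fin.last n) • EuclideanSpace.single (Fin.last n) (1 : ℝ) := by
  ext i
  refine Fin.lastCases ?_ (fun i => ?_) i
  · simp [up]
  · simp [up, low, Pi.single_apply, Fin.castSucc_ne_last]

/-- Solutions which do not depend on the last variable. -/
theorem exists_eq_lift_add {σ k : ℕ} {g : Euc (n + 1) → Cl 𝕜 (n + 1)}
    (hg : g ∈ hodge 𝕜 (n + 1) (σ + 1) k) (h : pd 𝕜 (Fin.last n) g = 0) :
    ∃ A ∈ hodge 𝕜 n (σ + 1) k, ∃ B ∈ hodge 𝕜 n σ k, g = lift 0 A + lift 1 B := by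
  obtain ⟨h1, h2, h3⟩ := mem_hodge_iff.1 hg
  -- The two components are defined through linear maps, not chosen point by point, so that they are
  -- visibly polynomial.
  obtain ⟨L, hL⟩ := exists_upCl_leftInverse (𝕜 := 𝕜) (n := n)
  let A : Euc n → Cl 𝕜 n := fun u => L (tangential 𝕜 n (g (up n u)))
  let B : Euc n → Cl 𝕜 n := fun u =>
    L (-(e 𝕜 (Fin.last n) * ((LinearMap.id - tangential 𝕜 n : Cl 𝕜 (n + 1) →ₗ[𝕜] Cl 𝕜 (n + 1)) (g (up n u)))))
  have key : ∀ u, A u ∈ sVectors 𝕜 n (σ + 1) ∧ B u ∈ sVectors 𝕜 n σ ∧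
      g (up n u) = upCl 𝕜 n (A u) + e 𝕜 (Fin.last n) * upCl 𝕜 n (B u) := by
    intro u
    obtain ⟨a, ha, b, hb, hab⟩ := exists_eq_upCl_add (h2 (up n u))
    have e1 : A u = a := by
      simp only [A, hab, map_add, tangential_upCl, tangential_e_last_mul, add_zero, hL]
    have e2 : B u = b := by
      simp only [B, hab, LinearMap.sub_apply, LinearMap.id_apply, map_add, tangential_upCl,
        tangential_e_last_mul, add_zero, add_sub_cancel_left, e_mul_e_mul_self, neg_neg, hL]
    rw [e1, e2]
    exact ⟨ha, hb, hab⟩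
  have hA : A ∈ HPoly 𝕜 (Cl 𝕜 n) n k :=
    HPoly_map (HPoly_map (HPoly_comp h1 (up n)) (tangential 𝕜 n)) L
  have hB : B ∈ HPoly 𝕜 (Cl 𝕜 n) n k :=
    HPoly_map (HPoly_map (HPoly_mul_left (HPoly_map (HPoly_comp h1 (up n))
      (LinearMap.id - tangential 𝕜 n)) _) (-LinearMap.id)) L
  have hgl : g = lift 0 A + lift 1 B := by
    funext x
    have := HPoly_eq_of_pd_eq_zero h1 h (up n (low x)) (x (Fin.last n))
    rw [← eq_up_low_add] at this
    rw [this, (key _).2.2, Pi.add_apply, lift, lift, pow_zero, one_mul, pow_one]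
  have hd : ∀ u, dirac 𝕜 A u = 0 ∧ dirac 𝕜 B u = 0 := by
    intro u
    have h4 := h3 (up n u)
    rw [hgl, dirac_add (lift_mem 0 hA) (lift_mem 1 hB), dirac_lift 0 hA, dirac_lift 1 hB, low_up] at h4
    have := upCl_add_e_last_mul_eq_zero (A := dirac 𝕜 A u) (B := -dirac 𝕜 B u)
      (by rw [map_neg, mul_neg]; simpa using h4)
    exact ⟨this.1, neg_eq_zero.1 this.2⟩
  exact ⟨A, mem_hodge_iff.2 ⟨hA, fun u => (key u).1, fun u => (hd u).1⟩,
    B, mem_hodge_iff.2 ⟨hB, fun u => (key u).2.1, fun u => (hd u).2⟩, hgl⟩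

/-- The sum of embedded functions with components `A j` and `B j`. -/
def embedSum (σ k : ℕ) (A B : ℕ → Euc n → Cl 𝕜 n) : Euc (n + 1) → Cl 𝕜 (n + 1) :=
  ∑ j ∈ Finset.range (k + 1), (embed 𝕜 n (σ + 1) (σ + 1) k j (A j) + embed 𝕜 n (σ + 1) σ k j (B j))

theorem embedSum_succ (σ k : ℕ) (A B : ℕ → Euc n → Cl 𝕜 n) : embedSum σ (k + 1) A B =
    (∑ j ∈ Finset.range (k + 1), (embed 𝕜 n (σ + 1) (σ + 1) (k + 1) j (A j) +
      embed 𝕜 n (σ + 1) σ (k + 1) j (B j))) + (lift 0 (A (k + 1)) + lift 1 (B (k + 1))) := by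
  rw [embedSum, Finset.sum_range_succ]
  congr 2
  · exact embed_self (σ + 1) 0 (k + 1) _
  · exact embed_self σ 1 (k + 1) _

theorem pd_sum_mem {V : Type*} [AddCommGroup V] [Module 𝕜 V] [Module ℝ V] [IsScalarTower ℝ 𝕜 V]
    {m k : ℕ} {ι : Type*} {S : Finset ι} {f : ι → Euc m → V} (h : ∀ j ∈ S, f j ∈ HPoly 𝕜 V m k)
    (i : Fin m) : pd 𝕜 i (∑ j ∈ S, f j) = ∑ j ∈ S, pd 𝕜 i (f j) := by
  have := (HasPd.sum (𝕜 := 𝕜) (i := i) fun j hj => hasPd_pd (h j hj) i).pd_eq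
  convert this using 1
  · congr 1; funext x; simp
  · funext x; simp

theorem pd_sum_embed (hn : 2 ≤ n) {σ : ℕ} (k : ℕ) {A B : ℕ → Euc n → Cl 𝕜 n}
    (hA : ∀ j, A j ∈ HPoly 𝕜 (Cl 𝕜 n) n j) (hB : ∀ j, B j ∈ HPoly 𝕜 (Cl 𝕜 n) n j) :
    pd 𝕜 (Fin.last n) (∑ j ∈ Finset.range (k + 1), (embed 𝕜 n (σ + 1) (σ + 1) (k + 1) j (A j) +
      embed 𝕜 n (σ + 1) σ (k + 1) j (B j))) = ((k : ℝ) + 1) • embedSum σ k A B := by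
  have h1 : ∀ j, embed 𝕜 n (σ + 1) (σ + 1) (k + 1) j (A j) ∈
    HPoly 𝕜 (Cl 𝕜 (n + 1)) (n + 1) (k + 1) := fun j => embed_mem_HPoly (σ + 1) 0 _ _ (hA j)
  have h2 : ∀ j, embed 𝕜 n (σ + 1) σ (k + 1) j (B j) ∈
    HPoly 𝕜 (Cl 𝕜 (n + 1)) (n + 1) (k + 1) := fun j => embed_mem_HPoly σ 1 _ _ (hB j)
  rw [pd_sum_mem fun j _ => Submodule.add_mem _ (h1 j) (h2 j), embedSum, Finset.smul_sum]
  refine Finset.sum_congr rfl fun j _ => ?_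
  rw [pd_add (h1 j) (h2 j), smul_add]
  congr 1
  · exact embed_hasPd_last hn (σ + 1) 0 k j (hA j)
  · exact embed_hasPd_last hn σ 1 k j (hB j)

theorem lift_pd_last_add {k : ℕ} {A B : Euc n → Cl 𝕜 n} (hA : A ∈ HPoly 𝕜 (Cl 𝕜 n) n k)
    (hB : B ∈ HPoly 𝕜 (Cl 𝕜 n) n k) : pd 𝕜 (Fin.last n) (lift 0 A + lift 1 B) = 0 := by
  rw [pd_add (lift_mem 0 hA) (lift_mem 1 hB), (lift_pd_last 0 hA).pd_eq, (lift_pd_last 1 hB).pd_eq,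
    add_zero]

/-- Differentiating in the last variable gives a multiple of the same sum in degree k, because the
terms with j = k + 1 do not depend on that variable. By induction only those terms are left, and
`lift_eq_zero` separates them. -/
theorem embedSum_eq_zero (hn : 2 ≤ n) {σ k : ℕ} {A B : ℕ → Euc n → Cl 𝕜 n}
    (hA : ∀ j, A j ∈ HPoly 𝕜 (Cl 𝕜 n) n j) (hB : ∀ j, B j ∈ HPoly 𝕜 (Cl 𝕜 n) n j)
    (h : embedSum σ k A B = 0) : ∀ j ≤ k, A j = 0 ∧ B j = 0 := by
  induction k with
  | zero =>
    intro j hj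
    obtain rfl : j = 0 := by omega
    rw [embedSum, zero_add, Finset.sum_range_one] at h
    have e1 : embed 𝕜 n (σ + 1) (σ + 1) 0 0 (A 0) = lift 0 (A 0) := embed_self (σ + 1) 0 0 _
    have e2 : embed 𝕜 n (σ + 1) σ 0 0 (B 0) = lift 1 (B 0) := embed_self σ 1 0 _
    rw [e1, e2] at h
    exact lift_eq_zero h
  | succ k ih =>
    have h0 : embedSum σ k A B = 0 := by
      have h1 := congrArg (pd 𝕜 (Fin.last n)) h
      rw [embedSum_succ, pd_zero, pd_add (k := k + 1) (k' := k + 1)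
        (Submodule.sum_mem _ fun j _ => Submodule.add_mem _ (embed_mem_HPoly (σ + 1) 0 _ _ (hA j))
          (embed_mem_HPoly σ 1 _ _ (hB j)))
        (Submodule.add_mem _ (lift_mem _ (hA _)) (lift_mem _ (hB _))),
        pd_sum_embed hn k hA hB, lift_pd_last_add (hA _) (hB _), add_zero] at h1
      exact (smul_eq_zero.1 h1).resolve_left (by positivity)
    have h2 := ih h0
    intro j hj
    rcases Nat.lt_or_ge j (k + 1) with hj' | hj'
    · exact h2 j (by omega)
    obtain rfl : j = k + 1 := by omega
    rw [embedSum_succ, Finset.sum_eq_zero, zero_add] at h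
    · exact lift_eq_zero h
    · intro j hj
      obtain ⟨e1, e2⟩ := h2 j (by have := Finset.mem_range.1 hj; omega)
      rw [e1, e2, map_zero, map_zero, add_zero]

/-- Every solution is a sum of embedded solutions in one variable less. -/
theorem exists_eq_embedSum (hn : 2 ≤ n) {σ k : ℕ} (hσ : σ ≤ n) {f : Euc (n + 1) → Cl 𝕜 (n + 1)}
    (hf : f ∈ hodge 𝕜 (n + 1) (σ + 1) k) :
    ∃ A B : ℕ → Euc n → Cl 𝕜 n, (∀ j, A j ∈ hodge 𝕜 n (σ + 1) j) ∧ (∀ j, B j ∈ hodge 𝕜 n σ j) ∧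
      f = embedSum σ k A B := by
  induction k generalizing f with
  | zero =>
    obtain ⟨A, hA, B, hB, h⟩ := exists_eq_lift_add hf (funext fun x => by
      refine congrFun (HasPd.pd_eq (g := 0) ?_) x
      have := hasPd_const (𝕜 := 𝕜) (Fin.last n) (f 0)
      rwa [show (fun _ => f 0) = f from funext fun x =>
        (HPoly_zero_const (mem_hodge_iff.1 hf).1 x).symm] at this)
    refine ⟨fun j => if j = 0 then A else 0, fun j => if j = 0 then B else 0,
      fun j => ?_, fun j => ?_, ?_⟩
    · rcases eq_or_ne j 0 with rfl | hj
      · simpa using hA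
      · simp [hj]
    · rcases eq_or_ne j 0 with rfl | hj
      · simpa using hB
      · simp [hj]
    · rw [embedSum, zero_add, Finset.sum_range_one, h]
      simp only [if_true]
      have e1 : embed 𝕜 n (σ + 1) (σ + 1) 0 0 A = lift 0 A := embed_self (σ + 1) 0 0 A
      have e2 : embed 𝕜 n (σ + 1) σ 0 0 B = lift 1 B := embed_self σ 1 0 B
      rw [e1, e2]
  | succ k ih =>
    -- For σ = n the space consists of pseudoscalar valued solutions of positive degree and is zero;
    -- embedded functions need not lie in it, so this case stands apart.
    rcases Nat.lt_or_ge σ n with hσ' | hσ'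
    swap
    · obtain rfl : σ = n := by omega
      rw [hodge_top_eq_bot (by omega), Submodule.mem_bot] at hf
      refine ⟨0, 0, fun j => Submodule.zero_mem _, fun j => Submodule.zero_mem _, ?_⟩
      rw [hf, embedSum]
      simp
    obtain ⟨A, B, hA, hB, h⟩ := ih (pd_mem_hodge hf (Fin.last n))
    have hA' := fun j => (mem_hodge_iff.1 (hA j)).1
    have hB' := fun j => (mem_hodge_iff.1 (hB j)).1
    set S := ∑ j ∈ Finset.range (k + 1), (embed 𝕜 n (σ + 1) (σ + 1) (k + 1) j (A j) +
      embed 𝕜 n (σ + 1) σ (k + 1) j (B j)) with hS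
    have hSm : S ∈ hodge 𝕜 (n + 1) (σ + 1) (k + 1) := Submodule.sum_mem _ fun j _ =>
      Submodule.add_mem _ (embed_mem_hodge hn (r := 0) (by omega) (by omega) (by omega) (hA j))
        (embed_mem_hodge hn (r := 1) (by omega) (by omega) (by omega) (hB j))
    -- The derivative of S is k + 1 times the derivative of f, so this multiple of S removes the
    -- dependence of f on the last variable.
    set c : 𝕜 := -((((k : ℝ) + 1)⁻¹ : ℝ) : 𝕜) with hc
    have hg : f + c • S ∈ hodge 𝕜 (n + 1) (σ + 1) (k + 1) :=
      Submodule.add_mem _ hf (Submodule.smul_mem _ _ hSm)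
    have hpd : pd 𝕜 (Fin.last n) (f + c • S) = 0 := by
      rw [pd_add (mem_hodge_iff.1 hf).1 (Submodule.smul_mem _ c (mem_hodge_iff.1 hSm).1),
        pd_smul (mem_hodge_iff.1 hSm).1, hS, pd_sum_embed hn k hA' hB', h, hc, neg_smul,
        ← RCLike.algebraMap_eq_ofReal, algebraMap_smul, smul_smul,
        inv_mul_cancel₀ (by positivity), one_smul, add_neg_cancel]
    obtain ⟨A', hA'', B', hB'', h'⟩ := exists_eq_lift_add hg hpd
    refine ⟨fun j => if j = k + 1 then A' else (-c) • A j,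
      fun j => if j = k + 1 then B' else (-c) • B j, fun j => ?_, fun j => ?_, ?_⟩
    · rcases eq_or_ne j (k + 1) with rfl | hj
      · simpa using hA''
      · simpa only [hj, if_false] using Submodule.smul_mem _ _ (hA j)
    · rcases eq_or_ne j (k + 1) with rfl | hj
      · simpa using hB''
      · simpa only [hj, if_false] using Submodule.smul_mem _ _ (hB j)
    · rw [embedSum_succ]
      simp only [if_true]
      rw [← h']
      have : ∑ j ∈ Finset.range (k + 1), (embed 𝕜 n (σ + 1) (σ + 1) (k + 1) j
          (if j = k + 1 then A' else (-c) • A j) +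
          embed 𝕜 n (σ + 1) σ (k + 1) j (if j = k + 1 then B' else (-c) • B j)) =
          (-c) • S := by
        rw [hS, Finset.smul_sum]
        refine Finset.sum_congr rfl fun j hj => ?_
        have : j ≠ k + 1 := by have := Finset.mem_range.1 hj; omega
        simp only [this, if_false, map_smul, smul_add]
      rw [this, neg_smul]
      abel

theorem piece_le_hodge (hn : 2 ≤ n) {s t k j : ℕ} (h : s = 0 ∨ s = n + 1 → k = 0)
    (hp : (t, j) ∈ indexSet n s k) : piece 𝕜 n s t k j ≤ hodge 𝕜 (n + 1) s k := by
  rintro _ ⟨P, hP, rfl⟩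
  obtain ⟨h1, -, h3, -⟩ := hp
  rcases h3 with h3 | h3
  · obtain rfl : t + 1 = s := h3
    exact embed_mem_hodge hn h1 le_rfl h hP
  · obtain rfl : t = s := h3
    exact embed_mem_hodge hn (r := 0) h1 (by omega) h hP

/-- The index set omits precisely pairs whose space is zero, so sums over all j ≤ k may be compared
with sums over the index set. -/
theorem hodge_eq_bot_of_notMem {s t k j : ℕ} (ht : t + 1 = s ∨ t = s) (hj : j ≤ k)
    (h : (t, j) ∉ indexSet n s k) : hodge 𝕜 n t j = ⊥ := by
  rcases lt_or_ge n t with h' | h'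
  · exact hodge_eq_bot_of_lt h'
  have h0 : (t = 0 ∨ t = n) ∧ 1 ≤ j := by
    by_contra hc
    exact h ⟨h', hj, ht, fun h0 => by simp only at h0 ⊢; omega⟩
  rcases h0.1 with rfl | rfl
  · exact hodge_zero_eq_bot h0.2
  · exact hodge_top_eq_bot h0.2

theorem iSup_piece (hn : 2 ≤ n) {s k : ℕ} (hs : s ≤ n + 1) (h : s = 0 ∨ s = n + 1 → k = 0) :
    ⨆ p : indexSet n s k, piece 𝕜 n s p.1.1 k p.1.2 = hodge 𝕜 (n + 1) s k := by
  refine le_antisymm (iSup_le fun p => piece_le_hodge hn h p.2) fun f hf => ?_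
  have hle : ∀ t j, (t, j) ∈ indexSet n s k → ∀ P ∈ hodge 𝕜 n t j, embed 𝕜 n s t k j P ∈
      ⨆ p : indexSet n s k, piece 𝕜 n s p.1.1 k p.1.2 := fun t j hp P hP =>
    Submodule.mem_iSup_of_mem (p := fun p : indexSet n s k => piece 𝕜 n s p.1.1 k p.1.2)
      ⟨(t, j), hp⟩ ⟨P, hP, rfl⟩
  rcases s with _ | σ
  · obtain rfl : k = 0 := h (Or.inl rfl)
    obtain ⟨h1, h2, -⟩ := mem_hodge_iff.1 hf
    obtain ⟨c, hc⟩ := mem_sVectors_zero (h2 0)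
    have hP : (fun _ => c • 1) ∈ hodge 𝕜 n 0 0 := mem_hodge_iff.2 ⟨HPoly_const _,
      fun x => Submodule.smul_mem _ _ one_mem_sVectors_zero, fun x => by
        simp [dirac, (hasPd_const _ _).pd_eq]⟩
    have := hle 0 0 ⟨by simp, le_rfl, Or.inr rfl, fun _ => rfl⟩ _ hP
    rwa [show embed 𝕜 n 0 0 0 0 (fun _ => c • 1) = f from by
      refine (embed_self 0 0 0 _).trans ?_
      funext x
      rw [HPoly_zero_const h1 x, hc]
      simp [lift]] at this
  · obtain ⟨A, B, hA, hB, rfl⟩ := exists_eq_embedSum hn (by omega) hf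
    have hle' : ∀ t j, t + 1 = σ + 1 ∨ t = σ + 1 → j ≤ k → ∀ P ∈ hodge 𝕜 n t j,
        embed 𝕜 n (σ + 1) t k j P ∈
          ⨆ p : indexSet n (σ + 1) k, piece 𝕜 n (σ + 1) p.1.1 k p.1.2 := by
      intro t j ht hj P hP
      by_cases hp : (t, j) ∈ indexSet n (σ + 1) k
      · exact hle t j hp P hP
      · rw [hodge_eq_bot_of_notMem ht hj hp, Submodule.mem_bot] at hP
        rw [hP, map_zero]
        exact Submodule.zero_mem _
    refine Submodule.sum_mem _ fun j hj => Submodule.add_mem _ ?_ ?_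
    · exact hle' _ _ (Or.inr rfl) (by have := Finset.mem_range.1 hj; omega) _ (hA j)
    · exact hle' _ _ (Or.inl rfl) (by have := Finset.mem_range.1 hj; omega) _ (hB j)

theorem iSupIndep_piece (hn : 2 ≤ n) (s k : ℕ) :
    iSupIndep fun p : indexSet n s k => piece 𝕜 n s p.1.1 k p.1.2 := by
  classical
  rcases s with _ | σ
  · have : Subsingleton (indexSet n 0 k) := ⟨by
      rintro ⟨⟨t, j⟩, -, -, h1, h2⟩ ⟨⟨t', j'⟩, -, -, h1', h2'⟩
      simp at h1 h2 h1' h2'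
      refine Subtype.ext (Prod.ext ?_ ?_) <;> simp <;> omega⟩
    exact iSupIndep_subsingleton _
  rw [iSupIndep_iff_finsetSum_eq_zero_imp_eq_zero]
  intro S v hv h0
  choose! P hP hPv using hv
  -- The given components, extended by zero to all pairs (t, j), so that a finite sum of pieces
  -- becomes an `embedSum`.
  let Q : ℕ × ℕ → Euc n → Cl 𝕜 n := fun p =>
    if h : ∃ hp : p ∈ indexSet n (σ + 1) k, ⟨p, hp⟩ ∈ S then P ⟨p, h.1⟩ else 0
  have hQ : ∀ p : ℕ × ℕ, Q p ∈ HPoly 𝕜 (Cl 𝕜 n) n p.2 := by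
    intro p
    by_cases h : ∃ hp : p ∈ indexSet n (σ + 1) k, ⟨p, hp⟩ ∈ S
    · simp only [Q, dif_pos h]
      exact (mem_hodge_iff.1 (hP _ h.2)).1
    · simp only [Q, dif_neg h]
      exact Submodule.zero_mem _
  have hQS : ∀ p ∈ S, Q p.1 = P p := fun p hp => by
    have h : ∃ hp : p.1 ∈ indexSet n (σ + 1) k, ⟨p.1, hp⟩ ∈ S := ⟨p.2, hp⟩
    simp only [Q, dif_pos h]
  have hsum : embedSum σ k (fun j => Q (σ + 1, j)) (fun j => Q (σ, j)) = 0 := by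
    rw [← h0, ← Finset.sum_congr rfl fun p hp => hPv p hp]
    have h1 : ∑ p ∈ S, embed 𝕜 n (σ + 1) p.1.1 k p.1.2 (P p) =
        ∑ p ∈ S.map (Function.Embedding.subtype _), embed 𝕜 n (σ + 1) p.1 k p.2 (Q p) := by
      rw [Finset.sum_map]
      refine Finset.sum_congr rfl fun p hp => ?_
      rw [← hQS p hp]
      rfl
    have h2 : S.map (Function.Embedding.subtype _) ⊆ {σ + 1, σ} ×ˢ Finset.range (k + 1) := by
      intro p hp
      obtain ⟨q, hq, rfl⟩ := Finset.mem_map.1 hp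
      obtain ⟨-, h3, h4, -⟩ := q.2
      simp
      omega
    rw [h1, Finset.sum_subset h2, Finset.sum_product, Finset.sum_pair (by simp), embedSum,
      Finset.sum_add_distrib]
    intro p hp hp'
    have : ¬ ∃ hp : p ∈ indexSet n (σ + 1) k, ⟨p, hp⟩ ∈ S := fun ⟨h3, h4⟩ =>
      hp' (Finset.mem_map.2 ⟨⟨p, h3⟩, h4, rfl⟩)
    simp only [Q, dif_neg this, map_zero]
  have hz := embedSum_eq_zero hn (fun j => hQ (σ + 1, j)) (fun j => hQ (σ, j)) hsum
  intro p hp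
  have : Q p.1 = 0 := by
    obtain ⟨⟨t, j⟩, -, h3, h4, -⟩ := p
    have h3' : j ≤ k := h3
    rcases h4 with h4 | h4
    · obtain rfl : t = σ := by simpa using h4
      exact (hz j h3').2
    · obtain rfl : t = σ + 1 := h4
      exact (hz j h3').1
  rw [← hPv p hp, ← hQS p hp, this, map_zero]

/-- Repeated differentiation in the last variable lowers k to j, where the embedding is
multiplication by the unit e_m^r. -/
theorem embed_injective (hn : 2 ≤ n) {t r k j : ℕ} (hj : j ≤ k) {P : Euc n → Cl 𝕜 n}
    (hP : P ∈ HPoly 𝕜 (Cl 𝕜 n) n j) (h : embed 𝕜 n (t + r) t k j P = 0) : P = 0 := by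
  induction k, hj using Nat.le_induction with
  | base =>
    rw [embed_self] at h
    funext u
    have h1 := congrFun h (up n u)
    rw [lift, low_up, Pi.zero_apply] at h1
    have h2 : IsUnit (e 𝕜 (Fin.last n) ^ r) := IsUnit.pow r
      ⟨⟨e 𝕜 (Fin.last n), -e 𝕜 (Fin.last n), by rw [mul_neg, e_mul_self, neg_neg],
        by rw [neg_mul, e_mul_self, neg_neg]⟩, rfl⟩
    rw [h2.mul_right_eq_zero] at h1
    exact upCl_injective (by rw [h1, Pi.zero_apply, map_zero])
  | succ k _ ih =>
    apply ih
    have h1 := congrArg (pd 𝕜 (Fin.last n)) h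
    rw [embed_hasPd_last hn t r k j hP, pd_zero] at h1
    exact (smul_eq_zero.1 h1).resolve_left (by positivity)

end Branching

/-! ### The Casimir operator on solutions -/

section Casimir

variable {𝕜 : Type*} [RCLike 𝕜] {m : ℕ}

/-- The spin part of the infinitesimal rotation in the `(a, b)`-plane. -/
def spin (a b : Fin m) : Cl 𝕜 m →ₗ[𝕜] Cl 𝕜 m :=
  LinearMap.mulRight 𝕜 (e 𝕜 a * e 𝕜 b) - LinearMap.mulLeft 𝕜 (e 𝕜 a * e 𝕜 b)

theorem spin_apply (a b : Fin m) (y : Cl 𝕜 m) :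
    spin a b y = y * (e 𝕜 a * e 𝕜 b) - e 𝕜 a * e 𝕜 b * y := rfl

theorem spin_real_smul (a b : Fin m) (c : ℝ) (y : Cl 𝕜 m) : spin a b (c • y) = c • spin a b y := by
  rw [spin_apply, spin_apply, smul_mul_assoc, mul_smul_comm, smul_sub]

/-- The infinitesimal rotation in the `(a, b)`-plane, acting on Clifford valued functions. -/
def lieOp (a b : Fin m) (f : Euc m → Cl 𝕜 m) (x : Euc m) : Cl 𝕜 m :=
  (2 : ℝ) • (x a • pd 𝕜 b f x - x b • pd 𝕜 a f x) + spin a b (f x)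

theorem HasPd.neg {i : Fin m} {f g : Euc m → Cl 𝕜 m} (h : HasPd 𝕜 i f g) :
    HasPd 𝕜 i (fun x => -f x) (fun x => -g x) := h.map (-LinearMap.id)

theorem pd_mem_succ {k : ℕ} {f : Euc m → Cl 𝕜 m} (hf : f ∈ HPoly 𝕜 (Cl 𝕜 m) m k) (a b : Fin m) :
    (fun x : Euc m => x a • pd 𝕜 b f x) ∈ HPoly 𝕜 (Cl 𝕜 m) m k := by
  rcases k with _ | k
  · have h0 : pd 𝕜 b f = 0 := by
      refine HasPd.pd_eq ?_
      have := hasPd_const (𝕜 := 𝕜) b (f 0)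
      rwa [show (fun _ => f 0) = f from funext fun x => (HPoly_zero_const hf x).symm] at this
    simp only [h0, Pi.zero_apply, smul_zero]
    exact Submodule.zero_mem _
  · exact HPoly_coord_smul (pd_mem hf b) a

theorem lieOp_mem {k : ℕ} {f : Euc m → Cl 𝕜 m} (hf : f ∈ HPoly 𝕜 (Cl 𝕜 m) m k) (a b : Fin m) :
    lieOp a b f ∈ HPoly 𝕜 (Cl 𝕜 m) m k :=
  Submodule.add_mem _ (real_smul_mem _ _ (Submodule.sub_mem _ (pd_mem_succ hf a b)
    (pd_mem_succ hf b a))) (HPoly_map hf (spin a b))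

theorem lieOp_hasPd {k : ℕ} {f : Euc m → Cl 𝕜 m} (hf : f ∈ HPoly 𝕜 (Cl 𝕜 m) m k) (a b c : Fin m) :
    HasPd 𝕜 c (lieOp a b f) fun x =>
      (2 : ℝ) • (((if c = a then (1 : ℝ) else 0) • pd 𝕜 b f x + x a • pd 𝕜 c (pd 𝕜 b f) x) +
        -((if c = b then (1 : ℝ) else 0) • pd 𝕜 a f x + x b • pd 𝕜 c (pd 𝕜 a f) x)) +
      spin a b (pd 𝕜 c f x) := by
  have h1 := (hasPd_pd (pd_mem hf b) c).coord_smul a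
  have h2 := ((hasPd_pd (pd_mem hf a) c).coord_smul b).neg
  have h3 := (hasPd_real_smul (h1.add h2) 2).add ((hasPd_pd hf c).map (spin a b))
  simp only [lieOp, sub_eq_add_neg]
  exact h3

/-- The correction for a = b makes the formula valid for all pairs (both sides vanish there), so
that the Casimir sum can run over all ordered pairs. -/
theorem lieOp_lieOp {k : ℕ} {f : Euc m → Cl 𝕜 m} (hf : f ∈ HPoly 𝕜 (Cl 𝕜 m) m k) (a b : Fin m)
    (x : Euc m) : lieOp a b (lieOp a b f) x =
      (4 : ℝ) • ((if a = b then (2 * x a) • pd 𝕜 a f x else 0) + (x a * x a) • pd 𝕜 b (pd 𝕜 b f) x +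
        (x b * x b) • pd 𝕜 a (pd 𝕜 a f) x - x a • pd 𝕜 a f x - x b • pd 𝕜 b f x
        - (2 : ℝ) • x a • x b • pd 𝕜 b (pd 𝕜 a f) x) +
      (4 : ℝ) • (x a • spin a b (pd 𝕜 b f x) - x b • spin a b (pd 𝕜 a f x)) +
      spin a b (spin a b (f x)) := by
  rw [lieOp, (lieOp_hasPd hf a b b).pd_eq, (lieOp_hasPd hf a b a).pd_eq, lieOp, map_add,
    spin_real_smul, map_sub, spin_real_smul, spin_real_smul, pd_comm hf a b]
  rcases eq_or_ne a b with rfl | hab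
  · simp only [if_true]
    module
  · simp only [hab, hab.symm, if_true, if_false]
    module

/-- Solutions are harmonic because the square of the Dirac operator is minus the Laplacian;
symmetrizing the double sum in a and b leaves the diagonal. -/
theorem sum_pd_pd {t k : ℕ} {f : Euc m → Cl 𝕜 m} (hf : f ∈ hodge 𝕜 m t k) (x : Euc m) :
    ∑ a, pd 𝕜 a (pd 𝕜 a f) x = 0 := by
  have h1 := (mem_hodge_iff.1 hf).1
  have hS : ∑ a, ∑ b, e 𝕜 a * (e 𝕜 b * pd 𝕜 b (pd 𝕜 a f) x) = 0 := by
    refine Finset.sum_eq_zero fun a _ => ?_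
    rw [← Finset.mul_sum]
    exact (congrArg _ ((mem_hodge_iff.1 (pd_mem_hodge hf a)).2.2 x)).trans (mul_zero _)
  have hS' : ∑ a, ∑ b, e 𝕜 b * (e 𝕜 a * pd 𝕜 b (pd 𝕜 a f) x) = 0 := by
    rw [Finset.sum_comm, ← hS]
    refine Finset.sum_congr rfl fun a _ => Finset.sum_congr rfl fun b _ => ?_
    rw [pd_comm h1]
  have h3 : ∀ a b, e 𝕜 a * (e 𝕜 b * pd 𝕜 b (pd 𝕜 a f) x) + e 𝕜 b * (e 𝕜 a * pd 𝕜 b (pd 𝕜 a f) x) =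
      if a = b then (-2 : ℝ) • pd 𝕜 a (pd 𝕜 a f) x else 0 := by
    intro a b
    split_ifs with hab
    · subst hab
      rw [e_mul_e_mul_self]
      module
    · rw [← mul_assoc, ← mul_assoc, e_mul_e hab, neg_mul, neg_add_cancel]
  have h4 : ∑ a, ∑ b, (e 𝕜 a * (e 𝕜 b * pd 𝕜 b (pd 𝕜 a f) x) +
      e 𝕜 b * (e 𝕜 a * pd 𝕜 b (pd 𝕜 a f) x)) = 0 := by
    simp only [Finset.sum_add_distrib, hS, hS', add_zero]
  simp only [h3, Finset.sum_ite_eq, Finset.mem_univ, if_true, ← Finset.smul_sum] at h4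
  exact (smul_eq_zero.1 h4).resolve_left (by norm_num)

theorem sum_smul_pd_pd {k : ℕ} {f : Euc m → Cl 𝕜 m} (hf : f ∈ HPoly 𝕜 (Cl 𝕜 m) m k) (x : Euc m) :
    ∑ a, ∑ b, x a • x b • pd 𝕜 b (pd 𝕜 a f) x = ((k : ℝ) * (k - 1)) • f x := by
  simp only [← Finset.smul_sum, HPoly_euler (pd_mem hf _)]
  simp only [smul_comm (x _) (((k - 1 : ℕ) : ℝ))]
  rw [← Finset.smul_sum, HPoly_euler hf, smul_smul]
  rcases k with _ | k
  · simp
  · push_cast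
    congr 1
    simp
    ring

theorem spin_swap (a b : Fin m) (y : Cl 𝕜 m) : spin b a y = -spin a b y := by
  rcases eq_or_ne a b with rfl | hab
  · simp [spin_apply, e_mul_self]
  · rw [spin_apply, spin_apply, e_mul_e hab, mul_neg, neg_mul]
    abel

/-- The term with e_a e_b on the left vanishes by the Dirac equation. The term with e_a e_b on the
right is reduced, by moving x past e_b, to the Dirac equation from the right (`sum_pd_mul_e`) and
Euler's identity. -/
theorem sum_spin_pd {t k : ℕ} {f : Euc m → Cl 𝕜 m} (hf : f ∈ hodge 𝕜 m t k) (x : Euc m) :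
    ∑ a, ∑ b, (x a • spin a b (pd 𝕜 b f x) - x b • spin a b (pd 𝕜 a f x)) =
      (-(4 * k) : ℝ) • f x := by
  obtain ⟨h1, h2, h3⟩ := mem_hodge_iff.1 hf
  have hs : ∑ a, ∑ b, x b • spin a b (pd 𝕜 a f x) = -∑ a, ∑ b, x a • spin a b (pd 𝕜 b f x) := by
    rw [Finset.sum_comm, ← Finset.sum_neg_distrib]
    refine Finset.sum_congr rfl fun a _ => ?_
    rw [← Finset.sum_neg_distrib]
    refine Finset.sum_congr rfl fun b _ => ?_
    rw [spin_swap, smul_neg]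
  have hx : ∑ a, ∑ b, x a • spin a b (pd 𝕜 b f x) = (-(2 * k) : ℝ) • f x := by
    have e1 : ∑ a, ∑ b, x a • (e 𝕜 a * e 𝕜 b * pd 𝕜 b f x) = 0 := by
      simp only [← Finset.smul_sum, mul_assoc, ← Finset.mul_sum]
      simp only [show ∑ i, e 𝕜 i * pd 𝕜 i f x = 0 from h3 x, mul_zero, smul_zero,
        Finset.sum_const_zero]
    have e2 : ∑ a, ∑ b, x a • (pd 𝕜 b f x * (e 𝕜 a * e 𝕜 b)) = (-(2 * k) : ℝ) • f x := by
      rw [Finset.sum_comm]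
      have : ∀ b, ∑ a, x a • (pd 𝕜 b f x * (e 𝕜 a * e 𝕜 b)) =
          -(pd 𝕜 b f x * e 𝕜 b * vec 𝕜 x) + (-2 : ℝ) • (x b • pd 𝕜 b f x) := by
        intro b
        have h4 : ∑ a, x a • (pd 𝕜 b f x * (e 𝕜 a * e 𝕜 b)) = pd 𝕜 b f x * (vec 𝕜 x * e 𝕜 b) := by
          rw [vec_eq_sum, Finset.sum_mul, Finset.mul_sum]
          simp only [smul_mul_assoc, mul_smul_comm]
        rw [h4, vec_mul_e, mul_add, mul_smul_comm, mul_one, mul_neg, mul_assoc, smul_smul]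
        congr 2
        ring
      simp only [this, Finset.sum_add_distrib, Finset.sum_neg_distrib, ← Finset.sum_mul,
        ← Finset.smul_sum, sum_pd_mul_e hf, HPoly_euler h1]
      rw [zero_mul, neg_zero, zero_add, smul_smul]
      congr 1
      ring
    simp only [spin_apply, smul_sub, Finset.sum_sub_distrib]
    rw [e1, e2, sub_zero]
  simp only [Finset.sum_sub_distrib]
  rw [hs, hx]
  module

/-- Up to diagonal corrections (e_a e_b)² = -1, and the cross term e_a e_b y e_a e_b is -e_a (e_b y
e_b) e_a, so its sum is obtained from two applications of `sum_e_mul_mul_e`. -/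
theorem sum_spin_spin {t : ℕ} {y : Cl 𝕜 m} (hy : y ∈ sVectors 𝕜 m t) :
    ∑ a, ∑ b, spin a b (spin a b y) = (-(8 * t * (m - t)) : ℝ) • y := by
  have hEE : ∀ a b : Fin m, e 𝕜 a * e 𝕜 b * (e 𝕜 a * e 𝕜 b) =
      (-1 + if a = b then (2 : ℝ) else 0) • (1 : Cl 𝕜 m) := by
    intro a b
    rcases eq_or_ne a b with rfl | h
    · rw [if_pos rfl, e_mul_self, neg_mul_neg, one_mul]
      norm_num
    · rw [if_neg h, add_zero, neg_one_smul, mul_assoc, ← mul_assoc (e 𝕜 b), e_mul_e h.symm, neg_mul,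
        mul_neg, mul_assoc, e_mul_e_mul_self, neg_neg, e_mul_self]
  have hS1 : ∑ a, ∑ b, e 𝕜 a * e 𝕜 b * y * (e 𝕜 a * e 𝕜 b) =
      (-((m : ℝ) - 2 * t) ^ 2 + 2 * m) • y := by
    have h1 : ∀ a b, e 𝕜 a * e 𝕜 b * y * (e 𝕜 a * e 𝕜 b) = -(e 𝕜 a * (e 𝕜 b * y * e 𝕜 b) * e 𝕜 a) +
        if a = b then (2 : ℝ) • y else 0 := by
      intro a b
      split_ifs with h
      · subst h
        simp only [mul_assoc, e_mul_e_mul_self, e_mul_self, mul_neg, neg_mul, mul_one, one_mul, neg_neg]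
        module
      · nth_rewrite 2 [e_mul_e h]
        simp only [add_zero, mul_neg, mul_assoc]
    have h2 : ∑ a, e 𝕜 a * (∑ b, e 𝕜 b * y * e 𝕜 b) * e 𝕜 a = (((m : ℝ) - 2 * t) ^ 2) • y := by
      rw [sum_e_mul_mul_e hy]
      simp only [mul_smul_comm, smul_mul_assoc]
      rw [← Finset.smul_sum, sum_e_mul_mul_e hy, smul_smul]
      congr 1
      have : ((-1 : ℝ) ^ (t + 1)) * (-1) ^ (t + 1) = 1 := by rw [← mul_pow]; norm_num
      linear_combination (m - 2 * t : ℝ) ^ 2 * this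
    simp only [h1, Finset.sum_add_distrib, Finset.sum_neg_distrib, Finset.sum_ite_eq,
      Finset.mem_univ, if_true, ← Finset.sum_mul, ← Finset.mul_sum, h2, Finset.sum_const,
      Finset.card_univ, Fintype.card_fin, ← Nat.cast_smul_eq_nsmul ℝ]
    module
  have hS2 : ∑ a : Fin m, ∑ b : Fin m, (-1 + if a = b then (2 : ℝ) else 0) • y =
      (-(m : ℝ) ^ 2 + 2 * m) • y := by
    simp only [← Finset.sum_smul]
    congr 1
    simp [Finset.sum_add_distrib]
    ring
  have h : ∀ a b, spin a b (spin a b y) = (2 : ℝ) • ((-1 + if a = b then (2 : ℝ) else 0) • y) -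
      (2 : ℝ) • (e 𝕜 a * e 𝕜 b * y * (e 𝕜 a * e 𝕜 b)) := by
    intro a b
    simp only [spin_apply, sub_mul, mul_sub]
    rw [mul_assoc y, hEE, mul_smul_comm, mul_one, ← mul_assoc (e 𝕜 a * e 𝕜 b) (e 𝕜 a * e 𝕜 b) y, hEE,
      smul_mul_assoc, one_mul, mul_assoc (e 𝕜 a * e 𝕜 b) y]
    module
  simp only [h, Finset.sum_sub_distrib, ← Finset.smul_sum]
  rw [hS1, hS2]
  module

/-- The Casimir operator is a scalar. -/
theorem casimir {t k : ℕ} {f : Euc m → Cl 𝕜 m} (hf : f ∈ hodge 𝕜 m t k) (x : Euc m) :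
    ∑ a, ∑ b, lieOp a b (lieOp a b f) x = (-(8 * (k + t) * (k + m - t)) : ℝ) • f x := by
  obtain ⟨h1, h2, h3⟩ := mem_hodge_iff.1 hf
  -- The orbital part: the Laplacian terms vanish and Euler's identity evaluates the others. With
  -- the mixed and spin parts, 4·(-2k(k+m-2)) - 16k - 8t(m-t) = -8(k+t)(k+m-t).
  have c1 : ∑ a, ∑ b, ((if a = b then (2 * x a) • pd 𝕜 a f x else 0) +
      (x a * x a) • pd 𝕜 b (pd 𝕜 b f) x +
        (x b * x b) • pd 𝕜 a (pd 𝕜 a f) x - x a • pd 𝕜 a f x - x b • pd 𝕜 b f x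
        - (2 : ℝ) • x a • x b • pd 𝕜 b (pd 𝕜 a f) x) = (-(2 * k * (k + m - 2)) : ℝ) • f x := by
    have s1 : ∑ a, ∑ b, (if a = b then (2 * x a) • pd 𝕜 a f x else 0) = (2 * k : ℝ) • f x := by
      simp only [Finset.sum_ite_eq, Finset.mem_univ, if_true, mul_smul, ← Finset.smul_sum,
        HPoly_euler h1]
    have s2 : ∑ a, ∑ b, (x a * x a) • pd 𝕜 b (pd 𝕜 b f) x = 0 := by
      simp only [← Finset.smul_sum, sum_pd_pd hf, smul_zero, Finset.sum_const_zero]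
    have s4 : ∑ _a : Fin m, ∑ b, x b • pd 𝕜 b f x = (m * k : ℝ) • f x := by
      rw [HPoly_euler h1, Finset.sum_const, Finset.card_univ, Fintype.card_fin,
        ← Nat.cast_smul_eq_nsmul ℝ, smul_smul]
    have s6 : ∑ a, ∑ b, (2 : ℝ) • x a • x b • pd 𝕜 b (pd 𝕜 a f) x =
        (2 : ℝ) • ((k : ℝ) * (k - 1)) • f x := by
      rw [← sum_smul_pd_pd h1 x]
      simp only [Finset.smul_sum]
    simp only [Finset.sum_sub_distrib, Finset.sum_add_distrib]
    rw [s1, s2, Finset.sum_comm (f := fun a b => (x b * x b) • pd 𝕜 a (pd 𝕜 a f) x), s2,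
      Finset.sum_comm (f := fun a _ => x a • pd 𝕜 a f x), s4, s6]
    module
  simp only [lieOp_lieOp h1, Finset.sum_add_distrib, ← Finset.smul_sum]
  rw [sum_spin_spin (h2 x), sum_spin_pd hf]
  simp only [← Finset.sum_add_distrib] at c1 ⊢
  rw [c1]
  module

end Casimir

/-! ### Infinitesimal rotations as derivatives of products of two unit vectors -/

section Rotation

variable {𝕜 : Type*} [RCLike 𝕜] {m : ℕ}

/-- The unit vector at angle `θ` in the `(a, b)`-plane. -/
def planeVec (a b : Fin m) (θ : ℝ) : Euc m :=
  Real.cos θ • EuclideanSpace.single a 1 + Real.sin θ • EuclideanSpace.single b 1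

theorem planeVec_norm {a b : Fin m} (h : a ≠ b) (θ : ℝ) : ‖planeVec a b θ‖ = 1 := by
  have : ‖planeVec a b θ‖ ^ 2 = 1 := by
    rw [← real_inner_self_eq_norm_sq, planeVec]
    simp only [inner_add_left, inner_add_right, real_inner_smul_left, real_inner_smul_right,
      EuclideanSpace.inner_single_left, EuclideanSpace.inner_single_right]
    simp [h, h.symm]
    have := Real.cos_sq_add_sin_sq θ
    linarith
  exact (pow_eq_one_iff_of_nonneg (norm_nonneg _) two_ne_zero).1 this

theorem conjBy_conjBy_planeVec {a b : Fin m} (θ : ℝ) (y : Cl 𝕜 m) :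
    conjBy 𝕜 (EuclideanSpace.single a 1) (conjBy 𝕜 (planeVec a b θ) y) =
      (Real.cos θ ^ 2) • y + (Real.cos θ * Real.sin θ) •
        (y * -(e 𝕜 b * e 𝕜 a) - e 𝕜 a * e 𝕜 b * y) +
      (Real.sin θ ^ 2) • (e 𝕜 a * e 𝕜 b * y * (e 𝕜 b * e 𝕜 a)) := by
  have h : ∀ i : Fin m, vec 𝕜 (EuclideanSpace.single i (1 : ℝ)) = e 𝕜 i := fun i => rfl
  rw [conjBy_apply, conjBy_apply, planeVec, vec_add, vec_smul, vec_smul, h, h]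
  have h1 : e 𝕜 a * ((Real.cos θ • e 𝕜 a + Real.sin θ • e 𝕜 b)) =
      -(Real.cos θ • (1 : Cl 𝕜 m)) + Real.sin θ • (e 𝕜 a * e 𝕜 b) := by
    rw [mul_add, mul_smul_comm, mul_smul_comm, e_mul_self, smul_neg]
  have h2 : (Real.cos θ • e 𝕜 a + Real.sin θ • e 𝕜 b) * e 𝕜 a =
      -(Real.cos θ • (1 : Cl 𝕜 m)) + Real.sin θ • (e 𝕜 b * e 𝕜 a) := by
    rw [add_mul, smul_mul_assoc, smul_mul_assoc, e_mul_self, smul_neg]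
  rw [neg_mul, mul_neg, neg_neg, mul_assoc, ← mul_assoc (e 𝕜 a), mul_assoc y, h1, h2]
  simp only [mul_add, add_mul, mul_neg, neg_mul, smul_mul_assoc, mul_smul_comm, one_mul, mul_one,
    mul_assoc]
  module

/-- Acting by two unit vectors at angle θ is a rotation by 2θ, which explains the factor 2 in
`lieOp`; at θ = 0 the two vectors agree and their actions cancel. In this way the Lie algebra is
reached from unit vectors alone. -/
theorem hasDerivAt_rotation {k : ℕ} {f : Euc m → Cl 𝕜 m} (hf : f ∈ HPoly 𝕜 (Cl 𝕜 m) m k)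
    {a b : Fin m} (h : a ≠ b) (φ : Cl 𝕜 m →ₗ[𝕜] 𝕜) (x : Euc m) :
    HasDerivAt (fun θ => φ (actBy 𝕜 (EuclideanSpace.single a 1) (actBy 𝕜 (planeVec a b θ) f) x))
      (φ (lieOp a b f x)) 0 := by
  set z := flip (EuclideanSpace.single a (1 : ℝ)) x with hz
  let γ : ℝ → Euc m := fun θ => flip (planeVec a b θ) z
  have hza : z a = x a := by
    simp [hz, flip_apply, EuclideanSpace.inner_single_left]
    ring
  have hzb : z b = -x b := by simp [hz, flip_apply, h]
  have hγ0 : γ 0 = x := by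
    simp only [γ, planeVec, Real.cos_zero, Real.sin_zero, one_smul, zero_smul, add_zero, hz]
    exact flip_flip (by simp) x
  have hγ : ∀ i, HasDerivAt (fun θ => γ θ i)
      ((if i = a then -2 * x b else 0) + (if i = b then 2 * x a else 0)) 0 := by
    intro i
    have e1 : (fun θ => γ θ i) = fun θ => 2 * (Real.cos θ * z a + Real.sin θ * z b) *
        (Real.cos θ * (if i = a then 1 else 0) + Real.sin θ * (if i = b then 1 else 0)) - z i := by
      funext θ
      simp [γ, flip_apply, planeVec, inner_add_left, real_inner_smul_left,
        EuclideanSpace.inner_single_left, Pi.single_apply]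
      split_ifs <;> ring
    rw [e1]
    have hc := Real.hasDerivAt_cos 0
    have hs := Real.hasDerivAt_sin 0
    have := ((((hc.mul_const (z a)).add (hs.mul_const (z b))).const_mul 2).mul
      ((hc.mul_const (if i = a then (1 : ℝ) else 0)).add
        (hs.mul_const (if i = b then (1 : ℝ) else 0)))).sub_const (z i)
    refine this.congr_deriv ?_
    simp only [Real.cos_zero, Real.sin_zero, hza, hzb, Pi.add_apply]
    split_ifs <;> ring
  have hd : ∀ ψ : Cl 𝕜 m →ₗ[𝕜] 𝕜, HasDerivAt (fun θ => ψ (f (γ θ)))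
      (ψ ((2 : ℝ) • (x a • pd 𝕜 b f x - x b • pd 𝕜 a f x))) 0 := by
    intro ψ
    refine (HPoly_hasDerivAt hf ψ hγ).congr_deriv ?_
    rw [hγ0]
    simp only [add_smul, ite_smul, zero_smul, Finset.sum_add_distrib, Finset.sum_ite_eq',
      Finset.mem_univ, if_true, LinearMap.map_smul_of_tower, map_sub]
    module
  -- Expanding both conjugations leaves the coefficients cos², cos·sin and sin². At θ = 0 the first
  -- contributes the derivative along the orbit, the second the spin part, the third nothing.
  have hfun : (fun θ => φ (actBy 𝕜 (EuclideanSpace.single a 1) (actBy 𝕜 (planeVec a b θ) f) x)) =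
      fun θ => (Real.cos θ ^ 2) • φ (f (γ θ)) + (Real.cos θ * Real.sin θ) •
        (φ ∘ₗ (LinearMap.mulRight 𝕜 (-(e 𝕜 b * e 𝕜 a)) - LinearMap.mulLeft 𝕜 (e 𝕜 a * e 𝕜 b)))
          (f (γ θ)) +
        (Real.sin θ ^ 2) • (φ ∘ₗ LinearMap.mulRight 𝕜 (e 𝕜 b * e 𝕜 a) ∘ₗ
          LinearMap.mulLeft 𝕜 (e 𝕜 a * e 𝕜 b)) (f (γ θ)) := by
    funext θ
    rw [actBy_apply, actBy_apply, conjBy_conjBy_planeVec, map_add, map_add,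
      LinearMap.map_smul_of_tower, LinearMap.map_smul_of_tower, LinearMap.map_smul_of_tower]
    rfl
  rw [hfun]
  have hc := Real.hasDerivAt_cos 0
  have hs := Real.hasDerivAt_sin 0
  have h1 := (hc.pow 2).smul (hd φ)
  have h2 := (hc.mul hs).smul (hd (φ ∘ₗ (LinearMap.mulRight 𝕜 (-(e 𝕜 b * e 𝕜 a)) -
    LinearMap.mulLeft 𝕜 (e 𝕜 a * e 𝕜 b))))
  have h3 := (hs.pow 2).smul (hd (φ ∘ₗ LinearMap.mulRight 𝕜 (e 𝕜 b * e 𝕜 a) ∘ₗ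
    LinearMap.mulLeft 𝕜 (e 𝕜 a * e 𝕜 b)))
  refine ((h1.add h2).add h3).congr_deriv ?_
  simp [hγ0, lieOp, spin_apply, e_mul_e h.symm, mul_assoc]

end Rotation

/-! ### From pointwise derivatives to derivatives under all functionals -/

section Duality

variable {𝕜 : Type*} [RCLike 𝕜] {m : ℕ} {V : Type*} [AddCommGroup V] [Module 𝕜 V] [Module ℝ V]
  [IsScalarTower ℝ 𝕜 V]

/-- A curve of polynomials which is differentiable pointwise is differentiable. -/
theorem hasDerivAt_dual [Module.Finite 𝕜 V] {k : ℕ} {R : ℝ → HPoly 𝕜 V m k} {L : HPoly 𝕜 V m k}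
    (h : ∀ (φ : V →ₗ[𝕜] 𝕜) (x : Euc m), HasDerivAt (fun θ => φ ((R θ).1 x)) (φ (L.1 x)) 0)
    (lam : Module.Dual 𝕜 (HPoly 𝕜 V m k)) : HasDerivAt (fun θ => lam (R θ)) (lam L) 0 := by
  let Φ : Submodule 𝕜 (Module.Dual 𝕜 (HPoly 𝕜 V m k)) :=
    { carrier := {l | HasDerivAt (fun θ => l (R θ)) (l L) 0}
      add_mem' := fun {a b} ha hb => by simpa using! HasDerivAt.add ha hb
      zero_mem' := by simpa using! hasDerivAt_const (0 : ℝ) (0 : 𝕜)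
      smul_mem' := fun c a ha => by simpa using! HasDerivAt.const_mul c ha }
  suffices hΦ : Φ = ⊤ by
    have : lam ∈ Φ := hΦ ▸ Submodule.mem_top
    exact this
  -- The functionals for which the claim holds form a subspace that contains the evaluations
  -- followed by functionals of V. These separate polynomials, so in finite dimension the subspace
  -- is the whole dual.
  rw [← Subspace.dualCoannihilator_dualAnnihilator_eq (W := Φ)]
  rw [show Φ.dualCoannihilator = ⊥ from ?_, Submodule.dualAnnihilator_bot]
  rw [eq_bot_iff]
  intro g hg
  rw [Submodule.mem_dualCoannihilator] at hg
  refine (Submodule.mem_bot 𝕜).2 (Subtype.ext (funext fun x => eq_of_dual (𝕜 := 𝕜) fun φ => ?_))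
  have := hg (φ ∘ₗ (LinearMap.proj x : (Euc m → V) →ₗ[𝕜] V) ∘ₗ (HPoly 𝕜 V m k).subtype) (h φ x)
  simpa using this

end Duality

section Separation

variable {𝕜 : Type*} [RCLike 𝕜] {m : ℕ}

theorem actBy_mem_HPoly {k : ℕ} {v : Euc m} {f : Euc m → Cl 𝕜 m} (hf : f ∈ HPoly 𝕜 (Cl 𝕜 m) m k) :
    actBy 𝕜 v f ∈ HPoly 𝕜 (Cl 𝕜 m) m k :=
  HPoly_map (HPoly_comp hf (flip v)) (conjBy 𝕜 v)

theorem hasDerivAt_dual_rotation {k : ℕ} {f : Euc m → Cl 𝕜 m} (hf : f ∈ HPoly 𝕜 (Cl 𝕜 m) m k)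
    {a b : Fin m} (h : a ≠ b) (lam : (Euc m → Cl 𝕜 m) →ₗ[𝕜] 𝕜) :
    HasDerivAt (fun θ => lam (actBy 𝕜 (EuclideanSpace.single a 1) (actBy 𝕜 (planeVec a b θ) f)))
      (lam (lieOp a b f)) 0 :=
  hasDerivAt_dual (R := fun θ => ⟨actBy 𝕜 (EuclideanSpace.single a 1) (actBy 𝕜 (planeVec a b θ) f),
    actBy_mem_HPoly (actBy_mem_HPoly hf)⟩) (L := ⟨lieOp a b f, lieOp_mem hf a b⟩)
    (fun φ x => hasDerivAt_rotation hf h φ x) (lam ∘ₗ (HPoly 𝕜 (Cl 𝕜 m) m k).subtype)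

theorem lieOp_self (a : Fin m) (f : Euc m → Cl 𝕜 m) : lieOp a a f = 0 := by
  funext x
  simp [lieOp, spin_apply, e_mul_self]

theorem norm_single (a : Fin m) : ‖(EuclideanSpace.single a 1 : Euc m)‖ = 1 := by simp

/-- The derivative of a curve in the space stays in it: every functional that vanishes on the space
vanishes along the rotation orbit of f, hence on its derivative. -/
theorem lieOp_mem_hodge {t k : ℕ} {f : Euc m → Cl 𝕜 m} (hf : f ∈ hodge 𝕜 m t k) (a b : Fin m) :
    lieOp a b f ∈ hodge 𝕜 m t k := by
  rcases eq_or_ne a b with rfl | h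
  · rw [lieOp_self]
    exact Submodule.zero_mem _
  by_contra hc
  obtain ⟨lam, h1, h2⟩ := Submodule.exists_dual_map_eq_bot_of_notMem hc inferInstance
  have h3 := hasDerivAt_dual_rotation (mem_hodge_iff.1 hf).1 h lam
  have h4 : ∀ g ∈ hodge 𝕜 m t k, lam g = 0 := fun g hg => by
    have : lam g ∈ (hodge 𝕜 m t k).map lam := ⟨g, hg, rfl⟩
    rwa [h2, Submodule.mem_bot] at this
  have h5 : (fun θ => lam (actBy 𝕜 (EuclideanSpace.single a 1) (actBy 𝕜 (planeVec a b θ) f))) =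
      fun _ => 0 :=
    funext fun θ => h4 _ (actBy_mem_hodge (norm_single a) (actBy_mem_hodge (planeVec_norm h θ) hf))
  rw [h5] at h3
  exact h1 (h3.unique (hasDerivAt_const _ _))

variable {t k t' k' : ℕ} {ε : ℝ} {Ψ : (Euc m → Cl 𝕜 m) →ₗ[𝕜] (Euc m → Cl 𝕜 m)}

theorem map_real_smul {V W : Type*} [AddCommGroup V] [Module 𝕜 V] [Module ℝ V] [IsScalarTower ℝ 𝕜 V]
    [AddCommGroup W] [Module 𝕜 W] [Module ℝ W] [IsScalarTower ℝ 𝕜 W] (L : V →ₗ[𝕜] W) (c : ℝ) (v : V) :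
    L (c • v) = c • L v := by
  rw [← algebraMap_smul 𝕜 c v, map_smul, algebraMap_smul]

/-- A rotation is a product of two unit vectors, so the sign ε enters squared and disappears. -/
theorem intertwine_lieOp (hε : ε * ε = 1) (hmap : ∀ f ∈ hodge 𝕜 m t k, Ψ f ∈ hodge 𝕜 m t' k')
    (hcomm : ∀ v : Euc m, ‖v‖ = 1 → ∀ f ∈ hodge 𝕜 m t k, Ψ (actBy 𝕜 v f) = ε • actBy 𝕜 v (Ψ f))
    {f : Euc m → Cl 𝕜 m} (hf : f ∈ hodge 𝕜 m t k) (a b : Fin m) :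
    Ψ (lieOp a b f) = lieOp a b (Ψ f) := by
  rcases eq_or_ne a b with rfl | h
  · rw [lieOp_self, lieOp_self, map_zero]
  funext x
  refine eq_of_dual (𝕜 := 𝕜) fun φ => ?_
  have h1 := hasDerivAt_dual_rotation (mem_hodge_iff.1 hf).1 h
    (φ ∘ₗ (LinearMap.proj x : (Euc m → Cl 𝕜 m) →ₗ[𝕜] Cl 𝕜 m) ∘ₗ Ψ)
  have h2 := hasDerivAt_rotation (mem_hodge_iff.1 (hmap f hf)).1 h φ x
  refine HasDerivAt.unique h1 (h2.congr_of_eventuallyEq (Filter.Eventually.of_forall fun θ => ?_))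
  have h3 : Ψ (actBy 𝕜 (EuclideanSpace.single a 1) (actBy 𝕜 (planeVec a b θ) f)) =
      actBy 𝕜 (EuclideanSpace.single a 1) (actBy 𝕜 (planeVec a b θ) (Ψ f)) := by
    rw [hcomm _ (norm_single a) _ (actBy_mem_hodge (planeVec_norm h θ) hf),
      hcomm _ (planeVec_norm h θ) _ hf, map_real_smul, smul_smul, hε, one_smul]
  simp only [LinearMap.comp_apply, LinearMap.proj_apply, h3]

theorem eq_zero_of_casimir_ne (hε : ε * ε = 1)
    (hmap : ∀ f ∈ hodge 𝕜 m t k, Ψ f ∈ hodge 𝕜 m t' k')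
    (hcomm : ∀ v : Euc m, ‖v‖ = 1 → ∀ f ∈ hodge 𝕜 m t k, Ψ (actBy 𝕜 v f) = ε • actBy 𝕜 v (Ψ f))
    (hne : ((k : ℝ) + t) * (k + m - t) ≠ (k' + t') * (k' + m - t'))
    {f : Euc m → Cl 𝕜 m} (hf : f ∈ hodge 𝕜 m t k) : Ψ f = 0 := by
  have h1 : ∑ a, ∑ b, lieOp a b (lieOp a b f) = (-(8 * (k + t) * (k + m - t)) : ℝ) • f := by
    funext x
    simp only [Finset.sum_apply, Pi.smul_apply, casimir hf]
  have h2 : ∑ a, ∑ b, lieOp a b (lieOp a b (Ψ f)) = (-(8 * (k' + t') * (k' + m - t')) : ℝ) • Ψ f := by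
    funext x
    simp only [Finset.sum_apply, Pi.smul_apply, casimir (hmap f hf)]
  have h3 := congrArg Ψ h1
  simp only [map_sum, intertwine_lieOp hε hmap hcomm (lieOp_mem_hodge hf _ _),
    intertwine_lieOp hε hmap hcomm hf, map_real_smul] at h3
  rw [h2, ← sub_eq_zero, ← sub_smul] at h3
  refine (smul_eq_zero.1 h3).resolve_left fun h => hne ?_
  linarith

/-- The action of a product of basis vectors. -/
def actList (l : List (Fin m)) (f : Euc m → Cl 𝕜 m) : Euc m → Cl 𝕜 m :=
  l.foldr (fun i g => actBy 𝕜 (EuclideanSpace.single i 1) g) f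

theorem conjBy_single_eL (a : Fin m) (L : List (Fin m)) :
    conjBy 𝕜 (EuclideanSpace.single a 1) (eL 𝕜 L) = (-1 : ℝ) ^ (L.length + L.count a) • eL 𝕜 L := by
  induction L with
  | nil => simp [eL_nil, conjBy_one (norm_single a)]
  | cons i L ih =>
    rw [eL_cons, conjBy_mul (norm_single a), ih, e, conjBy_vec (norm_single a), List.length_cons,
      List.count_cons]
    rcases eq_or_ne i a with rfl | h
    · have : flip (EuclideanSpace.single i (1 : ℝ)) (EuclideanSpace.single i 1) =
          EuclideanSpace.single i 1 := by
        rw [flip_apply]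
        simp
        module
      rw [this, mul_smul_comm]
      simp only [beq_self_eq_true, if_true]
      rw [show L.length + 1 + (L.count i + 1) = L.length + L.count i + 2 by ring,
        pow_add _ (L.length + L.count i), neg_one_sq, mul_one]
    · have : flip (EuclideanSpace.single a (1 : ℝ)) (EuclideanSpace.single i 1) =
          -EuclideanSpace.single i 1 := by
        rw [flip_apply]
        simp [h, EuclideanSpace.inner_single_left]
      rw [this, vec_neg, mul_smul_comm]
      simp only [beq_iff_eq, h, if_false, add_zero]
      rw [show L.length + 1 + L.count a = L.length + L.count a + 1 by ring, pow_succ]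
      simp

theorem flip_single (a i : Fin m) (x : Euc m) : flip (EuclideanSpace.single a (1 : ℝ)) x i =
    (-1) ^ (1 + if a = i then 1 else 0) * x i := by
  rcases eq_or_ne a i with rfl | h
  · simp [flip_apply, EuclideanSpace.inner_single_left]
    ring
  · simp [flip_apply, h, h.symm]

/-- Coordinatewise sign changes. -/
def signMap (c : Fin m → ℝ) (x : Euc m) : Euc m := WithLp.toLp 2 fun i => c i * x i

theorem actList_apply (l : List (Fin m)) (f : Euc m → Cl 𝕜 m) (x : Euc m) :
    actList l f x = l.foldr (fun i y => conjBy 𝕜 (EuclideanSpace.single i 1) y)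
      (f (signMap (fun i => (-1) ^ (l.length + l.count i)) x)) := by
  induction l generalizing x with
  | nil => simp [actList, signMap]
  | cons a l ih =>
    change actBy 𝕜 (EuclideanSpace.single a 1) (actList l f) x = _
    have : signMap (fun i => (-1) ^ (l.length + l.count i)) (flip (EuclideanSpace.single a 1) x) =
        signMap (fun i => (-1) ^ ((a :: l).length + (a :: l).count i)) x := by
      ext i
      simp only [signMap, flip_single, List.length_cons, List.count_cons, beq_iff_eq]
      rw [← mul_assoc, ← pow_add]
      congr 2
      ring
    rw [actBy_apply, ih, List.foldr_cons, this]

theorem foldr_conjBy_eL (l L : List (Fin m)) :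
    l.foldr (fun i y => conjBy 𝕜 (EuclideanSpace.single i 1) y) (eL 𝕜 L) =
      (-1 : ℝ) ^ (l.map fun a => L.length + L.count a).sum • eL 𝕜 L := by
  induction l with
  | nil => simp
  | cons a l ih =>
    rw [List.foldr_cons, ih, conjBy_smul, conjBy_single_eL, List.map_cons, List.sum_cons, smul_smul,
      ← pow_add, add_comm]

theorem foldr_conjBy_linear (l : List (Fin m)) : ∃ T : Cl 𝕜 m →ₗ[𝕜] Cl 𝕜 m, ∀ y,
    T y = l.foldr (fun i y => conjBy 𝕜 (EuclideanSpace.single i 1) y) y := by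
  induction l with
  | nil => exact ⟨LinearMap.id, fun y => rfl⟩
  | cons a l ih =>
    obtain ⟨T, hT⟩ := ih
    exact ⟨conjBy 𝕜 (EuclideanSpace.single a 1) ∘ₗ T, fun y => by
      rw [LinearMap.comp_apply, hT, List.foldr_cons]⟩

/-- In odd dimension the pseudoscalar acts trivially. -/
theorem actList_finRange (hm : Odd m) (f : Euc m → Cl 𝕜 m) : actList (List.finRange m) f = f := by
  have hcount : ∀ i : Fin m, (List.finRange m).count i = 1 := fun i =>
    List.count_eq_one_of_mem (List.nodup_finRange m) (List.mem_finRange i)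
  funext x
  have h1 : signMap (fun i => (-1) ^ ((List.finRange m).length + (List.finRange m).count i)) x = x := by
    ext i
    simp only [signMap, hcount, List.length_finRange]
    rw [pow_succ, hm.neg_one_pow]
    norm_num
  rw [actList_apply, h1]
  generalize f x = y
  obtain ⟨T, hT⟩ := foldr_conjBy_linear (𝕜 := 𝕜) (List.finRange m)
  rw [← hT]
  induction y using Cl_induction with
  | hL L hL =>
    rw [hT, foldr_conjBy_eL]
    -- The exponent is (m + 1) times the length of L, hence even for odd m.
    have : ((List.finRange m).map fun a => L.length + L.count a).sum = m * L.length + L.length := by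
      rw [← List.ofFn_eq_map, List.sum_ofFn, Finset.sum_add_distrib]
      congr 1
      · simp
      · have := Multiset.sum_count_eq_card (s := Finset.univ) (m := (L : Multiset (Fin m)))
          (fun a _ => Finset.mem_univ a)
        simpa using this
    rw [this, ← Nat.succ_mul, mul_comm, pow_mul, ← pow_mul, mul_comm, pow_mul,
      Even.neg_one_pow (by simpa using hm.add_one), one_pow, one_smul]
  | h0 => rw [map_zero]
  | hadd a b ha hb => rw [map_add, ha, hb]
  | hsmul c a ha => rw [map_smul, ha]

/-- The product of all m basis vectors acts as the identity, yet Ψ commutes with it up to (-1)^m =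
-1; hence Ψ f = -Ψ f. -/
theorem eq_zero_of_odd (hm : Odd m) (hmap : ∀ f ∈ hodge 𝕜 m t k, Ψ f ∈ hodge 𝕜 m t' k')
    (hcomm : ∀ v : Euc m, ‖v‖ = 1 → ∀ f ∈ hodge 𝕜 m t k, Ψ (actBy 𝕜 v f) = -actBy 𝕜 v (Ψ f))
    {f : Euc m → Cl 𝕜 m} (hf : f ∈ hodge 𝕜 m t k) : Ψ f = 0 := by
  have key : ∀ l : List (Fin m), actList l f ∈ hodge 𝕜 m t k ∧
      Ψ (actList l f) = (-1 : ℝ) ^ l.length • actList l (Ψ f) := by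
    intro l
    induction l with
    | nil => exact ⟨hf, by simp [actList]⟩
    | cons a l ih =>
      refine ⟨actBy_mem_hodge (norm_single a) ih.1, ?_⟩
      change Ψ (actBy 𝕜 (EuclideanSpace.single a 1) (actList l f)) =
        _ • actBy 𝕜 (EuclideanSpace.single a 1) (actList l (Ψ f))
      rw [hcomm _ (norm_single a) _ ih.1, ih.2, map_real_smul, List.length_cons, pow_succ]
      module
  have h1 := (key (List.finRange m)).2
  rw [actList_finRange hm, actList_finRange hm, List.length_finRange, hm.neg_one_pow,
    neg_one_smul] at h1
  have h2 : (2 : ℝ) • Ψ f = 0 := by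
    rw [two_smul]
    nth_rewrite 1 [h1]
    exact neg_add_cancel _
  exact (smul_eq_zero.1 h2).resolve_left (by norm_num)

/-- Different pieces have no common constituents. -/
theorem intertwiner_eq_zero {n s K j j' : ℕ} {Ψ : (Euc n → Cl 𝕜 n) →ₗ[𝕜] (Euc n → Cl 𝕜 n)}
    (hp : (t, j) ∈ indexSet n s K) (hq : (t', j') ∈ indexSet n s K) (hne : (t, j) ≠ (t', j'))
    (hmap : ∀ f ∈ hodge 𝕜 n t j, Ψ f ∈ hodge 𝕜 n t' j')
    (hcomm : ∀ v : Euc n, ‖v‖ = 1 → ∀ f ∈ hodge 𝕜 n t j, Ψ (actBy 𝕜 v f) =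
      ((-1 : ℝ) ^ (K + j + (s - t)) * (-1) ^ (K + j' + (s - t'))) • actBy 𝕜 v (Ψ f))
    {f : Euc n → Cl 𝕜 n} (hf : f ∈ hodge 𝕜 n t j) : Ψ f = 0 := by
  obtain ⟨p1, p2, p3, p4⟩ := hp
  obtain ⟨q1, q2, q3, q4⟩ := hq
  simp only at p1 p2 p3 p4 q1 q2 q3 q4
  by_cases hc : ((j : ℝ) + t) * (j + n - t) = (j' + t') * (j' + n - t')
  swap
  · refine eq_zero_of_casimir_ne ?_ hmap hcomm hc hf
    rw [mul_mul_mul_comm, ← mul_pow, ← mul_pow]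
    norm_num
  have hc' : ((j : ℤ) + t) * (j + n - t) = (j' + t') * (j' + n - t') := by exact_mod_cast hc
  have hjj : j = j' := by
    by_contra hj
    -- Equality of the Casimir values, rearranged. As t and t' are equal or consecutive, the right
    -- side has absolute value at most n, while for j ≠ j' the left side has absolute value at least
    -- j + j' + n > n.
    have h1 : ((j : ℤ) - j') * (j + j' + n) = (t' - t) * (n - t - t') := by linear_combination hc'
    have h2 : ((t' : ℤ) - t) * (n - t - t') ≤ n - 1 + (if t = t' then 1 else 0) ∧
        -(n - 1 + (if t = t' then 1 else 0)) ≤ ((t' : ℤ) - t) * (n - t - t') := by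
      have : t' = t ∨ t' = t + 1 ∨ t = t' + 1 := by omega
      rcases this with rfl | rfl | rfl
      · simp
      · rw [if_neg (by omega)]
        push_cast
        constructor <;> linarith
      · rw [if_neg (by omega)]
        push_cast
        constructor <;> linarith
    have h3 : (if t = t' then (1 : ℤ) else 0) ≤ 1 := by split_ifs <;> omega
    rcases lt_or_gt_of_ne hj with h | h
    · have : ((j : ℤ) - j') * (j + j' + n) ≤ (-1) * (j + j' + n) :=
        mul_le_mul_of_nonneg_right (by omega) (by omega)
      omega
    · have : 1 * ((j : ℤ) + j' + n) ≤ ((j : ℤ) - j') * (j + j' + n) :=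
        mul_le_mul_of_nonneg_right (by omega) (by omega)
      omega
  subst hjj
  have htt : t ≠ t' := fun h => hne (by rw [h])
  -- With j = j' and t ≠ t' only this coincidence is left; t and t' are consecutive, so n is odd and
  -- the two equivariance signs have product -1.
  have hsum : n = t + t' := by
    have : ((t : ℤ) - t') * (n - t - t') = 0 := by linear_combination hc'
    rcases mul_eq_zero.1 this with h | h
    · omega
    · omega
  refine eq_zero_of_odd (by rw [Nat.odd_iff]; omega) hmap (fun v hv f hf => ?_) hf
  have h1 : (-1 : ℝ) ^ (K + j + (s - t)) * (-1) ^ (K + j + (s - t')) = -1 := by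
    rw [← pow_add]
    refine Odd.neg_one_pow ?_
    rw [Nat.odd_iff]
    omega
  rw [hcomm v hv f hf, h1, neg_one_smul]

end Separation

/-! ### Equivariant orthogonal projections -/

section Projection

variable {𝕜 : Type*} [RCLike 𝕜] {E : Type*} [AddCommGroup E] [Module 𝕜 E]

theorem exists_orthogonal [Module.Finite 𝕜 E] (c : InnerProductSpace.Core 𝕜 E)
    (U : Submodule 𝕜 E) :
    ∃ O : Submodule 𝕜 E, IsCompl U O ∧ ∀ g, g ∈ O ↔ ∀ u ∈ U, c.inner u g = 0 := by
  letI : NormedAddCommGroup E := c.toNormedAddCommGroup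
  letI : InnerProductSpace 𝕜 E := InnerProductSpace.ofCore c.toCore
  exact ⟨Uᗮ, Submodule.isCompl_orthogonal U, fun g => Submodule.mem_orthogonal U g⟩

/-- The equivariant orthogonal projection onto an invariant subspace. -/
theorem exists_projection {ι : Type*} {H U : Submodule 𝕜 E} [Module.Finite 𝕜 H]
    (c : InnerProductSpace.Core 𝕜 H) (A : ι → E →ₗ[𝕜] E) (hA : ∀ i, ∀ f ∈ H, A i f ∈ H)
    (hAA : ∀ i f, A i (A i f) = f)
    (hc : ∀ i (f g : H), c.inner ⟨A i f, hA i f f.2⟩ ⟨A i g, hA i g g.2⟩ = c.inner f g)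
    (hUH : U ≤ H) (hU : ∀ i, ∀ f ∈ U, A i f ∈ U) :
    ∃ T : E →ₗ[𝕜] E, (∀ f ∈ H, T f ∈ U) ∧ (∀ f ∈ U, T f = f) ∧
      (∀ i, ∀ f ∈ H, T (A i f) = A i (T f)) ∧
      ∀ f : H, T f = 0 → ∀ u : H, u.1 ∈ U → c.inner u f = 0 := by
  obtain ⟨O, hO, hmem⟩ := exists_orthogonal c (U.comap H.subtype)
  -- The extension from H to the ambient space is arbitrary; only the behaviour on H is used.
  obtain ⟨T, hT⟩ := LinearMap.exists_extend (H.subtype ∘ₗ Submodule.projection _ _ hO)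
  have hT' : ∀ f : H, T f = (Submodule.projection _ _ hO f : H) := fun f => LinearMap.congr_fun hT f
  have hsplit : ∀ f : H, ∃ u ∈ U.comap H.subtype, ∃ o ∈ O, f = u + o := fun f => by
    obtain ⟨u, hu, o, ho, h⟩ := Submodule.mem_sup.1 (hO.sup_eq_top ▸ Submodule.mem_top : f ∈ _ ⊔ O)
    exact ⟨u, hu, o, ho, h.symm⟩
  have hval : ∀ u ∈ U.comap H.subtype, ∀ o ∈ O, T ((u + o : H) : E) = u := fun u hu o ho => by
    rw [hT', map_add, Submodule.projection_apply_of_mem_left hO hu,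
      (Submodule.projection_apply_eq_zero_iff hO).2 ho,
      add_zero]
  refine ⟨T, fun f hf => ?_, fun f hf => ?_, fun i f hf => ?_, fun f hf u hu => ?_⟩
  · obtain ⟨u, hu, o, ho, h⟩ := hsplit ⟨f, hf⟩
    have := hval u hu o ho
    rw [← h] at this
    rw [this]
    exact hu
  · have := hval ⟨f, hUH hf⟩ hf 0 (Submodule.zero_mem _)
    rwa [add_zero] at this
  · obtain ⟨u, hu, o, ho, h⟩ := hsplit ⟨f, hf⟩
    have h1 := hval u hu o ho
    rw [← h] at h1
    have h2 := hval ⟨A i u, hA i u u.2⟩ (hU i u hu) ⟨A i o, hA i o o.2⟩ ((hmem _).2 fun u' hu' => by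
      -- An isometric involution satisfies ⟨u', A o⟩ = ⟨A u', o⟩, so the orthogonal complement is
      -- invariant together with U.
      have h3 := hc i ⟨A i u', hA i u' u'.2⟩ o
      simp only [hAA] at h3
      rw [h3]
      exact (hmem o).1 ho _ (hU i u' hu'))
    have h4 : f = u + o := congrArg Subtype.val h
    rw [h1, h4, map_add]
    exact h2
  · obtain ⟨u', hu', o, ho, h⟩ := hsplit f
    have h1 := hval u' hu' o ho
    rw [← h, hf] at h1
    have h2 : u' = 0 := Subtype.ext h1.symm
    rw [h, h2, zero_add]
    exact (hmem o).1 ho u hu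

end Projection

/-! ### The L²-inner product over the ball -/

section L2

open MeasureTheory

variable {𝕜 : Type*} [RCLike 𝕜] {m : ℕ}

theorem continuous_apply_HPoly {V : Type*} [AddCommGroup V] [Module 𝕜 V] [Module ℝ V]
    [IsScalarTower ℝ 𝕜 V] {k : ℕ} {f : Euc m → V} (hf : f ∈ HPoly 𝕜 V m k) (φ : V →ₗ[𝕜] 𝕜) :
    Continuous fun x => φ (f x) := by
  induction hf using Submodule.span_induction with
  | mem f h =>
    obtain ⟨p, c, -, rfl⟩ := h
    simp only [map_real_smul]
    have : Continuous fun x : Euc m => MvPolynomial.eval (fun i => x i) p :=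
      (MvPolynomial.continuous_eval p).comp (by fun_prop)
    exact this.smul continuous_const
  | zero => simpa using! continuous_const
  | add f g _ _ hf hg => simpa using! hf.add hg
  | smul c f _ hf => simpa using! hf.const_mul c

/-- The coefficient of `e_I`. -/
def coefCl (I : Finset (Fin m)) : Cl 𝕜 m →ₗ[𝕜] 𝕜 where
  toFun a := scalarPart 𝕜 m (cliffConj 𝕜 m (eF 𝕜 I) * a)
  map_add' a b := by rw [mul_add, map_add]
  map_smul' c a := by rw [mul_smul_comm, scalarPart_smul]; rfl

theorem eq_sum_coefCl (a : Cl 𝕜 m) : a = ∑ I, coefCl I a • eF 𝕜 I := by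
  obtain ⟨c, hc⟩ := exists_eq_sum_eF a
  have : ∀ I, coefCl I a = c I := fun I => by
    rw [hc, map_sum]
    simp only [map_smul]
    simp only [coefCl, LinearMap.coe_mk, AddHom.coe_mk, scalarPart_cliffConj_eF]
    simp
  simp only [this]
  exact hc

theorem scalarPart_cliffConj_eq_sum (a b : Cl 𝕜 m) : scalarPart 𝕜 m (cliffConj 𝕜 m a * b) =
    ∑ I, (starRingEnd 𝕜 (coefCl I a)) * coefCl I b := by
  conv_lhs => rw [eq_sum_coefCl a, eq_sum_coefCl b]
  exact scalarPart_cliffConj_sum _ _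

theorem continuous_scalarPart {k k' : ℕ} {f g : Euc m → Cl 𝕜 m} (hf : f ∈ HPoly 𝕜 (Cl 𝕜 m) m k)
    (hg : g ∈ HPoly 𝕜 (Cl 𝕜 m) m k') :
    Continuous fun x => scalarPart 𝕜 m (cliffConj 𝕜 m (f x) * g x) := by
  simp only [scalarPart_cliffConj_eq_sum]
  exact continuous_finsetSum _ fun I _ => (RCLike.continuous_conj.comp
    (continuous_apply_HPoly hf _)).mul (continuous_apply_HPoly hg _)

theorem integrableOn_scalarPart {k k' : ℕ} {f g : Euc m → Cl 𝕜 m}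
    (hf : f ∈ HPoly 𝕜 (Cl 𝕜 m) m k) (hg : g ∈ HPoly 𝕜 (Cl 𝕜 m) m k') :
    IntegrableOn (fun x => scalarPart 𝕜 m (cliffConj 𝕜 m (f x) * g x))
      (Metric.ball (0 : Euc m) 1) :=
  ((continuous_scalarPart hf hg).continuousOn.integrableOn_compact
    (isCompact_closedBall (0 : Euc m) 1)).mono_set Metric.ball_subset_closedBall

theorem scalarPart_conjBy {v : Euc m} (hv : ‖v‖ = 1) (a b : Cl 𝕜 m) :
    scalarPart 𝕜 m (cliffConj 𝕜 m (conjBy 𝕜 v a) * conjBy 𝕜 v b) =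
      scalarPart 𝕜 m (cliffConj 𝕜 m a * b) := by
  have h1 : ∀ y : Cl 𝕜 m, vec 𝕜 v * (vec 𝕜 v * y) = -y := fun y => by
    rw [vec_mul_vec_mul_self, hv]; simp
  have h2 : vec 𝕜 v * vec 𝕜 v = (-1 : Cl 𝕜 m) := by
    have := h1 1
    rwa [mul_one] at this
  rw [conjBy_apply, conjBy_apply, map_neg, cliffConj_mul, cliffConj_mul, cliffConj_vec, neg_mul_neg,
    mul_assoc, mul_assoc, neg_mul (vec 𝕜 v), neg_mul (vec 𝕜 v), h1, neg_neg, map_neg,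
    scalarPart_vec_mul, mul_assoc, mul_assoc, h2, mul_neg, mul_neg, mul_one, map_neg, neg_neg]

/-- The reflection `flip v` as an isometry. -/
def flipIso {v : Euc m} (hv : ‖v‖ = 1) : Euc m ≃ₗᵢ[ℝ] Euc m where
  toLinearEquiv := LinearEquiv.ofInvolutive (flip v) (flip_flip hv)
  norm_map' := norm_flip hv

theorem l2Inner_actBy {v : Euc m} (hv : ‖v‖ = 1) (f g : Euc m → Cl 𝕜 m) :
    l2Inner 𝕜 (actBy 𝕜 v f) (actBy 𝕜 v g) = l2Inner 𝕜 f g := by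
  have h1 := (flipIso hv).measurePreserving.setIntegral_preimage_emb
    (flipIso hv).toHomeomorph.measurableEmbedding
    (fun x => scalarPart 𝕜 m (cliffConj 𝕜 m (f x) * g x)) (Metric.ball 0 1)
  have h2 : (flipIso hv) ⁻¹' Metric.ball 0 1 = Metric.ball (0 : Euc m) 1 := by
    rw [LinearIsometryEquiv.preimage_ball, map_zero]
  rw [h2] at h1
  simp only [l2Inner, actBy_apply, scalarPart_conjBy hv]
  exact h1

/-- A continuous nonnegative function with integral zero over the ball vanishes there; homogeneity
carries f = 0 from the ball to all points. -/
theorem eq_zero_of_l2Inner {k : ℕ} {f : Euc m → Cl 𝕜 m} (hf : f ∈ HPoly 𝕜 (Cl 𝕜 m) m k)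
    (h : l2Inner 𝕜 f f = 0) : f = 0 := by
  choose r hr0 hr1 hr2 using fun x => scalarPart_cliffConj_self (f x)
  have hc : Continuous r := by
    have : r = fun x => RCLike.re (scalarPart 𝕜 m (cliffConj 𝕜 m (f x) * f x)) := by
      funext x
      rw [hr1, RCLike.ofReal_re]
    rw [this]
    exact RCLike.continuous_re.comp (continuous_scalarPart hf hf)
  have hi : IntegrableOn r (Metric.ball (0 : Euc m) 1) :=
    (hc.continuousOn.integrableOn_compact (isCompact_closedBall (0 : Euc m) 1)).mono_set
      Metric.ball_subset_closedBall
  have h0 : ∫ x in Metric.ball (0 : Euc m) 1, r x = 0 := by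
    simp only [l2Inner, hr1, integral_ofReal] at h
    exact_mod_cast h
  rw [setIntegral_eq_zero_iff_of_nonneg_ae (Filter.Eventually.of_forall hr0) hi] at h0
  have h1 := Measure.eqOn_open_of_ae_eq h0 Metric.isOpen_ball hc.continuousOn continuousOn_const
  funext x
  have hx : (‖x‖ + 1)⁻¹ • x ∈ Metric.ball (0 : Euc m) 1 := by
    rw [mem_ball_zero_iff, norm_smul, norm_inv, Real.norm_of_nonneg (by positivity),
      inv_mul_lt_iff₀ (by positivity)]
    linarith
  have h2 := hr2 _ (h1 hx)
  rw [HPoly_homogeneous hf] at h2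
  exact (smul_eq_zero.1 h2).resolve_left (by positivity)

theorem l2Inner_conj_symm (f g : Euc m → Cl 𝕜 m) :
    starRingEnd 𝕜 (l2Inner 𝕜 g f) = l2Inner 𝕜 f g := by
  simp only [l2Inner, ← integral_conj, scalarPart_cliffConj_symm]

/-- The `L²`-inner product on a space of homogeneous polynomials. -/
def l2Core {k : ℕ} {H : Submodule 𝕜 (Euc m → Cl 𝕜 m)} (hH : H ≤ HPoly 𝕜 (Cl 𝕜 m) m k) :
    InnerProductSpace.Core 𝕜 H where
  inner f g := l2Inner 𝕜 f.1 g.1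
  conj_inner_symm f g := l2Inner_conj_symm _ _
  re_inner_nonneg f := by
    choose r hr0 hr1 hr2 using fun x => scalarPart_cliffConj_self (f.1 x)
    simp only [l2Inner, hr1, integral_ofReal, RCLike.ofReal_re]
    exact integral_nonneg hr0
  add_left f g h := by
    simp only [l2Inner, Submodule.coe_add, Pi.add_apply, map_add, add_mul]
    exact integral_add (integrableOn_scalarPart (hH f.2) (hH h.2))
      (integrableOn_scalarPart (hH g.2) (hH h.2))
  smul_left f g c := by
    simp only [l2Inner, Submodule.coe_smul, Pi.smul_apply, cliffConj_smul, smul_mul_assoc,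
      scalarPart_smul]
    exact integral_const_mul _ _
  definite f h := Subtype.ext (eq_zero_of_l2Inner (hH f.2) h)

end L2

/-! ### Recovering an equivariant operator from values at the pole -/

section Pole

variable {𝕜 : Type*} [RCLike 𝕜] {m n : ℕ}

theorem HPoly_eq_zero_of_ne {V : Type*} [AddCommGroup V] [Module 𝕜 V] [Module ℝ V]
    [IsScalarTower ℝ 𝕜 V] {k : ℕ} {f : Euc (n + 1) → V} (hf : f ∈ HPoly 𝕜 V (n + 1) k)
    (h : ∀ x, x ≠ 0 → f x = 0) : f = 0 := by
  funext x
  rcases eq_or_ne x 0 with rfl | hx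
  · have h1 := HPoly_homogeneous hf 0 (EuclideanSpace.single (Fin.last n) 1)
    rwa [zero_smul, h (EuclideanSpace.single (Fin.last n) 1) (by simp), smul_zero] at h1
  · exact h x hx

/-- The map x ↦ -v x v is the half-turn about the line of v, so v is the normalized bisector of x
and y; it exists unless they are antipodal. -/
theorem exists_flip {x y : Euc m} (hx : ‖x‖ = 1) (hy : ‖y‖ = 1) (h : x + y ≠ 0) :
    ∃ v : Euc m, ‖v‖ = 1 ∧ flip v x = y := by
  have hn : ‖x + y‖ ≠ 0 := norm_ne_zero_iff.2 h
  refine ⟨‖x + y‖⁻¹ • (x + y), by rw [norm_smul, norm_inv, norm_norm, inv_mul_cancel₀ hn], ?_⟩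
  have h1 : inner ℝ (x + y) x = ‖x + y‖ ^ 2 / 2 := by
    rw [norm_add_sq_real, inner_add_left, real_inner_self_eq_norm_sq, real_inner_comm, hx, hy]
    ring
  rw [flip_apply, real_inner_smul_left, h1, smul_smul]
  have : 2 * (‖x + y‖⁻¹ * (‖x + y‖ ^ 2 / 2)) * ‖x + y‖⁻¹ = 1 := by field_simp
  rw [this, one_smul, add_sub_cancel_left]

/-- Expresses the normal part at the pole by outer and inner products with the pole vector, a form
which makes sense at every point and is equivariant. -/
theorem sub_tangential (a : Cl 𝕜 (n + 1)) : a - tangential 𝕜 n a =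
    -wedge 𝕜 (EuclideanSpace.single (Fin.last n) 1)
      (bullet 𝕜 (EuclideanSpace.single (Fin.last n) 1) a) := by
  simp only [wedge, bullet, tangential, LinearMap.coe_mk, AddHom.coe_mk, gradeInv_smul, map_sub,
    map_mul, gradeInv_gradeInv, gradeInv_vec, ← e.eq_1, gradeInv_e, mul_sub, sub_mul, mul_smul_comm,
    smul_mul_assoc, e_mul_e_mul_self, neg_mul, mul_neg, mul_assoc, e_mul_self, mul_one]
  module

theorem wedge_bullet_smul (c : ℝ) (x : Euc m) (a : Cl 𝕜 m) :
    wedge 𝕜 (c • x) (bullet 𝕜 (c • x) a) = c ^ 2 • wedge 𝕜 x (bullet 𝕜 x a) := by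
  simp only [wedge, bullet, vec_smul, gradeInv_smul, map_sub, map_mul, smul_mul_assoc,
    mul_smul_comm, smul_sub, smul_add, mul_sub, sub_mul, gradeInv_vec]
  module

theorem real_smul_wedge (c : ℝ) (x : Euc m) (a : Cl 𝕜 m) :
    wedge 𝕜 x (c • a) = c • wedge 𝕜 x a := map_real_smul (wedgeₗ 𝕜 x) c a

theorem real_smul_bullet (c : ℝ) (x : Euc m) (a : Cl 𝕜 m) :
    bullet 𝕜 x (c • a) = c • bullet 𝕜 x a := map_real_smul (bulletₗ 𝕜 x) c a

theorem dirac_norm_sq_smul {k : ℕ} {g : Euc m → Cl 𝕜 m} (hg : g ∈ HPoly 𝕜 (Cl 𝕜 m) m k)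
    (x : Euc m) : dirac 𝕜 (fun x => ‖x‖ ^ 2 • g x) x =
      (2 : ℝ) • (vec 𝕜 x * g x) + ‖x‖ ^ 2 • dirac 𝕜 g x := by
  have h1 : ∀ i, HasPd 𝕜 i (fun x => ‖x‖ ^ 2 • g x)
      (fun x => (2 * x i) • g x + ‖x‖ ^ 2 • pd 𝕜 i g x) := fun i =>
    (hasPd_pd hg i).smul fun x => by
      have h2 : HasDerivAt (fun t : ℝ => x + t • EuclideanSpace.single i (1 : ℝ))
          (EuclideanSpace.single i 1) 0 := by
        simpa using ((hasDerivAt_id (0 : ℝ)).smul_const (EuclideanSpace.single i (1 : ℝ))).const_add x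
      have h3 := h2.norm_sq
      simpa [EuclideanSpace.inner_single_right] using h3
  simp only [dirac, (h1 _).pd_eq, mul_add, Finset.sum_add_distrib, mul_smul_comm, ← Finset.smul_sum,
    mul_smul]
  congr 2
  rw [vec_eq_sum, Finset.sum_mul]
  simp only [smul_mul_assoc]

/-- If the normal part of a solution is again a solution, then the solution vanishes. -/
theorem eq_zero_of_normal_part {s k : ℕ} (hs : 1 ≤ s) (hs' : s ≤ n) {f g : Euc (n + 1) → Cl 𝕜 (n + 1)}
    (hf : f ∈ hodge 𝕜 (n + 1) s k) (hg : g ∈ hodge 𝕜 (n + 1) s k)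
    (h : ∀ x, ‖x‖ ^ 2 • g x = -wedge 𝕜 x (bullet 𝕜 x (f x))) : f = 0 := by
  obtain ⟨σ, rfl⟩ : ∃ σ, s = σ + 1 := ⟨s - 1, by omega⟩
  obtain ⟨f1, f2, f3⟩ := mem_hodge_iff.1 hf
  obtain ⟨g1, g2, g3⟩ := mem_hodge_iff.1 hg
  have hb1 := HPoly_bullet f1
  have hb2 : ∀ x, bullet 𝕜 x (f x) ∈ sVectors 𝕜 (n + 1) σ := fun x => bullet_mem x (f2 x)
  refine HPoly_eq_zero_of_ne f1 fun x hx => ?_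
  have hx' : ‖x‖ ^ 2 ≠ 0 := by positivity
  -- The Dirac derivative of |x|² g is computed twice: directly, using that g is a solution, and
  -- from its expression through f.
  have e1 : dirac 𝕜 (fun x => ‖x‖ ^ 2 • g x) x = (2 : ℝ) • (vec 𝕜 x * g x) := by
    rw [dirac_norm_sq_smul g1, g3, smul_zero, add_zero]
  have e2 : dirac 𝕜 (fun x => ‖x‖ ^ 2 • g x) x =
      -dirac 𝕜 (fun x => wedge 𝕜 x (bullet 𝕜 x (f x))) x := by
    have : (fun x => ‖x‖ ^ 2 • g x) = (-1 : ℝ) • fun x => wedge 𝕜 x (bullet 𝕜 x (f x)) := by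
      funext x
      rw [h x, Pi.smul_apply, neg_one_smul]
    rw [this, dirac_real_smul (HPoly_wedge hb1), neg_one_smul]
  rw [dirac_wedge hb1 hb2, dirac_bullet f1 f2, f3, e1] at e2
  have e3 := wedge_of_mem x (f2 x)
  set w := wedge 𝕜 x (f x) with hw
  set b := bullet 𝕜 x (f x) with hb
  have e4 : (2 : ℝ) • (vec 𝕜 x * g x) = ((n : ℝ) - σ + k + 2) • b - ((k : ℝ) + σ + 1) • w := by
    rw [e2, e3]
    simp only [mul_zero, zero_mul, smul_zero, sub_zero, neg_zero, add_zero, mul_smul_comm,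
      smul_mul_assoc, pow_succ (-1 : ℝ) σ]
    push_cast
    module
  have e5 : vec 𝕜 x * wedge 𝕜 x b = (-(‖x‖ ^ 2)) • b := by
    rw [← wedge_add_bullet, wedge_wedge, zero_add, ← bullet_wedge_add, hb, bullet_bullet]
    simp [wedge]
  -- Multiplying e4 by |x|² allows |x|² g to be replaced by -x ∧ b, and x (x ∧ b) = -|x|² b by e5.
  have e6 : (2 * ‖x‖ ^ 2) • b = ‖x‖ ^ 2 • (((n : ℝ) - σ + k + 2) • b - ((k : ℝ) + σ + 1) • w) := by
    rw [← e4, smul_comm, ← mul_smul_comm, h x, mul_neg, e5]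
    module
  have e7 : ((n : ℝ) - σ + k) • b = ((k : ℝ) + σ + 1) • w := by
    have : (‖x‖ ^ 2) • (((n : ℝ) - σ + k) • b - ((k : ℝ) + σ + 1) • w) = 0 := by
      have e8 : (‖x‖ ^ 2) • (((n : ℝ) - σ + k) • b - ((k : ℝ) + σ + 1) • w) =
        ‖x‖ ^ 2 • (((n : ℝ) - σ + k + 2) • b - ((k : ℝ) + σ + 1) • w) - (2 * ‖x‖ ^ 2) • b := by module
      rw [e8, ← e6, sub_self]
    exact sub_eq_zero.1 ((smul_eq_zero.1 this).resolve_left hx')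
  have hn1 : ((n : ℝ) - σ + k) ≠ 0 := by
    have : ((σ + 1 : ℕ) : ℝ) ≤ n := by exact_mod_cast hs'
    push_cast at this
    have : (0 : ℝ) ≤ k := by positivity
    linarith
  have hn2 : ((k : ℝ) + σ + 1) ≠ 0 := by positivity
  -- In e7, b = x • f is killed by x • and w = x ∧ f by x ∧. Applying either product to e7 therefore
  -- kills one side, and both mixed products vanish; their sum is -|x|² f.
  have e9 : bullet 𝕜 x w = 0 := by
    have := congrArg (bullet 𝕜 x) e7
    rw [real_smul_bullet, real_smul_bullet, hb, bullet_bullet, smul_zero] at this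
    exact (smul_eq_zero.1 this.symm).resolve_left hn2
  have e10 : wedge 𝕜 x b = 0 := by
    have := congrArg (wedge 𝕜 x) e7
    rw [real_smul_wedge, real_smul_wedge, hw, wedge_wedge, smul_zero] at this
    exact (smul_eq_zero.1 this).resolve_left hn1
  have e11 := bullet_wedge_add x (f x)
  rw [← hw, ← hb, e9, e10, add_zero] at e11
  exact (smul_eq_zero.1 e11.symm).resolve_left (neg_ne_zero.2 hx')

/-- An equivariant operator which acts on values at the pole by a scalar on the tangential part and
a scalar on the normal part, is a scalar. -/
theorem eq_smul_of_pole {s k : ℕ} (hs : 1 ≤ s) (hs' : s ≤ n)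
    {T : (Euc (n + 1) → Cl 𝕜 (n + 1)) →ₗ[𝕜] (Euc (n + 1) → Cl 𝕜 (n + 1))}
    (hT : ∀ f ∈ hodge 𝕜 (n + 1) s k, T f ∈ hodge 𝕜 (n + 1) s k)
    (hc : ∀ v : Euc (n + 1), ‖v‖ = 1 → ∀ f ∈ hodge 𝕜 (n + 1) s k, T (actBy 𝕜 v f) = actBy 𝕜 v (T f))
    (c₁ c₂ : 𝕜) (hp : ∀ f ∈ hodge 𝕜 (n + 1) s k, T f (EuclideanSpace.single (Fin.last n) 1) =
      c₁ • tangential 𝕜 n (f (EuclideanSpace.single (Fin.last n) 1)) +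
      c₂ • (f (EuclideanSpace.single (Fin.last n) 1) -
        tangential 𝕜 n (f (EuclideanSpace.single (Fin.last n) 1)))) :
    ∃ c : 𝕜, ∀ f ∈ hodge 𝕜 (n + 1) s k, T f = c • f := by
  set p : Euc (n + 1) := EuclideanSpace.single (Fin.last n) 1 with hpdef
  have hpn : ‖p‖ = 1 := norm_single _
  have h0 : ∀ f ∈ hodge 𝕜 (n + 1) s k, T f p =
      c₁ • f p - (c₂ - c₁) • wedge 𝕜 p (bullet 𝕜 p (f p)) := fun f hf => by
    rw [hp f hf]
    have h1 := sub_tangential (f p)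
    have h2 : tangential 𝕜 n (f p) = f p + wedge 𝕜 p (bullet 𝕜 p (f p)) := by
      rw [← sub_eq_iff_eq_add', ← neg_sub, h1, neg_neg]
    rw [h1, h2]
    module
  have h1 : ∀ f ∈ hodge 𝕜 (n + 1) s k, ∀ x, ‖x‖ = 1 → T f x =
      c₁ • f x - (c₂ - c₁) • wedge 𝕜 x (bullet 𝕜 x (f x)) := fun f hf x hx => by
    -- The antipode of the pole, which `exists_flip` does not reach, is covered by homogeneity.
    by_cases hxp : x + p = 0
    · have hx' : x = (-1 : ℝ) • p := by rw [neg_one_smul]; exact eq_neg_of_add_eq_zero_left hxp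
      rw [hx', HPoly_homogeneous (mem_hodge_iff.1 (hT f hf)).1,
        HPoly_homogeneous (mem_hodge_iff.1 hf).1, h0 f hf, wedge_bullet_smul, real_smul_bullet,
        real_smul_wedge, neg_one_sq, one_smul, smul_sub, smul_comm c₁, smul_comm (c₂ - c₁)]
    · obtain ⟨v, hv, hvx⟩ := exists_flip hx hpn hxp
      have hvp : flip v p = x := by rw [← hvx, flip_flip hv]
      have hf' := actBy_mem_hodge hv hf
      have h2 : T f = actBy 𝕜 v (T (actBy 𝕜 v f)) := by rw [hc v hv f hf, actBy_actBy hv]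
      rw [h2, actBy_apply, hvx, h0 _ hf', actBy_apply, hvp, map_sub, map_smul, map_smul,
        conjBy_wedge hv, conjBy_bullet hv, conjBy_conjBy hv, hvp]
  have h2 : ∀ f ∈ hodge 𝕜 (n + 1) s k, ∀ x, ‖x‖ ^ 2 • T f x =
      c₁ • ‖x‖ ^ 2 • f x - (c₂ - c₁) • wedge 𝕜 x (bullet 𝕜 x (f x)) := fun f hf x => by
    rcases eq_or_ne x 0 with rfl | hx
    · simp [wedge, vec_zero]
    · have hxn : ‖x‖ ≠ 0 := norm_ne_zero_iff.2 hx
      obtain ⟨y, hyn, hxy⟩ : ∃ y : Euc (n + 1), ‖y‖ = 1 ∧ x = ‖x‖ • y :=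
        ⟨‖x‖⁻¹ • x, by rw [norm_smul, norm_inv, norm_norm, inv_mul_cancel₀ hxn],
          by rw [smul_smul, mul_inv_cancel₀ hxn, one_smul]⟩
      generalize ‖x‖ = r at hxy
      rw [hxy, HPoly_homogeneous (mem_hodge_iff.1 (hT f hf)).1,
        HPoly_homogeneous (mem_hodge_iff.1 hf).1, h1 f hf y hyn, wedge_bullet_smul, real_smul_bullet,
        real_smul_wedge, smul_sub, smul_sub, smul_comm c₁, smul_comm c₁, smul_comm (c₂ - c₁),
        smul_comm (c₂ - c₁)]
  -- If c₁ = c₂, then T = c₁. Otherwise (c₂ - c₁)⁻¹ (T f - c₁ f) is a solution equal on the sphere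
  -- to the normal part of f, so f = 0 and any scalar will do.
  by_cases hcc : c₂ = c₁
  · refine ⟨c₁, fun f hf => ?_⟩
    rw [← sub_eq_zero]
    refine HPoly_eq_zero_of_ne (Submodule.sub_mem _ (mem_hodge_iff.1 (hT f hf)).1
      (Submodule.smul_mem _ c₁ (mem_hodge_iff.1 hf).1)) fun x hx => ?_
    have h3 := h2 f hf x
    rw [hcc, sub_self, zero_smul, sub_zero, smul_comm, ← sub_eq_zero, ← smul_sub] at h3
    exact (smul_eq_zero.1 h3).resolve_left (by positivity)
  · refine ⟨0, fun f hf => ?_⟩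
    have : f = 0 := eq_zero_of_normal_part hs hs' hf
      (Submodule.smul_mem _ (c₂ - c₁)⁻¹ (Submodule.sub_mem _ (hT f hf) (Submodule.smul_mem _ c₁ hf)))
      fun x => by
        rw [Pi.smul_apply, Pi.sub_apply, Pi.smul_apply, smul_comm, smul_sub, h2 f hf x, smul_comm c₁,
          sub_sub_cancel_left, smul_neg, smul_smul, inv_mul_cancel₀ (sub_ne_zero.2 hcc), one_smul]
    rw [this, map_zero, smul_zero]

end Pole

/-! ### Equivariant operators and the pieces -/

section Schur

variable {𝕜 : Type*} [RCLike 𝕜] {n s k : ℕ}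

theorem actBy_embed_of_le {v : Euc n} (hv : ‖v‖ = 1) {t : ℕ} (h : t ≤ s) (j : ℕ)
    (P : Euc n → Cl 𝕜 n) : actBy 𝕜 (up n v) (embed 𝕜 n s t k j P) =
      (-1 : ℝ) ^ (k + j + (s - t)) • embed 𝕜 n s t k j (actBy 𝕜 v P) := by
  have := actBy_embed hv t (s - t) k j P
  rwa [Nat.add_sub_cancel' h] at this

theorem neg_one_pow_mul_self (a : ℕ) : (-1 : ℝ) ^ a * (-1) ^ a = 1 := by
  rw [← mul_pow]; norm_num

theorem embed_actBy_of_le {v : Euc n} (hv : ‖v‖ = 1) {t : ℕ} (h : t ≤ s) (j : ℕ)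
    (P : Euc n → Cl 𝕜 n) : embed 𝕜 n s t k j (actBy 𝕜 v P) =
      (-1 : ℝ) ^ (k + j + (s - t)) • actBy 𝕜 (up n v) (embed 𝕜 n s t k j P) := by
  rw [actBy_embed_of_le hv h, smul_smul, neg_one_pow_mul_self, one_smul]

theorem le_of_mem_indexSet {t j : ℕ} (h : (t, j) ∈ indexSet n s k) : t ≤ s := by
  obtain ⟨-, -, h, -⟩ := h
  simp only at h
  omega

theorem actBy_mem_piece {v : Euc n} (hv : ‖v‖ = 1) {t j : ℕ} (h : t ≤ s)
    {f : Euc (n + 1) → Cl 𝕜 (n + 1)} (hf : f ∈ piece 𝕜 n s t k j) :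
    actBy 𝕜 (up n v) f ∈ piece 𝕜 n s t k j := by
  obtain ⟨P, hP, rfl⟩ := hf
  rw [actBy_embed_of_le hv h, ← map_real_smul]
  exact ⟨_, real_smul_mem _ _ (actBy_mem_hodge hv hP), rfl⟩

theorem embed_eq_zero (hn : 2 ≤ n) {t j : ℕ} (h : t ≤ s) (hj : j ≤ k) {P : Euc n → Cl 𝕜 n}
    (hP : P ∈ hodge 𝕜 n t j) (h0 : embed 𝕜 n s t k j P = 0) : P = 0 := by
  refine embed_injective hn (t := t) (r := s - t) hj (mem_hodge_iff.1 hP).1 ?_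
  rwa [Nat.add_sub_cancel' h]

/-- There are no nonzero equivariant maps between different pieces. -/
theorem piece_intertwiner_eq_zero (hn : 2 ≤ n) {t j t' j' : ℕ} (hp : (t, j) ∈ indexSet n s k)
    (hq : (t', j') ∈ indexSet n s k) (hne : (t, j) ≠ (t', j'))
    {Θ : (Euc (n + 1) → Cl 𝕜 (n + 1)) →ₗ[𝕜] (Euc (n + 1) → Cl 𝕜 (n + 1))}
    (hmap : ∀ f ∈ piece 𝕜 n s t k j, Θ f ∈ piece 𝕜 n s t' k j')
    (hcomm : ∀ v : Euc n, ‖v‖ = 1 → ∀ f ∈ piece 𝕜 n s t k j,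
      Θ (actBy 𝕜 (up n v) f) = actBy 𝕜 (up n v) (Θ f))
    {f : Euc (n + 1) → Cl 𝕜 (n + 1)} (hf : f ∈ piece 𝕜 n s t k j) : Θ f = 0 := by
  have ht := le_of_mem_indexSet hp
  have ht' := le_of_mem_indexSet hq
  -- A left inverse of the second embedding transports Θ to a map Ψ between spaces of solutions on
  -- ℝ^n.
  obtain ⟨g, hg⟩ := LinearMap.exists_leftInverse_of_injective
    (embed 𝕜 n s t' k j' ∘ₗ (hodge 𝕜 n t' j').subtype) (LinearMap.ker_eq_bot'.2 fun P hP =>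
      Subtype.ext (embed_eq_zero hn ht' hq.2.1 P.2 hP))
  have hg' : ∀ Q (hQ : Q ∈ hodge 𝕜 n t' j'), g (embed 𝕜 n s t' k j' Q) = ⟨Q, hQ⟩ := fun Q hQ =>
    LinearMap.congr_fun hg ⟨Q, hQ⟩
  let Ψ : (Euc n → Cl 𝕜 n) →ₗ[𝕜] (Euc n → Cl 𝕜 n) :=
    (hodge 𝕜 n t' j').subtype ∘ₗ g ∘ₗ Θ ∘ₗ embed 𝕜 n s t k j
  have hΨ : ∀ P ∈ hodge 𝕜 n t j, Ψ P ∈ hodge 𝕜 n t' j' ∧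
      Θ (embed 𝕜 n s t k j P) = embed 𝕜 n s t' k j' (Ψ P) := by
    intro P hP
    obtain ⟨Q, hQ, h⟩ := hmap _ ⟨P, hP, rfl⟩
    have : Ψ P = Q := by
      change ((g (Θ (embed 𝕜 n s t k j P)) : hodge 𝕜 n t' j') : Euc n → Cl 𝕜 n) = Q
      rw [← h, hg' Q hQ]
    rw [this]
    exact ⟨hQ, h.symm⟩
  have hz : ∀ P ∈ hodge 𝕜 n t j, Ψ P = 0 := fun P hP => by
    refine intertwiner_eq_zero hp hq hne (fun P hP => (hΨ P hP).1) (fun v hv P hP => ?_) hP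
    have hP' := actBy_mem_hodge hv hP
    -- Ψ commutes with unit vectors up to the product of the signs of the two embeddings.
    have h1 : embed 𝕜 n s t' k j' (Ψ (actBy 𝕜 v P)) = embed 𝕜 n s t' k j'
        (((-1 : ℝ) ^ (k + j + (s - t)) * (-1) ^ (k + j' + (s - t'))) • actBy 𝕜 v (Ψ P)) := by
      rw [← (hΨ _ hP').2, embed_actBy_of_le hv ht, map_real_smul, hcomm v hv _ ⟨P, hP, rfl⟩,
        (hΨ P hP).2, map_real_smul, embed_actBy_of_le hv ht', smul_smul, mul_assoc,
        neg_one_pow_mul_self, mul_one]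
    rw [← sub_eq_zero, ← map_sub] at h1
    exact sub_eq_zero.1 (embed_eq_zero hn ht' hq.2.1 (Submodule.sub_mem _ (hΨ _ hP').1
      (real_smul_mem _ _ (actBy_mem_hodge hv (hΨ P hP).1))) h1)
  obtain ⟨P, hP, rfl⟩ := hf
  rw [(hΨ P hP).2, hz P hP, map_zero]

theorem finite_hodge (m s k : ℕ) : Module.Finite 𝕜 (hodge 𝕜 m s k) :=
  Submodule.finiteDimensional_of_le (S₂ := HPoly 𝕜 (Cl 𝕜 m) m k) fun _ hf => (mem_hodge_iff.1 hf).1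

theorem hodge_le_HPoly (m s k : ℕ) : hodge 𝕜 m s k ≤ HPoly 𝕜 (Cl 𝕜 m) m k :=
  fun _ hf => (mem_hodge_iff.1 hf).1

theorem norm_up_eq_one (v : {v : Euc n // ‖v‖ = 1}) : ‖up n v.1‖ = 1 := by rw [norm_up, v.2]

/-- Different pieces are orthogonal for every invariant inner product. -/
theorem piece_orthogonal (hn : 2 ≤ n) (hs : s = 0 ∨ s = n + 1 → k = 0)
    (c : InnerProductSpace.Core 𝕜 (hodge 𝕜 (n + 1) s k))
    (hc : ∀ (v : {v : Euc n // ‖v‖ = 1}) (f g : hodge 𝕜 (n + 1) s k),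
      c.inner ⟨actBy 𝕜 (up n v.1) f, actBy_mem_hodge (norm_up_eq_one v) f.2⟩
        ⟨actBy 𝕜 (up n v.1) g, actBy_mem_hodge (norm_up_eq_one v) g.2⟩ = c.inner f g)
    {t j t' j' : ℕ} (hp : (t, j) ∈ indexSet n s k)
    (hq : (t', j') ∈ indexSet n s k) (hne : (t, j) ≠ (t', j')) {f g : hodge 𝕜 (n + 1) s k}
    (hf : f.1 ∈ piece 𝕜 n s t k j) (hg : g.1 ∈ piece 𝕜 n s t' k j') : c.inner f g = 0 := by
  have := finite_hodge (𝕜 := 𝕜) (n + 1) s k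
  obtain ⟨T, h1, -, h3, h4⟩ := exists_projection c
    (fun v : {v : Euc n // ‖v‖ = 1} => actBy 𝕜 (up n v.1))
    (fun v f hf => actBy_mem_hodge (norm_up_eq_one v) hf) (fun v f => actBy_actBy (norm_up_eq_one v) f)
    hc (piece_le_hodge hn hs hq) (fun v f hf => actBy_mem_piece v.2 (le_of_mem_indexSet hq) hf)
  have h5 := piece_intertwiner_eq_zero hn hp hq hne (Θ := T)
    (fun f hf => h1 f (piece_le_hodge hn hs hp hf))
    (fun v hv f hf => h3 ⟨v, hv⟩ f (piece_le_hodge hn hs hp hf)) hf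
  rw [← c.conj_inner_symm, h4 f h5 g hg, map_zero]

/-- An equivariant operator preserves the pieces. -/
theorem map_mem_piece (hn : 2 ≤ n) (hs : s = 0 ∨ s = n + 1 → k = 0) (hs' : s ≤ n + 1)
    {T : (Euc (n + 1) → Cl 𝕜 (n + 1)) →ₗ[𝕜] (Euc (n + 1) → Cl 𝕜 (n + 1))}
    (hT : ∀ f ∈ hodge 𝕜 (n + 1) s k, T f ∈ hodge 𝕜 (n + 1) s k)
    (hcomm : ∀ v : Euc n, ‖v‖ = 1 → ∀ f ∈ hodge 𝕜 (n + 1) s k,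
      T (actBy 𝕜 (up n v) f) = actBy 𝕜 (up n v) (T f))
    {t j : ℕ} (hp : (t, j) ∈ indexSet n s k)
    {f : Euc (n + 1) → Cl 𝕜 (n + 1)} (hf : f ∈ piece 𝕜 n s t k j) :
    T f ∈ piece 𝕜 n s t k j := by
  have := finite_hodge (𝕜 := 𝕜) (n + 1) s k
  -- The invariant L²-inner product supplies an equivariant projection onto each piece.
  have hproj : ∀ q : indexSet n s k, ∃ Q : (Euc (n + 1) → Cl 𝕜 (n + 1)) →ₗ[𝕜] (Euc (n + 1) → Cl 𝕜 (n + 1)),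
      (∀ f ∈ hodge 𝕜 (n + 1) s k, Q f ∈ piece 𝕜 n s q.1.1 k q.1.2) ∧
      (∀ f ∈ piece 𝕜 n s q.1.1 k q.1.2, Q f = f) ∧
      ∀ v : Euc n, ‖v‖ = 1 → ∀ f ∈ hodge 𝕜 (n + 1) s k,
        Q (actBy 𝕜 (up n v) f) = actBy 𝕜 (up n v) (Q f) := by
    intro q
    obtain ⟨Q, h1, h2, h3, -⟩ := exists_projection (l2Core (hodge_le_HPoly (𝕜 := 𝕜) (n + 1) s k))
      (fun v : {v : Euc n // ‖v‖ = 1} => actBy 𝕜 (up n v.1))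
      (fun v f hf => actBy_mem_hodge (norm_up_eq_one v) hf)
      (fun v f => actBy_actBy (norm_up_eq_one v) f)
      (fun v f g => l2Inner_actBy (norm_up_eq_one v) f.1 g.1)
      (piece_le_hodge hn hs q.2) (fun v f hf => actBy_mem_piece v.2 (le_of_mem_indexSet q.2) hf)
    exact ⟨Q, h1, h2, fun v hv => h3 ⟨v, hv⟩⟩
  have hle : ∀ q : indexSet n s k, piece 𝕜 n s q.1.1 k q.1.2 ≤ hodge 𝕜 (n + 1) s k :=
    fun q => piece_le_hodge hn hs q.2
  have hfH := hle ⟨(t, j), hp⟩ hf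
  have hTf := hT f hfH
  rw [← iSup_piece hn hs' hs, Submodule.mem_iSup_iff_exists_finsupp] at hTf
  obtain ⟨g, hg, hsum⟩ := hTf
  have hg0 : ∀ q : indexSet n s k, q ≠ ⟨(t, j), hp⟩ → g q = 0 := by
    intro q hq
    obtain ⟨Q, h1, h2, h3⟩ := hproj q
    -- Q ∘ T maps the given piece equivariantly to a different one. The same applies to Q on every
    -- other summand, so what remains is the component of T f in the piece q.
    have e1 : Q (T f) = 0 := by
      refine piece_intertwiner_eq_zero hn hp q.2 (fun h => hq (Subtype.ext h.symm)) (Θ := Q ∘ₗ T)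
        (fun f hf => h1 _ (hT f (hle ⟨(t, j), hp⟩ hf))) (fun v hv f hf => ?_) hf
      have hf' := hle ⟨(t, j), hp⟩ hf
      rw [LinearMap.comp_apply, LinearMap.comp_apply, hcomm v hv f hf', h3 v hv _ (hT f hf')]
    rw [← hsum, Finsupp.sum, map_sum, Finset.sum_eq_single q, h2 _ (hg q)] at e1
    · exact e1
    · intro q' _ hq'
      exact piece_intertwiner_eq_zero hn q'.2 q.2 (fun h => hq' (Subtype.ext h))
        (fun f hf => h1 f (hle q' hf)) (fun v hv f hf => h3 v hv f (hle q' hf)) (hg q')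
    · intro hq'
      rw [Finsupp.notMem_support_iff.1 hq', map_zero]
  rw [← hsum, Finsupp.sum]
  refine Submodule.sum_mem _ fun q _ => ?_
  by_cases hq : q = ⟨(t, j), hp⟩
  · have := hg q
    rw [hq] at this ⊢
    exact this
  · rw [hg0 q hq]
    exact Submodule.zero_mem _

end Schur

/-! ### Irreducibility by induction on the dimension -/

section Irreducible

variable {𝕜 : Type*} [RCLike 𝕜] {m n s k : ℕ}

/-- `H^s_k(ℝ^m)` has no proper nonzero subspaces invariant under all reflections. -/
def HodgeIrreducible (𝕜 : Type*) [RCLike 𝕜] (m s k : ℕ) : Prop :=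
  ∀ U ≤ hodge 𝕜 m s k, (∀ v : Euc m, ‖v‖ = 1 → ∀ f ∈ U, actBy 𝕜 v f ∈ U) →
    U = ⊥ ∨ U = hodge 𝕜 m s k

/-- Applied to the equivariant orthogonal projection onto an invariant subspace U ≠ 0: the scalar is
1, so U is everything. Only idempotents have to be scalar, which lets the real and the complex case
be treated together. -/
theorem hodgeIrreducible_of_scalar
    (h : ∀ T : (Euc m → Cl 𝕜 m) →ₗ[𝕜] (Euc m → Cl 𝕜 m),
      (∀ f ∈ hodge 𝕜 m s k, T f ∈ hodge 𝕜 m s k) → (∀ f ∈ hodge 𝕜 m s k, T (T f) = T f) →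
      (∀ v : Euc m, ‖v‖ = 1 → ∀ f ∈ hodge 𝕜 m s k, T (actBy 𝕜 v f) = actBy 𝕜 v (T f)) →
      ∃ c : 𝕜, ∀ f ∈ hodge 𝕜 m s k, T f = c • f) : HodgeIrreducible 𝕜 m s k := by
  intro U hU hinv
  have := finite_hodge (𝕜 := 𝕜) m s k
  obtain ⟨T, h1, h2, h3, -⟩ := exists_projection (l2Core (hodge_le_HPoly (𝕜 := 𝕜) m s k))
    (fun v : {v : Euc m // ‖v‖ = 1} => actBy 𝕜 v.1) (fun v f hf => actBy_mem_hodge v.2 hf)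
    (fun v f => actBy_actBy v.2 f) (fun v f g => l2Inner_actBy v.2 f.1 g.1) hU
    (fun v f hf => hinv v.1 v.2 f hf)
  obtain ⟨c, hc⟩ := h T (fun f hf => hU (h1 f hf)) (fun f hf => h2 _ (h1 f hf))
    (fun v hv => h3 ⟨v, hv⟩)
  rcases eq_or_ne U ⊥ with h0 | h0
  · exact Or.inl h0
  · obtain ⟨u, hu, hu0⟩ := Submodule.exists_mem_ne_zero_of_ne_bot h0
    have h4 := hc u (hU hu)
    rw [h2 u hu] at h4
    have h5 : (1 - c) • u = 0 := by rw [sub_smul, one_smul, ← h4, sub_self]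
    have h6 : c = 1 := (sub_eq_zero.1 ((smul_eq_zero.1 h5).resolve_right hu0)).symm
    refine Or.inr (le_antisymm hU fun f hf => ?_)
    have h7 := hc f hf
    rw [h6, one_smul] at h7
    rw [← h7]
    exact h1 f hf

theorem hodgeIrreducible_of_line (w : Euc m → Cl 𝕜 m)
    (h : ∀ f ∈ hodge 𝕜 m s k, ∃ c : 𝕜, f = c • w) : HodgeIrreducible 𝕜 m s k := by
  intro U hU _
  rcases eq_or_ne U ⊥ with h0 | h0
  · exact Or.inl h0
  · obtain ⟨u, hu, hu0⟩ := Submodule.exists_mem_ne_zero_of_ne_bot h0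
    obtain ⟨c, rfl⟩ := h u (hU hu)
    have hc : c ≠ 0 := fun h => hu0 (by rw [h, zero_smul])
    refine Or.inr (le_antisymm hU fun f hf => ?_)
    obtain ⟨d, rfl⟩ := h f hf
    have := U.smul_mem (d * c⁻¹) hu
    rwa [smul_smul, inv_mul_cancel_right₀ hc] at this

theorem mem_sVectors_top {a : Cl 𝕜 m} (ha : a ∈ sVectors 𝕜 m m) :
    ∃ c : 𝕜, a = c • eL 𝕜 (List.finRange m) := by
  refine sVectors_induction (p := fun a => ∃ c : 𝕜, a = c • eL 𝕜 (List.finRange m)) ?_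
    ⟨0, (zero_smul _ _).symm⟩ ?_ ?_ ha
  · intro l hl hlen
    have hp : l.Perm (List.finRange m) :=
      (List.perm_ext_iff_of_nodup hl (List.nodup_finRange m)).2 fun i => by
        have h1 : l.toFinset = Finset.univ := Finset.eq_univ_of_card _ (by
          rw [List.toFinset_card_of_nodup hl, hlen, Fintype.card_fin])
        have h2 : i ∈ l.toFinset := h1 ▸ Finset.mem_univ i
        simpa using h2
    rcases eL_perm (𝕜 := 𝕜) hp hl with h | h
    · exact ⟨1, by rw [h, one_smul]⟩
    · exact ⟨-1, by rw [h, neg_smul, one_smul]⟩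
  · rintro _ _ ⟨c, rfl⟩ ⟨d, rfl⟩
    exact ⟨c + d, (add_smul _ _ _).symm⟩
  · rintro c _ ⟨d, rfl⟩
    exact ⟨c * d, smul_smul _ _ _⟩

theorem hodgeIrreducible_of_extreme (h : s = 0 ∨ s = m) : HodgeIrreducible 𝕜 m s k := by
  rcases Nat.eq_zero_or_pos k with rfl | hk
  · obtain ⟨w, hw⟩ : ∃ w : Cl 𝕜 m, ∀ a ∈ sVectors 𝕜 m s, ∃ c : 𝕜, a = c • w := by
      rcases h with rfl | rfl
      · exact ⟨1, fun a ha => mem_sVectors_zero ha⟩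
      · exact ⟨_, fun a ha => mem_sVectors_top ha⟩
    refine hodgeIrreducible_of_line (fun _ => w) fun f hf => ?_
    obtain ⟨f1, f2, -⟩ := mem_hodge_iff.1 hf
    obtain ⟨c, hc⟩ := hw _ (f2 0)
    exact ⟨c, funext fun x => by rw [HPoly_zero_const f1 x, hc]; rfl⟩
  · have hb : hodge 𝕜 m s k = ⊥ := by
      rcases h with rfl | rfl
      · exact hodge_zero_eq_bot hk
      · exact hodge_top_eq_bot hk
    exact fun U hU _ => Or.inl (le_bot_iff.1 (hb ▸ hU))

/-! ### The inductive step -/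

section Step

variable {T : (Euc (n + 1) → Cl 𝕜 (n + 1)) →ₗ[𝕜] (Euc (n + 1) → Cl 𝕜 (n + 1))}

/-- The kernel of T on an irreducible piece is everything or zero. In the second case T is the
identity, because T is idempotent and preserves the piece. The scalar is thus 0 or 1, without
Schur's lemma. -/
theorem exists_scalar_on_piece (hn : 2 ≤ n) (hs : s = 0 ∨ s = n + 1 → k = 0) (hs' : s ≤ n + 1)
    (hT : ∀ f ∈ hodge 𝕜 (n + 1) s k, T f ∈ hodge 𝕜 (n + 1) s k)
    (hTT : ∀ f ∈ hodge 𝕜 (n + 1) s k, T (T f) = T f)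
    (hcomm : ∀ v : Euc n, ‖v‖ = 1 → ∀ f ∈ hodge 𝕜 (n + 1) s k,
      T (actBy 𝕜 (up n v) f) = actBy 𝕜 (up n v) (T f))
    {t j : ℕ} (hp : (t, j) ∈ indexSet n s k) (hirr : HodgeIrreducible 𝕜 n t j) :
    ∃ c : 𝕜, ∀ P ∈ hodge 𝕜 n t j,
      T (embed 𝕜 n s t k j P) = c • embed 𝕜 n s t k j P := by
  have hle : ∀ P ∈ hodge 𝕜 n t j, embed 𝕜 n s t k j P ∈ hodge 𝕜 (n + 1) s k := fun P hP =>
    piece_le_hodge hn hs hp ⟨P, hP, rfl⟩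
  rcases hirr (hodge 𝕜 n t j ⊓ LinearMap.ker (T ∘ₗ embed 𝕜 n s t k j)) inf_le_left
    (fun v hv P hP => ⟨actBy_mem_hodge hv hP.1, by
      have h0 : T (embed 𝕜 n s t k j P) = 0 := hP.2
      rw [SetLike.mem_coe, LinearMap.mem_ker, LinearMap.comp_apply, embed_actBy_of_le hv (le_of_mem_indexSet hp),
        map_real_smul, hcomm v hv _ (hle P hP.1), h0, map_zero, smul_zero]⟩) with h | h
  · refine ⟨1, fun P hP => ?_⟩
    obtain ⟨Q, hQ, hQ'⟩ := map_mem_piece hn hs hs' hT hcomm hp (Submodule.mem_map_of_mem hP)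
    have h1 : Q - P ∈ hodge 𝕜 n t j ⊓ LinearMap.ker (T ∘ₗ embed 𝕜 n s t k j) :=
      ⟨Submodule.sub_mem _ hQ hP, by
        rw [SetLike.mem_coe, LinearMap.mem_ker, LinearMap.comp_apply, map_sub, map_sub, hQ', hTT _ (hle P hP),
          sub_self]⟩
    rw [h, Submodule.mem_bot, sub_eq_zero] at h1
    rw [one_smul, ← hQ', h1]
  · refine ⟨0, fun P hP => ?_⟩
    rw [← h] at hP
    rw [zero_smul]
    exact hP.2

theorem apply_pole_of_pos (hn : 2 ≤ n) (hs : s = 0 ∨ s = n + 1 → k = 0) (hs' : s ≤ n + 1)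
    (hT : ∀ f ∈ hodge 𝕜 (n + 1) s k, T f ∈ hodge 𝕜 (n + 1) s k)
    (hcomm : ∀ v : Euc n, ‖v‖ = 1 → ∀ f ∈ hodge 𝕜 (n + 1) s k,
      T (actBy 𝕜 (up n v) f) = actBy 𝕜 (up n v) (T f))
    {t j : ℕ} (ht : t + 1 = s ∨ t = s) (hj : j ≤ k) (hj1 : 1 ≤ j) {P : Euc n → Cl 𝕜 n}
    (hP : P ∈ hodge 𝕜 n t j) :
    T (embed 𝕜 n s t k j P) (EuclideanSpace.single (Fin.last n) 1) = 0 := by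
  by_cases hp : (t, j) ∈ indexSet n s k
  · obtain ⟨Q, hQ, hQ'⟩ := map_mem_piece hn hs hs' hT hcomm hp (Submodule.mem_map_of_mem hP)
    rw [← hQ']
    have := embed_apply_pole_of_pos (t := t) (r := s - t) (k := k) hj1 (mem_hodge_iff.1 hQ).1
    rwa [Nat.add_sub_cancel' (le_of_mem_indexSet hp)] at this
  · rw [hodge_eq_bot_of_notMem ht hj hp, Submodule.mem_bot] at hP
    rw [hP, map_zero, map_zero, Pi.zero_apply]

/-- Since only pieces with j = 0 are visible at the pole, irreducibility in one dimension less is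
needed for constant functions only. -/
theorem hodgeIrreducible_succ (hn : 2 ≤ n) (hs : 1 ≤ s) (hs' : s ≤ n)
    (h1 : HodgeIrreducible 𝕜 n (s - 1) 0) (h2 : HodgeIrreducible 𝕜 n s 0) :
    HodgeIrreducible 𝕜 (n + 1) s k := by
  obtain ⟨σ, rfl⟩ : ∃ σ, s = σ + 1 := ⟨s - 1, by omega⟩
  rw [Nat.add_sub_cancel] at h1
  refine hodgeIrreducible_of_scalar fun T hT hTT hcomm => ?_
  have hs0 : σ + 1 = 0 ∨ σ + 1 = n + 1 → k = 0 := by omega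
  have hcomm' : ∀ v : Euc n, ‖v‖ = 1 → ∀ f ∈ hodge 𝕜 (n + 1) (σ + 1) k,
      T (actBy 𝕜 (up n v) f) = actBy 𝕜 (up n v) (T f) := fun v hv =>
    hcomm (up n v) (by rw [norm_up, hv])
  obtain ⟨c₁, hc₁⟩ := exists_scalar_on_piece hn hs0 (by omega) hT hTT hcomm' (t := σ + 1) (j := 0)
    ⟨hs', Nat.zero_le _, Or.inr rfl, fun _ => rfl⟩ h2
  obtain ⟨c₂, hc₂⟩ := exists_scalar_on_piece hn hs0 (by omega) hT hTT hcomm' (t := σ) (j := 0)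
    ⟨by simp only; omega, Nat.zero_le _, Or.inl rfl, fun _ => rfl⟩ h1
  refine eq_smul_of_pole hs hs' hT hcomm c₁ c₂ fun f hf => ?_
  obtain ⟨A, B, hA, hB, rfl⟩ := exists_eq_embedSum hn (by omega) hf
  -- The value at the pole splits into the tangential part from `A 0` and the normal part from `B
  -- 0`, and T scales them by c₁ and c₂.
  have e1 : embedSum σ k A B (EuclideanSpace.single (Fin.last n) 1) =
      F n k 0 (EuclideanSpace.single (Fin.last n) 1) • upCl 𝕜 n (A 0 0) +
        F n k 0 (EuclideanSpace.single (Fin.last n) 1) •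
          (e 𝕜 (Fin.last n) * upCl 𝕜 n (B 0 0)) := by
    rw [embedSum, Finset.sum_apply, Finset.sum_eq_single 0, Pi.add_apply]
    · have := embed_apply_pole_zero (t := σ + 1) (r := 0) (k := k) (mem_hodge_iff.1 (hA 0)).1
      rw [add_zero, pow_zero, one_mul] at this
      rw [this, embed_apply_pole_zero (mem_hodge_iff.1 (hB 0)).1, pow_one]
    · intro j _ hj
      have := embed_apply_pole_of_pos (t := σ + 1) (r := 0) (k := k) (Nat.one_le_iff_ne_zero.2 hj)
        (mem_hodge_iff.1 (hA j)).1
      rw [add_zero] at this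
      rw [Pi.add_apply, this, embed_apply_pole_of_pos (Nat.one_le_iff_ne_zero.2 hj)
        (mem_hodge_iff.1 (hB j)).1, add_zero]
    · simp
  have e2 : T (embedSum σ k A B) (EuclideanSpace.single (Fin.last n) 1) =
      c₁ • F n k 0 (EuclideanSpace.single (Fin.last n) 1) • upCl 𝕜 n (A 0 0) +
        c₂ • F n k 0 (EuclideanSpace.single (Fin.last n) 1) •
          (e 𝕜 (Fin.last n) * upCl 𝕜 n (B 0 0)) := by
    rw [embedSum, map_sum, Finset.sum_apply, Finset.sum_eq_single 0, map_add, Pi.add_apply,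
      hc₁ _ (hA 0), hc₂ _ (hB 0)]
    · have := embed_apply_pole_zero (t := σ + 1) (r := 0) (k := k) (mem_hodge_iff.1 (hA 0)).1
      rw [add_zero, pow_zero, one_mul] at this
      rw [Pi.smul_apply, Pi.smul_apply, this, embed_apply_pole_zero (mem_hodge_iff.1 (hB 0)).1,
        pow_one]
    · intro j hj hj0
      have hjk : j ≤ k := by simpa [Nat.lt_succ_iff] using hj
      have hj1 := Nat.one_le_iff_ne_zero.2 hj0
      rw [map_add, Pi.add_apply,
        apply_pole_of_pos hn hs0 (by omega) hT hcomm' (Or.inr rfl) hjk hj1 (hA j),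
        apply_pole_of_pos hn hs0 (by omega) hT hcomm' (Or.inl rfl) hjk hj1 (hB j), add_zero]
    · simp
  rw [e2, e1, map_add, map_real_smul, map_real_smul, tangential_upCl, tangential_e_last_mul,
    smul_zero, add_zero, add_sub_cancel_left]

end Step

/-! ### The plane -/

/-- For the plane, where the branching lemmas are not available: elements of H with value at p on a
fixed line form a space of dimension at most one. The scalar is arbitrary, here 0, when no nonzero
element meets the conditions. -/
theorem exists_scalar_on_line {E V : Type*} [AddCommGroup V] [Module 𝕜 V]
    {H : Submodule 𝕜 (E → V)} (p : E) (hinj : ∀ f ∈ H, f p = 0 → f = 0)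
    (T : (E → V) →ₗ[𝕜] (E → V)) (w : V) :
    ∃ c : 𝕜, ∀ f ∈ H, (∃ a : 𝕜, f p = a • w) → (∃ a : 𝕜, T f p = a • w) → T f p = c • f p := by
  by_cases h : ∃ f ∈ H, f ≠ 0 ∧ (∃ a : 𝕜, f p = a • w) ∧ ∃ a : 𝕜, T f p = a • w
  · obtain ⟨f₀, hf₀, hne, ⟨a, ha⟩, b, hb⟩ := h
    have ha0 : a ≠ 0 := fun h => hne (hinj f₀ hf₀ (by rw [ha, h, zero_smul]))
    refine ⟨b / a, fun f hf ⟨a', ha'⟩ _ => ?_⟩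
    have h1 : f = (a' / a) • f₀ := by
      refine sub_eq_zero.1 (hinj _ (H.sub_mem hf (H.smul_mem _ hf₀)) ?_)
      rw [Pi.sub_apply, Pi.smul_apply, ha', ha, smul_smul, div_mul_cancel₀ _ ha0, sub_self]
    rw [h1, map_smul, Pi.smul_apply, Pi.smul_apply, hb, ha, smul_smul, smul_smul, smul_smul]
    congr 1
    field_simp
  · refine ⟨0, fun f hf h1 h2 => ?_⟩
    have h3 : f = 0 := by
      by_contra h0
      exact h ⟨f, hf, h0, h1, h2⟩
    rw [h3, map_zero, Pi.zero_apply, smul_zero]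

/-- In two variables the Dirac equation determines the first partial derivative from the second.
Euler's identity at the pole shows that the second derivative vanishes there too, so it is zero by
induction on the degree. -/
theorem eq_zero_of_pole_plane {f : Euc (1 + 1) → Cl 𝕜 (1 + 1)} (hf : f ∈ hodge 𝕜 (1 + 1) s k)
    (h : f (EuclideanSpace.single (Fin.last 1) 1) = 0) : f = 0 := by
  induction k generalizing f with
  | zero =>
    have := HPoly_zero_const (mem_hodge_iff.1 hf).1
    funext x
    rw [this x, ← this (EuclideanSpace.single (Fin.last 1) 1), h, Pi.zero_apply]
  | succ k ih =>
    obtain ⟨f1, -, f3⟩ := mem_hodge_iff.1 hf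
    have h1 := HPoly_euler f1 (EuclideanSpace.single (Fin.last 1) 1)
    rw [h, smul_zero, Fin.sum_univ_castSucc] at h1
    simp at h1
    have h2 : pd 𝕜 (Fin.last 1) f = 0 := ih (pd_mem_hodge hf (Fin.last 1)) h1
    refine HPoly_eq_zero_of_pd (Nat.succ_pos k) f1 fun i => ?_
    refine Fin.lastCases h2 (fun i => ?_) i
    funext x
    have h3 := f3 x
    rw [dirac, Fin.sum_univ_castSucc, h2, Pi.zero_apply, mul_zero, add_zero] at h3
    have hi : i = 0 := Subsingleton.elim _ _
    subst hi
    simp only [Finset.univ_unique, Finset.sum_singleton] at h3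
    have h4 := congrArg (e 𝕜 (Fin.castSucc (0 : Fin 1)) * ·) h3
    simp only [mul_zero] at h4
    have h5 := e_mul_e_mul_self (𝕜 := 𝕜) (Fin.castSucc (0 : Fin 1)) (pd 𝕜 (Fin.castSucc 0) f x)
    rw [Pi.zero_apply, ← neg_eq_zero, ← h5]
    exact h4

theorem eL_finRange_one : eL 𝕜 (List.finRange 1) = vec 𝕜 (EuclideanSpace.single (0 : Fin 1) 1) := by
  rw [eL, show List.finRange 1 = [0] from rfl]
  simp [e]

theorem exists_plane_components {a : Cl 𝕜 (1 + 1)} (ha : a ∈ sVectors 𝕜 (1 + 1) 1) :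
    (∃ c : 𝕜, tangential 𝕜 1 a = c • upCl 𝕜 1 (eL 𝕜 (List.finRange 1))) ∧
    (∃ c : 𝕜, a - tangential 𝕜 1 a = c • e 𝕜 (Fin.last 1)) ∧
    conjBy 𝕜 (up 1 (EuclideanSpace.single (0 : Fin 1) 1)) a =
      tangential 𝕜 1 a - (a - tangential 𝕜 1 a) := by
  obtain ⟨A, hA, B, hB, rfl⟩ := exists_eq_upCl_add (s := 0) ha
  obtain ⟨c, rfl⟩ := mem_sVectors_top hA
  obtain ⟨d, rfl⟩ := mem_sVectors_zero hB
  have hv : ‖(EuclideanSpace.single 0 1 : Euc 1)‖ = 1 := norm_single _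
  have hfl : flip (EuclideanSpace.single 0 1 : Euc 1) (EuclideanSpace.single 0 1) =
      EuclideanSpace.single 0 1 := by
    rw [flip_apply, real_inner_self_eq_norm_sq, hv]
    module
  rw [map_add, tangential_upCl, tangential_e_last_mul, add_zero, add_sub_cancel_left]
  refine ⟨⟨c, map_smul _ _ _⟩, ⟨d, by rw [map_smul, map_one, mul_smul_comm, mul_one]⟩, ?_⟩
  rw [map_add, conjBy_up_upCl hv, conjBy_mul (by rw [norm_up, hv]), conjBy_up_e_last hv,
    conjBy_up_upCl hv, neg_mul, sub_eq_add_neg]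
  simp only [map_smul, conjBy_one hv, eL_finRange_one, conjBy_vec hv, hfl]

theorem hodgeIrreducible_plane : HodgeIrreducible 𝕜 (1 + 1) 1 k := by
  refine hodgeIrreducible_of_scalar fun T hT _ hcomm => ?_
  set p : Euc (1 + 1) := EuclideanSpace.single (Fin.last 1) 1 with hp
  set v : Euc (1 + 1) := up 1 (EuclideanSpace.single (0 : Fin 1) 1) with hvdef
  have hv : ‖v‖ = 1 := by rw [hvdef, norm_up, norm_single]
  have hflip : flip v p = (-1 : ℝ) • p := by
    rw [flip_apply, hp, EuclideanSpace.inner_single_right, hvdef, up_apply_last]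
    simp
  -- The average over v = e_1. At the pole this vector fixes the tangential part and negates the
  -- normal part, while the factor (-1)^k compensates for moving the pole to its antipode; hence Q
  -- takes the tangential part of the value.
  let Q : (Euc (1 + 1) → Cl 𝕜 (1 + 1)) → (Euc (1 + 1) → Cl 𝕜 (1 + 1)) := fun f =>
    (1 / 2 : ℝ) • (f + (-1 : ℝ) ^ k • actBy 𝕜 v f)
  have hQ : ∀ f ∈ hodge 𝕜 (1 + 1) 1 k, Q f ∈ hodge 𝕜 (1 + 1) 1 k := fun f hf =>
    real_smul_mem _ _ (Submodule.add_mem _ hf (real_smul_mem _ _ (actBy_mem_hodge hv hf)))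
  have hQp : ∀ f ∈ hodge 𝕜 (1 + 1) 1 k, Q f p = tangential 𝕜 1 (f p) := fun f hf => by
    obtain ⟨f1, f2, -⟩ := mem_hodge_iff.1 hf
    have h1 : actBy 𝕜 v f p = (-1 : ℝ) ^ k • conjBy 𝕜 v (f p) := by
      rw [actBy_apply, hflip, HPoly_homogeneous f1, conjBy_smul]
    change (1 / 2 : ℝ) • (f p + (-1 : ℝ) ^ k • actBy 𝕜 v f p) = _
    rw [h1, smul_smul, neg_one_pow_mul_self, one_smul, (exists_plane_components (f2 p)).2.2]
    module
  have hTQ : ∀ f ∈ hodge 𝕜 (1 + 1) 1 k, T (Q f) = Q (T f) := fun f hf => by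
    change T ((1 / 2 : ℝ) • (f + (-1 : ℝ) ^ k • actBy 𝕜 v f)) = _
    rw [map_real_smul, map_add, map_real_smul, hcomm v hv f hf]
  have hinj : ∀ f ∈ hodge 𝕜 (1 + 1) 1 k, f p = 0 → f = 0 := fun f hf h => eq_zero_of_pole_plane hf h
  obtain ⟨c₁, hc₁⟩ := exists_scalar_on_line p hinj T (upCl 𝕜 1 (eL 𝕜 (List.finRange 1)))
  obtain ⟨c₂, hc₂⟩ := exists_scalar_on_line p hinj T (e 𝕜 (Fin.last 1))
  refine eq_smul_of_pole le_rfl le_rfl hT hcomm c₁ c₂ fun f hf => ?_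
  have f2 := (mem_hodge_iff.1 hf).2.1 p
  have g2 := (mem_hodge_iff.1 (hT f hf)).2.1 p
  have e1 : T (Q f) p = c₁ • Q f p := hc₁ _ (hQ f hf)
    (by rw [hQp f hf]; exact (exists_plane_components f2).1)
    (by rw [hTQ f hf, hQp _ (hT f hf)]; exact (exists_plane_components g2).1)
  have e2 : T (f - Q f) p = c₂ • (f - Q f) p := hc₂ _ (Submodule.sub_mem _ hf (hQ f hf))
    (by rw [Pi.sub_apply, hQp f hf]; exact (exists_plane_components f2).2.1)
    (by rw [map_sub, Pi.sub_apply, hTQ f hf, hQp _ (hT f hf)]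
        exact (exists_plane_components g2).2.1)
  have e3 : T f p = T (Q f) p + T (f - Q f) p := by
    rw [map_sub, Pi.sub_apply, add_sub_cancel]
  rw [e3, e1, e2, Pi.sub_apply, hQp f hf]

/-- `H^s_k(ℝ^m)` is irreducible under `Pin(m)`. -/
theorem hodgeIrreducible (hm : 2 ≤ m) (hs : s ≤ m) : HodgeIrreducible 𝕜 m s k := by
  induction m, hm using Nat.le_induction generalizing s k with
  | base =>
    by_cases h : s = 0 ∨ s = 2
    · exact hodgeIrreducible_of_extreme h
    · obtain rfl : s = 1 := by omega
      exact hodgeIrreducible_plane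
  | succ n hn ih =>
    by_cases h : s = 0 ∨ s = n + 1
    · exact hodgeIrreducible_of_extreme h
    · exact hodgeIrreducible_succ hn (by omega) (by omega) (ih (by omega)) (ih (by omega))

end Irreducible

/-! ### The pieces are nonzero and irreducible -/

section Nontrivial

variable {𝕜 : Type*} [RCLike 𝕜] {m n s k : ℕ}

theorem eL_ne_zero (l : List (Fin m)) : eL 𝕜 l ≠ 0 := by
  intro h
  have h1 := cliffConj_eL_mul_eL (𝕜 := 𝕜) l
  rw [h, mul_zero] at h1
  have h2 := scalarPart_one (𝕜 := 𝕜) (m := m)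
  rw [← h1, map_zero] at h2
  exact zero_ne_one h2

theorem const_mem_hodge {a : Cl 𝕜 m} (ha : a ∈ sVectors 𝕜 m s) :
    (fun _ => a) ∈ hodge 𝕜 m s 0 := by
  refine mem_hodge_iff.2 ⟨HPoly_const a, fun _ => ha, fun x => ?_⟩
  simp [dirac, (hasPd_const (𝕜 := 𝕜) _ a).pd_eq]

/-- The polynomial `(x_a - x_b e_a e_b)^k w`. -/
def powerMap (a b : Fin m) (w : Cl 𝕜 m) : ℕ → Euc m → Cl 𝕜 m
  | 0 => fun _ => w
  | k + 1 => fun x => x a • powerMap a b w k x + x b • (-(e 𝕜 a * e 𝕜 b) * powerMap a b w k x)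

theorem powerMap_mem_HPoly (a b : Fin m) (w : Cl 𝕜 m) (k : ℕ) :
    powerMap a b w k ∈ HPoly 𝕜 (Cl 𝕜 m) m k := by
  induction k with
  | zero => exact HPoly_const w
  | succ k ih =>
    exact Submodule.add_mem _ (HPoly_coord_smul ih a)
      (HPoly_coord_smul (HPoly_mul_left ih (-(e 𝕜 a * e 𝕜 b))) b)

theorem hasPd_powerMap (a b : Fin m) (w : Cl 𝕜 m) (k : ℕ) (i : Fin m) :
    HasPd 𝕜 i (powerMap a b w k) (fun x => (k : ℝ) •
      (((if i = a then (1 : ℝ) else 0) • (1 : Cl 𝕜 m) +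
        (if i = b then (1 : ℝ) else 0) • -(e 𝕜 a * e 𝕜 b)) * powerMap a b w (k - 1) x)) := by
  induction k with
  | zero =>
    simp only [Nat.cast_zero, zero_smul]
    exact hasPd_const i w
  | succ k ih =>
    have h := (ih.coord_smul a).add ((ih.mulL (-(e 𝕜 a * e 𝕜 b))).coord_smul b)
    refine Eq.subst (motive := HasPd 𝕜 i (powerMap a b w (k + 1))) (funext fun x => ?_) h
    have hk : ((k + 1 : ℕ) : ℝ) • powerMap a b w k x = powerMap a b w k x + (k : ℝ) •
        (x a • powerMap a b w (k - 1) x +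
          x b • (-(e 𝕜 a * e 𝕜 b) * powerMap a b w (k - 1) x)) := by
      rcases k with _ | k
      · simp
      · have h1 : powerMap a b w (k + 1) x = x a • powerMap a b w k x +
            x b • (-(e 𝕜 a * e 𝕜 b) * powerMap a b w k x) := rfl
        rw [Nat.add_sub_cancel, ← h1]
        push_cast
        module
    rw [Nat.add_sub_cancel, ← mul_smul_comm ((k + 1 : ℕ) : ℝ), hk]
    simp only [mul_add, add_mul, smul_mul_assoc, mul_smul_comm, one_mul, mul_assoc]
    module

/-- As (e_a e_b)² = -1, all values lie in the span of w and e_a e_b w. The two terms of the Dirac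
operator cancel because e_b (-e_a e_b) = -e_a: these are powers of a holomorphic variable in the (a,
b)-plane. -/
theorem powerMap_mem_hodge {a b : Fin m} (hab : a ≠ b) {w : Cl 𝕜 m} (hw : w ∈ sVectors 𝕜 m s)
    (hw' : e 𝕜 a * (e 𝕜 b * w) ∈ sVectors 𝕜 m s) (k : ℕ) :
    powerMap a b w k ∈ hodge 𝕜 m s k := by
  refine mem_hodge_iff.2 ⟨powerMap_mem_HPoly a b w k, fun x => ?_, fun x => ?_⟩
  · suffices h : powerMap a b w k x ∈ sVectors 𝕜 m s ∧
        -(e 𝕜 a * e 𝕜 b) * powerMap a b w k x ∈ sVectors 𝕜 m s from h.1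
    induction k with
    | zero =>
      refine ⟨hw, ?_⟩
      rw [neg_mul, mul_assoc]
      exact Submodule.neg_mem _ hw'
    | succ k ih =>
      refine ⟨Submodule.add_mem _ (smul_mem_sVectors _ ih.1) (smul_mem_sVectors _ ih.2), ?_⟩
      have h1 : -(e 𝕜 a * e 𝕜 b) * (-(e 𝕜 a * e 𝕜 b) * powerMap a b w k x) =
          -powerMap a b w k x := by
        rw [neg_mul, neg_mul, mul_neg, neg_neg, mul_assoc, mul_assoc, ← mul_assoc (e 𝕜 b), e_mul_e hab.symm, neg_mul,
          mul_neg, mul_assoc, e_mul_e_mul_self, neg_neg, e_mul_e_mul_self]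
      rw [powerMap, mul_add, mul_smul_comm, mul_smul_comm, h1]
      exact Submodule.add_mem _ (smul_mem_sVectors _ ih.2)
        (smul_mem_sVectors _ (Submodule.neg_mem _ ih.1))
  · simp only [dirac, (hasPd_powerMap a b w k _).pd_eq, mul_smul_comm, ← mul_assoc,
      mul_add, mul_one, ← Finset.smul_sum, ← Finset.sum_mul, Finset.sum_add_distrib, ite_smul,
      one_smul, zero_smul, mul_ite, mul_zero, mul_one, Finset.sum_ite_eq', Finset.mem_univ, if_true]
    have h1 : e 𝕜 b * -(e 𝕜 a * e 𝕜 b) = -e 𝕜 a := by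
      rw [e_mul_e hab, neg_neg, e_mul_e_mul_self]
    rw [h1, add_neg_cancel, zero_mul, smul_zero]

theorem powerMap_single {a b : Fin m} (hab : a ≠ b) (w : Cl 𝕜 m) (k : ℕ) :
    powerMap a b w k (EuclideanSpace.single a 1) = w := by
  induction k with
  | zero => rfl
  | succ k ih => simp [powerMap, ih, hab.symm]

theorem hodge_ne_bot_zero (hs : s ≤ m) : hodge 𝕜 m s 0 ≠ ⊥ := by
  intro h
  have hl : ((List.finRange m).take s).length = s := by simp [hs]
  have h1 := eL_mem_sVectors (𝕜 := 𝕜) (l := (List.finRange m).take s)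
    ((List.nodup_finRange m).sublist (List.take_sublist _ _))
  rw [hl] at h1
  have h2 := const_mem_hodge h1
  rw [h, Submodule.mem_bot] at h2
  exact eL_ne_zero _ (congrFun h2 0)

/-- With s + 1 distinct indices a, b, l take w = e_a e_l; then e_a e_b w = e_b e_l is also an
s-vector, and `powerMap` has the nonzero value w at the unit vector e_a. -/
theorem hodge_ne_bot (hs : 1 ≤ s) (hs' : s + 1 ≤ m) (k : ℕ) : hodge 𝕜 m s k ≠ ⊥ := by
  obtain ⟨σ, rfl⟩ : ∃ σ, s = σ + 1 := ⟨s - 1, by omega⟩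
  have hlen : ((List.finRange m).take (σ + 1 + 1)).length = σ + 1 + 1 := by simp [hs']
  have hnd : ((List.finRange m).take (σ + 1 + 1)).Nodup :=
    (List.nodup_finRange m).sublist (List.take_sublist _ _)
  match hL : (List.finRange m).take (σ + 1 + 1), hlen, hnd with
  | a :: b :: l, hlen, hnd =>
    have hlen' : l.length = σ := by simpa using hlen
    simp only [List.nodup_cons, List.mem_cons, not_or] at hnd
    obtain ⟨⟨hab, hal⟩, hbl, hl⟩ := hnd
    have h1 := eL_mem_sVectors (𝕜 := 𝕜) (List.nodup_cons.2 ⟨hal, hl⟩)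
    have h2 := eL_mem_sVectors (𝕜 := 𝕜) (List.nodup_cons.2 ⟨hbl, hl⟩)
    rw [List.length_cons, hlen'] at h1 h2
    have h3 : e 𝕜 a * (e 𝕜 b * eL 𝕜 (a :: l)) = eL 𝕜 (b :: l) := by
      rw [eL_cons, eL_cons, ← mul_assoc (e 𝕜 b), e_mul_e (Ne.symm hab), neg_mul, mul_neg, mul_assoc,
        e_mul_e_mul_self, neg_neg]
    have h4 := powerMap_mem_hodge hab h1 (h3 ▸ h2) k
    intro h
    rw [h, Submodule.mem_bot] at h4
    have h5 := powerMap_single (𝕜 := 𝕜) hab (eL 𝕜 (a :: l)) k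
    rw [h4] at h5
    exact eL_ne_zero _ h5.symm

theorem hodge_ne_bot_of_mem {t j : ℕ} (hp : (t, j) ∈ indexSet n s k) : hodge 𝕜 n t j ≠ ⊥ := by
  obtain ⟨h1, -, -, h4⟩ := hp
  simp only at h1 h4
  by_cases h : t = 0 ∨ t = n
  · rw [h4 h]
    exact hodge_ne_bot_zero h1
  · exact hodge_ne_bot (by omega) (by omega) j

theorem piece_ne_bot (hn : 2 ≤ n) {t j : ℕ} (hp : (t, j) ∈ indexSet n s k) :
    piece 𝕜 n s t k j ≠ ⊥ := by
  obtain ⟨P, hP, hP0⟩ := Submodule.exists_mem_ne_zero_of_ne_bot (hodge_ne_bot_of_mem (𝕜 := 𝕜) hp)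
  intro h
  have h1 : embed 𝕜 n s t k j P ∈ piece 𝕜 n s t k j := ⟨P, hP, rfl⟩
  rw [h, Submodule.mem_bot] at h1
  exact hP0 (embed_eq_zero hn (le_of_mem_indexSet hp) hp.2.1 hP h1)

/-- The pieces are irreducible under the reflections of `ℝ^n`. -/
theorem piece_irreducible (hn : 2 ≤ n) {t j : ℕ} (hp : (t, j) ∈ indexSet n s k)
    {U : Submodule 𝕜 (Euc (n + 1) → Cl 𝕜 (n + 1))} (hU : U ≤ piece 𝕜 n s t k j)
    (hinv : ∀ v : Euc n, ‖v‖ = 1 → ∀ f ∈ U, actBy 𝕜 (up n v) f ∈ U) :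
    U = ⊥ ∨ U = piece 𝕜 n s t k j := by
  rcases hodgeIrreducible (𝕜 := 𝕜) (k := j) hn hp.1 (hodge 𝕜 n t j ⊓ U.comap (embed 𝕜 n s t k j))
    inf_le_left (fun v hv P hP => ⟨actBy_mem_hodge hv hP.1, by
      rw [SetLike.mem_coe, Submodule.mem_comap, embed_actBy_of_le hv (le_of_mem_indexSet hp)]
      exact real_smul_mem _ _ (hinv v hv _ hP.2)⟩) with h | h
  · refine Or.inl ((Submodule.eq_bot_iff _).2 fun f hf => ?_)
    obtain ⟨P, hP, rfl⟩ := hU hf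
    have h1 : P ∈ hodge 𝕜 n t j ⊓ U.comap (embed 𝕜 n s t k j) := ⟨hP, hf⟩
    rw [h, Submodule.mem_bot] at h1
    rw [h1, map_zero]
  · refine Or.inr (le_antisymm hU ?_)
    rintro _ ⟨P, hP, rfl⟩
    rw [SetLike.mem_coe, ← h] at hP
    exact hP.2

end Nontrivial

/-! ### From unit vectors to representations of the Pin group -/

section PinAction

variable {𝕜 : Type*} [RCLike 𝕜] {m n s k : ℕ}

theorem coe_inv_of_eq_ι {v : Euc m} (hv : ‖v‖ = 1) {r : (RCl m)ˣ}
    (h : (r : RCl m) = CliffordAlgebra.ι (negSq m) v) :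
    ((r⁻¹ : (RCl m)ˣ) : RCl m) = -CliffordAlgebra.ι (negSq m) v := by
  apply Units.inv_eq_of_mul_eq_one_right
  rw [h, mul_neg, CliffordAlgebra.ι_sq_scalar, negSq_apply, hv]
  simp

theorem conj_of_eq_ι {v : Euc m} (hv : ‖v‖ = 1) {r : Pin m}
    (h : ((r : (RCl m)ˣ) : RCl m) = CliffordAlgebra.ι (negSq m) v) (x : Euc m) :
    conj r x = flip v x := by
  apply ι_injective m
  have h1 : QuadraticMap.polar (negSq m) v x = -(2 * inner ℝ v x) := by
    rw [QuadraticMap.polar, negSq_apply, negSq_apply, negSq_apply, norm_add_sq_real]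
    ring
  rw [ι_conj, InvMemClass.coe_inv, coe_inv_of_eq_ι hv h, h, neg_mul, neg_mul,
    CliffordAlgebra.ι_mul_ι_mul_ι, h1, negSq_apply, hv, ← map_neg, flip_apply]
  congr 1
  module

theorem hAction_of_eq_ι {v : Euc m} (hv : ‖v‖ = 1) {r : Pin m}
    (h : ((r : (RCl m)ˣ) : RCl m) = CliffordAlgebra.ι (negSq m) v) :
    hAction 𝕜 m r = actBy 𝕜 v := by
  ext f x
  change incl 𝕜 m ((r : (RCl m)ˣ) : RCl m) * f (conj r x) *
    incl 𝕜 m (((r⁻¹ : Pin m) : (RCl m)ˣ) : RCl m) = _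
  rw [conj_of_eq_ι hv h, InvMemClass.coe_inv, coe_inv_of_eq_ι hv h, h, actBy_apply, conjBy_apply,
    map_neg, mul_neg, mul_assoc]
  rfl

theorem hActionSub_of_eq_ι {v : Euc n} (hv : ‖v‖ = 1) {r : Pin n}
    (h : ((r : (RCl n)ˣ) : RCl n) = CliffordAlgebra.ι (negSq n) v) :
    hActionSub 𝕜 n r = actBy 𝕜 (up n v) := by
  refine hAction_of_eq_ι (r := upPin n r) (by rw [norm_up, hv]) ?_
  change upRCl n ((r : (RCl n)ˣ) : RCl n) = _
  rw [h, upRCl_ι]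

theorem exists_hActionSub_eq {v : Euc n} (hv : ‖v‖ = 1) :
    ∃ r : Pin n, hActionSub 𝕜 n r = actBy 𝕜 (up n v) := by
  have h1 : CliffordAlgebra.ι (negSq n) v * -CliffordAlgebra.ι (negSq n) v = 1 := by
    rw [mul_neg, CliffordAlgebra.ι_sq_scalar, negSq_apply, hv]
    simp
  have h2 : -CliffordAlgebra.ι (negSq n) v * CliffordAlgebra.ι (negSq n) v = 1 := by
    rw [neg_mul, ← mul_neg, h1]
  let r : (RCl n)ˣ := ⟨_, _, h1, h2⟩
  exact ⟨⟨r, Subgroup.subset_closure ⟨v, hv, rfl⟩⟩, hActionSub_of_eq_ι hv rfl⟩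

/-- A multiplicative property of the reflections of `ℝ^n` holds for all of `Pin(n)`. -/
theorem hActionSub_induction {p : Module.End 𝕜 (Euc (n + 1) → Cl 𝕜 (n + 1)) → Prop} (h1 : p 1)
    (hv : ∀ v : Euc n, ‖v‖ = 1 → p (actBy 𝕜 (up n v))) (hmul : ∀ A B, p A → p B → p (A * B))
    (r : Pin n) : p (hActionSub 𝕜 n r) := by
  suffices H : ∀ r (hr : r ∈ Pin n), p (hActionSub 𝕜 n ⟨r, hr⟩) ∧ p (hActionSub 𝕜 n ⟨r, hr⟩⁻¹) from
    (H r.1 r.2).1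
  intro r hr
  induction hr using Subgroup.closure_induction with
  | mem r h =>
    obtain ⟨v, hv1, h⟩ := h
    have h2 := hActionSub_of_eq_ι (𝕜 := 𝕜) (r := ⟨r, Subgroup.subset_closure ⟨v, hv1, h⟩⟩) hv1 h
    -- The action of a unit vector is an involution, so its inverse in the group acts by the same
    -- operator.
    have h3 : hActionSub 𝕜 n (⟨r, Subgroup.subset_closure ⟨v, hv1, h⟩⟩ : Pin n)⁻¹ =
        actBy 𝕜 (up n v) := by
      have h4 : actBy 𝕜 (up n v) * actBy 𝕜 (up n v) = 1 :=
        LinearMap.ext fun f => actBy_actBy (by rw [norm_up, hv1]) f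
      have h5 := map_mul (hActionSub 𝕜 n) (⟨r, Subgroup.subset_closure ⟨v, hv1, h⟩⟩ : Pin n)⁻¹
        ⟨r, Subgroup.subset_closure ⟨v, hv1, h⟩⟩
      rw [inv_mul_cancel, map_one, h2] at h5
      calc _ = hActionSub 𝕜 n (⟨r, Subgroup.subset_closure ⟨v, hv1, h⟩⟩ : Pin n)⁻¹ *
            (actBy 𝕜 (up n v) * actBy 𝕜 (up n v)) := by rw [h4, mul_one]
        _ = _ := by rw [← mul_assoc, ← h5, one_mul]
    exact ⟨h2 ▸ hv v hv1, h3 ▸ hv v hv1⟩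
  | one =>
    have h2 : (⟨1, Subgroup.one_mem _⟩ : Pin n) = 1 := rfl
    rw [h2, inv_one, map_one]
    exact ⟨h1, h1⟩
  | mul a b ha hb iha ihb =>
    have h2 : (⟨a * b, Subgroup.mul_mem _ ha hb⟩ : Pin n) = ⟨a, ha⟩ * ⟨b, hb⟩ := rfl
    rw [h2, mul_inv_rev, map_mul, map_mul]
    exact ⟨hmul _ _ iha.1 ihb.1, hmul _ _ ihb.2 iha.2⟩
  | inv a ha iha =>
    have h2 : (⟨a⁻¹, Subgroup.inv_mem _ ha⟩ : Pin n) = (⟨a, ha⟩ : Pin n)⁻¹ := rfl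
    rw [h2, inv_inv]
    exact ⟨iha.2, iha.1⟩

theorem hActionSub_mem {U : Submodule 𝕜 (Euc (n + 1) → Cl 𝕜 (n + 1))}
    (h : ∀ v : Euc n, ‖v‖ = 1 → ∀ f ∈ U, actBy 𝕜 (up n v) f ∈ U) (r : Pin n)
    {f : Euc (n + 1) → Cl 𝕜 (n + 1)} (hf : f ∈ U) : hActionSub 𝕜 n r f ∈ U :=
  hActionSub_induction (p := fun A => ∀ f ∈ U, A f ∈ U) (fun _ h => h) h
    (fun _ _ hA hB f hf => hA _ (hB f hf)) r f hf

theorem l2Inner_hActionSub (r : Pin n) (f g : Euc (n + 1) → Cl 𝕜 (n + 1)) :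
    l2Inner 𝕜 (hActionSub 𝕜 n r f) (hActionSub 𝕜 n r g) = l2Inner 𝕜 f g :=
  hActionSub_induction (p := fun A => ∀ f g, l2Inner 𝕜 (A f) (A g) = l2Inner 𝕜 f g)
    (fun _ _ => rfl) (fun v hv f g => l2Inner_actBy (by rw [norm_up, hv]) f g)
    (fun A B hA hB f g => (hA (B f) (B g)).trans (hB f g)) r f g

/-- `H^s_k(ℝ^(n+1))` as a representation of `Pin(n)`. -/
def hodgeSub (𝕜 : Type*) [RCLike 𝕜] (n s k : ℕ) : Subrepresentation (hActionSub 𝕜 n) where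
  toSubmodule := hodge 𝕜 (n + 1) s k
  apply_mem_toSubmodule r _ hf :=
    hActionSub_mem (fun v hv _ hf => actBy_mem_hodge (by rw [norm_up, hv]) hf) r hf

/-- The pieces as representations of `Pin(n)`. -/
def pieceSub (𝕜 : Type*) [RCLike 𝕜] (n s k : ℕ) (p : indexSet n s k) :
    Subrepresentation (hActionSub 𝕜 n) where
  toSubmodule := piece 𝕜 n s p.1.1 k p.1.2
  apply_mem_toSubmodule r _ hf :=
    hActionSub_mem (fun _ hv _ hf => actBy_mem_piece hv (le_of_mem_indexSet p.2) hf) r hf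

theorem pieceSub_isIrreducible (hn : 2 ≤ n) (p : indexSet n s k) :
    (pieceSub 𝕜 n s k p).toRepresentation.IsIrreducible := by
  have hne : ∃ f : (pieceSub 𝕜 n s k p).toSubmodule, f ≠ 0 := by
    obtain ⟨f, hf, hf0⟩ := Submodule.exists_mem_ne_zero_of_ne_bot (piece_ne_bot (𝕜 := 𝕜) hn p.2)
    exact ⟨⟨f, hf⟩, fun h => hf0 (congrArg Subtype.val h)⟩
  refine
    { exists_pair_ne := ⟨⊥, ⊤, fun h => ?_⟩
      eq_bot_or_eq_top := fun U => ?_ }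
  · obtain ⟨f, hf⟩ := hne
    have h1 : f ∈ (⊤ : Subrepresentation (pieceSub 𝕜 n s k p).toRepresentation).toSubmodule :=
      Submodule.mem_top
    rw [← h] at h1
    exact hf ((Submodule.mem_bot 𝕜).1 h1)
  -- A subrepresentation of the piece is viewed as a subspace of the ambient function space;
  -- invariance under unit vectors is enough there.
  · rcases piece_irreducible hn p.2 (U := U.toSubmodule.map (pieceSub 𝕜 n s k p).toSubmodule.subtype)
      (by rintro _ ⟨f, -, rfl⟩; exact f.2) (by
        rintro v hv _ ⟨f, hf, rfl⟩
        obtain ⟨r, hr⟩ := exists_hActionSub_eq (𝕜 := 𝕜) hv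
        refine ⟨_, U.apply_mem_toSubmodule r hf, ?_⟩
        rw [← hr]
        rfl) with h | h
    · left
      refine Subrepresentation.toSubmodule_injective ((Submodule.eq_bot_iff _).2 fun f hf => ?_)
      have h1 := Submodule.mem_map_of_mem (f := (pieceSub 𝕜 n s k p).toSubmodule.subtype) hf
      rw [h, Submodule.mem_bot] at h1
      exact Subtype.ext h1
    · right
      refine Subrepresentation.toSubmodule_injective ((Submodule.eq_top_iff').2 fun f => ?_)
      have h1 : f.1 ∈ piece 𝕜 n s p.1.1 k p.1.2 := f.2
      rw [← h] at h1
      obtain ⟨g, hg, hgf⟩ := h1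
      rwa [← Subtype.ext (a1 := g) (a2 := f) hgf]

theorem pieceSub_isEmpty_equiv (hn : 2 ≤ n) {p q : indexSet n s k} (hpq : p ≠ q) :
    IsEmpty ((pieceSub 𝕜 n s k p).toRepresentation.Equiv
      (pieceSub 𝕜 n s k q).toRepresentation) := by
  refine ⟨fun Φ => ?_⟩
  -- An equivalence, extended arbitrarily to all functions, is an equivariant map between different
  -- pieces; it vanishes on the first piece, which is nonzero.
  obtain ⟨Θ, hΘ⟩ := LinearMap.exists_extend
    ((pieceSub 𝕜 n s k q).toSubmodule.subtype ∘ₗ Φ.toLinearEquiv.toLinearMap)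
  have hΘ' : ∀ f : (pieceSub 𝕜 n s k p).toSubmodule, Θ f.1 = (Φ.toLinearEquiv f).1 :=
    fun f => LinearMap.congr_fun hΘ f
  obtain ⟨f, hf, hf0⟩ := Submodule.exists_mem_ne_zero_of_ne_bot (piece_ne_bot (𝕜 := 𝕜) hn p.2)
  have h0 := piece_intertwiner_eq_zero hn p.2 q.2 (fun h => hpq (Subtype.ext h)) (Θ := Θ)
    (fun f hf => by
      have h1 := hΘ' ⟨f, hf⟩
      simp only at h1
      rw [h1]
      exact (Φ.toLinearEquiv ⟨f, hf⟩).2)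
    (fun v hv f hf => by
      obtain ⟨r, hr⟩ := exists_hActionSub_eq (𝕜 := 𝕜) hv
      have h1 := LinearMap.congr_fun (Φ.isIntertwining' r) (⟨f, hf⟩ : (pieceSub 𝕜 n s k p).toSubmodule)
      have h2 := congrArg Subtype.val h1
      have h3 := hΘ' ((pieceSub 𝕜 n s k p).toRepresentation r ⟨f, hf⟩)
      have h4 := hΘ' ⟨f, hf⟩
      simp only at h4
      rw [h4, ← hr]
      exact h3.trans h2) hf
  have h5 := (hΘ' ⟨f, hf⟩).symm.trans h0
  have h6 : Φ.toLinearEquiv ⟨f, hf⟩ = 0 := Subtype.ext h5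
  exact hf0 (congrArg Subtype.val ((LinearEquiv.map_eq_zero_iff _).1 h6))

theorem pieceSub_orthogonal (hn : 2 ≤ n) (hs : s = 0 ∨ s = n + 1 → k = 0)
    (c : InnerProductSpace.Core 𝕜 (hodgeSub 𝕜 n s k).toSubmodule)
    (hc : InvariantInner 𝕜 (hodgeSub 𝕜 n s k).toRepresentation c) {p q : indexSet n s k}
    (hpq : p ≠ q) (f g : (hodgeSub 𝕜 n s k).toSubmodule) (hf : f.1 ∈ pieceSub 𝕜 n s k p)
    (hg : g.1 ∈ pieceSub 𝕜 n s k q) : c.inner f g = 0 := by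
  refine piece_orthogonal hn hs c (fun v f g => ?_) p.2 q.2 (fun h => hpq (Subtype.ext h)) hf hg
  obtain ⟨r, hr⟩ := exists_hActionSub_eq (𝕜 := 𝕜) v.2
  have h1 : ∀ f : hodge 𝕜 (n + 1) s k, (hodgeSub 𝕜 n s k).toRepresentation r f =
      (⟨actBy 𝕜 (up n v.1) f, actBy_mem_hodge (norm_up_eq_one v) f.2⟩ : hodge 𝕜 (n + 1) s k) :=
    fun f => Subtype.ext (LinearMap.congr_fun hr f.1)
  have h2 := hc r f g
  rw [h1 f, h1 g] at h2
  exact h2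

end PinAction
end HodgeDeRham
end

open HodgeDeRham in
/-- The branching of `H^s_k(ℝ^m)`, `m = n + 1 ≥ 3`, under the `H`-action of `Pin(m-1)`. -/
theorem theorem4p2 (𝕜 : Type*) [RCLike 𝕜] (n : ℕ) (hn : 3 ≤ n + 1) (s : ℕ) (hs : s ≤ n + 1)
    (k : ℕ) :
    -- for `s = 0` or `s = m` and `k ≥ 1` the space is trivial
    ((s = 0 ∨ s = n + 1) → 1 ≤ k → hodge 𝕜 (n + 1) s k = ⊥) ∧
    -- in all other cases it branches as follows
    (¬ ((s = 0 ∨ s = n + 1) ∧ 1 ≤ k) →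
      ∃ (V : Subrepresentation (hActionSub 𝕜 n))
        (W : indexSet n s k → Subrepresentation (hActionSub 𝕜 n)),
        V.toSubmodule = hodge 𝕜 (n + 1) s k ∧
        (∀ p, (W p).toSubmodule = piece 𝕜 n s p.1.1 k p.1.2) ∧
        -- direct sum
        iSupIndep (fun p => (W p).toSubmodule) ∧
        ⨆ p, (W p).toSubmodule = V.toSubmodule ∧
        -- irreducible and multiplicity free
        (∀ p, (W p).toRepresentation.IsIrreducible) ∧
        (∀ p q, p ≠ q → IsEmpty ((W p).toRepresentation.Equiv (W q).toRepresentation)) ∧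
        -- orthogonal with respect to any invariant inner product
        (∀ c : InnerProductSpace.Core 𝕜 V.toSubmodule, InvariantInner 𝕜 V.toRepresentation c →
          ∀ p q, p ≠ q → ∀ f g : V.toSubmodule, f.1 ∈ W p → g.1 ∈ W q → c.inner f g = 0) ∧
        -- the `L²`-inner product is an invariant inner product
        (∀ f g : V.toSubmodule, MeasureTheory.IntegrableOn
          (fun x => scalarPart 𝕜 (n + 1) (cliffConj 𝕜 (n + 1) (f.1 x) * g.1 x))
          (Metric.ball (0 : Euc (n + 1)) 1)) ∧
        (∃ c : InnerProductSpace.Core 𝕜 V.toSubmodule, InvariantInner 𝕜 V.toRepresentation c ∧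
          ∀ f g : V.toSubmodule, c.inner f g = l2Inner 𝕜 f.1 g.1) ∧
        (∀ p q, p ≠ q → ∀ f ∈ W p, ∀ g ∈ W q, l2Inner 𝕜 f g = 0)) := by
  have hn' : 2 ≤ n := by omega
  refine ⟨?_, fun h => ?_⟩
  · rintro (rfl | rfl) hk
    · exact hodge_zero_eq_bot hk
    · exact hodge_top_eq_bot hk
  have hk : s = 0 ∨ s = n + 1 → k = 0 := fun h0 => by
    by_contra hk
    exact h ⟨h0, Nat.one_le_iff_ne_zero.2 hk⟩
  have hle : ∀ f : (hodgeSub 𝕜 n s k).toSubmodule, f.1 ∈ HPoly 𝕜 (Cl 𝕜 (n + 1)) (n + 1) k :=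
    fun f => hodge_le_HPoly (n + 1) s k f.2
  have hinv : InvariantInner 𝕜 (hodgeSub 𝕜 n s k).toRepresentation
      (l2Core (hodge_le_HPoly (𝕜 := 𝕜) (n + 1) s k)) := fun r f g =>
    l2Inner_hActionSub r f.1 g.1
  refine ⟨hodgeSub 𝕜 n s k, pieceSub 𝕜 n s k, rfl, fun _ => rfl, iSupIndep_piece hn' s k,
    iSup_piece hn' hs hk, pieceSub_isIrreducible hn', fun p q => pieceSub_isEmpty_equiv hn',
    fun c hc p q hpq => pieceSub_orthogonal hn' hk c hc hpq,
    fun f g => integrableOn_scalarPart (hle f) (hle g), ⟨_, hinv, fun _ _ => rfl⟩,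
    fun p q hpq f hf g hg => ?_⟩
  exact pieceSub_orthogonal hn' hk _ hinv hpq ⟨f, piece_le_hodge hn' hk p.2 hf⟩
    ⟨g, piece_le_hodge hn' hk q.2 hg⟩ hf hg
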